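/- A \emph{graphex} $\mathbb W=(W,S,I,\Omega,\mu)$ consists of a $\sigma$-finite measure space $(\Omega,\mu)$, a symmetric measurable $W:\Omega\times\Omega\to[0,1]$, a measurable $S:\Omega\to[0,\infty)$ and a number $I\ge 0$, such that (1) $W(\cdot,x)$ is integrable for almost every $x$, and (2) there is a measurable $\Omega'\subseteq\Omega$ with $\mu(\Omega\setminus\Omega')<\infty$ and $\|\mathbb W|_{\Omega'}\|_1<\infty$. Here $\|\mathbb W\|_1=\int_{\Omega\times\Omega}W\,d\mu\,d\mu+2\int_\Omega S\,d\mu+2I$, and $\mathbb W|_{\Omega'}$ is the restriction of $\mathbb W$ to $\Omega'$. The marginal of $\mathbb W$ is $D_{\mathbb W}(x)=\int_\Omega W(x,y)\,d\mu(y)+S(x)$. For finite $C,D\ge 0$, $\mathbb W$ is $(C,D)$-bounded if $\|\mathbb W\|_1\le C$ and $\|D_{\mathbb W}\|_\infty\le D$. $\mathbb W$ is in $L^1\cap L^2$ if $W\in L^1\cap L^2(\mu\times\mu)$ and $D_{\mathbb W}\in L^1\cap L^2(\mu)$; its edge density is $\rho(\mathbb W)=\int W+2\int S+2I$. The pullback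 of $\mathbb W$ under $\phi$ is obtained by composing $W$ and $S$ with $\phi$ in each variable and keeping $I$. For two graphexes in $L^1\cap L^2$ over the same measure space let $$d_{2\to2}(\mathbb W_1,\mathbb W_2)=\max\Bigl(\|W_1-W_2\|_{2\to2},\ \|D_{\mathbb W_1}-D_{\mathbb W_2}\|_2^{1/2},\ |\rho(\mathbb W_1)-\rho(\mathbb W_2)|^{1/3}\Bigr),$$ where $\|U\|_{2\to2}=\sup_{\|g\|_2=1}\bigl\|\int U(\cdot,y)g(y)\,d\mu(y)\bigr\|_2$. For arbitrary graphexes $\mathbb W_1,\mathbb W_2$ in $L^1\cap L^2$, the \emph{kernel distance} $\delta_{2\to2}(\mathbb W_1,\mathbb W_2)$ is defined as follows: extend both graphexes by zero to spaces of infinite total mass (by appending to each $\Omega_i$ a line with Lebesgue measure) and take the infimum, over all couplings of the two extended measures, of the $d_{2\to2}$-distance of the pullbacks of the extensions under the two coordinate projections. For arbitrary graphexes $\mathbb W_1,\mathbb W_2$, the \emph{weak kernel distance} $\delta_\diamond(\mathbb W_1,\mathbb W_2)$ is the infimum of all $c\ge 0$ for which there are measures $\widetilde\mu_i$ on $\Omega_i$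 with $\mu_i(B)-c^2\le\widetilde\mu_i(B)\le\mu_i(B)$ for all measurable $B$ ($i=1,2$), such that the graphexes $\widetilde{\mathbb W}_i$ obtained by replacing $\mu_i$ by $\widetilde\mu_i$ are in $L^1\cap L^2$ and $\delta_{2\to2}(\widetilde{\mathbb W}_1,\widetilde{\mathbb W}_2)\le c$. A set $\mathcal S$ of graphexes is \emph{tight} if for every $\varepsilon>0$ there are finite $C,D$ such that every $\mathbb W\in\mathcal S$ becomes $(C,D)$-bounded after restriction to the complement of a measurable set of measure at most $\varepsilon$. \textbf{Theorem.} The weak kernel distance $\delta_\diamond$ is a (finite-valued) pseudometric on the space of all graphexes, and this space is complete. A set of graphexes is relatively compact (has compact closure) under $\delta_\diamond$ if and only if it is tight. In particular, for all finite $C,D\ge 0$, the set of graphexes with $\|\mathbb W\|_1\le C$ is compact under $\delta_\diamond$, and the set of $(C,D)$-bounded graphexes is compact under $\delta_\diamond$; moreover, $(C,D)$-bounded graphexes are in $L^1\cap L^2$, $\delta_{2\to2}$ is a (finite-valued) pseudometric on the graphexes in $L^1\cap L^2$, and the set of $(C,D)$-bounded graphexes is also compact under $\delta_{2\to2}$.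 -/

import Mathlib

open MeasureTheory
open scoped ENNReal NNReal

universe u v

/-- The function part `(W, S, I)` of a graphex over a set `Ω`: graphon part, star part and dust
part. The measure on `Ω` is passed separately, so that it can be replaced without touching the
functions. -/
structure GraphexData (Ω : Type u) where
  /-- The graphon part. -/
  W : Ω → Ω → ℝ
  /-- The star part. -/
  S : Ω → ℝ
  /-- The dust part. -/
  I : ℝ

namespace GraphexData

/-- `‖𝕎‖₁ = ∫∫ |W| + 2 ∫ |S| + 2 |I|`, possibly infinite. -/
noncomputable def norm1 {Ω : Type u} [MeasurableSpace Ω] (T : GraphexData Ω) (μ : Measure Ω) :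
    ℝ≥0∞ :=
  (∫⁻ x, ∫⁻ y, ‖T.W x y‖ₑ ∂μ ∂μ) + 2 * (∫⁻ x, ‖T.S x‖ₑ ∂μ) + 2 * ‖T.I‖ₑ

/-- The marginal `D_𝕎(x) = ∫ W(x,y) dμ(y) + S(x)` for non-negative `W` and `S`. -/
noncomputable def marginal {Ω : Type u} [MeasurableSpace Ω] (T : GraphexData Ω) (μ : Measure Ω)
    (x : Ω) : ℝ≥0∞ :=
  (∫⁻ y, ENNReal.ofReal (T.W x y) ∂μ) + ENNReal.ofReal (T.S x)

/-- The edge density `ρ(𝕎) = ∫ W + 2 ∫ S + 2 I`. -/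
noncomputable def rho {Ω : Type u} [MeasurableSpace Ω] (T : GraphexData Ω) (μ : Measure Ω) : ℝ :=
  (∫ p, T.W p.1 p.2 ∂(μ.prod μ)) + 2 * (∫ x, T.S x ∂μ) + 2 * T.I

/-- `(C, D)`-boundedness: `‖𝕎‖₁ ≤ C` and `‖D_𝕎‖_∞ ≤ D`. -/
def IsBounded {Ω : Type u} [MeasurableSpace Ω] (T : GraphexData Ω) (μ : Measure Ω) (C D : ℝ≥0) :
    Prop :=
  T.norm1 μ ≤ C ∧ essSup (T.marginal μ) μ ≤ D

/-- `𝕎` is in `L¹ ∩ L²`: both the graphon part and the marginal are in `L¹ ∩ L²`. -/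
def MemL1L2 {Ω : Type u} [MeasurableSpace Ω] (T : GraphexData Ω) (μ : Measure Ω) : Prop :=
  (MemLp (fun p : Ω × Ω => T.W p.1 p.2) 1 (μ.prod μ) ∧
    MemLp (fun p : Ω × Ω => T.W p.1 p.2) 2 (μ.prod μ)) ∧
  (MemLp (T.marginal μ) 1 μ ∧ MemLp (T.marginal μ) 2 μ)

/-- The pullback of a graphex under a map `φ`. -/
def pullback {Ω : Type u} {Ω' : Type v} (T : GraphexData Ω) (φ : Ω' → Ω) : GraphexData Ω' where
  W x y := T.W (φ x) (φ y)
  S x := T.S (φ x)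
  I := T.I

/-- The functions of the trivial extension obtained by appending a real line to `Ω`: everything
is extended by zero. -/
def extend {Ω : Type u} (T : GraphexData Ω) : GraphexData (Ω ⊕ ℝ) where
  W a b :=
    match a, b with
    | Sum.inl x, Sum.inl y => T.W x y
    | _, _ => 0
  S a :=
    match a with
    | Sum.inl x => T.S x
    | Sum.inr _ => 0
  I := T.I

end GraphexData

/-- The measure of the trivial extension: `μ` on `Ω` and Lebesgue measure on the appended line. It
has infinite total mass. -/
noncomputable def extendMeasure {Ω : Type u} [MeasurableSpace Ω] (μ : Measure Ω) :
    Measure (Ω ⊕ ℝ) :=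
  μ.map Sum.inl + (volume : Measure ℝ).map Sum.inr

/-- The kernel norm `‖U‖_{2→2} = sup {‖U ∘ g‖₂ : ‖g‖₂ = 1}`, where
`(U ∘ g)(x) = ∫ U(x,y) g(y) dμ(y)`. -/
noncomputable def kernelNorm {Ω : Type u} [MeasurableSpace Ω] (U : Ω → Ω → ℝ) (μ : Measure Ω) :
    ℝ≥0∞ :=
  ⨆ (g : Lp ℝ 2 μ) (_ : ‖g‖ = 1), eLpNorm (fun x => ∫ y, U x y * g y ∂μ) 2 μ

/-- The distance `d_{2→2}` of two graphexes in `L¹ ∩ L²` on the same measure space. -/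
noncomputable def d22 {Ω : Type u} [MeasurableSpace Ω] (T₁ T₂ : GraphexData Ω) (μ : Measure Ω) :
    ℝ≥0∞ :=
  max (kernelNorm (fun x y => T₁.W x y - T₂.W x y) μ)
    (max ((eLpNorm (fun x => (T₁.marginal μ x).toReal - (T₂.marginal μ x).toReal) 2 μ) ^
        (1 / 2 : ℝ))
      (ENNReal.ofReal |T₁.rho μ - T₂.rho μ| ^ (1 / 3 : ℝ)))

/-- `γ` is a coupling of `μ₁` and `μ₂`. -/
def IsCoupling {Ω₁ : Type u} {Ω₂ : Type v} [MeasurableSpace Ω₁] [MeasurableSpace Ω₂]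
    (γ : Measure (Ω₁ × Ω₂)) (μ₁ : Measure Ω₁) (μ₂ : Measure Ω₂) : Prop :=
  γ.map Prod.fst = μ₁ ∧ γ.map Prod.snd = μ₂

/-- The infimum of `d_{2→2}` of the two pullbacks over all couplings. -/
noncomputable def couplingDist22 {Ω₁ : Type u} {Ω₂ : Type v} [MeasurableSpace Ω₁]
    [MeasurableSpace Ω₂] (T₁ : GraphexData Ω₁) (μ₁ : Measure Ω₁) (T₂ : GraphexData Ω₂)
    (μ₂ : Measure Ω₂) : ℝ≥0∞ :=
  ⨅ (γ : Measure (Ω₁ × Ω₂)) (_ : IsCoupling γ μ₁ μ₂),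
    d22 (T₁.pullback Prod.fst) (T₂.pullback Prod.snd) γ

/-- The kernel distance `δ_{2→2}`: extend both graphexes trivially to spaces of infinite total
mass, then optimize over couplings. (The value does not depend on the choice of the extensions.) -/
noncomputable def delta22 {Ω₁ : Type u} {Ω₂ : Type v} [MeasurableSpace Ω₁]
    [MeasurableSpace Ω₂] (T₁ : GraphexData Ω₁) (μ₁ : Measure Ω₁) (T₂ : GraphexData Ω₂)
    (μ₂ : Measure Ω₂) : ℝ≥0∞ :=
  couplingDist22 T₁.extend (extendMeasure μ₁) T₂.extend (extendMeasure μ₂)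

/-- `μ - r ≤ ν ≤ μ`, that is, `μ(B) - r ≤ ν(B) ≤ μ(B)` for all measurable `B`. -/
def IsNearlyFull {Ω : Type u} [MeasurableSpace Ω] (μ ν : Measure Ω) (r : ℝ≥0) : Prop :=
  ∀ B : Set Ω, MeasurableSet B → μ B ≤ ν B + r ∧ ν B ≤ μ B

/-- The weak kernel distance `δ_⋄`: the infimum of all `c` such that both measures can be decreased
by at most `c²` so that the resulting graphexes are in `L¹ ∩ L²` and have kernel distance at
most `c`. -/
noncomputable def deltaDiamond {Ω₁ : Type u} {Ω₂ : Type v} [MeasurableSpace Ω₁]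
    [MeasurableSpace Ω₂] (T₁ : GraphexData Ω₁) (μ₁ : Measure Ω₁) (T₂ : GraphexData Ω₂)
    (μ₂ : Measure Ω₂) : ℝ≥0∞ :=
  ⨅ (c : ℝ≥0) (_ : ∃ (ν₁ : Measure Ω₁) (ν₂ : Measure Ω₂),
      T₁.MemL1L2 ν₁ ∧ T₂.MemL1L2 ν₂ ∧
      IsNearlyFull μ₁ ν₁ (c ^ 2) ∧ IsNearlyFull μ₂ ν₂ (c ^ 2) ∧
      delta22 T₁ ν₁ T₂ ν₂ ≤ c), (c : ℝ≥0∞)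

/-- A graphex: a `σ`-finite measure space `(Ω, μ)` together with a symmetric measurable
`W : Ω × Ω → [0,1]`, a measurable `S : Ω → [0,∞)` and a number `I ≥ 0` satisfying the two local
finiteness conditions. The restriction of a graphex to a measurable set `A` is expressed by
restricting the measure to `A`. -/
structure Graphex where
  /-- The underlying feature space. -/
  Ω : Type u
  [measurableSpace : MeasurableSpace Ω]
  /-- The measure on the feature space. -/
  μ : Measure Ω
  [sigmaFinite : SigmaFinite μ]
  /-- The triple `(W, S, I)`. -/
  data : GraphexData Ω
  measurable_W : Measurable (fun p : Ω × Ω => data.W p.1 p.2)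
  W_mem : ∀ x y, data.W x y ∈ Set.Icc (0 : ℝ) 1
  W_symm : ∀ x y, data.W x y = data.W y x
  measurable_S : Measurable data.S
  S_nonneg : ∀ x, 0 ≤ data.S x
  I_nonneg : 0 ≤ data.I
  integrable_section : ∀ᵐ x ∂μ, Integrable (fun y => data.W y x) μ
  exists_integrable_restrict : ∃ A : Set Ω, MeasurableSet A ∧ μ Aᶜ < ∞ ∧
    data.norm1 (μ.restrict A) < ∞

attribute [instance] Graphex.measurableSpace Graphex.sigmaFinite

namespace Graphex

/-- `‖𝕎‖₁`. -/
noncomputable def norm1 (V : Graphex.{u}) : ℝ≥0∞ := V.data.norm1 V.μ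

/-- `(C, D)`-boundedness of a graphex. -/
def IsBounded (V : Graphex.{u}) (C D : ℝ≥0) : Prop := V.data.IsBounded V.μ C D

/-- Membership in `L¹ ∩ L²` of a graphex. -/
def MemL1L2 (V : Graphex.{u}) : Prop := V.data.MemL1L2 V.μ

/-- The kernel distance of two graphexes (meaningful for graphexes in `L¹ ∩ L²`). -/
noncomputable def kernelDist (V₁ V₂ : Graphex.{u}) : ℝ≥0∞ :=
  delta22 V₁.data V₁.μ V₂.data V₂.μ

/-- The weak kernel distance of two graphexes. -/
noncomputable def weakKernelDist (V₁ V₂ : Graphex.{u}) : ℝ≥0∞ :=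
  deltaDiamond V₁.data V₁.μ V₂.data V₂.μ

/-- A set of graphexes is tight if for every `ε > 0` there are `C` and `D` such that every member
becomes `(C, D)`-bounded after removing a measurable set of measure at most `ε`. -/
def IsTight (𝒮 : Set Graphex.{u}) : Prop :=
  ∀ ε : ℝ≥0, 0 < ε → ∃ C D : ℝ≥0, ∀ V ∈ 𝒮, ∃ A : Set V.Ω, MeasurableSet A ∧ V.μ A ≤ ε ∧
    V.data.IsBounded (V.μ.restrict Aᶜ) C D

end Graphex

/-!
# Compactness of graphexes under the kernel distance and the weak kernel distance

Both distances are studied through *partial couplings*. A measure `γ` on the product of the two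
extended spaces is only required to project to `μ₁` and `μ₂` off the appended lines (`Covers`), and
`JointNear … k d r` says that for some such `γ` the kernels, the marginals and the edge densities
of the pullbacks differ by at most `k`, `d` and `r`. What happens on the appended lines is
irrelevant for these quantities, and there is room on a line of infinite length to complete a
partial coupling to a coupling; hence `δ_{2→2} < c` gives `JointNear … c c² c³`, which in turn gives
`δ_{2→2} ≤ c` (`jointNear_of_delta22_lt`, `JointNear.delta22_le'`).

*Triangle inequality.* The feature spaces are arbitrary σ-finite spaces, so couplings cannot be
composed by disintegration. Instead, the middle graphex is approximated by a step function
(`exists_step_approx`), and the two couplings are glued along the labels of its cells by multiples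
of product measures (`exists_glue`). The pullbacks of the step function to the glued space agree, so
this costs an arbitrarily small error (`JointNear.trans`). For `δ_⋄` the two decreased measures of
the middle graphex have a common minorant which is still nearly full. If a measure of total mass
at most `s²` is removed, the bounds `(c, c², c³)` become `(c, c² + c s, c³ + 2 c² s + c s²)`
(`Near.of_add`, `JointNear.restrict_right`), so the roots in the definition of `d_{2→2}` are exactly
what makes `c + c'` an upper bound in the end (`deltaDiamond_triangle`).

*Total boundedness.* For a `(C, D)`-bounded graphex, the part of the kernel where the marginal is
small has small kernel norm by Schur's test, and the set where it is not small has bounded measure,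
by Markov's inequality. There the weak regularity lemma applies: up to a small error the kernel is a
pullback of one finite kernel that depends on the bounds only (`exists_regularity`). Hence a graphex
is determined up to `ε` by finitely many numbers, the masses of the cells and the edge density, and
these are rounded (`Graphex.exists_colouring`).

*Completeness.* Every graphex in `L¹ ∩ L²` is close to its averages over finitely many cells, with
the same norm and the same upper bounds for the marginal (`exists_average_jointNear`,
`exists_step_delta22_le`). A rapidly convergent sequence may therefore be replaced by step
graphexes, and these can be realized one after the other on the line by subdividing the cells
according to the comparison measures (`exists_refinement`, `exists_labellings`). Off small
exceptional sets, which are summable, the kernels then form a Cauchy sequence in the kernel norm.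
This norm does not control `W` pointwise, but `0 ≤ W ≤ 1` is preserved by convex combinations, and
suitable convex combinations of the tails converge almost everywhere; so a limit `W` exists.
The marginals converge in `L²` and the edge densities converge, which leaves the star part as the
difference of the limit of the marginals and the marginal of `W`, and the dust part as the missing
part of the edge density (`IsLocallyCauchy.exists_limit`, `Graphex.exists_limit`). Fatou type bounds
show that both are nonnegative, and that bounds on `‖𝕎‖₁` and on the marginal pass to the limit.

*Compactness.* Compact means totally bounded and complete. Members of a tight set are `δ_⋄`-close to
`(C, D)`-bounded graphexes, so tight sets are totally bounded (`IsTight.exists_colouring`).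
Conversely, a single graphex becomes bounded off a small set, and so does every graphex near to it
(`Graphex.exists_isBounded_of_weakKernelDist_lt`), so that a finite net gives tightness
(`isTight_of_finite_net`).
-/

open Filter Topology Function

/-! ### Square integrable kernels and the kernel norm -/

section SquareIntegrable

variable {X : Type*} {Y : Type*} [MeasurableSpace X] [MeasurableSpace Y]

lemma ENNReal.le_of_sq_le_sq {a b : ℝ≥0∞} (h : a ^ 2 ≤ b ^ 2) : a ≤ b := by
  by_contra hlt
  push Not at hlt
  exact absurd h (not_le.2 (ENNReal.pow_right_strictMono two_ne_zero hlt))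

lemma ENNReal.add_sq_le_two_mul (a b : ℝ≥0∞) : (a + b) ^ 2 ≤ 2 * (a ^ 2 + b ^ 2) := by
  have := ENNReal.rpow_add_le_mul_rpow_add_rpow a b one_le_two
  norm_num at this
  exact this

lemma eLpNorm_two_sq {E : Type*} [NormedAddCommGroup E] (f : X → E) (μ : Measure X) :
    eLpNorm f 2 μ ^ 2 = ∫⁻ x, ‖f x‖ₑ ^ 2 ∂μ := by
  rw [eLpNorm_eq_lintegral_rpow_enorm_toReal two_ne_zero ENNReal.ofNat_ne_top]
  simp only [ENNReal.toReal_ofNat, ENNReal.rpow_ofNat, one_div]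
  rw [← ENNReal.rpow_natCast, ← ENNReal.rpow_mul]
  simp

lemma memLp_two_of_lintegral_sq {f : X → ℝ} {μ : Measure X} (hf : Measurable f)
    (h : ∫⁻ x, ‖f x‖ₑ ^ 2 ∂μ ≠ ∞) : MemLp f 2 μ := by
  refine ⟨hf.aestronglyMeasurable, ?_⟩
  rw [← eLpNorm_two_sq] at h
  exact lt_top_iff_ne_top.2 fun h' => h (by simp [h'])

lemma lintegral_enorm_mul_le {f g : X → ℝ} {μ : Measure X} (hf : AEStronglyMeasurable f μ)
    (hg : AEStronglyMeasurable g μ) :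
    ∫⁻ x, ‖f x‖ₑ * ‖g x‖ₑ ∂μ ≤ eLpNorm f 2 μ * eLpNorm g 2 μ := by
  have h := ENNReal.lintegral_mul_le_Lp_mul_Lq μ Real.HolderConjugate.two_two
    hf.enorm hg.enorm
  rw [eLpNorm_eq_lintegral_rpow_enorm_toReal two_ne_zero ENNReal.ofNat_ne_top,
    eLpNorm_eq_lintegral_rpow_enorm_toReal two_ne_zero ENNReal.ofNat_ne_top]
  simpa using h

lemma enorm_integral_mul_le {f g : X → ℝ} {μ : Measure X} (hf : AEStronglyMeasurable f μ)
    (hg : AEStronglyMeasurable g μ) :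
    ‖∫ x, f x * g x ∂μ‖ₑ ≤ eLpNorm f 2 μ * eLpNorm g 2 μ := by
  refine (enorm_integral_le_lintegral_enorm _).trans ?_
  simpa only [enorm_mul] using lintegral_enorm_mul_le hf hg

/-- A measurable kernel which is square integrable with respect to `μ × μ`. -/
structure IsL2Kernel (U : X → X → ℝ) (μ : Measure X) : Prop where
  measurable : Measurable (uncurry U)
  lintegral_sq : ∫⁻ x, ∫⁻ y, ‖U x y‖ₑ ^ 2 ∂μ ∂μ ≠ ∞

namespace IsL2Kernel

variable {U V : X → X → ℝ} {μ ν : Measure X}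

lemma measurable_section (hU : IsL2Kernel U μ) (x : X) : Measurable (U x) :=
  hU.measurable.of_uncurry_left

lemma ae_memLp [SFinite μ] (hU : IsL2Kernel U μ) : ∀ᵐ x ∂μ, MemLp (U x) 2 μ := by
  have hm : Measurable fun x => ∫⁻ y, ‖U x y‖ₑ ^ 2 ∂μ :=
    Measurable.lintegral_prod_right (f := fun x y => ‖U x y‖ₑ ^ 2) (hU.measurable.enorm.pow_const 2)
  filter_upwards [ae_lt_top hm hU.lintegral_sq] with x hx
  exact memLp_two_of_lintegral_sq (hU.measurable_section x) hx.ne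

lemma mono (hU : IsL2Kernel U μ) (h : ν ≤ μ) : IsL2Kernel U ν :=
  ⟨hU.measurable, ne_top_of_le_ne_top hU.lintegral_sq
    (lintegral_mono' h fun _ => lintegral_mono' h fun _ => le_rfl)⟩

lemma add [SFinite μ] (hU : IsL2Kernel U μ) (hV : IsL2Kernel V μ) :
    IsL2Kernel (fun x y => U x y + V x y) μ := by
  refine ⟨hU.measurable.add hV.measurable, ?_⟩
  have hm : ∀ {U : X → X → ℝ}, IsL2Kernel U μ →
      Measurable fun x => ∫⁻ y, ‖U x y‖ₑ ^ 2 ∂μ := fun {U} hU =>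
    Measurable.lintegral_prod_right (f := fun x y => ‖U x y‖ₑ ^ 2) (hU.measurable.enorm.pow_const 2)
  have hb : ∀ x y, ‖U x y + V x y‖ₑ ^ 2 ≤ 2 * (‖U x y‖ₑ ^ 2 + ‖V x y‖ₑ ^ 2) := by
    intro x y
    refine (pow_le_pow_left' (enorm_add_le (U x y) (V x y)) 2).trans ?_
    exact ENNReal.add_sq_le_two_mul _ _
  refine ne_top_of_le_ne_top ?_ (lintegral_mono fun x => lintegral_mono fun y => hb x y)
  have : ∀ x, ∫⁻ y, 2 * (‖U x y‖ₑ ^ 2 + ‖V x y‖ₑ ^ 2) ∂μ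
      = 2 * ((∫⁻ y, ‖U x y‖ₑ ^ 2 ∂μ) + ∫⁻ y, ‖V x y‖ₑ ^ 2 ∂μ) := by
    intro x
    rw [lintegral_const_mul' _ _ (by simp), lintegral_add_left]
    exact ((hU.measurable_section x).enorm.pow_const 2)
  simp_rw [this]
  rw [lintegral_const_mul' _ _ (by simp), lintegral_add_left (hm hU)]
  exact ENNReal.mul_ne_top (by simp) (ENNReal.add_ne_top.2 ⟨hU.lintegral_sq, hV.lintegral_sq⟩)

lemma neg (hU : IsL2Kernel U μ) : IsL2Kernel (fun x y => -U x y) μ :=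
  ⟨hU.measurable.neg, by simpa using hU.lintegral_sq⟩

lemma sub [SFinite μ] (hU : IsL2Kernel U μ) (hV : IsL2Kernel V μ) :
    IsL2Kernel (fun x y => U x y - V x y) μ := by
  simpa only [sub_eq_add_neg] using hU.add hV.neg

end IsL2Kernel

section KernelNorm

variable {U V : X → X → ℝ} {μ ν : Measure X}

lemma measurable_integral_kernel_mul [SFinite μ] (hU : Measurable (uncurry U)) {g : X → ℝ}
    (hg : Measurable g) : Measurable fun x => ∫ y, U x y * g y ∂μ :=
  (StronglyMeasurable.integral_prod_right (f := fun x y => U x y * g y)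
    (hU.mul (hg.comp measurable_snd)).stronglyMeasurable).measurable

/-- The defining inequality of the kernel norm as an operator norm. -/
lemma eLpNorm_kernel_le {g : X → ℝ} (hg : MemLp g 2 μ) :
    eLpNorm (fun x => ∫ y, U x y * g y ∂μ) 2 μ ≤ kernelNorm U μ * eLpNorm g 2 μ := by
  set G : Lp ℝ 2 μ := hg.toLp g
  have hG : ‖G‖ = (eLpNorm g 2 μ).toReal := Lp.norm_toLp g hg
  by_cases h0 : ‖G‖ = 0
  · have : g =ᵐ[μ] 0 := by
      rw [norm_eq_zero] at h0
      exact (hg.coeFn_toLp).symm.trans (by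
        have : (hg.toLp g) = 0 := h0
        rw [this]; exact Lp.coeFn_zero _ _ _)
    have h1 : (fun x => ∫ y, U x y * g y ∂μ) = fun _ => 0 := by
      funext x
      rw [← integral_zero X ℝ]
      apply integral_congr_ae
      filter_upwards [this] with y hy
      simp [hy]
    rw [h1]; simp
  · set H : Lp ℝ 2 μ := ‖G‖⁻¹ • G
    have hH : ‖H‖ = 1 := by
      simp only [H, norm_smul, norm_inv, norm_norm]
      exact inv_mul_cancel₀ h0
    have h1 : eLpNorm (fun x => ∫ y, U x y * H y ∂μ) 2 μ ≤ kernelNorm U μ :=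
      le_iSup₂ (f := fun (g : Lp ℝ 2 μ) (_ : ‖g‖ = 1) =>
        eLpNorm (fun x => ∫ y, U x y * g y ∂μ) 2 μ) H hH
    have h2 : (fun x => ∫ y, U x y * g y ∂μ) = ‖G‖ • fun x => ∫ y, U x y * H y ∂μ := by
      funext x
      simp only [Pi.smul_apply, smul_eq_mul]
      rw [← integral_const_mul]
      apply integral_congr_ae
      filter_upwards [Lp.coeFn_smul ‖G‖⁻¹ G, hg.coeFn_toLp] with y hy hy'
      simp only [H]
      rw [hy]
      simp only [Pi.smul_apply, smul_eq_mul]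
      rw [show (G y) = g y from hy']
      field_simp
    rw [h2, eLpNorm_const_smul, mul_comm]
    refine mul_le_mul' h1 (le_of_eq ?_)
    rw [Real.enorm_of_nonneg (norm_nonneg _), hG, ENNReal.ofReal_toReal hg.2.ne]

lemma kernelNorm_le {c : ℝ≥0∞}
    (h : ∀ g : X → ℝ, Measurable g → MemLp g 2 μ →
      eLpNorm (fun x => ∫ y, U x y * g y ∂μ) 2 μ ≤ c * eLpNorm g 2 μ) :
    kernelNorm U μ ≤ c := by
  refine iSup₂_le fun g hg => ?_
  refine (h g (Lp.stronglyMeasurable g).measurable (Lp.memLp g)).trans ?_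
  have : eLpNorm g 2 μ = 1 := by
    rw [Lp.norm_def] at hg
    rw [← ENNReal.ofReal_toReal (Lp.eLpNorm_ne_top g), hg, ENNReal.ofReal_one]
  rw [this, mul_one]

/-- The kernel norm is at most the Hilbert–Schmidt norm. -/
lemma kernelNorm_sq_le_lintegral [SFinite μ] (hU : Measurable (uncurry U)) :
    kernelNorm U μ ^ 2 ≤ ∫⁻ x, ∫⁻ y, ‖U x y‖ₑ ^ 2 ∂μ ∂μ := by
  set J := ∫⁻ x, ∫⁻ y, ‖U x y‖ₑ ^ 2 ∂μ ∂μ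
  have hJ : (J ^ (1 / 2 : ℝ)) ^ 2 = J := by
    rw [← ENNReal.rpow_natCast, ← ENNReal.rpow_mul]; simp
  rw [← hJ]
  refine pow_le_pow_left' (kernelNorm_le fun g hgm hg => ENNReal.le_of_sq_le_sq ?_) 2
  rw [eLpNorm_two_sq, mul_pow, hJ, ← lintegral_mul_const' _ _ (by
    exact ENNReal.pow_ne_top hg.2.ne)]
  refine lintegral_mono fun x => ?_
  rw [← eLpNorm_two_sq, ← mul_pow]
  exact pow_le_pow_left' (enorm_integral_mul_le hU.of_uncurry_left.aestronglyMeasurable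
    hg.1) 2

lemma IsL2Kernel.kernelNorm_ne_top [SFinite μ] (hU : IsL2Kernel U μ) : kernelNorm U μ ≠ ∞ := by
  intro h
  have := kernelNorm_sq_le_lintegral hU.measurable (μ := μ)
  rw [h] at this
  exact hU.lintegral_sq (top_le_iff.1 (by simpa using this))

lemma IsL2Kernel.ae_integrable_mul [SFinite μ] (hU : IsL2Kernel U μ) {g : X → ℝ}
    (hg : MemLp g 2 μ) : ∀ᵐ x ∂μ, Integrable (fun y => U x y * g y) μ := by
  filter_upwards [hU.ae_memLp] with x hx
  exact hx.integrable_mul hg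

lemma kernelNorm_add_le [SFinite μ] (hU : IsL2Kernel U μ) (hV : IsL2Kernel V μ) :
    kernelNorm (fun x y => U x y + V x y) μ ≤ kernelNorm U μ + kernelNorm V μ := by
  refine kernelNorm_le fun g hgm hg => ?_
  have h : (fun x => ∫ y, (U x y + V x y) * g y ∂μ) =ᵐ[μ]
      (fun x => ∫ y, U x y * g y ∂μ) + fun x => ∫ y, V x y * g y ∂μ := by
    filter_upwards [hU.ae_integrable_mul hg, hV.ae_integrable_mul hg] with x h1 h2
    simp only [Pi.add_apply, add_mul]
    exact integral_add h1 h2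
  rw [eLpNorm_congr_ae h, add_mul]
  exact (eLpNorm_add_le (measurable_integral_kernel_mul hU.measurable hgm).aestronglyMeasurable
    (measurable_integral_kernel_mul hV.measurable hgm).aestronglyMeasurable one_le_two).trans
    (add_le_add (eLpNorm_kernel_le hg) (eLpNorm_kernel_le hg))

lemma kernelNorm_neg : kernelNorm (fun x y => -U x y) μ = kernelNorm U μ := by
  unfold kernelNorm
  congr 1; funext g; congr 1; funext _
  simp only [neg_mul, integral_neg]
  exact eLpNorm_neg _ _ _

lemma kernelNorm_sub_comm :
    kernelNorm (fun x y => U x y - V x y) μ = kernelNorm (fun x y => V x y - U x y) μ := by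
  rw [← kernelNorm_neg]; simp

lemma kernelNorm_const_mul (c : ℝ) :
    kernelNorm (fun x y => c * U x y) μ ≤ ‖c‖ₑ * kernelNorm U μ := by
  refine kernelNorm_le fun g _ hg => ?_
  have : (fun x => ∫ y, c * U x y * g y ∂μ) = c • fun x => ∫ y, U x y * g y ∂μ := by
    funext x
    simp only [mul_assoc, integral_const_mul, Pi.smul_apply, smul_eq_mul]
  rw [this, eLpNorm_const_smul, mul_assoc]
  gcongr
  exact eLpNorm_kernel_le hg

/-- The bilinear form of a kernel is bounded by the kernel norm. -/
lemma enorm_integral_kernel_le [SFinite μ] (hU : Measurable (uncurry U)) {f g : X → ℝ}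
    (hf : MemLp f 2 μ) (hgm : Measurable g) (hg : MemLp g 2 μ) :
    ‖∫ x, f x * ∫ y, U x y * g y ∂μ ∂μ‖ₑ
      ≤ kernelNorm U μ * eLpNorm f 2 μ * eLpNorm g 2 μ := by
  refine (enorm_integral_mul_le hf.1
    (measurable_integral_kernel_mul hU hgm).aestronglyMeasurable).trans ?_
  calc _ ≤ eLpNorm f 2 μ * (kernelNorm U μ * eLpNorm g 2 μ) := by
        gcongr; exact eLpNorm_kernel_le hg
    _ = _ := by ring

/-- The adjoint of composition with `q`, applied to `g`: it exists because `h ↦ h ∘ q` is a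
contraction of `L²` spaces as soon as `q` pushes `μ` to a measure below `η`. -/
lemma exists_adjoint_comp {q : X → Y} (hq : Measurable q) {η : Measure Y} (hle : μ.map q ≤ η)
    {g : X → ℝ} (hg : MemLp g 2 μ) :
    ∃ g' : Y → ℝ, Measurable g' ∧ MemLp g' 2 η ∧ eLpNorm g' 2 η ≤ eLpNorm g 2 μ ∧
      ∀ h : Y → ℝ, MemLp h 2 η → ∫ x, h (q x) * g x ∂μ = ∫ y, h y * g' y ∂η := by
  have hac : ∀ {p : Y → Prop}, (∀ᵐ y ∂η, p y) → ∀ᵐ x ∂μ, p (q x) := fun hp =>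
    ae_of_ae_map hq.aemeasurable (hp.filter_mono (ae_mono hle))
  have hcomp : ∀ {h : Y → ℝ}, MemLp h 2 η → MemLp (fun x => h (q x)) 2 μ := fun hh =>
    (hh.mono_measure hle).comp_of_map hq.aemeasurable
  have hnorm : ∀ {h : Y → ℝ}, MemLp h 2 η → eLpNorm (fun x => h (q x)) 2 μ ≤ eLpNorm h 2 η := by
    intro h hh
    have := eLpNorm_map_measure (p := 2) (hh.mono_measure hle).1 hq.aemeasurable
    rw [Function.comp_def] at this
    rw [← this]
    exact eLpNorm_mono_measure _ hle
  let φ₀ : Lp ℝ 2 η →ₗ[ℝ] ℝ :=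
    { toFun := fun h => ∫ x, h (q x) * g x ∂μ
      map_add' := by
        intro h₁ h₂
        refine Eq.trans ?_ (integral_add ((hcomp (Lp.memLp h₁)).integrable_mul hg)
          ((hcomp (Lp.memLp h₂)).integrable_mul hg))
        apply integral_congr_ae
        filter_upwards [hac (Lp.coeFn_add h₁ h₂)] with x hx
        rw [hx]
        simp only [Pi.add_apply, add_mul]
      map_smul' := by
        intro c h
        simp only [RingHom.id_apply, smul_eq_mul]
        rw [← integral_const_mul]
        apply integral_congr_ae
        filter_upwards [hac (Lp.coeFn_smul c h)] with x hx
        rw [hx]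
        simp only [Pi.smul_apply, smul_eq_mul, mul_assoc] }
  have hb : ∀ h : Lp ℝ 2 η, ‖φ₀ h‖ ≤ (eLpNorm g 2 μ).toReal * ‖h‖ := by
    intro h
    have h1 : ‖φ₀ h‖ₑ ≤ eLpNorm g 2 μ * eLpNorm h 2 η := by
      refine (enorm_integral_mul_le (hcomp (Lp.memLp h)).1 hg.1).trans ?_
      rw [mul_comm]
      gcongr
      exact hnorm (Lp.memLp h)
    rw [Lp.norm_def, ← ENNReal.toReal_mul, ← toReal_enorm]
    exact ENNReal.toReal_mono (ENNReal.mul_ne_top hg.2.ne (Lp.eLpNorm_ne_top h)) h1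
  let φ : Lp ℝ 2 η →L[ℝ] ℝ := φ₀.mkContinuous _ hb
  let G : Lp ℝ 2 η := (InnerProductSpace.toDual ℝ (Lp ℝ 2 η)).symm φ
  have hG : ‖G‖ ≤ (eLpNorm g 2 μ).toReal := by
    rw [LinearIsometryEquiv.norm_map]
    exact LinearMap.mkContinuous_norm_le _ ENNReal.toReal_nonneg _
  refine ⟨G, (Lp.stronglyMeasurable G).measurable, Lp.memLp G, ?_, fun h hh => ?_⟩
  · rw [Lp.norm_def] at hG
    exact (ENNReal.toReal_le_toReal (Lp.eLpNorm_ne_top G) hg.2.ne).1 hG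
  · have h1 : inner ℝ G (hh.toLp h) = φ (hh.toLp h) := InnerProductSpace.toDual_symm_apply
    have h2 : φ (hh.toLp h) = ∫ x, h (q x) * g x ∂μ := by
      change ∫ x, (hh.toLp h) (q x) * g x ∂μ = _
      apply integral_congr_ae
      filter_upwards [hac hh.coeFn_toLp] with x hx
      rw [hx]
    rw [← h2, ← h1, L2.inner_def]
    apply integral_congr_ae
    filter_upwards [hh.coeFn_toLp] with y hy
    simp [hy]

/-- Pulling a kernel back along a map that pushes `μ` below `η` does not increase the kernel
norm. -/
lemma kernelNorm_comp_le [SFinite μ] {q : X → Y} (hq : Measurable q) {η : Measure Y} [SFinite η]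
    (hle : μ.map q ≤ η) {U : Y → Y → ℝ} (hU : IsL2Kernel U η) :
    kernelNorm (fun x y => U (q x) (q y)) μ ≤ kernelNorm U η := by
  refine kernelNorm_le fun g hgm hg => ?_
  obtain ⟨g', hg'm, hg', hle', hint⟩ := exists_adjoint_comp hq hle hg
  have h1 : (fun x => ∫ y, U (q x) (q y) * g y ∂μ) =ᵐ[μ]
      (fun y => ∫ z, U y z * g' z ∂η) ∘ q := by
    have : ∀ᵐ x ∂μ, MemLp (U (q x)) 2 η :=
      ae_of_ae_map hq.aemeasurable (hU.ae_memLp.filter_mono (ae_mono hle))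
    filter_upwards [this] with x hx
    exact hint _ hx
  rw [eLpNorm_congr_ae h1]
  rw [← eLpNorm_map_measure
    (measurable_integral_kernel_mul hU.measurable hg'm).aestronglyMeasurable hq.aemeasurable]
  refine (eLpNorm_mono_measure _ hle).trans ((eLpNorm_kernel_le hg').trans ?_)
  gcongr

lemma kernelNorm_mono_measure [SFinite μ] [SFinite ν] (h : ν ≤ μ) (hU : IsL2Kernel U μ) :
    kernelNorm U ν ≤ kernelNorm U μ :=
  kernelNorm_comp_le measurable_id (by simpa using h) hU

lemma kernelNorm_le_restrict {A : Set X} (hA : MeasurableSet A)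
    (hl : ∀ x y, x ∉ A → U x y = 0) (hr : ∀ x y, y ∉ A → U x y = 0) :
    kernelNorm U μ ≤ kernelNorm U (μ.restrict A) := by
  refine kernelNorm_le fun g hgm hg => ?_
  have h1 : (fun x => ∫ y, U x y * g y ∂μ) =
      A.indicator fun x => ∫ y, U x y * g y ∂(μ.restrict A) := by
    funext x
    by_cases hx : x ∈ A
    · rw [Set.indicator_of_mem hx]
      refine (setIntegral_eq_integral_of_forall_compl_eq_zero fun y hy => ?_).symm
      simp [hr x y hy]
    · simp [Set.indicator_of_notMem hx, hl x _ hx]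
  rw [h1, eLpNorm_indicator_eq_eLpNorm_restrict hA]
  refine (eLpNorm_kernel_le (hg.restrict A)).trans ?_
  gcongr
  exact Measure.restrict_le_self

lemma kernelNorm_map_le {q : X → Y} (hq : Measurable q) [SFinite μ] {U : Y → Y → ℝ}
    (hU : Measurable (uncurry U)) :
    kernelNorm U (μ.map q) ≤ kernelNorm (fun x y => U (q x) (q y)) μ := by
  refine kernelNorm_le fun g hgm hg => ?_
  have hm : Measurable fun x => ∫ y, U x y * g y ∂(μ.map q) :=
    measurable_integral_kernel_mul hU hgm
  rw [eLpNorm_map_measure hm.aestronglyMeasurable hq.aemeasurable,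
    eLpNorm_map_measure hgm.aestronglyMeasurable hq.aemeasurable]
  have : (fun x => ∫ y, U x y * g y ∂(μ.map q)) ∘ q
      = fun x => ∫ y, U (q x) (q y) * (g ∘ q) y ∂μ := by
    funext x
    simp only [comp_apply]
    rw [integral_map hq.aemeasurable]
    exact (hU.of_uncurry_left.mul hgm).aestronglyMeasurable
  rw [this]
  exact eLpNorm_kernel_le ((memLp_map_measure_iff hg.1 hq.aemeasurable).1 hg)

/-- The Schur test. -/
lemma kernelNorm_sq_le_schur [SFinite μ] (hU : Measurable (uncurry U)) {a b : ℝ≥0∞} (hb : b ≠ ∞)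
    (ha : ∀ᵐ x ∂μ, ∫⁻ y, ‖U x y‖ₑ ∂μ ≤ a) (hb' : ∀ᵐ y ∂μ, ∫⁻ x, ‖U x y‖ₑ ∂μ ≤ b)
    (ha' : a ≠ ∞) :
    kernelNorm U μ ^ 2 ≤ a * b := by
  have hJ : ((a * b) ^ (1 / 2 : ℝ)) ^ 2 = a * b := by
    rw [← ENNReal.rpow_natCast, ← ENNReal.rpow_mul]; simp
  rw [← hJ]
  refine pow_le_pow_left' (kernelNorm_le fun g hgm hg => ENNReal.le_of_sq_le_sq ?_) 2
  rw [eLpNorm_two_sq, mul_pow, hJ, eLpNorm_two_sq]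
  have h1 : ∀ᵐ x ∂μ, ‖∫ y, U x y * g y ∂μ‖ₑ ^ 2 ≤ a * ∫⁻ y, ‖U x y‖ₑ * ‖g y‖ₑ ^ 2 ∂μ := by
    filter_upwards [ha] with x hx
    have hUx : Measurable (U x) := hU.of_uncurry_left
    have h2 : ‖∫ y, U x y * g y ∂μ‖ₑ ≤ ∫⁻ y, ‖U x y‖ₑ ^ (1 / 2 : ℝ) *
        (‖U x y‖ₑ ^ (1 / 2 : ℝ) * ‖g y‖ₑ) ∂μ := by
      refine (enorm_integral_le_lintegral_enorm _).trans (lintegral_mono fun y => ?_)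
      rw [enorm_mul, ← mul_assoc, ← ENNReal.rpow_add_of_nonneg _ _ (by norm_num) (by norm_num)]
      norm_num
    have h3 := h2.trans (ENNReal.lintegral_mul_le_Lp_mul_Lq μ Real.HolderConjugate.two_two
      (hUx.enorm.pow_const _).aemeasurable ((hUx.enorm.pow_const _).mul hgm.enorm).aemeasurable)
    refine (pow_le_pow_left' h3 2).trans ?_
    rw [mul_pow]
    simp only [← ENNReal.rpow_natCast, ← ENNReal.rpow_mul]
    norm_num
    refine mul_le_mul' hx (le_of_eq ?_)
    refine lintegral_congr fun y => ?_
    rw [mul_pow, ← ENNReal.rpow_natCast, ← ENNReal.rpow_mul]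
    norm_num
  calc _ ≤ ∫⁻ x, a * ∫⁻ y, ‖U x y‖ₑ * ‖g y‖ₑ ^ 2 ∂μ ∂μ := lintegral_mono_ae h1
    _ = a * ∫⁻ y, ∫⁻ x, ‖U x y‖ₑ * ‖g y‖ₑ ^ 2 ∂μ ∂μ := by
      rw [lintegral_const_mul' _ _ ha', lintegral_lintegral_swap]
      exact (hU.enorm.mul ((hgm.comp measurable_snd).enorm.pow_const 2)).aemeasurable
    _ ≤ a * ∫⁻ y, b * ‖g y‖ₑ ^ 2 ∂μ := by
      gcongr 1
      refine lintegral_mono_ae ?_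
      filter_upwards [hb'] with y hy
      rw [lintegral_mul_const _ hU.of_uncurry_right.enorm]
      gcongr
    _ = _ := by rw [lintegral_const_mul' _ _ hb, mul_assoc]

end KernelNorm

end SquareIntegrable

/-! ### Marginals, norms and edge densities -/

lemma measurableEmbedding_inl {α β : Type*} [MeasurableSpace α] [MeasurableSpace β] :
    MeasurableEmbedding (Sum.inl : α → α ⊕ β) :=
  ⟨Sum.inl_injective, measurable_inl, fun {_} hs => measurableSet_inl_image.2 hs⟩

namespace GraphexData

variable {Ω : Type*} {X : Type*} [MeasurableSpace Ω] [MeasurableSpace X]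

/-- The requirements on the functions of a graphex that do not involve the measure: measurability,
symmetry and the bounds on the values. -/
structure IsProper (T : GraphexData Ω) : Prop where
  measurable_W : Measurable (fun p : Ω × Ω => T.W p.1 p.2)
  W_mem : ∀ x y, T.W x y ∈ Set.Icc (0 : ℝ) 1
  W_symm : ∀ x y, T.W x y = T.W y x
  measurable_S : Measurable T.S
  S_nonneg : ∀ x, 0 ≤ T.S x
  I_nonneg : 0 ≤ T.I

/-- Finiteness of `‖𝕎‖₁` and of the `L²` norm of the marginal; for proper data this is membership
in `L¹ ∩ L²`. -/
structure FiniteOn (T : GraphexData Ω) (μ : Measure Ω) : Prop where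
  norm1_ne_top : T.norm1 μ ≠ ∞
  lintegral_sq : ∫⁻ x, T.marginal μ x ^ 2 ∂μ ≠ ∞

variable {T : GraphexData Ω} {μ ν : Measure Ω}

namespace IsProper

lemma pullback (hT : T.IsProper) {q : X → Ω} (hq : Measurable q) : (T.pullback q).IsProper where
  measurable_W := hT.measurable_W.comp (hq.prodMap hq)
  W_mem _ _ := hT.W_mem _ _
  W_symm _ _ := hT.W_symm _ _
  measurable_S := hT.measurable_S.comp hq
  S_nonneg _ := hT.S_nonneg _
  I_nonneg := hT.I_nonneg

lemma extend (hT : T.IsProper) : T.extend.IsProper where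
  measurable_W := by
    let e : Ω × Ω → (Ω ⊕ ℝ) × (Ω ⊕ ℝ) := Prod.map Sum.inl Sum.inl
    have he : MeasurableEmbedding e :=
      measurableEmbedding_inl.prodMap measurableEmbedding_inl
    have h2 : (fun p : (Ω ⊕ ℝ) × (Ω ⊕ ℝ) => T.extend.W p.1 p.2) =
        Function.extend e (fun p => T.W p.1 p.2) 0 := by
      funext ⟨a, b⟩
      by_cases h : ∃ p, e p = (a, b)
      · obtain ⟨p, hp⟩ := h
        rw [← hp, he.injective.extend_apply]
        rfl
      · rw [Function.extend_apply' _ _ _ h]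
        rcases a with a | a <;> rcases b with b | b <;> try rfl
        exact absurd ⟨(a, b), rfl⟩ h
    rw [h2]
    exact he.measurable_extend hT.measurable_W measurable_const
  W_mem a b := by
    rcases a with a | a <;> rcases b with b | b <;> simp [GraphexData.extend, (hT.W_mem _ _).1,
      (hT.W_mem _ _).2]
  W_symm a b := by
    rcases a with a | a <;> rcases b with b | b
    · exact hT.W_symm a b
    all_goals rfl
  measurable_S := by
    refine measurable_fun_sum ?_ ?_
    · exact hT.measurable_S
    · exact measurable_const
  S_nonneg a := by rcases a with a | a <;> simp [GraphexData.extend, hT.S_nonneg]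
  I_nonneg := hT.I_nonneg

lemma measurable_section (hT : T.IsProper) (x : Ω) : Measurable (T.W x) :=
  hT.measurable_W.comp measurable_prodMk_left

lemma measurable_uncurry (hT : T.IsProper) : Measurable (uncurry T.W) := hT.measurable_W

lemma norm1_eq (hT : T.IsProper) : T.norm1 μ = (∫⁻ x, ∫⁻ y, ENNReal.ofReal (T.W x y) ∂μ ∂μ)
    + 2 * (∫⁻ x, ENNReal.ofReal (T.S x) ∂μ) + 2 * ENNReal.ofReal T.I := by
  unfold norm1
  simp only [Real.enorm_of_nonneg (hT.W_mem _ _).1, Real.enorm_of_nonneg (hT.S_nonneg _),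
    Real.enorm_of_nonneg hT.I_nonneg]

lemma measurable_lintegral_W [SFinite μ] (hT : T.IsProper) :
    Measurable fun x => ∫⁻ y, ENNReal.ofReal (T.W x y) ∂μ :=
  Measurable.lintegral_prod_right (f := fun x y => ENNReal.ofReal (T.W x y))
    hT.measurable_W.ennreal_ofReal

lemma measurable_marginal [SFinite μ] (hT : T.IsProper) : Measurable (T.marginal μ) :=
  hT.measurable_lintegral_W.add hT.measurable_S.ennreal_ofReal

lemma lintegral_marginal [SFinite ν] (hT : T.IsProper) :
    ∫⁻ x, T.marginal ν x ∂μ =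
      (∫⁻ x, ∫⁻ y, ENNReal.ofReal (T.W x y) ∂ν ∂μ) + ∫⁻ x, ENNReal.ofReal (T.S x) ∂μ := by
  unfold marginal
  rw [lintegral_add_left hT.measurable_lintegral_W]

lemma lintegral_marginal_le [SFinite μ] (hT : T.IsProper) :
    ∫⁻ x, T.marginal μ x ∂μ ≤ T.norm1 μ := by
  rw [hT.lintegral_marginal, hT.norm1_eq]
  refine le_trans ?_ le_self_add
  gcongr
  exact le_mul_of_one_le_left' one_le_two

lemma lintegral_W_le (hT : T.IsProper) :
    ∫⁻ x, ∫⁻ y, ENNReal.ofReal (T.W x y) ∂μ ∂μ ≤ T.norm1 μ := by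
  rw [hT.norm1_eq, add_assoc]
  exact le_self_add

lemma rho_eq [SFinite μ] (hT : T.IsProper) (h : T.norm1 μ ≠ ∞) : T.rho μ = (T.norm1 μ).toReal := by
  unfold rho
  rw [hT.norm1_eq] at h ⊢
  rw [ENNReal.add_ne_top, ENNReal.add_ne_top] at h
  rw [ENNReal.toReal_add (ENNReal.add_ne_top.2 h.1) h.2, ENNReal.toReal_add h.1.1 h.1.2]
  congr 1
  · congr 1
    · rw [integral_eq_lintegral_of_nonneg_ae (Eventually.of_forall fun p => (hT.W_mem _ _).1)
        hT.measurable_W.aestronglyMeasurable]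
      rw [lintegral_prod _ hT.measurable_W.ennreal_ofReal.aemeasurable]
    · rw [integral_eq_lintegral_of_nonneg_ae (Eventually.of_forall fun p => hT.S_nonneg _)
        hT.measurable_S.aestronglyMeasurable]
      simp
  · simp [hT.I_nonneg]

lemma norm1_mono (_hT : T.IsProper) (h : ν ≤ μ) : T.norm1 ν ≤ T.norm1 μ := by
  unfold norm1
  gcongr

lemma marginal_mono (_hT : T.IsProper) (h : ν ≤ μ) (x : Ω) : T.marginal ν x ≤ T.marginal μ x := by
  unfold marginal
  gcongr

end IsProper

namespace FiniteOn

lemma mono (hF : T.FiniteOn μ) (hT : T.IsProper) (h : ν ≤ μ) : T.FiniteOn ν :=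
  ⟨ne_top_of_le_ne_top hF.1 (hT.norm1_mono h), ne_top_of_le_ne_top hF.2
    (lintegral_mono' h fun x => pow_le_pow_left' (hT.marginal_mono h x) 2)⟩

lemma isL2Kernel (hF : T.FiniteOn μ) (hT : T.IsProper) : IsL2Kernel T.W μ := by
  refine ⟨hT.measurable_W, ne_top_of_le_ne_top hF.1 (le_trans ?_ hT.lintegral_W_le)⟩
  refine lintegral_mono fun x => lintegral_mono fun y => ?_
  rw [Real.enorm_of_nonneg (hT.W_mem x y).1]
  refine pow_le_of_le_one zero_le ?_ two_ne_zero
  exact ENNReal.ofReal_le_one.2 (hT.W_mem x y).2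

lemma ae_lt_top [SFinite μ] (hF : T.FiniteOn μ) (hT : T.IsProper) :
    ∀ᵐ x ∂μ, T.marginal μ x < ∞ :=
  MeasureTheory.ae_lt_top hT.measurable_marginal
    (ne_top_of_le_ne_top hF.1 hT.lintegral_marginal_le)

lemma memLp_marginal [SFinite μ] (hF : T.FiniteOn μ) (hT : T.IsProper) :
    MemLp (fun x => (T.marginal μ x).toReal) 2 μ := by
  refine memLp_two_of_lintegral_sq hT.measurable_marginal.ennreal_toReal
    (ne_top_of_le_ne_top hF.2 (lintegral_mono fun x => pow_le_pow_left' ?_ 2))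
  rw [Real.enorm_of_nonneg ENNReal.toReal_nonneg]
  exact ENNReal.ofReal_toReal_le

end FiniteOn

lemma IsProper.memL1L2_iff [SFinite μ] (hT : T.IsProper) : T.MemL1L2 μ ↔ T.FiniteOn μ := by
  have hm1 : AEStronglyMeasurable (fun p : Ω × Ω => T.W p.1 p.2) (μ.prod μ) :=
    hT.measurable_W.aestronglyMeasurable
  have hm2 : AEStronglyMeasurable (T.marginal μ) μ := hT.measurable_marginal.aestronglyMeasurable
  have hsq : eLpNorm (T.marginal μ) 2 μ ^ 2 = ∫⁻ x, T.marginal μ x ^ 2 ∂μ := by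
    rw [eLpNorm_eq_lintegral_rpow_enorm_toReal two_ne_zero ENNReal.ofNat_ne_top]
    simp only [ENNReal.toReal_ofNat, ENNReal.rpow_ofNat, one_div, enorm_eq_self]
    rw [← ENNReal.rpow_natCast, ← ENNReal.rpow_mul]
    simp
  constructor
  · rintro ⟨⟨h1, _⟩, h3, h4⟩
    have h5 : ∫⁻ x, T.marginal μ x ∂μ ≠ ∞ := by
      have := h3.2.ne
      rw [eLpNorm_one_eq_lintegral_enorm] at this
      simpa using this
    refine ⟨?_, ?_⟩
    · rw [hT.lintegral_marginal, ENNReal.add_ne_top] at h5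
      rw [hT.norm1_eq]
      exact ENNReal.add_ne_top.2 ⟨ENNReal.add_ne_top.2 ⟨h5.1,
        ENNReal.mul_ne_top (by simp) h5.2⟩, ENNReal.mul_ne_top (by simp) (by simp)⟩
    · rw [← hsq]
      exact ENNReal.pow_ne_top h4.2.ne
  · intro hF
    refine ⟨⟨⟨hm1, ?_⟩, ⟨hm1, ?_⟩⟩, ⟨hm2, ?_⟩, ⟨hm2, ?_⟩⟩
    · rw [eLpNorm_one_eq_lintegral_enorm,
        lintegral_prod _ hT.measurable_W.enorm.aemeasurable]
      refine lt_of_le_of_lt ?_ (lt_top_iff_ne_top.2 hF.1)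
      unfold norm1
      rw [add_assoc]
      exact le_self_add
    · have := (hF.isL2Kernel hT).lintegral_sq
      rw [← lintegral_prod _ ((hT.measurable_W.enorm.pow_const 2)).aemeasurable,
        ← eLpNorm_two_sq] at this
      exact lt_top_iff_ne_top.2 fun h => this (by rw [h]; simp)
    · rw [eLpNorm_one_eq_lintegral_enorm]
      refine lt_of_le_of_lt ?_ (lt_top_iff_ne_top.2
        (ne_top_of_le_ne_top hF.1 hT.lintegral_marginal_le))
      simp
    · have := hF.2
      rw [← hsq] at this
      exact lt_top_iff_ne_top.2 fun h => this (by rw [h]; simp)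

/-- The data vanish as soon as one of the arguments lies outside of `Z`. -/
structure VanishesOff (T : GraphexData Ω) (Z : Set Ω) : Prop where
  W_eq : ∀ x y, x ∉ Z → T.W x y = 0
  S_eq : ∀ x, x ∉ Z → T.S x = 0

lemma VanishesOff.W_eq' {Z : Set Ω} (h : T.VanishesOff Z) (hT : T.IsProper) (x y : Ω)
    (hy : y ∉ Z) : T.W x y = 0 := by
  rw [hT.W_symm, h.W_eq _ _ hy]

lemma VanishesOff.marginal_eq {Z : Set Ω} (h : T.VanishesOff Z) (x : Ω)
    (hx : x ∉ Z) : T.marginal μ x = 0 := by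
  simp [marginal, h.W_eq x _ hx, h.S_eq x hx]

omit [MeasurableSpace Ω] in
lemma vanishesOff_univ : T.VanishesOff Set.univ := ⟨fun _ _ h => absurd trivial h,
  fun _ h => absurd trivial h⟩

end GraphexData

lemma lintegral_eq_of_restrict_eq {Y : Type*} [MeasurableSpace Y] {Z : Set Y}
    (hZ : MeasurableSet Z) {μ ν : Measure Y} (h : μ.restrict Z = ν.restrict Z) {f : Y → ℝ≥0∞}
    (hf : ∀ x, x ∉ Z → f x = 0) : ∫⁻ x, f x ∂μ = ∫⁻ x, f x ∂ν := by
  have : f = Z.indicator f := by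
    funext x
    by_cases hx : x ∈ Z
    · rw [Set.indicator_of_mem hx]
    · rw [Set.indicator_of_notMem hx, hf x hx]
  rw [this, lintegral_indicator hZ, lintegral_indicator hZ, h]

namespace GraphexData

/-! ### Pullbacks and comparison on one space -/

section Pullback

variable {X : Type*} {Y : Type*} [MeasurableSpace X] [MeasurableSpace Y]
  {T A B C : GraphexData Y} {q : X → Y} {γ : Measure X} {η : Measure Y} {Z : Set Y}

lemma IsProper.marginal_pullback (hT : T.IsProper) (hq : Measurable q) (hZ : MeasurableSet Z)
    (hv : T.VanishesOff Z) (h : (γ.map q).restrict Z = η.restrict Z) (x : X) :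
    (T.pullback q).marginal γ x = T.marginal η (q x) := by
  unfold marginal
  simp only [GraphexData.pullback]
  congr 1
  rw [← lintegral_eq_of_restrict_eq hZ h (fun y hy => by rw [hv.W_eq' hT _ _ hy]; simp),
    lintegral_map (hT.measurable_section _).ennreal_ofReal hq]

lemma IsProper.norm1_pullback [SFinite γ] [SFinite η] (hT : T.IsProper) (hq : Measurable q)
    (hZ : MeasurableSet Z)
    (hv : T.VanishesOff Z) (h : (γ.map q).restrict Z = η.restrict Z) :
    (T.pullback q).norm1 γ = T.norm1 η := by
  have hpb := hT.pullback hq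
  rw [hpb.norm1_eq, hT.norm1_eq]
  congr 1
  congr 1
  · rw [← lintegral_eq_of_restrict_eq hZ h
      (fun x hx => by simp [hv.W_eq _ _ hx]), lintegral_map hT.measurable_lintegral_W hq]
    refine lintegral_congr fun x => ?_
    rw [← lintegral_eq_of_restrict_eq hZ h (fun y hy => by rw [hv.W_eq' hT _ _ hy]; simp),
      lintegral_map (hT.measurable_section _).ennreal_ofReal hq]
    rfl
  · rw [← lintegral_eq_of_restrict_eq hZ h (fun y hy => by rw [hv.S_eq _ hy]; simp),
      lintegral_map hT.measurable_S.ennreal_ofReal hq]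
    rfl

lemma IsProper.rho_pullback [SFinite γ] [SFinite η] (hT : T.IsProper) (hq : Measurable q)
    (hZ : MeasurableSet Z) (hv : T.VanishesOff Z) (h : (γ.map q).restrict Z = η.restrict Z)
    (hF : T.norm1 η ≠ ∞) : (T.pullback q).rho γ = T.rho η := by
  rw [hT.rho_eq hF, (hT.pullback hq).rho_eq (by rwa [hT.norm1_pullback hq hZ hv h]),
    hT.norm1_pullback hq hZ hv h]

lemma IsProper.finiteOn_pullback [SFinite γ] [SFinite η] (hT : T.IsProper) (hq : Measurable q)
    (hZ : MeasurableSet Z) (hv : T.VanishesOff Z) (h : (γ.map q).restrict Z = η.restrict Z) :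
    (T.pullback q).FiniteOn γ ↔ T.FiniteOn η := by
  have h2 : ∫⁻ x, (T.pullback q).marginal γ x ^ 2 ∂γ = ∫⁻ x, T.marginal η x ^ 2 ∂η := by
    rw [← lintegral_eq_of_restrict_eq hZ h (fun x hx => by rw [hv.marginal_eq x hx]; simp),
      lintegral_map (hT.measurable_marginal.pow_const 2) hq]
    simp_rw [hT.marginal_pullback hq hZ hv h]
  constructor
  · rintro ⟨h3, h4⟩
    exact ⟨by rwa [hT.norm1_pullback hq hZ hv h] at h3, by rwa [h2] at h4⟩
  · rintro ⟨h3, h4⟩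
    exact ⟨by rwa [hT.norm1_pullback hq hZ hv h], by rwa [h2]⟩

/-- The three components of the distance `d_{2→2}` are bounded by `k`, `d` and `r`, without the
roots that make `d_{2→2}` homogeneous. -/
structure Near (A B : GraphexData X) (γ : Measure X) (k d r : ℝ≥0∞) : Prop where
  kernel : kernelNorm (fun x y => A.W x y - B.W x y) γ ≤ k
  marginal : eLpNorm (fun x => (A.marginal γ x).toReal - (B.marginal γ x).toReal) 2 γ ≤ d
  rho : ‖A.rho γ - B.rho γ‖ₑ ≤ r

lemma Near.mono {A B : GraphexData X} {k d r k' d' r' : ℝ≥0∞} (h : A.Near B γ k d r)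
    (hk : k ≤ k') (hd : d ≤ d') (hr : r ≤ r') : A.Near B γ k' d' r' :=
  ⟨h.1.trans hk, h.2.trans hd, h.3.trans hr⟩

lemma Near.symm {A B : GraphexData X} {k d r : ℝ≥0∞} (h : A.Near B γ k d r) :
    B.Near A γ k d r := by
  refine ⟨by rw [kernelNorm_sub_comm]; exact h.1, ?_, ?_⟩
  · rw [← eLpNorm_neg]
    refine le_of_eq_of_le (congrArg (fun f => eLpNorm f 2 γ) ?_) h.2
    funext x
    simp
  · rw [← enorm_neg, neg_sub]; exact h.3

lemma near_self (A : GraphexData X) (γ : Measure X) : A.Near A γ 0 0 0 := by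
  refine ⟨?_, by simp, by simp⟩
  refine kernelNorm_le fun g _ _ => ?_
  simp

lemma Near.trans [SFinite γ] {A B C : GraphexData X} {k d r k' d' r' : ℝ≥0∞}
    (hA : A.IsProper) (hB : B.IsProper) (hC : C.IsProper)
    (fA : A.FiniteOn γ) (fB : B.FiniteOn γ) (fC : C.FiniteOn γ)
    (h : A.Near B γ k d r) (h' : B.Near C γ k' d' r') :
    A.Near C γ (k + k') (d + d') (r + r') := by
  refine ⟨?_, ?_, ?_⟩
  · have := kernelNorm_add_le ((fA.isL2Kernel hA).sub (fB.isL2Kernel hB))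
      ((fB.isL2Kernel hB).sub (fC.isL2Kernel hC))
    simp only [sub_add_sub_cancel] at this
    exact this.trans (add_le_add h.1 h'.1)
  · have := eLpNorm_add_le (μ := γ) (p := 2)
      (hA.measurable_marginal.ennreal_toReal.sub
        hB.measurable_marginal.ennreal_toReal : Measurable fun x => (A.marginal γ x).toReal -
          (B.marginal γ x).toReal).aestronglyMeasurable
      (hB.measurable_marginal.ennreal_toReal.sub
        hC.measurable_marginal.ennreal_toReal : Measurable fun x => (B.marginal γ x).toReal -
          (C.marginal γ x).toReal).aestronglyMeasurable one_le_two
    refine le_trans (le_of_eq ?_) (this.trans (add_le_add h.2 h'.2))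
    congr 1
    funext x
    simp
  · have := enorm_add_le (A.rho γ - B.rho γ) (B.rho γ - C.rho γ)
    simp only [sub_add_sub_cancel] at this
    exact this.trans (add_le_add h.3 h'.3)

lemma eLpNorm_marginal_sub_pullback [SFinite γ] [SFinite η] (hA : A.IsProper) (hB : B.IsProper)
    (hq : Measurable q) (hZ : MeasurableSet Z) (vA : A.VanishesOff Z) (vB : B.VanishesOff Z)
    (h : (γ.map q).restrict Z = η.restrict Z) :
    eLpNorm (fun x => ((A.pullback q).marginal γ x).toReal
      - ((B.pullback q).marginal γ x).toReal) 2 γ =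
    eLpNorm (fun x => (A.marginal η x).toReal - (B.marginal η x).toReal) 2 η := by
  have : ∀ a b : ℝ≥0∞, a ^ 2 = b ^ 2 → a = b := fun a b h =>
    (ENNReal.pow_right_strictMono two_ne_zero).injective h
  apply this
  rw [eLpNorm_two_sq, eLpNorm_two_sq, ← lintegral_eq_of_restrict_eq hZ h
    (fun x hx => by rw [vA.marginal_eq x hx, vB.marginal_eq x hx]; simp),
    lintegral_map (f := fun x => ‖(A.marginal η x).toReal - (B.marginal η x).toReal‖ₑ ^ 2)
      ((hA.measurable_marginal.ennreal_toReal.sub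
      hB.measurable_marginal.ennreal_toReal).enorm.pow_const 2) hq]
  simp_rw [hA.marginal_pullback hq hZ vA h, hB.marginal_pullback hq hZ vB h]

lemma Near.pullback [SFinite γ] [SFinite η] (hA : A.IsProper) (hB : B.IsProper)
    (fA : A.FiniteOn η) (fB : B.FiniteOn η) (hq : Measurable q) (hZ : MeasurableSet Z)
    (vA : A.VanishesOff Z) (vB : B.VanishesOff Z) (h : (γ.map q).restrict Z = η.restrict Z)
    {k d r : ℝ≥0∞} (hN : A.Near B η k d r) : (A.pullback q).Near (B.pullback q) γ k d r := by
  refine ⟨?_, ?_, ?_⟩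
  · refine (kernelNorm_le_restrict (hq hZ) (fun x y hx => ?_) (fun x y hy => ?_)).trans
      ((kernelNorm_comp_le hq (η := η) ?_
        (U := fun x y => A.W x y - B.W x y)
        ((fA.isL2Kernel hA).sub (fB.isL2Kernel hB))).trans hN.1)
    · simp [GraphexData.pullback, vA.W_eq _ _ hx, vB.W_eq _ _ hx]
    · simp [GraphexData.pullback, vA.W_eq' hA _ _ hy, vB.W_eq' hB _ _ hy]
    · rw [← Measure.restrict_map hq hZ, h]
      exact Measure.restrict_le_self
  · rw [eLpNorm_marginal_sub_pullback hA hB hq hZ vA vB h]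
    exact hN.2
  · rw [hA.rho_pullback hq hZ vA h fA.1, hB.rho_pullback hq hZ vB h fB.1]
    exact hN.3

lemma Near.of_pullback [SFinite γ] [SFinite η] (hA : A.IsProper) (hB : B.IsProper)
    (fA : A.FiniteOn η) (fB : B.FiniteOn η) (hq : Measurable q) (hZ : MeasurableSet Z)
    (vA : A.VanishesOff Z) (vB : B.VanishesOff Z) (h : (γ.map q).restrict Z = η.restrict Z)
    {k d r : ℝ≥0∞} (hN : (A.pullback q).Near (B.pullback q) γ k d r) : A.Near B η k d r := by
  have fA' := (hA.finiteOn_pullback hq hZ vA h).2 fA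
  have fB' := (hB.finiteOn_pullback hq hZ vB h).2 fB
  refine ⟨?_, ?_, ?_⟩
  · refine (kernelNorm_le_restrict hZ (fun x y hx => ?_) (fun x y hy => ?_)).trans ?_
    · simp [vA.W_eq _ _ hx, vB.W_eq _ _ hx]
    · simp [vA.W_eq' hA _ _ hy, vB.W_eq' hB _ _ hy]
    · rw [← h, Measure.restrict_map hq hZ]
      refine (kernelNorm_map_le hq (U := fun x y => A.W x y - B.W x y)
        (hA.measurable_W.sub hB.measurable_W)).trans ?_
      refine (kernelNorm_mono_measure Measure.restrict_le_self ?_).trans hN.1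
      exact (fA'.isL2Kernel (hA.pullback hq)).sub (fB'.isL2Kernel (hB.pullback hq))
  · rw [← eLpNorm_marginal_sub_pullback hA hB hq hZ vA vB h]
    exact hN.2
  · rw [← hA.rho_pullback hq hZ vA h fA.1, ← hB.rho_pullback hq hZ vB h fB.1]
    exact hN.3

end Pullback

/-! ### Removing a part of the measure -/

section Reweight

variable {X : Type*} [MeasurableSpace X] {A B T : GraphexData X} {γ γ' η : Measure X}

/-- Splitting the measure: inclusion-exclusion for `‖𝕎‖₁` in terms of the marginal. -/
lemma IsProper.norm1_add (hT : T.IsProper) [SFinite γ'] [SFinite η] :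
    T.norm1 (γ' + η) + ∫⁻ x, ∫⁻ y, ENNReal.ofReal (T.W x y) ∂η ∂η
      = T.norm1 γ' + 2 * ∫⁻ x, T.marginal (γ' + η) x ∂η := by
  rw [hT.norm1_eq, hT.norm1_eq, hT.lintegral_marginal]
  simp only [lintegral_add_measure]
  rw [lintegral_add_left hT.measurable_lintegral_W, lintegral_add_left hT.measurable_lintegral_W]
  have : ∫⁻ x, ∫⁻ y, ENNReal.ofReal (T.W x y) ∂η ∂γ' =
      ∫⁻ x, ∫⁻ y, ENNReal.ofReal (T.W x y) ∂γ' ∂η := by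
    rw [lintegral_lintegral_swap hT.measurable_W.ennreal_ofReal.aemeasurable]
    simp_rw [hT.W_symm]
  rw [this]
  ring

lemma IsProper.toReal_marginal_add (hT : T.IsProper) [SFinite γ'] [SFinite η] {x : X}
    (hx : T.marginal (γ' + η) x ≠ ∞) :
    (T.marginal (γ' + η) x).toReal = (T.marginal γ' x).toReal + ∫ y, T.W x y ∂η := by
  rw [integral_eq_lintegral_of_nonneg_ae (Eventually.of_forall fun y => (hT.W_mem _ _).1)
    (hT.measurable_section x).aestronglyMeasurable]
  have h1 : T.marginal (γ' + η) x = T.marginal γ' x + ∫⁻ y, ENNReal.ofReal (T.W x y) ∂η := by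
    unfold marginal
    rw [lintegral_add_measure]
    ring
  rw [h1] at hx ⊢
  rw [ENNReal.add_ne_top] at hx
  exact ENNReal.toReal_add hx.1 hx.2

lemma IsProper.integral_W_eq (hT : T.IsProper) [SFinite η]
    (h : ∫⁻ x, ∫⁻ y, ENNReal.ofReal (T.W x y) ∂η ∂η ≠ ∞) :
    ∫ x, ∫ y, T.W x y ∂η ∂η = (∫⁻ x, ∫⁻ y, ENNReal.ofReal (T.W x y) ∂η ∂η).toReal := by
  rw [← integral_toReal hT.measurable_lintegral_W.aemeasurable
    (ae_lt_top hT.measurable_lintegral_W h)]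
  refine integral_congr_ae (Eventually.of_forall fun x => ?_)
  simp only
  rw [integral_eq_lintegral_of_nonneg_ae (Eventually.of_forall fun y => (hT.W_mem _ _).1)
    (hT.measurable_section x).aestronglyMeasurable]

/-- Inclusion-exclusion for the edge density when the part `η` of the measure is removed. -/
lemma IsProper.rho_eq_of_add (hT : T.IsProper) [SFinite γ'] [SFinite η]
    (h : T.norm1 (γ' + η) ≠ ∞) :
    T.rho γ' = T.rho (γ' + η) + (∫ x, ∫ y, T.W x y ∂η ∂η)
      - 2 * ∫ x, (T.marginal (γ' + η) x).toReal ∂η := by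
  have hle : γ' ≤ γ' + η := Measure.le_add_right le_rfl
  have hle' : η ≤ γ' + η := Measure.le_add_left le_rfl
  have e1 := hT.norm1_add (γ' := γ') (η := η)
  have f1 : ∫⁻ x, T.marginal (γ' + η) x ∂η ≠ ∞ := ne_top_of_le_ne_top h
    ((lintegral_mono' hle' fun _ => le_rfl).trans hT.lintegral_marginal_le)
  have f2 : ∫⁻ x, ∫⁻ y, ENNReal.ofReal (T.W x y) ∂η ∂η ≠ ∞ :=
    ne_top_of_le_ne_top h (hT.lintegral_W_le.trans (hT.norm1_mono hle'))
  have f3 : T.norm1 γ' ≠ ∞ := ne_top_of_le_ne_top h (hT.norm1_mono hle)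
  have e2 : ∫ x, (T.marginal (γ' + η) x).toReal ∂η
      = (∫⁻ x, T.marginal (γ' + η) x ∂η).toReal :=
    integral_toReal hT.measurable_marginal.aemeasurable (ae_lt_top hT.measurable_marginal f1)
  have e4 := congrArg ENNReal.toReal e1
  rw [ENNReal.toReal_add h f2, ENNReal.toReal_add f3 (ENNReal.mul_ne_top (by simp) f1),
    ENNReal.toReal_mul] at e4
  rw [hT.rho_eq f3, hT.rho_eq h, e2, hT.integral_W_eq f2]
  simp only [ENNReal.toReal_ofNat] at e4
  linarith

/-- Removing a part `η` of mass at most `s²` from the measure. The exponents match those in the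
definition of `d_{2→2}`: with `k = c`, `d = c²`, `r = c³` the new bounds are at most
`(c + s)²` and `(c + s)³`. -/
lemma Near.of_add [SFinite γ'] [IsFiniteMeasure η] (hA : A.IsProper) (hB : B.IsProper)
    (fA : A.FiniteOn (γ' + η)) (fB : B.FiniteOn (γ' + η)) {s : ℝ≥0∞} (hs : η Set.univ ≤ s ^ 2)
    {k d r : ℝ≥0∞} (h : A.Near B (γ' + η) k d r) :
    A.Near B γ' k (d + k * s) (r + 2 * d * s + k * s ^ 2) := by
  set γ := γ' + η
  have hle : γ' ≤ γ := Measure.le_add_right le_rfl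
  have hle' : η ≤ γ := Measure.le_add_left le_rfl
  have hU : IsL2Kernel (fun x y => A.W x y - B.W x y) γ :=
    (fA.isL2Kernel hA).sub (fB.isL2Kernel hB)
  have h1 : MemLp (fun _ : X => (1 : ℝ)) 2 η := memLp_const 1
  have h1n : eLpNorm (fun _ : X => (1 : ℝ)) 2 η ≤ s := by
    apply ENNReal.le_of_sq_le_sq
    rw [eLpNorm_two_sq]
    simpa using hs
  refine ⟨(kernelNorm_mono_measure hle hU).trans h.1, ?_, ?_⟩
  -- The function `g` is the density of `η` with respect to `γ' + η`: the marginals for `γ'` are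
  -- those for `γ' + η` minus the kernels applied to `g`.
  · obtain ⟨g, hgm, hg, hgn, hgi⟩ := exists_adjoint_comp measurable_id
      (η := γ) (by simpa using hle') h1
    have hae : (fun x => (A.marginal γ' x).toReal - (B.marginal γ' x).toReal) =ᵐ[γ]
        (fun x => (A.marginal γ x).toReal - (B.marginal γ x).toReal) -
          fun x => ∫ y, (A.W x y - B.W x y) * g y ∂γ := by
      filter_upwards [fA.ae_lt_top hA, fB.ae_lt_top hB, hU.ae_memLp] with x hx1 hx2 hx3
      have h4 := hgi _ hx3
      simp only [id, mul_one] at h4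
      simp only [Pi.sub_apply]
      rw [← h4, hA.toReal_marginal_add hx1.ne, hB.toReal_marginal_add hx2.ne, integral_sub]
      · ring
      · exact Integrable.of_bound (hA.measurable_section x).aestronglyMeasurable 1
          (Eventually.of_forall fun y => by
            rw [Real.norm_of_nonneg (hA.W_mem _ _).1]; exact (hA.W_mem _ _).2)
      · exact Integrable.of_bound (hB.measurable_section x).aestronglyMeasurable 1
          (Eventually.of_forall fun y => by
            rw [Real.norm_of_nonneg (hB.W_mem _ _).1]; exact (hB.W_mem _ _).2)
    refine (eLpNorm_mono_measure _ hle).trans ?_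
    rw [eLpNorm_congr_ae hae]
    refine (eLpNorm_sub_le (hA.measurable_marginal.ennreal_toReal.sub
        hB.measurable_marginal.ennreal_toReal).aestronglyMeasurable
        (measurable_integral_kernel_mul hU.measurable hgm).aestronglyMeasurable one_le_two).trans ?_
    refine add_le_add h.2 ((eLpNorm_kernel_le hg).trans ?_)
    exact mul_le_mul' h.1 (hgn.trans h1n)
  · have hfin : ∀ {T : GraphexData X}, T.IsProper → T.FiniteOn γ →
        T.rho γ' = T.rho γ + (∫ x, 1 * ∫ y, T.W x y * 1 ∂η ∂η)
          - 2 * ∫ x, (T.marginal γ x).toReal * 1 ∂η := by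
      intro T hT fT
      simpa only [one_mul, mul_one] using hT.rho_eq_of_add fT.1
    have hWint : ∀ {T : GraphexData X}, T.IsProper → ∀ x, Integrable (fun y => T.W x y) η :=
      fun {T} hT x => Integrable.of_bound (hT.measurable_section x).aestronglyMeasurable 1
          (Eventually.of_forall fun y => by
            rw [Real.norm_of_nonneg (hT.W_mem _ _).1]; exact (hT.W_mem _ _).2)
    have hWint2 : ∀ {T : GraphexData X}, T.IsProper →
        Integrable (fun x => ∫ y, T.W x y * 1 ∂η) η := by
      intro T hT
      refine Integrable.of_bound (measurable_integral_kernel_mul hT.measurable_uncurry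
        measurable_const).aestronglyMeasurable (η.real Set.univ) (Eventually.of_forall fun x => ?_)
      refine (norm_integral_le_of_norm_le_const (C := 1) (Eventually.of_forall fun y => ?_)).trans
        (by simp)
      rw [mul_one, Real.norm_of_nonneg (hT.W_mem _ _).1]; exact (hT.W_mem _ _).2
    have hDint : ∀ {T : GraphexData X}, T.IsProper → T.FiniteOn γ →
        Integrable (fun x => (T.marginal γ x).toReal * 1) η := by
      intro T hT fT
      exact ((fT.memLp_marginal hT).mono_measure hle').integrable_mul h1
    -- The integral kernel with constant factors `1` is the form in which the bound by the kernel
    -- norm is available.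
    have e : A.rho γ' - B.rho γ' = (A.rho γ - B.rho γ)
        - 2 * (∫ x, ((A.marginal γ x).toReal - (B.marginal γ x).toReal) * 1 ∂η)
        + ∫ x, 1 * ∫ y, (A.W x y - B.W x y) * 1 ∂η ∂η := by
      rw [hfin hA fA, hfin hB fB]
      have e5 : (∫ x, ((A.marginal γ x).toReal - (B.marginal γ x).toReal) * 1 ∂η) =
          (∫ x, (A.marginal γ x).toReal * 1 ∂η) - ∫ x, (B.marginal γ x).toReal * 1 ∂η := by
        rw [← integral_sub (hDint hA fA) (hDint hB fB)]
        simp only [mul_one]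
      have e6 : (∫ x, 1 * ∫ y, (A.W x y - B.W x y) * 1 ∂η ∂η) =
          (∫ x, 1 * ∫ y, A.W x y * 1 ∂η ∂η) - ∫ x, 1 * ∫ y, B.W x y * 1 ∂η ∂η := by
        simp only [one_mul]
        rw [← integral_sub (hWint2 hA) (hWint2 hB)]
        refine integral_congr_ae (Eventually.of_forall fun x => ?_)
        simp only [mul_one]
        exact integral_sub (hWint hA x) (hWint hB x)
      rw [e5, e6]
      ring
    rw [e]
    refine (enorm_add_le _ _).trans (add_le_add ?_ ?_)
    · rw [sub_eq_add_neg]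
      refine (enorm_add_le _ _).trans (add_le_add h.3 ?_)
      rw [enorm_neg, enorm_mul, mul_assoc]
      have : ‖(2 : ℝ)‖ₑ = 2 := by
        rw [Real.enorm_of_nonneg (by norm_num)]; simp
      rw [this]
      gcongr
      refine (enorm_integral_mul_le (hA.measurable_marginal.ennreal_toReal.sub
        hB.measurable_marginal.ennreal_toReal).aestronglyMeasurable h1.1).trans ?_
      exact mul_le_mul' ((eLpNorm_mono_measure _ hle').trans h.2) h1n
    · refine (enorm_integral_kernel_le hU.measurable h1 measurable_const h1).trans ?_
      rw [pow_two, ← mul_assoc]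
      gcongr
      exact (kernelNorm_mono_measure hle' hU).trans h.1

end Reweight

end GraphexData

/-! ### Partial couplings -/

namespace GraphexData

section Covers

variable {Ω Ω₁ Ω₂ Ω₃ : Type*} {X : Type*} [MeasurableSpace Ω] [MeasurableSpace Ω₁]
  [MeasurableSpace Ω₂] [MeasurableSpace Ω₃] [MeasurableSpace X]

/-- The partial map `p`, undefined where its value lies on the appended line, pushes `γ`
to `μ`. -/
structure Covers (γ : Measure X) (p : X → Ω ⊕ ℝ) (μ : Measure Ω) : Prop where
  measurable : Measurable p
  measure_preimage : ∀ B : Set Ω, MeasurableSet B → γ (p ⁻¹' (Sum.inl '' B)) = μ B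

variable {γ : Measure X} {p p' : X → Ω ⊕ ℝ} {μ ν : Measure Ω} {T : GraphexData Ω}

omit [MeasurableSpace Ω] in
lemma extend_vanishesOff : T.extend.VanishesOff (Set.range Sum.inl) := by
  refine ⟨fun x y hx => ?_, fun x hx => ?_⟩
  · rcases x with x | x
    · exact absurd ⟨x, rfl⟩ hx
    · rcases y with y | y <;> rfl
  · rcases x with x | x
    · exact absurd ⟨x, rfl⟩ hx
    · rfl

lemma covers_inl (μ : Measure Ω) : Covers μ (Sum.inl : Ω → Ω ⊕ ℝ) μ :=
  ⟨measurable_inl, fun B _ => by rw [Set.preimage_image_eq _ Sum.inl_injective]⟩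

lemma Covers.restrict_map (h : Covers γ p μ) :
    (γ.map p).restrict (Set.range Sum.inl) = (μ.map Sum.inl).restrict (Set.range Sum.inl) := by
  ext B hB
  rw [Measure.restrict_apply hB, Measure.restrict_apply hB,
    Measure.map_apply h.measurable (hB.inter measurableSet_range_inl),
    Measure.map_apply measurable_inl (hB.inter measurableSet_range_inl)]
  have : B ∩ Set.range Sum.inl = Sum.inl '' (Sum.inl ⁻¹' B) := by
    rw [Set.image_preimage_eq_inter_range]
  rw [this, h.measure_preimage _ (measurable_inl hB), Set.preimage_image_eq _ Sum.inl_injective]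

lemma map_inl_restrict (μ : Measure Ω) : (μ.map (Sum.inl : Ω → Ω ⊕ ℝ)).restrict
    (Set.range Sum.inl) = (μ.map Sum.inl).restrict (Set.range Sum.inl) := rfl

lemma marginal_extend_inl (hT : T.IsProper) (x : Ω) :
    T.extend.marginal (μ.map Sum.inl) (Sum.inl x) = T.marginal μ x :=
  (hT.extend.marginal_pullback measurable_inl measurableSet_range_inl extend_vanishesOff
    (map_inl_restrict μ) x).symm

lemma Covers.marginal_eq (h : Covers γ p μ) (hT : T.IsProper) (x : X) :
    (T.extend.pullback p).marginal γ x = Sum.elim (T.marginal μ) 0 (p x) := by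
  rw [hT.extend.marginal_pullback h.measurable measurableSet_range_inl extend_vanishesOff
    h.restrict_map]
  rcases hx : p x with y | y
  · rw [marginal_extend_inl hT]; rfl
  · rw [extend_vanishesOff.marginal_eq _ (by simp)]; rfl

lemma Covers.norm1_eq [SFinite γ] [SFinite μ] (h : Covers γ p μ) (hT : T.IsProper) :
    (T.extend.pullback p).norm1 γ = T.norm1 μ := by
  rw [hT.extend.norm1_pullback h.measurable measurableSet_range_inl extend_vanishesOff
    h.restrict_map]
  exact (hT.extend.norm1_pullback measurable_inl measurableSet_range_inl extend_vanishesOff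
    (map_inl_restrict μ)).symm

lemma Covers.finiteOn_iff [SFinite γ] [SFinite μ] (h : Covers γ p μ) (hT : T.IsProper) :
    (T.extend.pullback p).FiniteOn γ ↔ T.FiniteOn μ := by
  rw [hT.extend.finiteOn_pullback h.measurable measurableSet_range_inl extend_vanishesOff
    h.restrict_map]
  exact (hT.extend.finiteOn_pullback measurable_inl measurableSet_range_inl extend_vanishesOff
    (map_inl_restrict μ)).symm

lemma Covers.rho_eq [SFinite γ] [SFinite μ] (h : Covers γ p μ) (hT : T.IsProper)
    (hF : T.norm1 μ ≠ ∞) : (T.extend.pullback p).rho γ = T.rho μ := by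
  rw [hT.rho_eq hF, (hT.extend.pullback h.measurable).rho_eq (by rwa [h.norm1_eq hT]),
    h.norm1_eq hT]

lemma Covers.comp {Y : Type*} [MeasurableSpace Y] {η : Measure Y} {q : Y → X} (h : Covers γ p μ)
    (hq : Measurable q) (hη : η.map q = γ) : Covers η (p ∘ q) μ := by
  refine ⟨h.measurable.comp hq, fun B hB => ?_⟩
  rw [← h.measure_preimage B hB, ← hη, Measure.map_apply hq]
  · rfl
  · exact h.measurable (measurableSet_inl_image.2 hB)

lemma Covers.map_inl {Y : Type*} [MeasurableSpace Y] {q : X → Y} {r : Y → Ω ⊕ ℝ}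
    (hq : Measurable q) (hr : Measurable r) (h : Covers γ (r ∘ q) μ) :
    Covers (γ.map q) r μ := by
  refine ⟨hr, fun B hB => ?_⟩
  rw [Measure.map_apply hq (hr (measurableSet_inl_image.2 hB)), ← h.measure_preimage B hB]
  rfl

lemma Covers.lintegral (h : Covers γ p μ) {f : Ω → ℝ≥0∞} (hf : Measurable f) :
    ∫⁻ x, Sum.elim f 0 (p x) ∂γ = ∫⁻ x, f x ∂μ := by
  have hf' : Measurable (Sum.elim f (0 : ℝ → ℝ≥0∞)) := hf.sumElim measurable_const
  rw [← lintegral_map hf' h.measurable, lintegral_eq_of_restrict_eq measurableSet_range_inl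
    h.restrict_map, lintegral_map hf' measurable_inl]
  · rfl
  · rintro (x | x) hx
    · exact absurd ⟨x, rfl⟩ hx
    · rfl

lemma Covers.eLpNorm_eq (h : Covers γ p μ) {f : Ω → ℝ} (hf : Measurable f) :
    eLpNorm (fun x => Sum.elim f 0 (p x)) 2 γ = eLpNorm f 2 μ := by
  apply (ENNReal.pow_right_strictMono two_ne_zero).injective
  simp only
  rw [eLpNorm_two_sq, eLpNorm_two_sq, ← h.lintegral (hf.enorm.pow_const 2)]
  refine lintegral_congr fun x => ?_
  rcases p x with y | y <;> simp

/-- The extension of a kernel by zero to the appended line. -/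
def extendKernel (U : Ω → Ω → ℝ) (a b : Ω ⊕ ℝ) : ℝ :=
  Sum.elim (fun x => Sum.elim (fun y => U x y) 0 b) 0 a

lemma measurable_extendKernel {U : Ω → Ω → ℝ} (hU : Measurable (uncurry U)) :
    Measurable (uncurry (extendKernel U)) := by
  let e : Ω × Ω → (Ω ⊕ ℝ) × (Ω ⊕ ℝ) := Prod.map Sum.inl Sum.inl
  have he : MeasurableEmbedding e :=
    measurableEmbedding_inl.prodMap measurableEmbedding_inl
  have h2 : uncurry (extendKernel U) = Function.extend e (uncurry U) 0 := by
    funext ⟨a, b⟩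
    by_cases h : ∃ p, e p = (a, b)
    · obtain ⟨p, hp⟩ := h
      rw [← hp, he.injective.extend_apply]
      rfl
    · rw [Function.extend_apply' _ _ _ h]
      rcases a with a | a <;> rcases b with b | b <;> try rfl
      exact absurd ⟨(a, b), rfl⟩ h
  rw [h2]
  exact he.measurable_extend hU measurable_const

lemma Covers.kernelNorm_le [SFinite γ] [SFinite μ] (h : Covers γ p μ) {U : Ω → Ω → ℝ}
    (hU : IsL2Kernel U μ) :
    kernelNorm (fun x y => extendKernel U (p x) (p y)) γ ≤ kernelNorm U μ := by
  have hm := measurable_extendKernel hU.measurable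
  have hR : MeasurableSet (Set.range (Sum.inl : Ω → Ω ⊕ ℝ)) := measurableSet_range_inl
  have hL : IsL2Kernel (extendKernel U) (μ.map Sum.inl) := by
    refine ⟨hm, ?_⟩
    rw [lintegral_map (Measurable.lintegral_prod_right
      (f := fun x y => ‖extendKernel U x y‖ₑ ^ 2) (hm.enorm.pow_const 2)) measurable_inl]
    convert hU.lintegral_sq using 3 with x
    rw [lintegral_map (hm.of_uncurry_left.enorm.pow_const 2) measurable_inl]
    rfl
  refine (kernelNorm_le_restrict (h.measurable hR) ?_ ?_).trans
    ((kernelNorm_comp_le h.measurable (η := μ.map Sum.inl) ?_ hL).trans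
      (kernelNorm_map_le measurable_inl hm))
  · intro x y hx
    rcases hx' : p x with z | z
    · exact absurd ⟨z, hx'.symm⟩ hx
    · rfl
  · intro x y hy
    rcases hy' : p y with z | z
    · exact absurd ⟨z, hy'.symm⟩ hy
    · rcases p x with w | w <;> rfl
  · rw [← Measure.restrict_map h.measurable hR, h.restrict_map]
    exact Measure.restrict_le_self

/-- There is a measure on the product of the two extended spaces that couples `μ₁` and `μ₂`, except
that what it does on the appended lines is not prescribed, for which the pullbacks are near. -/
def JointNear (T₁ : GraphexData Ω₁) (μ₁ : Measure Ω₁) (T₂ : GraphexData Ω₂) (μ₂ : Measure Ω₂)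
    (k d r : ℝ≥0∞) : Prop :=
  ∃ γ : Measure ((Ω₁ ⊕ ℝ) × (Ω₂ ⊕ ℝ)), SFinite γ ∧ Covers γ Prod.fst μ₁ ∧ Covers γ Prod.snd μ₂ ∧
    (T₁.extend.pullback Prod.fst).Near (T₂.extend.pullback Prod.snd) γ k d r

variable {T₁ : GraphexData Ω₁} {μ₁ : Measure Ω₁} {T₂ : GraphexData Ω₂} {μ₂ : Measure Ω₂}
  {T₃ : GraphexData Ω₃} {μ₃ : Measure Ω₃} {k d r : ℝ≥0∞}

lemma jointNear_of_covers [SFinite γ] [SFinite μ₁] [SFinite μ₂] (h₁ : T₁.IsProper)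
    (h₂ : T₂.IsProper) (f₁ : T₁.FiniteOn μ₁) (f₂ : T₂.FiniteOn μ₂) {p₁ : X → Ω₁ ⊕ ℝ}
    {p₂ : X → Ω₂ ⊕ ℝ} (c₁ : Covers γ p₁ μ₁) (c₂ : Covers γ p₂ μ₂)
    (h : (T₁.extend.pullback p₁).Near (T₂.extend.pullback p₂) γ k d r) :
    JointNear T₁ μ₁ T₂ μ₂ k d r := by
  have hq : Measurable fun x => (p₁ x, p₂ x) := c₁.measurable.prodMk c₂.measurable
  have d₁ : Covers (γ.map fun x => (p₁ x, p₂ x)) Prod.fst μ₁ := Covers.map_inl hq measurable_fst c₁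
  have d₂ : Covers (γ.map fun x => (p₁ x, p₂ x)) Prod.snd μ₂ := Covers.map_inl hq measurable_snd c₂
  refine ⟨γ.map fun x => (p₁ x, p₂ x), inferInstance, d₁, d₂, ?_⟩
  exact Near.of_pullback (q := fun x => (p₁ x, p₂ x)) (Z := Set.univ)
    (h₁.extend.pullback measurable_fst)
    (h₂.extend.pullback measurable_snd) ((d₁.finiteOn_iff h₁).2 f₁) ((d₂.finiteOn_iff h₂).2 f₂)
    hq MeasurableSet.univ vanishesOff_univ vanishesOff_univ rfl h

lemma JointNear.symm [SFinite μ₁] [SFinite μ₂] (h₁ : T₁.IsProper)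
    (h₂ : T₂.IsProper) (f₁ : T₁.FiniteOn μ₁) (f₂ : T₂.FiniteOn μ₂)
    (h : JointNear T₁ μ₁ T₂ μ₂ k d r) : JointNear T₂ μ₂ T₁ μ₁ k d r := by
  obtain ⟨γ, _, c₁, c₂, hN⟩ := h
  exact jointNear_of_covers h₂ h₁ f₂ f₁ c₂ c₁ hN.symm

lemma jointNear_self [SFinite μ] (hT : T.IsProper) (fT : T.FiniteOn μ) :
    JointNear T μ T μ 0 0 0 :=
  jointNear_of_covers hT hT fT fT (covers_inl μ) (covers_inl μ) (near_self _ _)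

lemma JointNear.mono {k' d' r' : ℝ≥0∞} (h : JointNear T₁ μ₁ T₂ μ₂ k d r)
    (hk : k ≤ k') (hd : d ≤ d') (hr : r ≤ r') : JointNear T₁ μ₁ T₂ μ₂ k' d' r' := by
  obtain ⟨γ, s, c₁, c₂, hN⟩ := h
  exact ⟨γ, s, c₁, c₂, hN.mono hk hd hr⟩

lemma FiniteOn.exists_near {A B : GraphexData X} [SFinite γ] (hA : A.IsProper) (hB : B.IsProper)
    (fA : A.FiniteOn γ) (fB : B.FiniteOn γ) :
    ∃ k d r, k ≠ ∞ ∧ d ≠ ∞ ∧ r ≠ ∞ ∧ A.Near B γ k d r :=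
  ⟨_, _, _, ((fA.isL2Kernel hA).sub (fB.isL2Kernel hB)).kernelNorm_ne_top,
    ((fA.memLp_marginal hA).sub (fB.memLp_marginal hB)).2.ne, enorm_ne_top,
    ⟨le_rfl, le_rfl, le_rfl⟩⟩

/-- Two graphexes in `L¹ ∩ L²` can be compared by coupling everything with the appended lines. -/
lemma exists_jointNear [SFinite μ₁] [SFinite μ₂] (h₁ : T₁.IsProper)
    (h₂ : T₂.IsProper) (f₁ : T₁.FiniteOn μ₁) (f₂ : T₂.FiniteOn μ₂) :
    ∃ k d r, k ≠ ∞ ∧ d ≠ ∞ ∧ r ≠ ∞ ∧ JointNear T₁ μ₁ T₂ μ₂ k d r := by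
  set γ : Measure (Ω₁ ⊕ Ω₂) := μ₁.map Sum.inl + μ₂.map Sum.inr
  have c₁ : Covers γ (Sum.map id fun _ => (0 : ℝ)) μ₁ := by
    refine ⟨measurable_fun_sum measurable_inl (measurable_inr.comp measurable_const),
      fun B hB => ?_⟩
    have : (Sum.map id fun _ : Ω₂ => (0 : ℝ)) ⁻¹' (Sum.inl '' B) = Sum.inl '' B := by
      ext (x | x) <;> simp
    rw [this]
    simp only [γ, Measure.add_apply]
    rw [Measure.map_apply measurable_inl (measurableSet_inl_image.2 hB),
      Measure.map_apply measurable_inr (measurableSet_inl_image.2 hB),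
      Set.preimage_image_eq _ Sum.inl_injective]
    simp
  have c₂ : Covers γ (Sum.elim (fun _ => Sum.inr (0 : ℝ)) Sum.inl) μ₂ := by
    refine ⟨measurable_fun_sum measurable_const measurable_inl, fun B hB => ?_⟩
    have : (Sum.elim (fun _ : Ω₁ => Sum.inr (0 : ℝ)) Sum.inl) ⁻¹' (Sum.inl '' B)
        = Sum.inr '' B := by
      ext (x | x) <;> simp
    rw [this]
    simp only [γ, Measure.add_apply]
    rw [Measure.map_apply measurable_inl (measurableSet_inr_image.2 hB),
      Measure.map_apply measurable_inr (measurableSet_inr_image.2 hB),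
      Set.preimage_image_eq _ Sum.inr_injective]
    simp
  obtain ⟨k, d, r, hk, hd, hr, hN⟩ := FiniteOn.exists_near (γ := γ)
    (h₁.extend.pullback c₁.measurable)
    (h₂.extend.pullback c₂.measurable) ((c₁.finiteOn_iff h₁).2 f₁) ((c₂.finiteOn_iff h₂).2 f₂)
  exact ⟨k, d, r, hk, hd, hr, jointNear_of_covers h₁ h₂ f₁ f₂ c₁ c₂ hN⟩

end Covers

end GraphexData

/-! ### Nearly full measures -/

section NearlyFull

variable {Ω : Type*} [MeasurableSpace Ω] {μ ν κ : Measure Ω} {r s : ℝ≥0}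

lemma IsNearlyFull.le (h : IsNearlyFull μ ν r) : ν ≤ μ :=
  Measure.le_iff.2 fun B hB => (h B hB).2

lemma isNearlyFull_self (μ : Measure Ω) (r : ℝ≥0) : IsNearlyFull μ μ r :=
  fun _ _ => ⟨le_self_add, le_rfl⟩

lemma IsNearlyFull.trans (h : IsNearlyFull μ ν r) (h' : IsNearlyFull ν κ s) :
    IsNearlyFull μ κ (r + s) := by
  intro B hB
  refine ⟨(h B hB).1.trans ?_, (h' B hB).2.trans (h B hB).2⟩
  push_cast
  calc ν B + r ≤ (κ B + s) + r := by gcongr; exact (h' B hB).1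
    _ = _ := by ring

lemma IsNearlyFull.mono (h : IsNearlyFull μ ν r) (hrs : r ≤ s) : IsNearlyFull μ ν s :=
  fun B hB => ⟨(h B hB).1.trans (by gcongr), (h B hB).2⟩

lemma IsNearlyFull.sigmaFinite [SigmaFinite μ] (h : IsNearlyFull μ ν r) : SigmaFinite ν :=
  Measure.sigmaFinite_of_le μ h.le

lemma isNearlyFull_restrict {A : Set Ω} (hA : MeasurableSet A) (h : μ Aᶜ ≤ r) :
    IsNearlyFull μ (μ.restrict A) r := by
  intro B hB
  refine ⟨?_, Measure.restrict_apply_le _ _⟩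
  rw [Measure.restrict_apply hB, ← measure_inter_add_sdiff B hA]
  gcongr
  refine (measure_mono fun x hx => ?_).trans h
  exact hx.2

/-- A measure below `μ` has a density with values in `[0, 1]`. -/
lemma exists_density_of_le [SigmaFinite μ] (h : ν ≤ μ) :
    ∃ θ : Ω → ℝ≥0∞, Measurable θ ∧ (∀ x, θ x ≤ 1) ∧ ν = μ.withDensity θ := by
  have := Measure.sigmaFinite_of_le μ h
  refine ⟨fun x => min (ν.rnDeriv μ x) 1, (Measure.measurable_rnDeriv ν μ).min measurable_const,
    fun x => min_le_right _ _, ?_⟩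
  rw [← Measure.withDensity_rnDeriv_eq ν μ (Measure.absolutelyContinuous_of_le h)]
  refine withDensity_congr_ae ?_
  rw [Measure.withDensity_rnDeriv_eq ν μ (Measure.absolutelyContinuous_of_le h)]
  filter_upwards [Measure.rnDeriv_le_one_of_le h] with x hx
  exact (min_eq_left hx).symm

lemma withDensity_add_withDensity_one_sub (μ : Measure Ω) {θ : Ω → ℝ≥0∞} (hθ : Measurable θ)
    (h1 : ∀ x, θ x ≤ 1) : μ.withDensity θ + μ.withDensity (fun x => 1 - θ x) = μ := by
  rw [← withDensity_add_left hθ]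
  have : (θ + fun x => 1 - θ x) = 1 := by
    funext x
    exact add_tsub_cancel_of_le (h1 x)
  rw [this, withDensity_one]

lemma measure_univ_le_of_add_le [SigmaFinite μ] (h : ∀ B, MeasurableSet B → μ B ≤ ν B + r)
    (hadd : ν + κ = μ) : κ Set.univ ≤ r := by
  rw [← iUnion_spanningSets μ, (monotone_spanningSets μ).measure_iUnion]
  refine iSup_le fun n => ?_
  have hS := measurableSet_spanningSets μ n
  have hlt := measure_spanningSets_lt_top μ n
  have h1 := h _ hS
  have h2 : μ (spanningSets μ n) = ν (spanningSets μ n) + κ (spanningSets μ n) := by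
    exact (congrArg (fun m : Measure Ω => m (spanningSets μ n)) hadd).symm
  rw [h2] at h1 hlt
  exact (ENNReal.add_le_add_iff_left (ne_top_of_le_ne_top hlt.ne le_self_add)).1 h1

/-- Two measures that are both nearly equal to `μ` have a common minorant that is nearly equal to
both of them, with the two error terms interchanged. -/
lemma IsNearlyFull.exists_common [SigmaFinite μ] (h : IsNearlyFull μ ν r)
    (h' : IsNearlyFull μ κ s) : ∃ m : Measure Ω, IsNearlyFull ν m s ∧ IsNearlyFull κ m r := by
  obtain ⟨f, hf, hf1, rfl⟩ := exists_density_of_le h.le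
  obtain ⟨g, hg, hg1, rfl⟩ := exists_density_of_le h'.le
  have key : ∀ {f g : Ω → ℝ≥0∞} {s : ℝ≥0}, Measurable f → Measurable g →
      IsNearlyFull μ (μ.withDensity g) s → (∀ x, f x ≤ 1) →
      IsNearlyFull (μ.withDensity f) (μ.withDensity fun x => min (f x) (g x)) s := by
    intro f g s hf hg h' hf1 B hB
    have hF : MeasurableSet {x | g x < f x} := measurableSet_lt hg hf
    refine ⟨?_, withDensity_mono (Eventually.of_forall fun x => min_le_left _ _) B⟩
    rw [← measure_inter_add_sdiff (μ := μ.withDensity f) B hF,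
      ← measure_inter_add_sdiff (μ := μ.withDensity fun x => min (f x) (g x)) B hF]
    have e1 : (μ.withDensity fun x => min (f x) (g x)) (B ∩ {x | g x < f x}) =
        (μ.withDensity g) (B ∩ {x | g x < f x}) := by
      rw [withDensity_apply _ (hB.inter hF), withDensity_apply _ (hB.inter hF)]
      exact setLIntegral_congr_fun (hB.inter hF) fun x hx => min_eq_right hx.2.le
    have e2 : (μ.withDensity fun x => min (f x) (g x)) (B \ {x | g x < f x}) =
        (μ.withDensity f) (B \ {x | g x < f x}) := by
      rw [withDensity_apply _ (hB.diff hF), withDensity_apply _ (hB.diff hF)]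
      exact setLIntegral_congr_fun (hB.diff hF) fun x hx => min_eq_left (not_lt.1 hx.2)
    rw [e1, e2, add_right_comm]
    gcongr
    refine le_trans ?_ (h' _ (hB.inter hF)).1
    conv_rhs => rw [← withDensity_one (μ := μ)]
    exact withDensity_mono (Eventually.of_forall hf1) _
  refine ⟨μ.withDensity fun x => min (f x) (g x), key hf hg h' hf1, ?_⟩
  simp_rw [min_comm (f _)]
  exact key hg hf h hg1

end NearlyFull

namespace GraphexData

variable {Ω₁ Ω₂ : Type*} [MeasurableSpace Ω₁] [MeasurableSpace Ω₂]
  {T₁ : GraphexData Ω₁} {μ₁ : Measure Ω₁} {T₂ : GraphexData Ω₂} {μ₂ ν₂ : Measure Ω₂}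
  {k d r : ℝ≥0∞}

/-- If the second measure of a comparison is decreased, the first one can be decreased along with
it. -/
lemma JointNear.restrict_right [SFinite μ₁] [SigmaFinite μ₂] (h₁ : T₁.IsProper)
    (h₂ : T₂.IsProper) (f₁ : T₁.FiniteOn μ₁) (f₂ : T₂.FiniteOn μ₂)
    (h : JointNear T₁ μ₁ T₂ μ₂ k d r) {c : ℝ≥0} (hν : IsNearlyFull μ₂ ν₂ (c ^ 2)) :
    ∃ ν₁ : Measure Ω₁, IsNearlyFull μ₁ ν₁ (c ^ 2) ∧
      JointNear T₁ ν₁ T₂ ν₂ k (d + k * c) (r + 2 * d * c + k * c ^ 2) := by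
  obtain ⟨γ, _, c₁, c₂, hN⟩ := h
  obtain ⟨θ, hθ, hθ1, rfl⟩ := exists_density_of_le hν.le
  let Θ : Ω₂ ⊕ ℝ → ℝ≥0∞ := Sum.elim θ 1
  have hΘ : Measurable Θ := hθ.sumElim measurable_one
  have hΘ1 : ∀ z : (Ω₁ ⊕ ℝ) × (Ω₂ ⊕ ℝ), Θ z.2 ≤ 1 := by
    rintro ⟨a, b | b⟩
    · exact hθ1 b
    · exact le_rfl
  -- The density of `ν₂` is pulled back to the joint measure; nothing is removed where the second
  -- coordinate lies on the appended line.
  set γ' := γ.withDensity fun z => Θ z.2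
  set η := γ.withDensity fun z => 1 - Θ z.2
  have hadd : γ' + η = γ :=
    withDensity_add_withDensity_one_sub γ (hΘ.comp measurable_snd) hΘ1
  have hη : η Set.univ ≤ (c : ℝ≥0∞) ^ 2 := by
    have e1 : η Set.univ = (μ₂.withDensity fun x => 1 - θ x) Set.univ := by
      simp only [η, withDensity_apply _ MeasurableSet.univ, Measure.restrict_univ]
      rw [← c₂.lintegral (f := fun x => 1 - θ x) (measurable_const.sub hθ)]
      refine lintegral_congr fun z => ?_
      rcases z with ⟨a, b | b⟩ <;> simp [Θ]
    rw [e1]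
    have := measure_univ_le_of_add_le (r := c ^ 2) (fun B hB => (hν B hB).1)
      (withDensity_add_withDensity_one_sub μ₂ hθ hθ1)
    simpa using this
  have : IsFiniteMeasure η := ⟨lt_of_le_of_lt hη (by simp)⟩
  have hle : γ' ≤ γ := by rw [← hadd]; exact Measure.le_add_right le_rfl
  have d₁ : Covers γ' Prod.fst ((γ'.map Prod.fst).comap Sum.inl) := by
    refine ⟨measurable_fst, fun B hB => ?_⟩
    rw [measurableEmbedding_inl.comap_apply,
      Measure.map_apply measurable_fst (measurableSet_inl_image.2 hB)]
  have d₂ : Covers γ' Prod.snd (μ₂.withDensity θ) := by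
    refine ⟨measurable_snd, fun B hB => ?_⟩
    have hB' : MeasurableSet ((Prod.snd : (Ω₁ ⊕ ℝ) × (Ω₂ ⊕ ℝ) → _) ⁻¹' (Sum.inl '' B)) :=
      measurable_snd (measurableSet_inl_image.2 hB)
    rw [withDensity_apply _ hB, withDensity_apply _ hB', ← lintegral_indicator hB,
      ← lintegral_indicator hB', ← c₂.lintegral (hθ.indicator hB)]
    refine lintegral_congr fun z => ?_
    rcases z with ⟨a, b | b⟩
    · by_cases hb : b ∈ B <;> simp [Θ, Set.indicator, hb]
    · simp [Set.indicator]
  have hfull : IsNearlyFull μ₁ ((γ'.map Prod.fst).comap Sum.inl) (c ^ 2) := by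
    intro B hB
    rw [← d₁.measure_preimage B hB, ← c₁.measure_preimage B hB]
    refine ⟨?_, hle _⟩
    conv_lhs => rw [← hadd]
    rw [Measure.add_apply]
    gcongr
    refine (measure_mono (Set.subset_univ _)).trans ?_
    simpa using hη
  refine ⟨_, hfull, γ', inferInstance, d₁, d₂, ?_⟩
  have F₁ := (c₁.finiteOn_iff h₁).2 f₁
  have F₂ := (c₂.finiteOn_iff h₂).2 f₂
  rw [← hadd] at F₁ F₂ hN
  exact hN.of_add (h₁.extend.pullback measurable_fst) (h₂.extend.pullback measurable_snd) F₁ F₂ hη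

end GraphexData

/-! ### Approximation by step functions -/

section StepApproximation

variable {Ω : Type*} [MeasurableSpace Ω] {μ : Measure Ω}

lemma ae_eq_zero_of_setIntegral_prod_eq_zero [SigmaFinite μ] {f : Ω × Ω → ℝ}
    (hf : MemLp f 2 (μ.prod μ))
    (h : ∀ A B : Set Ω, MeasurableSet A → MeasurableSet B → μ A ≠ ∞ → μ B ≠ ∞ →
      ∫ z in A ×ˢ B, f z ∂(μ.prod μ) = 0) : f =ᵐ[μ.prod μ] 0 := by
  set R : ℕ → Set (Ω × Ω) := fun n => spanningSets μ n ×ˢ spanningSets μ n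
  have hS := measurableSet_spanningSets μ
  have hfin := fun n => (measure_spanningSets_lt_top μ n).ne
  have hRm : ∀ n, MeasurableSet (R n) := fun n => (hS n).prod (hS n)
  have hRf : ∀ n, μ.prod μ (R n) ≠ ∞ := fun n => by
    rw [Measure.prod_prod]; exact ENNReal.mul_ne_top (hfin n) (hfin n)
  have hint : ∀ n, IntegrableOn f (R n) (μ.prod μ) := fun n => by
    have : IsFiniteMeasure ((μ.prod μ).restrict (R n)) := ⟨by
      rw [Measure.restrict_apply_univ]; exact lt_top_iff_ne_top.2 (hRf n)⟩
    exact (hf.restrict (R n)).integrable one_le_two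
  have key : ∀ n, ∀ s, MeasurableSet s → ∫ z in s, f z ∂((μ.prod μ).restrict (R n)) = 0 := by
    intro n s hs
    induction s, hs using MeasurableSpace.induction_on_inter
      (generateFrom_prod (α := Ω) (β := Ω)).symm
      isPiSystem_prod with
    | empty => simp
    | basic t ht =>
      obtain ⟨A, hA, B, hB, rfl⟩ := ht
      have hA' : MeasurableSet A := hA
      have hB' : MeasurableSet B := hB
      rw [Measure.restrict_restrict (hA'.prod hB'), Set.prod_inter_prod]
      exact h _ _ (hA'.inter (hS n)) (hB'.inter (hS n))
        (measure_ne_top_of_subset Set.inter_subset_right (hfin n))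
        (measure_ne_top_of_subset Set.inter_subset_right (hfin n))
    | compl t ht ih =>
      have h1 := integral_add_compl ht (hint n)
      rw [ih, zero_add] at h1
      rw [h1]
      exact h _ _ (hS n) (hS n) (hfin n) (hfin n)
    | iUnion g hd hm ih =>
      rw [integral_iUnion hm hd (hint n).integrableOn]
      simp [ih]
  have h0 : ∀ n, f =ᵐ[(μ.prod μ).restrict (R n)] 0 := fun n =>
    (hint n).ae_eq_zero_of_forall_setIntegral_eq_zero fun s hs _ => key n s hs
  have hU : ⋃ n, R n = Set.univ := by
    rw [Set.eq_univ_iff_forall]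
    rintro ⟨x, y⟩
    obtain ⟨i, hi⟩ := Set.mem_iUnion.1 ((iUnion_spanningSets μ).symm ▸ Set.mem_univ x)
    obtain ⟨j, hj⟩ := Set.mem_iUnion.1 ((iUnion_spanningSets μ).symm ▸ Set.mem_univ y)
    exact Set.mem_iUnion.2 ⟨max i j, monotone_spanningSets μ (le_max_left i j) hi,
      monotone_spanningSets μ (le_max_right i j) hj⟩
  rw [← Measure.restrict_univ (μ := μ.prod μ), ← hU]
  exact (ae_restrict_iUnion_iff _ _).2 h0

/-- Linear combinations of indicators of rectangles are dense in `L²`. -/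
lemma exists_rectangle_approx [SigmaFinite μ] {f : Ω × Ω → ℝ} (hf : MemLp f 2 (μ.prod μ))
    {ε : ℝ≥0∞} (hε : ε ≠ 0) :
    ∃ (n : ℕ) (c : Fin n → ℝ) (A B : Fin n → Set Ω), (∀ j, MeasurableSet (A j) ∧ μ (A j) ≠ ∞) ∧
      (∀ j, MeasurableSet (B j) ∧ μ (B j) ≠ ∞) ∧
      eLpNorm (fun z => f z - ∑ j, c j * ((A j).indicator 1 z.1 * (B j).indicator 1 z.2)) 2
        (μ.prod μ) ≤ ε := by
  classical
  let s : Set (Lp ℝ 2 (μ.prod μ)) := {g | ∃ A B : Set Ω, MeasurableSet A ∧ MeasurableSet B ∧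
    μ A ≠ ∞ ∧ μ B ≠ ∞ ∧ (g : Ω × Ω → ℝ) =ᵐ[μ.prod μ] fun z => A.indicator 1 z.1 * B.indicator 1 z.2}
  have hind : ∀ (A B : Set Ω) (z : Ω × Ω), (A ×ˢ B).indicator (fun _ => (1 : ℝ)) z
      = A.indicator 1 z.1 * B.indicator 1 z.2 := by
    intro A B z
    by_cases h1 : z.1 ∈ A <;> by_cases h2 : z.2 ∈ B <;> simp [Set.indicator, h1, h2]
  have htop : (Submodule.span ℝ s).topologicalClosure = ⊤ := by
    rw [Submodule.topologicalClosure_eq_top_iff, Submodule.eq_bot_iff]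
    intro g hg
    rw [Submodule.mem_orthogonal] at hg
    rw [Lp.eq_zero_iff_ae_eq_zero]
    refine ae_eq_zero_of_setIntegral_prod_eq_zero (Lp.memLp g) fun A B hA hB hA' hB' => ?_
    have hAB : MeasurableSet (A ×ˢ B) := hA.prod hB
    have hABf : μ.prod μ (A ×ˢ B) ≠ ∞ := by
      rw [Measure.prod_prod]; exact ENNReal.mul_ne_top hA' hB'
    have h1 := hg (indicatorConstLp 2 hAB hABf (1 : ℝ)) (Submodule.subset_span
      ⟨A, B, hA, hB, hA', hB', indicatorConstLp_coeFn.trans (Eventually.of_forall fun z =>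
        hind A B z)⟩)
    rwa [L2.inner_indicatorConstLp_one] at h1
  have hmem : hf.toLp f ∈ closure (Submodule.span ℝ s : Set (Lp ℝ 2 (μ.prod μ))) := by
    rw [← Submodule.topologicalClosure_coe, htop]
    trivial
  rw [EMetric.mem_closure_iff] at hmem
  obtain ⟨g, hg, hgd⟩ := hmem ε (pos_iff_ne_zero.2 hε)
  obtain ⟨n, c, G, rfl⟩ := (Submodule.mem_span_set').1 hg
  choose A B hA hB hA' hB' hG using fun i => (G i).2
  refine ⟨n, c, A, B, fun j => ⟨hA j, hA' j⟩, fun j => ⟨hB j, hB' j⟩, ?_⟩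
  have hsum : ∀ t : Finset (Fin n), ((∑ i ∈ t, c i • (G i : Lp ℝ 2 (μ.prod μ)) :
      Lp ℝ 2 (μ.prod μ)) : Ω × Ω → ℝ) =ᵐ[μ.prod μ]
      fun z => ∑ j ∈ t, c j * ((A j).indicator 1 z.1 * (B j).indicator 1 z.2) := by
    intro t
    induction t using Finset.induction_on with
    | empty =>
      simp only [Finset.sum_empty]
      exact Lp.coeFn_zero _ _ _
    | insert i t hi ih =>
      rw [Finset.sum_insert hi]
      filter_upwards [ih, Lp.coeFn_add (c i • (G i : Lp ℝ 2 (μ.prod μ)))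
        (∑ i ∈ t, c i • (G i : Lp ℝ 2 (μ.prod μ))), Lp.coeFn_smul (c i) (G i : Lp ℝ 2 (μ.prod μ)),
        hG i] with z h1 h2 h3 h4
      rw [h2, Pi.add_apply, h1, h3, Pi.smul_apply, h4, Finset.sum_insert hi, smul_eq_mul]
  refine le_trans (le_of_eq ?_) hgd.le
  rw [Lp.edist_def]
  refine eLpNorm_congr_ae ?_
  filter_upwards [hsum Finset.univ, hf.coeFn_toLp] with z h1 h2
  rw [Pi.sub_apply, h1, h2]

/-- The partition generated by finitely many sets of finite measure, as a labelling; points outside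
of all the sets get the label `0`. -/
lemma exists_labelling {κ : Type*} [Fintype κ] (F : κ → Set Ω) (hF : ∀ j, MeasurableSet (F j))
    (hfin : ∀ j, μ (F j) ≠ ∞) :
    ∃ (n : ℕ) (l : Ω → Fin (n + 1)) (φ : κ → Fin (n + 1) → ℝ), Measurable l ∧
      (∀ i, i ≠ 0 → μ (l ⁻¹' {i}) ≠ ∞) ∧ (∀ j, φ j 0 = 0) ∧
      ∀ j x, (F j).indicator 1 x = φ j (l x) := by
  classical
  let e : (κ → Bool) ≃ Fin (Fintype.card (κ → Bool)) := Fintype.equivFin _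
  let t : Ω → κ → Bool := fun x j => decide (x ∈ F j)
  have ht : Measurable t := by
    refine measurable_pi_lambda _ fun j => ?_
    refine measurable_to_bool ?_
    convert hF j using 1
    ext x; simp [t]
  let V : Set Ω := ⋃ j, F j
  have hV : MeasurableSet V := MeasurableSet.iUnion hF
  refine ⟨Fintype.card (κ → Bool), fun x => if x ∈ V then (e (t x)).succ else 0,
    fun j => Fin.cases 0 (fun i => if e.symm i j then 1 else 0), ?_, ?_, ?_, ?_⟩
  · refine Measurable.ite hV ?_ measurable_const
    exact (measurable_of_finite fun a : κ → Bool => (e a).succ).comp ht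
  · intro i hi
    have hsub : (fun x => if x ∈ V then (e (t x)).succ else 0) ⁻¹' {i} ⊆ V := by
      intro x hx
      by_contra hxV
      simp only [Set.mem_preimage, hxV, if_false, Set.mem_singleton_iff] at hx
      exact hi hx.symm
    refine measure_ne_top_of_subset hsub ?_
    · refine ne_top_of_le_ne_top ?_ (measure_iUnion_le F)
      rw [tsum_fintype]
      exact ENNReal.sum_ne_top.2 fun j _ => hfin j
  · intro j
    rfl
  · intro j x
    by_cases hx : x ∈ V
    · simp [hx, t, Set.indicator]
    · have : x ∉ F j := fun h => hx (Set.mem_iUnion.2 ⟨j, h⟩)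
      simp [hx, this]

/-- Simultaneous approximation in `L²` of a kernel and a function by step functions. -/
lemma exists_step_approx [SigmaFinite μ] {U : Ω → Ω → ℝ} (hU : IsL2Kernel U μ) {f : Ω → ℝ}
    (hf : MemLp f 2 μ) {ε : ℝ≥0∞} (hε : ε ≠ 0) :
    ∃ (n : ℕ) (l : Ω → Fin (n + 1)) (b : Fin (n + 1) → Fin (n + 1) → ℝ) (d : Fin (n + 1) → ℝ),
      Measurable l ∧ (∀ i, i ≠ 0 → μ (l ⁻¹' {i}) ≠ ∞) ∧
      (∀ i, b 0 i = 0) ∧ (∀ i, b i 0 = 0) ∧ d 0 = 0 ∧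
      ∫⁻ x, ∫⁻ y, ‖U x y - b (l x) (l y)‖ₑ ^ 2 ∂μ ∂μ ≤ ε ^ 2 ∧
      eLpNorm (fun x => f x - d (l x)) 2 μ ≤ ε := by
  classical
  have hU' : MemLp (uncurry U) 2 (μ.prod μ) := by
    refine memLp_two_of_lintegral_sq hU.measurable ?_
    rw [lintegral_prod _ (hU.measurable.enorm.pow_const 2).aemeasurable]
    exact hU.lintegral_sq
  obtain ⟨m, c, A, B, hA, hB, hAB⟩ := exists_rectangle_approx hU' hε
  obtain ⟨g, hg, hg2⟩ := hf.exists_simpleFunc_eLpNorm_sub_lt ENNReal.ofNat_ne_top hε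
  let κ := Fin m ⊕ Fin m ⊕ {y // y ∈ g.range.erase 0}
  let F : κ → Set Ω := Sum.elim A (Sum.elim B fun y => g ⁻¹' {(y : ℝ)})
  obtain ⟨n, l, φ, hl, hlf, hφ, hlφ⟩ := exists_labelling (μ := μ) F (by
      rintro (j | j | y)
      · exact (hA j).1
      · exact (hB j).1
      · exact g.measurableSet_fiber _) (by
      rintro (j | j | y)
      · exact (hA j).2
      · exact (hB j).2
      · exact (SimpleFunc.measure_preimage_lt_top_of_memLp two_ne_zero ENNReal.ofNat_ne_top g hg2 _
          (Finset.ne_of_mem_erase y.2)).ne)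
  refine ⟨n, l, fun u v => ∑ j, c j * (φ (Sum.inl j) u * φ (Sum.inr (Sum.inl j)) v),
    fun u => ∑ y : {y // y ∈ g.range.erase 0}, (y : ℝ) * φ (Sum.inr (Sum.inr y)) u,
    hl, hlf, fun i => by simp [hφ], fun i => by simp [hφ], by simp [hφ], ?_, ?_⟩
  · have h1 := pow_le_pow_left' hAB 2
    rw [eLpNorm_two_sq, lintegral_prod] at h1
    · refine le_trans (le_of_eq ?_) h1
      refine lintegral_congr fun x => lintegral_congr fun y => ?_
      simp only [uncurry]
      have e1 : ∀ j x, (A j).indicator 1 x = φ (Sum.inl j) (l x) := fun j => hlφ (Sum.inl j)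
      have e2 : ∀ j x, (B j).indicator 1 x = φ (Sum.inr (Sum.inl j)) (l x) :=
        fun j => hlφ (Sum.inr (Sum.inl j))
      simp only [e1, e2]
    · refine Measurable.aemeasurable (Measurable.pow_const (Measurable.enorm ?_) 2)
      refine hU.measurable.sub (Finset.measurable_fun_sum _ fun j _ => ?_)
      exact measurable_const.mul (((measurable_one.indicator (hA j).1).comp measurable_fst).mul
        ((measurable_one.indicator (hB j).1).comp measurable_snd))
  · refine le_trans (le_of_eq ?_) hg.le
    congr 1
    funext x
    simp only [Pi.sub_apply, sub_right_inj]
    have e3 : ∀ (y : {y // y ∈ g.range.erase 0}) (x : Ω), (g ⁻¹' {(y : ℝ)}).indicator 1 x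
        = φ (Sum.inr (Sum.inr y)) (l x) := fun y => hlφ (Sum.inr (Sum.inr y))
    simp only [← e3]
    by_cases hx : g x = 0
    · rw [hx]
      refine Finset.sum_eq_zero fun y _ => ?_
      have : x ∉ g ⁻¹' {(y : ℝ)} := by
        rw [Set.mem_preimage, hx]
        exact (Finset.ne_of_mem_erase y.2).symm
      simp [this]
    · rw [Finset.sum_eq_single (⟨g x, Finset.mem_erase.2 ⟨hx, g.mem_range_self x⟩⟩ :
        {y // y ∈ g.range.erase 0})]
      · simp
      · intro y _ hy
        have : x ∉ g ⁻¹' {(y : ℝ)} := by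
          rw [Set.mem_preimage]
          exact fun h => hy (Subtype.ext h.symm)
        simp [this]
      · simp

end StepApproximation

/-! ### Gluing measures along labels -/

section Gluing

variable {Y₁ Y₂ : Type*} [MeasurableSpace Y₁] [MeasurableSpace Y₂]

lemma inv_max_mul_le_one (a b : ℝ≥0∞) : (max a b)⁻¹ * b ≤ 1 :=
  (mul_le_mul_right (le_max_right a b) _).trans (ENNReal.inv_mul_le_one _)

lemma one_sub_inv_max_mul_le {a b : ℝ≥0∞} (ha : a ≠ ∞) (hb : b ≠ ∞) :
    (1 - (max a b)⁻¹ * b) * a ≤ a - b := by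
  rcases le_or_gt a b with h | h
  · rw [max_eq_right h]
    rcases eq_or_ne b 0 with rfl | hb0
    · rw [le_zero_iff.1 h]; simp
    · rw [ENNReal.inv_mul_cancel hb0 hb]; simp
  · rw [max_eq_left h.le, ENNReal.sub_mul (fun _ _ => ha), one_mul, mul_right_comm,
      ENNReal.inv_mul_cancel (ne_bot_of_gt h) ha, one_mul]

/-- Gluing two measures along labellings of their spaces by a finite set. The cells with the same
label are coupled by a multiple of the product measure. What remains of a cell because the masses of
the two cells differ is coupled with a base point of the other space, and so is everything with
label `0`. -/
lemma exists_glue (γ₁ : Measure Y₁) (γ₂ : Measure Y₂) [SFinite γ₁] [SFinite γ₂] {n : ℕ}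
    {l₁ : Y₁ → Fin (n + 1)} {l₂ : Y₂ → Fin (n + 1)} (hl₁ : Measurable l₁) (hl₂ : Measurable l₂)
    (hf₁ : ∀ i, i ≠ 0 → γ₁ (l₁ ⁻¹' {i}) ≠ ∞) (hf₂ : ∀ i, i ≠ 0 → γ₂ (l₂ ⁻¹' {i}) ≠ ∞)
    {y₁ : Y₁} {y₂ : Y₂} (hy₁ : l₁ y₁ = 0) (hy₂ : l₂ y₂ = 0) :
    ∃ γ : Measure (Y₁ × Y₂), SFinite γ ∧
      (∀ B, MeasurableSet B → y₁ ∉ B → γ (Prod.fst ⁻¹' B) = γ₁ B) ∧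
      (∀ B, MeasurableSet B → y₂ ∉ B → γ (Prod.snd ⁻¹' B) = γ₂ B) ∧
      γ {z | l₁ z.1 ≠ l₂ z.2} ≤ ∑ i : Fin n,
        ((γ₁ (l₁ ⁻¹' {i.succ}) - γ₂ (l₂ ⁻¹' {i.succ}))
          + (γ₂ (l₂ ⁻¹' {i.succ}) - γ₁ (l₁ ⁻¹' {i.succ}))) := by
  set A : Fin (n + 1) → Set Y₁ := fun i => l₁ ⁻¹' {i}
  set A' : Fin (n + 1) → Set Y₂ := fun i => l₂ ⁻¹' {i}
  have hA : ∀ i, MeasurableSet (A i) := fun i => hl₁ (measurableSet_singleton i)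
  have hA' : ∀ i, MeasurableSet (A' i) := fun i => hl₂ (measurableSet_singleton i)
  set m : Fin (n + 1) → ℝ≥0∞ := fun i => γ₁ (A i)
  set m' : Fin (n + 1) → ℝ≥0∞ := fun i => γ₂ (A' i)
  set c : Fin (n + 1) → ℝ≥0∞ := fun i => (max (m i) (m' i))⁻¹
  have hc' : ∀ i, c i * m' i ≤ 1 := fun i => inv_max_mul_le_one _ _
  have hc : ∀ i, c i * m i ≤ 1 := fun i => by
    simp only [c]; rw [max_comm]; exact inv_max_mul_le_one _ _
  -- With `c = (max m m')⁻¹` the coefficient of the product measure is as large as both marginals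
  -- permit; the two other terms of `P i` restore the missing parts of the marginals.
  let P : Fin n → Measure (Y₁ × Y₂) := fun i =>
    c i.succ • (γ₁.restrict (A i.succ)).prod (γ₂.restrict (A' i.succ))
    + (1 - c i.succ * m' i.succ) • (γ₁.restrict (A i.succ)).prod (Measure.dirac y₂)
    + (1 - c i.succ * m i.succ) • (Measure.dirac y₁).prod (γ₂.restrict (A' i.succ))
  let γ : Measure (Y₁ × Y₂) := Measure.sum P
    + (γ₁.restrict (A 0)).prod (Measure.dirac y₂) + (Measure.dirac y₁).prod (γ₂.restrict (A' 0))
  have split₁ : ∀ B, MeasurableSet B → γ₁ (B ∩ A 0) + ∑ i : Fin n, γ₁ (B ∩ A i.succ) = γ₁ B := by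
    intro B hB
    have h1 := sum_measure_preimage_singleton (μ := γ₁.restrict B) (f := l₁) Finset.univ
      (fun y _ => hl₁ (measurableSet_singleton y))
    rw [Fin.sum_univ_succ] at h1
    simp only [Finset.coe_univ, Set.preimage_univ, Measure.restrict_apply_univ] at h1
    rw [← h1, Measure.restrict_apply (hA 0), Set.inter_comm]
    congr 1
    refine Finset.sum_congr rfl fun i _ => ?_
    rw [Measure.restrict_apply (hA i.succ), Set.inter_comm]
  have split₂ : ∀ B, MeasurableSet B → γ₂ (B ∩ A' 0) + ∑ i : Fin n, γ₂ (B ∩ A' i.succ) = γ₂ B := by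
    intro B hB
    have h1 := sum_measure_preimage_singleton (μ := γ₂.restrict B) (f := l₂) Finset.univ
      (fun y _ => hl₂ (measurableSet_singleton y))
    rw [Fin.sum_univ_succ] at h1
    simp only [Finset.coe_univ, Set.preimage_univ, Measure.restrict_apply_univ] at h1
    rw [← h1, Measure.restrict_apply (hA' 0), Set.inter_comm]
    congr 1
    refine Finset.sum_congr rfl fun i _ => ?_
    rw [Measure.restrict_apply (hA' i.succ), Set.inter_comm]
  refine ⟨γ, inferInstance, ?_, ?_, ?_⟩
  · intro B hB hyB
    rw [← Set.prod_univ]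
    simp only [γ, P, Measure.add_apply, Measure.sum_apply_of_countable, Measure.smul_apply,
      Measure.prod_prod, Measure.restrict_apply hB, Measure.restrict_apply_univ, smul_eq_mul,
      measure_univ, mul_one, Measure.dirac_apply' _ hB, Set.indicator_of_notMem hyB, zero_mul,
      mul_zero, add_zero, tsum_fintype]
    rw [← split₁ B hB, add_comm]
    congr 1
    refine Finset.sum_congr rfl fun i _ => ?_
    calc c i.succ * (γ₁ (B ∩ A i.succ) * γ₂ (A' i.succ))
          + (1 - c i.succ * m' i.succ) * γ₁ (B ∩ A i.succ)
        = (c i.succ * m' i.succ + (1 - c i.succ * m' i.succ)) * γ₁ (B ∩ A i.succ) := by ring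
      _ = _ := by rw [add_tsub_cancel_of_le (hc' _), one_mul]
  · intro B hB hyB
    rw [← Set.univ_prod]
    simp only [γ, P, Measure.add_apply, Measure.sum_apply_of_countable, Measure.smul_apply,
      Measure.prod_prod, Measure.restrict_apply hB, Measure.restrict_apply_univ, smul_eq_mul,
      measure_univ, one_mul, Measure.dirac_apply' _ hB, Set.indicator_of_notMem hyB,
      mul_zero, add_zero, tsum_fintype]
    rw [← split₂ B hB, add_comm]
    congr 1
    refine Finset.sum_congr rfl fun i _ => ?_
    calc c i.succ * (γ₁ (A i.succ) * γ₂ (B ∩ A' i.succ))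
          + (1 - c i.succ * m i.succ) * γ₂ (B ∩ A' i.succ)
        = (c i.succ * m i.succ + (1 - c i.succ * m i.succ)) * γ₂ (B ∩ A' i.succ) := by ring
      _ = _ := by rw [add_tsub_cancel_of_le (hc _), one_mul]
  -- Labels differ only on the parts that are coupled with a base point.
  · set D : Set (Y₁ × Y₂) := {z | l₁ z.1 ≠ l₂ z.2}
    have hD : MeasurableSet D := (measurableSet_eq_fun (hl₁.comp measurable_fst)
      (hl₂.comp measurable_snd)).compl
    have z1 : ((γ₁.restrict (A 0)).prod (Measure.dirac y₂)) D = 0 := by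
      rw [Measure.prod_apply hD, setLIntegral_congr_fun (g := 0) (hA 0)]
      · simp
      · intro x hx
        have hx' : l₁ x = 0 := hx
        change (Measure.dirac y₂) (Prod.mk x ⁻¹' D) = 0
        rw [Measure.dirac_apply' _ (measurable_prodMk_left hD)]
        simp [D, hx', hy₂]
    have z2 : ((Measure.dirac y₁).prod (γ₂.restrict (A' 0))) D = 0 := by
      rw [Measure.prod_apply_symm hD, setLIntegral_congr_fun (g := 0) (hA' 0)]
      · simp
      · intro x hx
        have hx' : l₂ x = 0 := hx
        change (Measure.dirac y₁) ((fun y => (y, x)) ⁻¹' D) = 0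
        rw [Measure.dirac_apply' _ (measurable_prodMk_right hD)]
        simp [D, hx', hy₁]
    have z3 : ∀ i, ((γ₁.restrict (A i)).prod (γ₂.restrict (A' i))) D = 0 := by
      intro i
      rw [Measure.prod_restrict, Measure.restrict_apply hD]
      have : D ∩ A i ×ˢ A' i = ∅ := by
        ext z
        simp only [D, A, A', Set.mem_inter_iff, Set.mem_ofPred_eq, Set.mem_prod, Set.mem_preimage,
          Set.mem_singleton_iff, Set.mem_empty_iff_false, iff_false]
        rintro ⟨h1, h2, h3⟩
        exact h1 (h2.trans h3.symm)
      rw [this, measure_empty]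
    simp only [γ, P, Measure.add_apply, Measure.sum_apply_of_countable, Measure.smul_apply, z1, z2,
      z3, smul_eq_mul, mul_zero, zero_add, add_zero, tsum_fintype]
    refine Finset.sum_le_sum fun i _ => add_le_add ?_ ?_
    · refine le_trans ?_ (one_sub_inv_max_mul_le (hf₁ _ i.succ_ne_zero) (hf₂ _ i.succ_ne_zero))
      refine mul_le_mul_right ?_ _
      refine (measure_mono (Set.subset_univ _)).trans ?_
      rw [← Set.univ_prod_univ, Measure.prod_prod]
      simp [A]
    · refine le_trans ?_ (one_sub_inv_max_mul_le (hf₂ _ i.succ_ne_zero) (hf₁ _ i.succ_ne_zero))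
      rw [max_comm]
      refine mul_le_mul_right ?_ _
      refine (measure_mono (Set.subset_univ _)).trans ?_
      rw [← Set.univ_prod_univ, Measure.prod_prod]
      simp [A']

end Gluing

/-! ### Composition of partial couplings -/

namespace GraphexData

section Step

variable {Ω Ω₁ Ω₂ Ω₃ : Type*} {X : Type*} [MeasurableSpace Ω] [MeasurableSpace Ω₁]
  [MeasurableSpace Ω₂] [MeasurableSpace Ω₃] [MeasurableSpace X]

/-- A labelling of `Ω`, extended to the appended line by the label `0`. -/
def extendLabel {n : ℕ} (l : Ω → Fin (n + 1)) : Ω ⊕ ℝ → Fin (n + 1) := Sum.elim l fun _ => 0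

lemma measurable_extendLabel {n : ℕ} {l : Ω → Fin (n + 1)} (hl : Measurable l) :
    Measurable (extendLabel l) := hl.sumElim measurable_const

/-- A step kernel with finitely many values, on cells of finite measure. -/
lemma isL2Kernel_step {μ : Measure Ω} {n : ℕ} {l : Ω → Fin (n + 1)} (hl : Measurable l)
    (hf : ∀ i, i ≠ 0 → μ (l ⁻¹' {i}) ≠ ∞) {b : Fin (n + 1) → Fin (n + 1) → ℝ}
    (hb : ∀ i, b 0 i = 0) (hb' : ∀ i, b i 0 = 0) :
    IsL2Kernel (fun x y => b (l x) (l y)) μ := by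
  have hm : Measurable (uncurry fun x y => b (l x) (l y)) :=
    (measurable_of_finite (uncurry b)).comp (hl.prodMap hl)
  refine ⟨hm, ?_⟩
  set V : Set Ω := (l ⁻¹' {0})ᶜ
  have hV : MeasurableSet V := (hl (measurableSet_singleton 0)).compl
  have hVf : μ V ≠ ∞ := by
    have : V = ⋃ i : Fin n, l ⁻¹' {i.succ} := by
      ext x
      simp only [V, Set.mem_compl_iff, Set.mem_preimage, Set.mem_singleton_iff, Set.mem_iUnion]
      refine ⟨fun h => ?_, ?_⟩
      · obtain ⟨j, hj⟩ := Fin.exists_succ_eq.2 h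
        exact ⟨j, hj.symm⟩
      · rintro ⟨j, hj⟩ h
        exact j.succ_ne_zero (hj.symm.trans h)
    rw [this]
    refine ne_top_of_le_ne_top ?_ (measure_iUnion_le _)
    rw [tsum_fintype]
    exact ENNReal.sum_ne_top.2 fun i _ => hf _ i.succ_ne_zero
  obtain ⟨M, hM⟩ : ∃ M : ℝ≥0, ∀ p : Fin (n + 1) × Fin (n + 1), ‖b p.1 p.2‖ₑ ^ 2 ≤ M := by
    obtain ⟨M, hM⟩ := (Set.finite_range fun p : Fin (n + 1) × Fin (n + 1) =>
      ‖b p.1 p.2‖₊ ^ 2).bddAbove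
    refine ⟨M, fun p => ?_⟩
    rw [enorm_eq_nnnorm]
    exact_mod_cast hM ⟨p, rfl⟩
  have hle : ∀ x y, ‖b (l x) (l y)‖ₑ ^ 2 ≤
      V.indicator (fun _ => V.indicator (fun _ => (M : ℝ≥0∞)) y) x := by
    intro x y
    by_cases hx : l x = 0
    · simp [hx, hb]
    · by_cases hy : l y = 0
      · simp [hy, hb']
      · rw [Set.indicator_of_mem (show x ∈ V from hx), Set.indicator_of_mem (show y ∈ V from hy)]
        exact hM (l x, l y)
  refine ne_top_of_le_ne_top ?_ (lintegral_mono fun x => lintegral_mono fun y => hle x y)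
  have : ∀ x, ∫⁻ y, V.indicator (fun _ => V.indicator (fun _ => (M : ℝ≥0∞)) y) x ∂μ =
      V.indicator (fun _ => M * μ V) x := by
    intro x
    by_cases hx : x ∈ V
    · simp only [Set.indicator_of_mem hx]
      rw [lintegral_indicator_const hV]
    · simp [Set.indicator_of_notMem hx]
  simp_rw [this]
  rw [lintegral_indicator_const hV]
  exact ENNReal.mul_ne_top (ENNReal.mul_ne_top ENNReal.coe_ne_top hVf) hVf

lemma Covers.measure_label {γ : Measure X} {p : X → Ω ⊕ ℝ} {μ : Measure Ω} (h : Covers γ p μ)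
    {n : ℕ} {l : Ω → Fin (n + 1)} (hl : Measurable l) {i : Fin (n + 1)} (hi : i ≠ 0) :
    γ ((fun x => extendLabel l (p x)) ⁻¹' {i}) = μ (l ⁻¹' {i}) := by
  rw [← h.measure_preimage _ (hl (measurableSet_singleton i))]
  congr 1
  ext x
  simp only [Set.mem_preimage, Set.mem_singleton_iff]
  rcases p x with y | y
  · simp [extendLabel]
  · simp [extendLabel, hi.symm]

/-- Two graphexes that are approximated by the same step data on labelled spaces are near each
other, up to the distance of the two versions of the step data. -/
lemma near_of_step {γ : Measure X} [SFinite γ] {T₁ : GraphexData Ω₁} {μ₁ : Measure Ω₁}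
    {T₂ : GraphexData Ω₂} {μ₂ : Measure Ω₂} [SFinite μ₁] [SFinite μ₂] (h₁ : T₁.IsProper)
    (h₂ : T₂.IsProper) (f₁ : T₁.FiniteOn μ₁) (f₂ : T₂.FiniteOn μ₂) {p₁ : X → Ω₁ ⊕ ℝ}
    {p₂ : X → Ω₂ ⊕ ℝ} (c₁ : Covers γ p₁ μ₁) (c₂ : Covers γ p₂ μ₂) {n : ℕ}
    {l₁ : Ω₁ → Fin (n + 1)} {l₂ : Ω₂ → Fin (n + 1)} (hl₁ : Measurable l₁) (hl₂ : Measurable l₂)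
    (hf₁ : ∀ i, i ≠ 0 → μ₁ (l₁ ⁻¹' {i}) ≠ ∞) (hf₂ : ∀ i, i ≠ 0 → μ₂ (l₂ ⁻¹' {i}) ≠ ∞)
    {b : Fin (n + 1) → Fin (n + 1) → ℝ} (hb : ∀ i, b 0 i = 0) (hb' : ∀ i, b i 0 = 0)
    {d : Fin (n + 1) → ℝ} (hd : d 0 = 0) {k₁ k₂ k₀ d₁ d₂ d₀ r : ℝ≥0∞}
    (hk₁ : kernelNorm (fun x y => T₁.W x y - b (l₁ x) (l₁ y)) μ₁ ≤ k₁)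
    (hk₂ : kernelNorm (fun x y => T₂.W x y - b (l₂ x) (l₂ y)) μ₂ ≤ k₂)
    (hk₀ : kernelNorm (fun x y => b (extendLabel l₁ (p₁ x)) (extendLabel l₁ (p₁ y))
      - b (extendLabel l₂ (p₂ x)) (extendLabel l₂ (p₂ y))) γ ≤ k₀)
    (hd₁ : eLpNorm (fun x => (T₁.marginal μ₁ x).toReal - d (l₁ x)) 2 μ₁ ≤ d₁)
    (hd₂ : eLpNorm (fun x => (T₂.marginal μ₂ x).toReal - d (l₂ x)) 2 μ₂ ≤ d₂)
    (hd₀ : eLpNorm (fun x => d (extendLabel l₁ (p₁ x)) - d (extendLabel l₂ (p₂ x))) 2 γ ≤ d₀)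
    (hr : ‖T₁.rho μ₁ - T₂.rho μ₂‖ₑ ≤ r) :
    (T₁.extend.pullback p₁).Near (T₂.extend.pullback p₂) γ (k₁ + k₀ + k₂) (d₁ + d₀ + d₂) r := by
  have L₁ := (f₁.isL2Kernel h₁).sub (isL2Kernel_step hl₁ hf₁ hb hb')
  have L₂ := (f₂.isL2Kernel h₂).sub (isL2Kernel_step hl₂ hf₂ hb hb')
  have P₁ := c₁.finiteOn_iff h₁ |>.2 f₁ |>.isL2Kernel (h₁.extend.pullback c₁.measurable)
  have P₂ := c₂.finiteOn_iff h₂ |>.2 f₂ |>.isL2Kernel (h₂.extend.pullback c₂.measurable)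
  have B₁ : IsL2Kernel (fun x y => b (extendLabel l₁ (p₁ x)) (extendLabel l₁ (p₁ y))) γ :=
    isL2Kernel_step ((measurable_extendLabel hl₁).comp c₁.measurable)
      (fun i hi => (c₁.measure_label hl₁ hi).trans_ne (hf₁ i hi)) hb hb'
  have B₂ : IsL2Kernel (fun x y => b (extendLabel l₂ (p₂ x)) (extendLabel l₂ (p₂ y))) γ :=
    isL2Kernel_step ((measurable_extendLabel hl₂).comp c₂.measurable)
      (fun i hi => (c₂.measure_label hl₂ hi).trans_ne (hf₂ i hi)) hb hb'
  have e₁ : ∀ x y, (T₁.extend.pullback p₁).W x y - b (extendLabel l₁ (p₁ x)) (extendLabel l₁ (p₁ y))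
      = extendKernel (fun x y => T₁.W x y - b (l₁ x) (l₁ y)) (p₁ x) (p₁ y) := by
    intro x y
    simp only [GraphexData.pullback]
    rcases p₁ x with u | u <;> rcases p₁ y with v | v <;>
      simp [GraphexData.extend, extendKernel, extendLabel, hb, hb']
  have e₂ : ∀ x y, (T₂.extend.pullback p₂).W x y - b (extendLabel l₂ (p₂ x)) (extendLabel l₂ (p₂ y))
      = extendKernel (fun x y => T₂.W x y - b (l₂ x) (l₂ y)) (p₂ x) (p₂ y) := by
    intro x y
    simp only [GraphexData.pullback]
    rcases p₂ x with u | u <;> rcases p₂ y with v | v <;>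
      simp [GraphexData.extend, extendKernel, extendLabel, hb, hb']
  refine ⟨?_, ?_, ?_⟩
  · have t1 := kernelNorm_add_le ((P₁.sub B₁).add (B₁.sub B₂)) (B₂.sub P₂)
    have t2 := kernelNorm_add_le (P₁.sub B₁) (B₁.sub B₂)
    simp only [sub_add_sub_cancel] at t1 t2
    refine t1.trans (add_le_add (t2.trans (add_le_add ?_ hk₀)) ?_)
    · simp only [e₁]
      exact (c₁.kernelNorm_le L₁).trans hk₁
    · rw [kernelNorm_sub_comm]
      simp only [e₂]
      exact (c₂.kernelNorm_le L₂).trans hk₂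
  · have g₁ : ∀ x, ((T₁.extend.pullback p₁).marginal γ x).toReal - d (extendLabel l₁ (p₁ x))
        = Sum.elim (fun x => (T₁.marginal μ₁ x).toReal - d (l₁ x)) 0 (p₁ x) := by
      intro x
      rw [c₁.marginal_eq h₁]
      rcases p₁ x with y | y <;> simp [extendLabel, hd]
    have g₂ : ∀ x, ((T₂.extend.pullback p₂).marginal γ x).toReal - d (extendLabel l₂ (p₂ x))
        = Sum.elim (fun x => (T₂.marginal μ₂ x).toReal - d (l₂ x)) 0 (p₂ x) := by
      intro x
      rw [c₂.marginal_eq h₂]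
      rcases p₂ x with y | y <;> simp [extendLabel, hd]
    have hdm : ∀ {f : X → Fin (n + 1)}, Measurable f → Measurable fun x => d (f x) := fun hf =>
      (measurable_of_finite d).comp hf
    have m₁ : Measurable fun x => (T₁.marginal μ₁ x).toReal - d (l₁ x) :=
      h₁.measurable_marginal.ennreal_toReal.sub ((measurable_of_finite d).comp hl₁)
    have m₂ : Measurable fun x => (T₂.marginal μ₂ x).toReal - d (l₂ x) :=
      h₂.measurable_marginal.ennreal_toReal.sub ((measurable_of_finite d).comp hl₂)
    have n₁ : Measurable fun x =>
        ((T₁.extend.pullback p₁).marginal γ x).toReal - d (extendLabel l₁ (p₁ x)) :=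
      (h₁.extend.pullback c₁.measurable).measurable_marginal.ennreal_toReal.sub
        (hdm ((measurable_extendLabel hl₁).comp c₁.measurable))
    have n₂ : Measurable fun x =>
        d (extendLabel l₂ (p₂ x)) - ((T₂.extend.pullback p₂).marginal γ x).toReal :=
      (hdm ((measurable_extendLabel hl₂).comp c₂.measurable)).sub
        (h₂.extend.pullback c₂.measurable).measurable_marginal.ennreal_toReal
    have n₀ : Measurable fun x => d (extendLabel l₁ (p₁ x)) - d (extendLabel l₂ (p₂ x)) :=
      (hdm ((measurable_extendLabel hl₁).comp c₁.measurable)).sub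
        (hdm ((measurable_extendLabel hl₂).comp c₂.measurable))
    have t1 := eLpNorm_add_le (p := 2) (μ := γ) (n₁.add n₀).aestronglyMeasurable
      n₂.aestronglyMeasurable one_le_two
    have t2 := eLpNorm_add_le (p := 2) (μ := γ) n₁.aestronglyMeasurable
      n₀.aestronglyMeasurable one_le_two
    refine le_trans (le_of_eq ?_) (t1.trans (add_le_add (t2.trans (add_le_add ?_ hd₀)) ?_))
    · congr 1
      funext x
      simp only [Pi.add_apply]
      ring
    · simp only [g₁]
      rw [c₁.eLpNorm_eq m₁]
      exact hd₁
    · rw [← eLpNorm_neg]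
      have : (-fun x => d (extendLabel l₂ (p₂ x)) - ((T₂.extend.pullback p₂).marginal γ x).toReal)
          = fun x => Sum.elim (fun x => (T₂.marginal μ₂ x).toReal - d (l₂ x)) 0 (p₂ x) := by
        funext x
        rw [← g₂]
        simp
      rw [this, c₂.eLpNorm_eq m₂]
      exact hd₂
  · rw [c₁.rho_eq h₁ f₁.1, c₂.rho_eq h₂ f₂.1]
    exact hr

variable {T₁ : GraphexData Ω₁} {μ₁ : Measure Ω₁} {T₂ : GraphexData Ω₂} {μ₂ : Measure Ω₂}
  {T₃ : GraphexData Ω₃} {μ₃ : Measure Ω₃} {k d r k' d' r' : ℝ≥0∞}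

lemma kernelNorm_congr_ae {U V : X → X → ℝ} {γ : Measure X} {N : Set X} (hN : γ N = 0)
    (h : ∀ x y, x ∉ N → y ∉ N → U x y = V x y) : kernelNorm U γ ≤ kernelNorm V γ := by
  refine kernelNorm_le fun g _ hg => le_trans (le_of_eq (eLpNorm_congr_ae ?_))
    (eLpNorm_kernel_le hg)
  have hae : ∀ᵐ x ∂γ, x ∉ N := measure_eq_zero_iff_ae_notMem.1 hN
  filter_upwards [hae] with x hx
  refine integral_congr_ae ?_
  filter_upwards [hae] with y hy
  rw [h x y hx hy]

omit [MeasurableSpace Ω₁] [MeasurableSpace Ω₂] in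
lemma extend_fst_vanishesOff {T : GraphexData Ω₁} :
    (T.extend.pullback (Prod.fst : (Ω₁ ⊕ ℝ) × (Ω₂ ⊕ ℝ) → _)).VanishesOff
      {(Sum.inr 0, Sum.inr 0)}ᶜ := by
  refine ⟨fun x y hx => ?_, fun x hx => ?_⟩ <;>
  · simp only [Set.mem_compl_iff, Set.mem_singleton_iff, not_not] at hx
    rw [hx]
    rfl

omit [MeasurableSpace Ω₁] [MeasurableSpace Ω₂] in
lemma extend_snd_vanishesOff {T : GraphexData Ω₂} :
    (T.extend.pullback (Prod.snd : (Ω₁ ⊕ ℝ) × (Ω₂ ⊕ ℝ) → _)).VanishesOff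
      {(Sum.inr 0, Sum.inr 0)}ᶜ := by
  refine ⟨fun x y hx => ?_, fun x hx => ?_⟩ <;>
  · simp only [Set.mem_compl_iff, Set.mem_singleton_iff, not_not] at hx
    rw [hx]
    rfl

/-- Joint measures can be composed up to an arbitrarily small error, by gluing them along a fine
partition of the middle space. No regularity of the measurable spaces is needed. -/
lemma JointNear.trans [SFinite μ₁] [SigmaFinite μ₂] [SFinite μ₃] (h₁ : T₁.IsProper)
    (h₂ : T₂.IsProper) (h₃ : T₃.IsProper) (f₁ : T₁.FiniteOn μ₁) (f₂ : T₂.FiniteOn μ₂)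
    (f₃ : T₃.FiniteOn μ₃) (h : JointNear T₁ μ₁ T₂ μ₂ k d r)
    (h' : JointNear T₂ μ₂ T₃ μ₃ k' d' r') {ε : ℝ≥0∞} (hε : ε ≠ 0) :
    JointNear T₁ μ₁ T₃ μ₃ (k + k' + ε) (d + d' + ε) (r + r') := by
  obtain ⟨γ₁, _, c₁, c₂, hN⟩ := h
  obtain ⟨γ₂, _, c₂', c₃, hN'⟩ := h'
  obtain ⟨n, l, b, e, hl, hlf, hb, hb', he, hbU, hef⟩ := exists_step_approx
    (f₂.isL2Kernel h₂) (f₂.memLp_marginal h₂) (ε := ε / 2)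
    (ENNReal.div_ne_zero.2 ⟨hε, ENNReal.ofNat_ne_top⟩)
  have hL := measurable_extendLabel hl
  obtain ⟨γ, _, hγ₁, hγ₂, hγ⟩ := exists_glue γ₁ γ₂
    (l₁ := fun z => extendLabel l z.2) (l₂ := fun z => extendLabel l z.1)
    (hL.comp measurable_snd) (hL.comp measurable_fst)
    (fun i hi => (c₂.measure_label hl hi).trans_ne (hlf i hi))
    (fun i hi => (c₂'.measure_label hl hi).trans_ne (hlf i hi))
    (y₁ := (Sum.inr 0, Sum.inr 0)) (y₂ := (Sum.inr 0, Sum.inr 0)) rfl rfl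
  -- Both joint measures cover `μ₂`, so the cells have equal masses and the gluing is exact.
  have hγ0 : γ {z | extendLabel l z.1.2 ≠ extendLabel l z.2.1} = 0 := by
    refine le_zero_iff.1 (hγ.trans (le_of_eq (Finset.sum_eq_zero fun i _ => ?_)))
    have e1 := c₂.measure_label hl i.succ_ne_zero
    have e2 := c₂'.measure_label hl i.succ_ne_zero
    rw [e1, e2]
    simp
  have D₁ : Covers γ (fun z => z.1.1) μ₁ := ⟨by fun_prop, fun B hB => by
    rw [← c₁.measure_preimage B hB,
      ← hγ₁ _ (measurable_fst (measurableSet_inl_image.2 hB)) (by simp)]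
    rfl⟩
  have D₂ : Covers γ (fun z => z.1.2) μ₂ := ⟨by fun_prop, fun B hB => by
    rw [← c₂.measure_preimage B hB,
      ← hγ₁ _ (measurable_snd (measurableSet_inl_image.2 hB)) (by simp)]
    rfl⟩
  have D₂' : Covers γ (fun z => z.2.1) μ₂ := ⟨by fun_prop, fun B hB => by
    rw [← c₂'.measure_preimage B hB,
      ← hγ₂ _ (measurable_fst (measurableSet_inl_image.2 hB)) (by simp)]
    rfl⟩
  have D₃ : Covers γ (fun z => z.2.2) μ₃ := ⟨by fun_prop, fun B hB => by
    rw [← c₃.measure_preimage B hB,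
      ← hγ₂ _ (measurable_snd (measurableSet_inl_image.2 hB)) (by simp)]
    rfl⟩
  have N₁ : (T₁.extend.pullback fun z : ((Ω₁ ⊕ ℝ) × (Ω₂ ⊕ ℝ)) × ((Ω₂ ⊕ ℝ) × (Ω₃ ⊕ ℝ)) =>
      z.1.1).Near (T₂.extend.pullback fun z => z.1.2) γ k d r := by
    have hs : MeasurableSet ({(Sum.inr 0, Sum.inr 0)}ᶜ : Set ((Ω₁ ⊕ ℝ) × (Ω₂ ⊕ ℝ))) := by
      have : ({(Sum.inr 0, Sum.inr 0)} : Set ((Ω₁ ⊕ ℝ) × (Ω₂ ⊕ ℝ)))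
          = (Sum.inr '' {0}) ×ˢ (Sum.inr '' {0}) := by simp
      rw [this]
      exact ((measurableSet_inr_image.2 (measurableSet_singleton _)).prod
        (measurableSet_inr_image.2 (measurableSet_singleton _))).compl
    refine hN.pullback (h₁.extend.pullback measurable_fst) (h₂.extend.pullback measurable_snd)
      ((c₁.finiteOn_iff h₁).2 f₁) ((c₂.finiteOn_iff h₂).2 f₂) (q := Prod.fst) measurable_fst
      hs extend_fst_vanishesOff extend_snd_vanishesOff ?_
    ext B hB
    rw [Measure.restrict_apply hB, Measure.restrict_apply hB,
      Measure.map_apply measurable_fst (hB.inter hs), hγ₁ _ (hB.inter hs) (by simp)]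
  have N₃ : (T₂.extend.pullback fun z : ((Ω₁ ⊕ ℝ) × (Ω₂ ⊕ ℝ)) × ((Ω₂ ⊕ ℝ) × (Ω₃ ⊕ ℝ)) =>
      z.2.1).Near (T₃.extend.pullback fun z => z.2.2) γ k' d' r' := by
    have hs : MeasurableSet ({(Sum.inr 0, Sum.inr 0)}ᶜ : Set ((Ω₂ ⊕ ℝ) × (Ω₃ ⊕ ℝ))) := by
      have : ({(Sum.inr 0, Sum.inr 0)} : Set ((Ω₂ ⊕ ℝ) × (Ω₃ ⊕ ℝ)))
          = (Sum.inr '' {0}) ×ˢ (Sum.inr '' {0}) := by simp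
      rw [this]
      exact ((measurableSet_inr_image.2 (measurableSet_singleton _)).prod
        (measurableSet_inr_image.2 (measurableSet_singleton _))).compl
    refine hN'.pullback (h₂.extend.pullback measurable_fst) (h₃.extend.pullback measurable_snd)
      ((c₂'.finiteOn_iff h₂).2 f₂) ((c₃.finiteOn_iff h₃).2 f₃) (q := Prod.snd) measurable_snd
      hs extend_fst_vanishesOff extend_snd_vanishesOff ?_
    ext B hB
    rw [Measure.restrict_apply hB, Measure.restrict_apply hB,
      Measure.map_apply measurable_snd (hB.inter hs), hγ₂ _ (hB.inter hs) (by simp)]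
  have hkb : kernelNorm (fun x y => T₂.W x y - b (l x) (l y)) μ₂ ≤ ε / 2 :=
    ENNReal.le_of_sq_le_sq ((kernelNorm_sq_le_lintegral
      ((f₂.isL2Kernel h₂).sub (isL2Kernel_step hl hlf hb hb')).measurable).trans hbU)
  -- Through the step approximation, the two copies of the middle graphex are near to each other.
  have N₂ : (T₂.extend.pullback fun z : ((Ω₁ ⊕ ℝ) × (Ω₂ ⊕ ℝ)) × ((Ω₂ ⊕ ℝ) × (Ω₃ ⊕ ℝ)) =>
      z.1.2).Near (T₂.extend.pullback fun z => z.2.1) γ (ε / 2 + 0 + ε / 2) (ε / 2 + 0 + ε / 2)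
      0 := by
    refine near_of_step h₂ h₂ f₂ f₂ D₂ D₂' hl hl hlf hlf hb hb' he hkb hkb ?_ hef hef ?_ (by simp)
    · refine (kernelNorm_congr_ae (V := fun _ _ => 0) hγ0 fun x y hx hy => ?_).trans
        (kernelNorm_le fun g _ _ => by simp)
      simp only [Set.mem_ofPred_eq, not_not] at hx hy
      rw [hx, hy, sub_self]
    · have : (fun z : ((Ω₁ ⊕ ℝ) × (Ω₂ ⊕ ℝ)) × ((Ω₂ ⊕ ℝ) × (Ω₃ ⊕ ℝ)) =>
          e (extendLabel l z.1.2) - e (extendLabel l z.2.1)) =ᵐ[γ] 0 := by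
        have hae : ∀ᵐ z ∂γ, z ∉ {z : ((Ω₁ ⊕ ℝ) × (Ω₂ ⊕ ℝ)) × ((Ω₂ ⊕ ℝ) × (Ω₃ ⊕ ℝ)) |
          extendLabel l z.1.2 ≠ extendLabel l z.2.1} := measure_eq_zero_iff_ae_notMem.1 hγ0
        filter_upwards [hae] with z hz
        simp only [not_not] at hz
        rw [hz, sub_self]
        rfl
      rw [eLpNorm_congr_ae this, eLpNorm_zero]
  have F₁ := (D₁.finiteOn_iff h₁).2 f₁
  have F₂ := (D₂.finiteOn_iff h₂).2 f₂
  have F₂' := (D₂'.finiteOn_iff h₂).2 f₂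
  have F₃ := (D₃.finiteOn_iff h₃).2 f₃
  have Q₁ := h₁.extend.pullback D₁.measurable
  have Q₂ := h₂.extend.pullback D₂.measurable
  have Q₂' := h₂.extend.pullback D₂'.measurable
  have Q₃ := h₃.extend.pullback D₃.measurable
  refine jointNear_of_covers h₁ h₃ f₁ f₃ D₁ D₃ (((N₁.trans Q₁ Q₂ Q₂' F₁ F₂ F₂' N₂).trans
    Q₁ Q₂' Q₃ F₁ F₂' F₃ N₃).mono (le_of_eq ?_) (le_of_eq ?_) (le_of_eq ?_))
  · rw [add_zero, ENNReal.add_halves]; ring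
  · rw [add_zero, ENNReal.add_halves]; ring
  · ring

end Step

end GraphexData

/-! ### Partial couplings and couplings of the trivial extensions -/

section Realization

lemma volume_preimage_affine (s : ℝ) {q : ℝ} (hq : 0 ≤ q) {B : Set ℝ} (hB : MeasurableSet B) :
    ENNReal.ofReal q * (volume.restrict (Set.Ico (0 : ℝ) 1)) ((fun t => s + q * t) ⁻¹' B)
      = volume (B ∩ Set.Ico s (s + q)) := by
  rcases hq.eq_or_lt with rfl | hq
  · simp
  have hm : Measurable fun t : ℝ => s + q * t := by fun_prop
  rw [Measure.restrict_apply (hm hB)]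
  have : (fun t : ℝ => s + q * t) ⁻¹' B ∩ Set.Ico 0 1
      = (fun t => q * t) ⁻¹' ((fun t => s + t) ⁻¹' (B ∩ Set.Ico s (s + q))) := by
    ext t
    simp only [Set.mem_inter_iff, Set.mem_preimage, Set.mem_Ico]
    have h1 : 0 ≤ t ↔ s ≤ s + q * t := by
      rw [le_add_iff_nonneg_right]; exact (mul_nonneg_iff_of_pos_left hq).symm
    have h2 : t < 1 ↔ s + q * t < s + q := by
      rw [add_lt_add_iff_left]; exact (mul_lt_iff_lt_one_right hq).symm
    rw [h1, h2]
  rw [this, Real.volume_preimage_mul_left hq.ne', measure_preimage_add, ← mul_assoc,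
    ← ENNReal.ofReal_mul hq.le, abs_of_pos (inv_pos.2 hq), mul_inv_cancel₀ hq.ne',
    ENNReal.ofReal_one, one_mul]

/-- Every `σ`-finite measure of infinite total mass, multiplied by a unit interval, can be mapped
onto Lebesgue measure on a half-line: lay out the pieces of a countable partition one after the
other. -/
lemma exists_map_eq_volume {X : Type*} [MeasurableSpace X] (m : Measure X) [SigmaFinite m]
    (hm : m Set.univ = ∞) :
    ∃ pos : X × ℝ → ℝ, Measurable pos ∧
      (m.prod (volume.restrict (Set.Ico (0 : ℝ) 1))).map pos = volume.restrict (Set.Ici 0) := by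
  set Q : ℕ → Set X := disjointed (spanningSets m)
  set idx : X → ℕ := spanningSetsIndex m
  have hidx : Measurable idx := measurableSet_spanningSetsIndex m
  have hQ : ∀ n, idx ⁻¹' {n} = Q n := fun n => preimage_spanningSetsIndex_singleton m n
  have hQm : ∀ n, MeasurableSet (Q n) := fun n => hQ n ▸ hidx (measurableSet_singleton n)
  have hQf : ∀ n, m (Q n) ≠ ∞ := fun n =>
    measure_ne_top_of_subset (disjointed_subset _ _) (measure_spanningSets_lt_top m n).ne
  set q : ℕ → ℝ := fun n => (m (Q n)).toReal
  have hq : ∀ n, 0 ≤ q n := fun n => ENNReal.toReal_nonneg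
  have hqm : ∀ n, ENNReal.ofReal (q n) = m (Q n) := fun n => ENNReal.ofReal_toReal (hQf n)
  set s : ℕ → ℝ := fun n => ∑ i ∈ Finset.range n, q i
  have hs : ∀ n, s (n + 1) = s n + q n := fun n => Finset.sum_range_succ _ _
  have hmono : Monotone s := monotone_nat_of_le_succ fun n => by rw [hs]; linarith [hq n]
  have hsum : ∑' n, m (Q n) = ∞ := by
    rw [← measure_iUnion (fun i j hij => disjoint_disjointed _ hij) hQm, iUnion_disjointed,
      iUnion_spanningSets, hm]
  have htend : Tendsto s atTop atTop := by
    rw [← not_summable_iff_tendsto_nat_atTop_of_nonneg hq]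
    intro h
    have := h.tsum_ofReal_ne_top
    simp only [hqm] at this
    exact this hsum
  have hcover : ⋃ n, Set.Ico (s n) (s (n + 1)) = Set.Ici 0 := by
    ext x
    simp only [Set.mem_iUnion, Set.mem_Ico, Set.mem_Ici]
    constructor
    · rintro ⟨n, hn, _⟩
      have : s 0 ≤ s n := hmono (Nat.zero_le n)
      simp only [s, Finset.range_zero, Finset.sum_empty] at this
      exact le_trans this hn
    · intro hx
      have hex : ∃ n, x < s n := (htend.eventually_gt_atTop x).exists
      have h1 := Nat.find_spec hex
      have h2 : Nat.find hex ≠ 0 := by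
        intro h0
        rw [h0] at h1
        simp only [s, Finset.range_zero, Finset.sum_empty] at h1
        linarith
      obtain ⟨k, hk⟩ := Nat.exists_eq_succ_of_ne_zero h2
      refine ⟨k, not_lt.1 (Nat.find_min hex (by omega)), ?_⟩
      rwa [hk] at h1
  refine ⟨fun z => s (idx z.1) + q (idx z.1) * z.2, ?_, ?_⟩
  · exact ((measurable_from_top (f := s)).comp (hidx.comp measurable_fst)).add
      (((measurable_from_top (f := q)).comp (hidx.comp measurable_fst)).mul measurable_snd)
  · ext B hB
    have hmeas : Measurable fun z : X × ℝ => s (idx z.1) + q (idx z.1) * z.2 :=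
      ((measurable_from_top (f := s)).comp (hidx.comp measurable_fst)).add
      (((measurable_from_top (f := q)).comp (hidx.comp measurable_fst)).mul measurable_snd)
    have haff : ∀ n, MeasurableSet ((fun t : ℝ => s n + q n * t) ⁻¹' B) := fun n =>
      (by fun_prop : Measurable fun t : ℝ => s n + q n * t) hB
    rw [Measure.map_apply hmeas hB, Measure.restrict_apply hB, ← hcover, Set.inter_iUnion,
      measure_iUnion]
    · have : (fun z : X × ℝ => s (idx z.1) + q (idx z.1) * z.2) ⁻¹' B =
          ⋃ n, Q n ×ˢ ((fun t : ℝ => s n + q n * t) ⁻¹' B) := by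
        ext ⟨x, t⟩
        simp only [Set.mem_preimage, Set.mem_iUnion, Set.mem_prod, ← hQ, Set.mem_singleton_iff]
        constructor
        · intro h
          exact ⟨_, rfl, h⟩
        · rintro ⟨n, rfl, h⟩
          exact h
      rw [this, measure_iUnion]
      · refine tsum_congr fun n => ?_
        rw [Measure.prod_prod, ← hqm, volume_preimage_affine _ (hq n) hB, hs]
      · intro i j hij
        exact Set.Disjoint.set_prod_left (disjoint_disjointed _ hij) _ _
      · exact fun n => (hQm n).prod (haff n)
    · intro i j hij
      exact (hmono.pairwise_disjoint_on_Ico_succ hij).mono Set.inter_subset_right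
        Set.inter_subset_right
    · exact fun n => hB.inter measurableSet_Ico

section

variable {Ω Ω₁ Ω₂ X : Type*} [MeasurableSpace Ω] [MeasurableSpace Ω₁] [MeasurableSpace Ω₂]
  [MeasurableSpace X]

lemma extendMeasure_inl (μ : Measure Ω) {B : Set Ω} (hB : MeasurableSet B) :
    extendMeasure μ (Sum.inl '' B) = μ B := by
  rw [extendMeasure, Measure.add_apply, Measure.map_apply measurable_inl
    (measurableSet_inl_image.2 hB), Measure.map_apply measurable_inr
    (measurableSet_inl_image.2 hB), Set.preimage_image_eq _ Sum.inl_injective]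
  simp

lemma extendMeasure_apply (μ : Measure Ω) {B : Set (Ω ⊕ ℝ)} (hB : MeasurableSet B) :
    extendMeasure μ B = μ (Sum.inl ⁻¹' B) + volume (Sum.inr ⁻¹' B) := by
  rw [extendMeasure, Measure.add_apply, Measure.map_apply measurable_inl hB,
    Measure.map_apply measurable_inr hB]

instance sigmaFinite_extendMeasure (μ : Measure Ω) [SigmaFinite μ] :
    SigmaFinite (extendMeasure μ) := by
  refine ⟨⟨⟨fun n => Sum.inl '' spanningSets μ n ∪ Sum.inr '' spanningSets volume n,
    fun _ => trivial, fun n => ?_, ?_⟩⟩⟩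
  · rw [extendMeasure_apply _ ((measurableSet_inl_image.2 (measurableSet_spanningSets μ n)).union
      (measurableSet_inr_image.2 (measurableSet_spanningSets volume n)))]
    simp only [Set.preimage_union, Set.preimage_image_eq _ Sum.inl_injective,
      Set.preimage_image_eq _ Sum.inr_injective, Set.preimage_inl_image_inr,
      Set.preimage_inr_image_inl, Set.union_empty, Set.empty_union]
    exact ENNReal.add_lt_top.2 ⟨measure_spanningSets_lt_top μ n,
      measure_spanningSets_lt_top volume n⟩
  · rw [Set.iUnion_union_distrib, ← Set.image_iUnion, ← Set.image_iUnion, iUnion_spanningSets,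
      iUnion_spanningSets, Set.image_univ, Set.image_univ, Set.range_inl_union_range_inr]

open GraphexData in
/-- A partial map onto `Ω` extends to a map onto the trivial extension of `Ω`, after adding a line
and an interval to its domain. -/
lemma GraphexData.Covers.exists_lift {γ : Measure X} [SigmaFinite γ] {p : X → Ω ⊕ ℝ} {μ : Measure Ω}
    (h : Covers γ p μ) :
    ∃ P : (X ⊕ ℝ) × ℝ → Ω ⊕ ℝ, Measurable P ∧
      ((extendMeasure γ).prod (volume.restrict (Set.Ico (0 : ℝ) 1))).map P = extendMeasure μ ∧
      ∀ T : GraphexData Ω, T.extend.pullback P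
        = (T.extend.pullback p).extend.pullback Prod.fst := by
  classical
  set p' : X ⊕ ℝ → Ω ⊕ ℝ := Sum.elim p Sum.inr
  have hp' : Measurable p' := h.measurable.sumElim measurable_inr
  set g : X ⊕ ℝ → ℝ := Sum.elim (fun _ => 0) id
  have hg : Measurable g := measurable_const.sumElim measurable_id
  set R : Set (Ω ⊕ ℝ) := Set.range Sum.inl
  have hR : MeasurableSet R := measurableSet_range_inl
  -- The negative half-line of the added line is mapped identically. The rest of what does not go to
  -- `Ω` has infinite mass, since it contains the positive half-line, and can be mapped onto the
  -- positive half-line.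
  set K : Set (X ⊕ ℝ) := p' ⁻¹' Rᶜ ∩ g ⁻¹' Set.Ici 0
  have hK : MeasurableSet K := (hp' hR.compl).inter (hg measurableSet_Ici)
  have hKinf : (extendMeasure γ).restrict K Set.univ = ∞ := by
    rw [Measure.restrict_apply_univ, extendMeasure_apply _ hK]
    have : Sum.inr ⁻¹' K = Set.Ici (0 : ℝ) := by
      ext x; simp [K, p', g, R]
    rw [this, Real.volume_Ici]
    simp
  obtain ⟨pos, hpos, hmap⟩ := exists_map_eq_volume ((extendMeasure γ).restrict K) hKinf
  set P : (X ⊕ ℝ) × ℝ → Ω ⊕ ℝ := fun z => if p' z.1 ∈ R then p' z.1 else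
    Sum.inr (if g z.1 < 0 then g z.1 else pos z)
  have hP : Measurable P := by
    refine Measurable.ite (hp'.comp measurable_fst hR) (hp'.comp measurable_fst) ?_
    refine measurable_inr.comp (Measurable.ite ?_ (hg.comp measurable_fst) hpos)
    exact measurableSet_lt (hg.comp measurable_fst) measurable_const
  refine ⟨P, hP, ?_, fun T => ?_⟩
  · ext B hB
    set B₁ : Set Ω := Sum.inl ⁻¹' B
    set B₂ : Set ℝ := Sum.inr ⁻¹' B
    have hB₁ : MeasurableSet B₁ := measurable_inl hB
    have hB₂ : MeasurableSet B₂ := measurable_inr hB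
    set S₁ : Set ((X ⊕ ℝ) × ℝ) := (p' ⁻¹' (Sum.inl '' B₁)) ×ˢ Set.univ
    set S₂ : Set ((X ⊕ ℝ) × ℝ) := (Sum.inr '' (B₂ ∩ Set.Iio 0)) ×ˢ Set.univ
    set S₃ : Set ((X ⊕ ℝ) × ℝ) := pos ⁻¹' B₂ ∩ K ×ˢ Set.univ
    have m₁ : MeasurableSet S₁ := (hp' (measurableSet_inl_image.2 hB₁)).prod MeasurableSet.univ
    have m₂ : MeasurableSet S₂ := (measurableSet_inr_image.2 (hB₂.inter measurableSet_Iio)).prod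
      MeasurableSet.univ
    have m₃ : MeasurableSet S₃ := (hpos hB₂).inter (hK.prod MeasurableSet.univ)
    have hunion : P ⁻¹' B = S₁ ∪ (S₂ ∪ S₃) := by
      ext ⟨x, t⟩
      simp only [P, S₁, S₂, S₃, Set.mem_preimage, Set.mem_union, Set.mem_prod, Set.mem_univ,
        and_true, Set.mem_inter_iff]
      rcases x with x | x
      · rcases hx : p x with a | a
        · simp [p', hx, R, B₁, K]
        · simp [p', hx, R, B₁, K, g, B₂]
      · by_cases hx : x < 0
        · simp [p', hx, R, K, g, B₂]
        · simp [p', hx, R, K, g, B₂, not_lt.1 hx]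
    have d₁ : Disjoint S₁ (S₂ ∪ S₃) := by
      rw [Set.disjoint_left]
      rintro ⟨x, t⟩ h1 h2
      have h1' : p' x ∈ Sum.inl '' B₁ := h1.1
      obtain ⟨a, _, ha⟩ := h1'
      rcases h2 with h2 | h2
      · obtain ⟨y, _, rfl⟩ := h2.1
        simp [p'] at ha
      · exact h2.2.1.1 ⟨a, ha⟩
    have d₂ : Disjoint S₂ S₃ := by
      rw [Set.disjoint_left]
      rintro ⟨x, t⟩ h1 h2
      obtain ⟨y, hy, rfl⟩ := h1.1
      have h3 : (0 : ℝ) ≤ g (Sum.inr y) := h2.2.1.2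
      have h4 : y < 0 := hy.2
      simp only [g, Sum.elim_inr, id] at h3
      linarith
    have hone : (volume.restrict (Set.Ico (0 : ℝ) 1)) Set.univ = 1 := by simp
    rw [Measure.map_apply hP hB, hunion, measure_union d₁ (m₂.union m₃), measure_union d₂ m₃,
      Measure.prod_prod, Measure.prod_prod, hone, mul_one, mul_one, extendMeasure_apply _ hB]
    congr 1
    · rw [extendMeasure_apply _ (hp' (measurableSet_inl_image.2 hB₁)), ← h.measure_preimage _ hB₁]
      have e : Sum.inr ⁻¹' (p' ⁻¹' (Sum.inl '' B₁)) = (∅ : Set ℝ) := by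
        ext x; simp [p']
      rw [e]
      simp only [measure_empty, add_zero]
      rfl
    · have e₂ : extendMeasure γ (Sum.inr '' (B₂ ∩ Set.Iio 0)) = volume (B₂ ∩ Set.Iio 0) := by
        rw [extendMeasure_apply _ (measurableSet_inr_image.2 (hB₂.inter measurableSet_Iio)),
          Set.preimage_image_eq _ Sum.inr_injective]
        simp
      have e₃ : ((extendMeasure γ).prod (volume.restrict (Set.Ico (0 : ℝ) 1))) S₃
          = volume (B₂ ∩ Set.Ici 0) := by
        rw [← Measure.restrict_apply hB₂, ← hmap, Measure.map_apply hpos hB₂,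
          ← Measure.restrict_apply (hpos hB₂)]
        congr 1
        conv_rhs => rw [← Measure.restrict_univ
          (μ := (volume.restrict (Set.Ico (0 : ℝ) 1)))]
        rw [Measure.prod_restrict]
      rw [e₂, e₃]
      have : (Set.Ici (0 : ℝ)) = (Set.Iio 0)ᶜ := by simp
      rw [this, ← Set.sdiff_eq]
      exact measure_inter_add_sdiff _ measurableSet_Iio
  · have hz : ∀ z, (∃ x a, z.1 = Sum.inl x ∧ p x = Sum.inl a ∧ P z = Sum.inl a) ∨
        ((∃ r, P z = Sum.inr r) ∧ ((∃ r, z.1 = Sum.inr r) ∨ ∃ x r, z.1 = Sum.inl x ∧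
          p x = Sum.inr r)) := by
      rintro ⟨x | x, t⟩
      · rcases hx : p x with a | a
        · left
          exact ⟨x, a, rfl, hx, by simp [P, p', hx, R]⟩
        · right
          exact ⟨⟨_, by simp only [P, p', Sum.elim_inl, hx, R]; simp; rfl⟩, Or.inr ⟨x, a, rfl, hx⟩⟩
      · right
        exact ⟨⟨_, by simp only [P, p', Sum.elim_inr, R]; simp; rfl⟩, Or.inl ⟨x, rfl⟩⟩
    have hW : ∀ z w, T.extend.W (P z) (P w) = (T.extend.pullback p).extend.W z.1 w.1 := by
      intro z w
      rcases hz z with ⟨x, a, hx, hxa, hPx⟩ | ⟨⟨r, hr⟩, ⟨s, hs⟩ | ⟨x, s, hx, hs⟩⟩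
      · rcases hz w with ⟨y, b, hy, hyb, hPy⟩ | ⟨⟨r, hr⟩, ⟨s, hs⟩ | ⟨y, s, hy, hs⟩⟩
        · rw [hPx, hPy, hx, hy]
          change _ = T.extend.W (p x) (p y)
          rw [hxa, hyb]
        · rw [hPx, hr, hx, hs]
          rfl
        · rw [hPx, hr, hx, hy]
          change _ = T.extend.W (p x) (p y)
          rw [hxa, hs]
          rfl
      · rw [hr, hs]
        rcases P w with a | a <;> rcases w.1 with b | b <;> rfl
      · rw [hr, hx]
        rcases w.1 with b | b
        · change _ = T.extend.W (p x) (p b)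
          rw [hs]
          rcases P w with a | a <;> rcases p b with c | c <;> rfl
        · rcases P w with a | a <;> rfl
    have hS : ∀ z, T.extend.S (P z) = (T.extend.pullback p).extend.S z.1 := by
      intro z
      rcases hz z with ⟨x, a, hx, hxa, hPx⟩ | ⟨⟨r, hr⟩, ⟨s, hs⟩ | ⟨x, s, hx, hs⟩⟩
      · rw [hPx, hx]
        change _ = T.extend.S (p x)
        rw [hxa]
      · rw [hr, hs]
        rfl
      · rw [hr, hx]
        change _ = T.extend.S (p x)
        rw [hs]
        rfl
    simp only [GraphexData.pullback, GraphexData.mk.injEq]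
    exact ⟨funext fun z => funext fun w => hW z w, funext hS, rfl⟩

namespace GraphexData

variable {T₁ : GraphexData Ω₁} {μ₁ : Measure Ω₁} {T₂ : GraphexData Ω₂} {μ₂ : Measure Ω₂}
  {k d r : ℝ≥0∞}

lemma Near.extend_pullback {Y : Type*} [MeasurableSpace Y] {A B : GraphexData X} {η : Measure X}
    {γ : Measure Y} [SFinite η] [SFinite γ] {q : Y → X ⊕ ℝ} (hA : A.IsProper) (hB : B.IsProper)
    (fA : A.FiniteOn η) (fB : B.FiniteOn η) (hq : Covers γ q η) (h : A.Near B η k d r) :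
    (A.extend.pullback q).Near (B.extend.pullback q) γ k d r := by
  have fA' : A.extend.FiniteOn (η.map Sum.inl) := (hA.extend.finiteOn_pullback measurable_inl
    measurableSet_range_inl extend_vanishesOff (map_inl_restrict η)).1 fA
  have fB' : B.extend.FiniteOn (η.map Sum.inl) := (hB.extend.finiteOn_pullback measurable_inl
    measurableSet_range_inl extend_vanishesOff (map_inl_restrict η)).1 fB
  have h' : A.extend.Near B.extend (η.map Sum.inl) k d r :=
    Near.of_pullback (γ := η) (q := Sum.inl) hA.extend hB.extend fA' fB' measurable_inl
      measurableSet_range_inl extend_vanishesOff extend_vanishesOff (map_inl_restrict η) h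
  exact h'.pullback hA.extend hB.extend fA' fB' hq.measurable measurableSet_range_inl
    extend_vanishesOff extend_vanishesOff hq.restrict_map

lemma covers_fst_of_isCoupling {γ : Measure ((Ω₁ ⊕ ℝ) × (Ω₂ ⊕ ℝ))}
    (h : IsCoupling γ (extendMeasure μ₁) (extendMeasure μ₂)) : Covers γ Prod.fst μ₁ :=
  ⟨measurable_fst, fun B hB => by
    rw [← Measure.map_apply measurable_fst (measurableSet_inl_image.2 hB), h.1,
      extendMeasure_inl _ hB]⟩

lemma covers_snd_of_isCoupling {γ : Measure ((Ω₁ ⊕ ℝ) × (Ω₂ ⊕ ℝ))}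
    (h : IsCoupling γ (extendMeasure μ₁) (extendMeasure μ₂)) : Covers γ Prod.snd μ₂ :=
  ⟨measurable_snd, fun B hB => by
    rw [← Measure.map_apply measurable_snd (measurableSet_inl_image.2 hB), h.2,
      extendMeasure_inl _ hB]⟩

/-- A partial coupling can be realized by a coupling of the trivial extensions. -/
lemma JointNear.delta22_le [SigmaFinite μ₁] [SigmaFinite μ₂] (h₁ : T₁.IsProper)
    (h₂ : T₂.IsProper) (f₁ : T₁.FiniteOn μ₁) (f₂ : T₂.FiniteOn μ₂)
    (h : JointNear T₁ μ₁ T₂ μ₂ k d r) :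
    delta22 T₁ μ₁ T₂ μ₂ ≤ max k (max (d ^ (1 / 2 : ℝ)) (r ^ (1 / 3 : ℝ))) := by
  obtain ⟨γ, _, c₁, c₂, hN⟩ := h
  set Z : Set ((Ω₁ ⊕ ℝ) × (Ω₂ ⊕ ℝ)) :=
    Prod.fst ⁻¹' Set.range Sum.inl ∪ Prod.snd ⁻¹' Set.range Sum.inl
  have hZ : MeasurableSet Z := (measurable_fst measurableSet_range_inl).union
    (measurable_snd measurableSet_range_inl)
  -- Where both coordinates lie on the appended lines, `γ` may fail to be σ-finite; that part is
  -- irrelevant and is removed.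
  set γ₀ := γ.restrict Z
  have cov₁ : Covers γ₀ Prod.fst μ₁ := ⟨measurable_fst, fun B hB => by
    rw [← c₁.measure_preimage B hB, Measure.restrict_apply
      (measurable_fst (measurableSet_inl_image.2 hB)), Set.inter_eq_left.2]
    rintro z ⟨a, _, ha⟩
    exact Or.inl ⟨a, ha⟩⟩
  have cov₂ : Covers γ₀ Prod.snd μ₂ := ⟨measurable_snd, fun B hB => by
    rw [← c₂.measure_preimage B hB, Measure.restrict_apply
      (measurable_snd (measurableSet_inl_image.2 hB)), Set.inter_eq_left.2]
    rintro z ⟨a, _, ha⟩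
    exact Or.inr ⟨a, ha⟩⟩
  have : SigmaFinite γ₀ := by
    refine ⟨⟨⟨fun n => Prod.fst ⁻¹' (Sum.inl '' spanningSets μ₁ n) ∪
      Prod.snd ⁻¹' (Sum.inl '' spanningSets μ₂ n) ∪ Zᶜ, fun _ => trivial, fun n => ?_, ?_⟩⟩⟩
    · refine lt_of_le_of_lt ((measure_union_le _ _).trans (add_le_add (measure_union_le _ _)
        le_rfl)) ?_
      rw [cov₁.measure_preimage _ (measurableSet_spanningSets μ₁ n),
        cov₂.measure_preimage _ (measurableSet_spanningSets μ₂ n), Measure.restrict_apply hZ.compl]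
      simp [measure_spanningSets_lt_top]
    · rw [Set.eq_univ_iff_forall]
      rintro ⟨x | x, y⟩
      · obtain ⟨n, hn⟩ := Set.mem_iUnion.1 ((iUnion_spanningSets μ₁).symm ▸ Set.mem_univ x)
        exact Set.mem_iUnion.2 ⟨n, Or.inl (Or.inl ⟨x, hn, rfl⟩)⟩
      · rcases y with y | y
        · obtain ⟨n, hn⟩ := Set.mem_iUnion.1 ((iUnion_spanningSets μ₂).symm ▸ Set.mem_univ y)
          exact Set.mem_iUnion.2 ⟨n, Or.inl (Or.inr ⟨y, hn, rfl⟩)⟩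
        · exact Set.mem_iUnion.2 ⟨0, Or.inr (by simp [Z])⟩
  have v₁ : (T₁.extend.pullback (Prod.fst : (Ω₁ ⊕ ℝ) × (Ω₂ ⊕ ℝ) → _)).VanishesOff Z :=
    ⟨fun x y hx => extend_vanishesOff.W_eq _ _ fun h => hx (Or.inl h),
      fun x hx => extend_vanishesOff.S_eq _ fun h => hx (Or.inl h)⟩
  have v₂ : (T₂.extend.pullback (Prod.snd : (Ω₁ ⊕ ℝ) × (Ω₂ ⊕ ℝ) → _)).VanishesOff Z :=
    ⟨fun x y hx => extend_vanishesOff.W_eq _ _ fun h => hx (Or.inr h),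
      fun x hx => extend_vanishesOff.S_eq _ fun h => hx (Or.inr h)⟩
  have Q₁ := h₁.extend.pullback (measurable_fst : Measurable
    (Prod.fst : (Ω₁ ⊕ ℝ) × (Ω₂ ⊕ ℝ) → _))
  have Q₂ := h₂.extend.pullback (measurable_snd : Measurable
    (Prod.snd : (Ω₁ ⊕ ℝ) × (Ω₂ ⊕ ℝ) → _))
  have hN₀ : (T₁.extend.pullback Prod.fst).Near (T₂.extend.pullback Prod.snd) γ₀ k d r :=
    hN.pullback Q₁ Q₂ ((c₁.finiteOn_iff h₁).2 f₁) ((c₂.finiteOn_iff h₂).2 f₂) (q := id)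
      measurable_id hZ v₁ v₂ (by
        rw [Measure.map_id, Measure.restrict_restrict hZ, Set.inter_self])
  obtain ⟨P₁, hP₁, map₁, pull₁⟩ := cov₁.exists_lift
  obtain ⟨P₂, hP₂, map₂, pull₂⟩ := cov₂.exists_lift
  set Λ := (extendMeasure γ₀).prod (volume.restrict (Set.Ico (0 : ℝ) 1))
  have hcov : Covers Λ (Prod.fst : (((Ω₁ ⊕ ℝ) × (Ω₂ ⊕ ℝ)) ⊕ ℝ) × ℝ → _) γ₀ := by
    refine ⟨measurable_fst, fun B hB => ?_⟩
    rw [← Set.prod_univ, Measure.prod_prod, extendMeasure_inl _ hB]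
    simp
  have hN₁ : (T₁.extend.pullback P₁).Near (T₂.extend.pullback P₂) Λ k d r := by
    rw [pull₁, pull₂]
    exact hN₀.extend_pullback Q₁ Q₂ ((cov₁.finiteOn_iff h₁).2 f₁) ((cov₂.finiteOn_iff h₂).2 f₂) hcov
  have hP : Measurable fun z => (P₁ z, P₂ z) := hP₁.prodMk hP₂
  -- The joint distribution of the two completed maps is a coupling of the extensions.
  set Γ := Λ.map fun z => (P₁ z, P₂ z)
  have hΓ : IsCoupling Γ (extendMeasure μ₁) (extendMeasure μ₂) := by
    refine ⟨?_, ?_⟩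
    · rw [Measure.map_map measurable_fst hP]; exact map₁
    · rw [Measure.map_map measurable_snd hP]; exact map₂
  have hN₂ : (T₁.extend.pullback Prod.fst).Near (T₂.extend.pullback Prod.snd) Γ k d r :=
    Near.of_pullback (q := fun z => (P₁ z, P₂ z)) (Z := Set.univ) Q₁ Q₂
      (((covers_fst_of_isCoupling hΓ).finiteOn_iff h₁).2 f₁)
      (((covers_snd_of_isCoupling hΓ).finiteOn_iff h₂).2 f₂)
      hP MeasurableSet.univ vanishesOff_univ vanishesOff_univ rfl hN₁
  refine (iInf₂_le Γ hΓ).trans ?_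
  unfold d22
  rw [← Real.enorm_eq_ofReal_abs]
  exact max_le_max hN₂.1 (max_le_max (ENNReal.rpow_le_rpow hN₂.2 (by norm_num))
    (ENNReal.rpow_le_rpow hN₂.3 (by norm_num)))

/-- With the bounds `c`, `c²` and `c³` the roots in `d_{2→2}` all become `c`. -/
lemma JointNear.delta22_le' [SigmaFinite μ₁] [SigmaFinite μ₂] (h₁ : T₁.IsProper)
    (h₂ : T₂.IsProper) (f₁ : T₁.FiniteOn μ₁) (f₂ : T₂.FiniteOn μ₂) {c : ℝ≥0∞}
    (h : JointNear T₁ μ₁ T₂ μ₂ c (c ^ 2) (c ^ 3)) : delta22 T₁ μ₁ T₂ μ₂ ≤ c := by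
  refine (h.delta22_le h₁ h₂ f₁ f₂).trans (le_of_eq ?_)
  rw [← ENNReal.rpow_natCast, ← ENNReal.rpow_natCast, ← ENNReal.rpow_mul, ← ENNReal.rpow_mul]
  norm_num

/-- A coupling of the trivial extensions is in particular a partial coupling of the given
measures. -/
lemma jointNear_of_delta22_lt [SigmaFinite μ₁] {c : ℝ≥0∞} (h : delta22 T₁ μ₁ T₂ μ₂ < c) :
    JointNear T₁ μ₁ T₂ μ₂ c (c ^ 2) (c ^ 3) := by
  unfold delta22 couplingDist22 at h
  simp only [iInf_lt_iff] at h
  obtain ⟨γ, hγ, hlt⟩ := h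
  unfold d22 at hlt
  rw [max_lt_iff, max_lt_iff, ← Real.enorm_eq_ofReal_abs] at hlt
  have : SigmaFinite (γ.map Prod.fst) := by rw [hγ.1]; infer_instance
  have : SigmaFinite γ := SigmaFinite.of_map γ measurable_fst.aemeasurable inferInstance
  refine ⟨γ, inferInstance, covers_fst_of_isCoupling hγ, covers_snd_of_isCoupling hγ,
    hlt.1.le, ?_, ?_⟩
  · have := ENNReal.rpow_le_rpow hlt.2.1.le (show (0 : ℝ) ≤ 2 by norm_num)
    rw [← ENNReal.rpow_mul] at this
    norm_num at this
    exact this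
  · have := ENNReal.rpow_le_rpow hlt.2.2.le (show (0 : ℝ) ≤ 3 by norm_num)
    rw [← ENNReal.rpow_mul] at this
    norm_num at this
    exact this

end GraphexData

end

end Realization

/-! ### The two distances are pseudometrics -/

section Distances

namespace GraphexData

variable {Ω Ω₁ Ω₂ Ω₃ : Type*} [MeasurableSpace Ω] [MeasurableSpace Ω₁] [MeasurableSpace Ω₂]
  [MeasurableSpace Ω₃] {T : GraphexData Ω} {μ : Measure Ω}
  {T₁ : GraphexData Ω₁} {μ₁ : Measure Ω₁} {T₂ : GraphexData Ω₂} {μ₂ : Measure Ω₂}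
  {T₃ : GraphexData Ω₃} {μ₃ : Measure Ω₃}

lemma delta22_self [SigmaFinite μ] (hT : T.IsProper) (fT : T.FiniteOn μ) :
    delta22 T μ T μ = 0 := by
  refine le_antisymm ?_ zero_le
  refine JointNear.delta22_le' hT hT fT fT ?_
  simpa using jointNear_self hT fT

lemma delta22_ne_top [SigmaFinite μ₁] [SigmaFinite μ₂] (h₁ : T₁.IsProper)
    (h₂ : T₂.IsProper) (f₁ : T₁.FiniteOn μ₁) (f₂ : T₂.FiniteOn μ₂) :
    delta22 T₁ μ₁ T₂ μ₂ ≠ ∞ := by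
  obtain ⟨k, d, r, hk, hd, hr, h⟩ := exists_jointNear h₁ h₂ f₁ f₂
  refine ne_top_of_le_ne_top ?_ (h.delta22_le h₁ h₂ f₁ f₂)
  simp only [ne_eq, max_eq_top, ENNReal.rpow_eq_top_iff, not_or]
  simp [hk, hd, hr]

lemma delta22_comm_le [SigmaFinite μ₁] [SigmaFinite μ₂] (h₁ : T₁.IsProper)
    (h₂ : T₂.IsProper) (f₁ : T₁.FiniteOn μ₁) (f₂ : T₂.FiniteOn μ₂) :
    delta22 T₂ μ₂ T₁ μ₁ ≤ delta22 T₁ μ₁ T₂ μ₂ :=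
  le_of_forall_gt fun c hc => by
    obtain ⟨c', hc', hc''⟩ := exists_between hc
    exact (((jointNear_of_delta22_lt hc').symm h₁ h₂ f₁ f₂).delta22_le' h₂ h₁ f₂ f₁).trans_lt hc''

lemma delta22_comm [SigmaFinite μ₁] [SigmaFinite μ₂] (h₁ : T₁.IsProper)
    (h₂ : T₂.IsProper) (f₁ : T₁.FiniteOn μ₁) (f₂ : T₂.FiniteOn μ₂) :
    delta22 T₁ μ₁ T₂ μ₂ = delta22 T₂ μ₂ T₁ μ₁ :=
  le_antisymm (delta22_comm_le h₂ h₁ f₂ f₁) (delta22_comm_le h₁ h₂ f₁ f₂)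

lemma delta22_triangle [SigmaFinite μ₁] [SigmaFinite μ₂] [SigmaFinite μ₃] (h₁ : T₁.IsProper)
    (h₂ : T₂.IsProper) (h₃ : T₃.IsProper) (f₁ : T₁.FiniteOn μ₁) (f₂ : T₂.FiniteOn μ₂)
    (f₃ : T₃.FiniteOn μ₃) :
    delta22 T₁ μ₁ T₃ μ₃ ≤ delta22 T₁ μ₁ T₂ μ₂ + delta22 T₂ μ₂ T₃ μ₃ := by
  refine ENNReal.le_of_forall_pos_le_add fun ε hε _ => ?_
  have hδ := delta22_ne_top h₁ h₂ f₁ f₂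
  have hδ' := delta22_ne_top h₂ h₃ f₂ f₃
  set δ := delta22 T₁ μ₁ T₂ μ₂
  set δ' := delta22 T₂ μ₂ T₃ μ₃
  have he : ((ε / 3 : ℝ≥0) : ℝ≥0∞) ≠ 0 := by
    simpa using (div_pos hε three_pos).ne'
  set e : ℝ≥0∞ := ((ε / 3 : ℝ≥0) : ℝ≥0∞)
  have hc : 0 < δ + e := (pos_iff_ne_zero.2 he).trans_le le_add_self
  have hc' : 0 < δ' + e := (pos_iff_ne_zero.2 he).trans_le le_add_self
  have hN := jointNear_of_delta22_lt (ENNReal.lt_add_right hδ he)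
  have hN' := jointNear_of_delta22_lt (ENNReal.lt_add_right hδ' he)
  set c := δ + e
  set c' := δ' + e
  have hη : min e (2 * c * c') ≠ 0 := by
    rw [← pos_iff_ne_zero]
    refine lt_min (pos_iff_ne_zero.2 he) (ENNReal.mul_pos (mul_ne_zero two_ne_zero hc.ne') hc'.ne')
  have h := hN.trans h₁ h₂ h₃ f₁ f₂ f₃ hN' hη
  have h' : JointNear T₁ μ₁ T₃ μ₃ (c + c' + e) ((c + c' + e) ^ 2) ((c + c' + e) ^ 3) := by
    refine h.mono (by gcongr; exact min_le_left _ _) ?_ ?_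
    · calc c ^ 2 + c' ^ 2 + min e (2 * c * c') ≤ c ^ 2 + c' ^ 2 + 2 * c * c' := by
            gcongr; exact min_le_right _ _
        _ = (c + c') ^ 2 := by ring
        _ ≤ _ := pow_le_pow_left' le_self_add _
    · calc c ^ 3 + c' ^ 3 ≤ c ^ 3 + c' ^ 3 + (3 * c ^ 2 * c' + 3 * c * c' ^ 2) := le_self_add
        _ = (c + c') ^ 3 := by ring
        _ ≤ _ := pow_le_pow_left' le_self_add _
  refine (h'.delta22_le' h₁ h₃ f₁ f₃).trans (le_of_eq ?_)
  have : (ε : ℝ≥0∞) = e + e + e := by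
    rw [← ENNReal.coe_add, ← ENNReal.coe_add]
    congr 1
    ring_nf
  rw [this]
  ring

/-- An admissible value in the definition of the weak kernel distance gives an upper bound. -/
lemma deltaDiamond_le [SigmaFinite μ₁] [SigmaFinite μ₂] (h₁ : T₁.IsProper) (h₂ : T₂.IsProper)
    {c : ℝ≥0} {ν₁ : Measure Ω₁} {ν₂ : Measure Ω₂} (f₁ : T₁.FiniteOn ν₁) (f₂ : T₂.FiniteOn ν₂)
    (n₁ : IsNearlyFull μ₁ ν₁ (c ^ 2)) (n₂ : IsNearlyFull μ₂ ν₂ (c ^ 2))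
    (h : delta22 T₁ ν₁ T₂ ν₂ ≤ c) : deltaDiamond T₁ μ₁ T₂ μ₂ ≤ c := by
  have := n₁.sigmaFinite
  have := n₂.sigmaFinite
  exact iInf₂_le c ⟨ν₁, ν₂, h₁.memL1L2_iff.2 f₁, h₂.memL1L2_iff.2 f₂, n₁, n₂, h⟩

/-- A witness for an upper bound of `δ_⋄`, with the comparison in the form without roots. -/
lemma exists_of_deltaDiamond_lt [SigmaFinite μ₁] [SigmaFinite μ₂] (h₁ : T₁.IsProper)
    (h₂ : T₂.IsProper) {a : ℝ≥0∞} (h : deltaDiamond T₁ μ₁ T₂ μ₂ < a) :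
    ∃ c : ℝ≥0, c < a ∧ ∃ (ν₁ : Measure Ω₁) (ν₂ : Measure Ω₂), T₁.FiniteOn ν₁ ∧ T₂.FiniteOn ν₂ ∧
      IsNearlyFull μ₁ ν₁ (c ^ 2) ∧ IsNearlyFull μ₂ ν₂ (c ^ 2) ∧
      JointNear T₁ ν₁ T₂ ν₂ c (c ^ 2) (c ^ 3) := by
  obtain ⟨c, hc⟩ := iInf_lt_iff.1 h
  obtain ⟨⟨ν₁, ν₂, m₁, m₂, n₁, n₂, hN⟩, hca⟩ := iInf_lt_iff.1 hc
  obtain ⟨c', hcc', hc'a⟩ := exists_between hca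
  lift c' to ℝ≥0 using (hc'a.trans_le le_top).ne
  have hle : c ≤ c' := by exact_mod_cast hcc'.le
  have := n₁.sigmaFinite
  have := n₂.sigmaFinite
  refine ⟨c', hc'a, ν₁, ν₂, h₁.memL1L2_iff.1 m₁, h₂.memL1L2_iff.1 m₂, n₁.mono (by gcongr),
    n₂.mono (by gcongr), jointNear_of_delta22_lt (hN.trans_lt hcc')⟩

lemma deltaDiamond_self_le [SigmaFinite μ] (hT : T.IsProper) {c : ℝ≥0} {ν : Measure Ω}
    (f : T.FiniteOn ν) (n : IsNearlyFull μ ν (c ^ 2)) : deltaDiamond T μ T ν ≤ c := by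
  have := n.sigmaFinite
  exact deltaDiamond_le hT hT f f n (isNearlyFull_self _ _) (by simp [delta22_self hT f])

lemma deltaDiamond_le_delta22 [SigmaFinite μ₁] [SigmaFinite μ₂] (h₁ : T₁.IsProper)
    (h₂ : T₂.IsProper) (f₁ : T₁.FiniteOn μ₁) (f₂ : T₂.FiniteOn μ₂) :
    deltaDiamond T₁ μ₁ T₂ μ₂ ≤ delta22 T₁ μ₁ T₂ μ₂ := by
  have h := delta22_ne_top h₁ h₂ f₁ f₂
  rw [← ENNReal.coe_toNNReal h]
  exact deltaDiamond_le h₁ h₂ f₁ f₂ (isNearlyFull_self _ _) (isNearlyFull_self _ _)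
    (by rw [ENNReal.coe_toNNReal h])

lemma deltaDiamond_comm_le [SigmaFinite μ₁] [SigmaFinite μ₂] (h₁ : T₁.IsProper)
    (h₂ : T₂.IsProper) : deltaDiamond T₂ μ₂ T₁ μ₁ ≤ deltaDiamond T₁ μ₁ T₂ μ₂ :=
  le_of_forall_gt fun a ha => by
    obtain ⟨c, hc, ν₁, ν₂, f₁, f₂, n₁, n₂, hN⟩ := exists_of_deltaDiamond_lt h₁ h₂ ha
    have := n₁.sigmaFinite
    have := n₂.sigmaFinite
    exact (deltaDiamond_le h₂ h₁ f₂ f₁ n₂ n₁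
      ((hN.symm h₁ h₂ f₁ f₂).delta22_le' h₂ h₁ f₂ f₁)).trans_lt hc

lemma deltaDiamond_comm [SigmaFinite μ₁] [SigmaFinite μ₂] (h₁ : T₁.IsProper)
    (h₂ : T₂.IsProper) : deltaDiamond T₁ μ₁ T₂ μ₂ = deltaDiamond T₂ μ₂ T₁ μ₁ :=
  le_antisymm (deltaDiamond_comm_le h₂ h₁) (deltaDiamond_comm_le h₁ h₂)

/-- The exponents in the definitions of `d_{2→2}` and `δ_⋄` are matched to make this exact: passing
to a common part of the two decreased middle measures costs cross terms, which are those in the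
expansions of `(c + c')²` and `(c + c')³`. -/
lemma deltaDiamond_triangle [SigmaFinite μ₁] [SigmaFinite μ₂] [SigmaFinite μ₃] (h₁ : T₁.IsProper)
    (h₂ : T₂.IsProper) (h₃ : T₃.IsProper) :
    deltaDiamond T₁ μ₁ T₃ μ₃ ≤ deltaDiamond T₁ μ₁ T₂ μ₂ + deltaDiamond T₂ μ₂ T₃ μ₃ := by
  refine ENNReal.le_of_forall_pos_le_add fun ε hε hfin => ?_
  have he : ((ε / 3 : ℝ≥0) : ℝ≥0∞) ≠ 0 := by
    simpa using (div_pos hε three_pos).ne'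
  have hfin' := ENNReal.add_lt_top.1 hfin
  obtain ⟨c, hc, ν₁, ν₂, f₁, f₂, n₁, n₂, hN⟩ :=
    exists_of_deltaDiamond_lt h₁ h₂ (ENNReal.lt_add_right hfin'.1.ne he)
  obtain ⟨c', hc', ν₂', ν₃, f₂', f₃, n₂', n₃, hN'⟩ :=
    exists_of_deltaDiamond_lt h₂ h₃ (ENNReal.lt_add_right hfin'.2.ne he)
  have := n₁.sigmaFinite
  have := n₂.sigmaFinite
  have := n₂'.sigmaFinite
  have := n₃.sigmaFinite
  obtain ⟨m, hm, hm'⟩ := n₂.exists_common n₂'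
  have := hm.sigmaFinite
  obtain ⟨κ₁, k₁, hκ₁⟩ := hN.restrict_right h₁ h₂ f₁ f₂ hm
  obtain ⟨κ₃, k₃, hκ₃⟩ := (hN'.symm h₂ h₃ f₂' f₃).restrict_right h₃ h₂ f₃ f₂' hm'
  have := k₁.sigmaFinite
  have := k₃.sigmaFinite
  have g₁ := f₁.mono h₁ k₁.le
  have g₂ := f₂.mono h₂ hm.le
  have g₃ := f₃.mono h₃ k₃.le
  set e : ℝ≥0 := ε / 3
  have he' : 0 < e := div_pos hε three_pos
  have hη : min (e : ℝ≥0∞) (e ^ 2) ≠ 0 := by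
    rw [← pos_iff_ne_zero]
    exact lt_min (by simpa using he') (by positivity)
  have h := hκ₁.trans h₁ h₂ h₃ g₁ g₂ g₃ (hκ₃.symm h₃ h₂ g₃ g₂) hη
  have h' : JointNear T₁ κ₁ T₃ κ₃ ((c + c' + e : ℝ≥0) : ℝ≥0∞) ((c + c' + e : ℝ≥0) ^ 2)
      ((c + c' + e : ℝ≥0) ^ 3) := by
    push_cast
    refine h.mono (by gcongr; exact min_le_left _ _) ?_ ?_
    · calc (c : ℝ≥0∞) ^ 2 + c * c' + (c' ^ 2 + c' * c) + min (e : ℝ≥0∞) (e ^ 2)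
          ≤ (c : ℝ≥0∞) ^ 2 + c * c' + (c' ^ 2 + c' * c) + e ^ 2 := by
            gcongr; exact min_le_right _ _
        _ ≤ (c : ℝ≥0∞) ^ 2 + c * c' + (c' ^ 2 + c' * c) + e ^ 2 + 2 * (c + c') * e := le_self_add
        _ = _ := by ring
    · calc (c : ℝ≥0∞) ^ 3 + 2 * c ^ 2 * c' + c * c' ^ 2 + (c' ^ 3 + 2 * c' ^ 2 * c + c' * c ^ 2)
          = (c + c' : ℝ≥0∞) ^ 3 := by ring
        _ ≤ _ := pow_le_pow_left' le_self_add _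
  have hsum : c ^ 2 + c' ^ 2 ≤ (c + c' + e) ^ 2 := by
    have : (c + c' + e) ^ 2 = c ^ 2 + c' ^ 2 + (2 * c * c' + e ^ 2 + 2 * (c + c') * e) := by ring
    rw [this]
    exact le_self_add
  refine (deltaDiamond_le h₁ h₃ g₁ g₃ ((n₁.trans k₁).mono hsum)
    ((n₃.trans k₃).mono ((add_comm _ _).le.trans hsum)) (h'.delta22_le' h₁ h₃ g₁ g₃)).trans ?_
  have : (ε : ℝ≥0∞) = e + e + e := by
    rw [← ENNReal.coe_add, ← ENNReal.coe_add]
    congr 1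
    simp only [e]
    ring_nf
  rw [this]
  push_cast
  calc (c + c' + e : ℝ≥0∞) ≤ _ + e + (_ + e) + e := by gcongr
    _ = _ := by ring

lemma deltaDiamond_ne_top [SigmaFinite μ₁] [SigmaFinite μ₂] (h₁ : T₁.IsProper)
    (h₂ : T₂.IsProper) {ν₁ : Measure Ω₁} {ν₂ : Measure Ω₂} (f₁ : T₁.FiniteOn ν₁)
    (f₂ : T₂.FiniteOn ν₂) {r : ℝ≥0} (n₁ : IsNearlyFull μ₁ ν₁ r) (n₂ : IsNearlyFull μ₂ ν₂ r) :
    deltaDiamond T₁ μ₁ T₂ μ₂ ≠ ∞ := by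
  have := n₁.sigmaFinite
  have := n₂.sigmaFinite
  have h := delta22_ne_top h₁ h₂ f₁ f₂
  lift delta22 T₁ ν₁ T₂ ν₂ to ℝ≥0 using h with δ hδ
  have hr : r ≤ (δ + (r + 1)) ^ 2 := by
    calc r ≤ r + 1 := le_self_add
      _ ≤ (r + 1) ^ 2 := le_self_pow₀ (le_add_of_nonneg_left zero_le) two_ne_zero
      _ ≤ _ := pow_le_pow_left' le_add_self _
  refine ne_top_of_le_ne_top ENNReal.coe_ne_top
    (deltaDiamond_le (c := δ + (r + 1)) h₁ h₂ f₁ f₂ (n₁.mono hr) (n₂.mono hr) ?_)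
  rw [← hδ]
  exact_mod_cast le_self_add

/-- Adding a set of finite measure on which the marginal is bounded keeps `‖𝕎‖₁` finite. -/
lemma IsProper.norm1_restrict_union_le [SigmaFinite μ] (hT : T.IsProper) {A B : Set Ω}
    (hB : MeasurableSet B) (hAB : Disjoint A B) {D : ℝ≥0∞}
    (hD : ∀ x ∈ B, T.marginal μ x ≤ D) :
    T.norm1 (μ.restrict (A ∪ B)) ≤ T.norm1 (μ.restrict A) + 2 * (D * μ B) := by
  rw [Measure.restrict_union hAB hB]
  refine le_trans (le_self_add.trans_eq hT.norm1_add) ?_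
  gcongr
  rw [← Measure.restrict_union hAB hB]
  calc ∫⁻ x in B, T.marginal (μ.restrict (A ∪ B)) x ∂μ ≤ ∫⁻ _ in B, D ∂μ :=
        setLIntegral_mono' hB fun x hx =>
          (hT.marginal_mono Measure.restrict_le_self x).trans (hD x hx)
    _ = D * μ B := by simp

/-- Bounded graphexes are in `L¹ ∩ L²`. -/
lemma IsProper.finiteOn_of_isBounded [SFinite μ] (hT : T.IsProper) {C D : ℝ≥0}
    (h : T.IsBounded μ C D) : T.FiniteOn μ := by
  refine ⟨ne_top_of_le_ne_top ENNReal.coe_ne_top h.1, ?_⟩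
  have hD : ∀ᵐ x ∂μ, T.marginal μ x ≤ D := by
    filter_upwards [ae_le_essSup (f := T.marginal μ) (μ := μ)] with x hx using hx.trans h.2
  refine ne_top_of_le_ne_top (b := (D : ℝ≥0∞) * C) (ENNReal.mul_ne_top (by simp) (by simp)) ?_
  calc ∫⁻ x, T.marginal μ x ^ 2 ∂μ ≤ ∫⁻ x, D * T.marginal μ x ∂μ := by
        refine lintegral_mono_ae ?_
        filter_upwards [hD] with x hx
        rw [sq]
        gcongr
    _ = D * ∫⁻ x, T.marginal μ x ∂μ := lintegral_const_mul' _ _ (by simp)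
    _ ≤ D * C := by gcongr; exact hT.lintegral_marginal_le.trans h.1

/-- By Markov's inequality, `‖𝕎‖₁ ≤ C` gives boundedness off a set of measure at most `ε`. -/
lemma IsProper.exists_isBounded_restrict [SFinite μ] (hT : T.IsProper) {C ε : ℝ≥0} (hε : 0 < ε)
    (h : T.norm1 μ ≤ C) : ∃ A, MeasurableSet A ∧ μ A ≤ ε ∧
      T.IsBounded (μ.restrict Aᶜ) C (C / ε) := by
  have hm := hT.measurable_marginal (μ := μ)
  refine ⟨{x | (C / ε : ℝ≥0) < T.marginal μ x}, measurableSet_lt measurable_const hm, ?_,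
    (hT.norm1_mono Measure.restrict_le_self).trans h, ?_⟩
  · rcases eq_or_ne C 0 with rfl | hC
    · have : ∫⁻ x, T.marginal μ x ∂μ = 0 :=
        le_antisymm (hT.lintegral_marginal_le.trans (by simpa using h)) zero_le
      rw [lintegral_eq_zero_iff hm] at this
      have h0 : μ {x | ((0 / ε : ℝ≥0) : ℝ≥0∞) < T.marginal μ x} = 0 := by
        refine measure_mono_null ?_ (ae_iff.1 this)
        intro x hx
        simpa using (ne_of_gt (lt_of_le_of_lt zero_le hx))
      exact h0.le.trans zero_le
    · have hq : ((C / ε : ℝ≥0) : ℝ≥0∞) ≠ 0 := by simpa using ⟨hC, hε.ne'⟩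
      refine (measure_mono (Set.ofPred_subset_ofPred.2 fun x hx => le_of_lt hx)).trans
        ((meas_ge_le_lintegral_div hm.aemeasurable hq ENNReal.coe_ne_top).trans ?_)
      refine ENNReal.div_le_of_le_mul ((hT.lintegral_marginal_le.trans h).trans_eq ?_)
      rw [← ENNReal.coe_mul, mul_div_cancel₀ _ hε.ne']
  · refine essSup_le_of_ae_le _ ?_
    filter_upwards [ae_restrict_mem (measurableSet_lt measurable_const hm).compl] with x hx
    exact (hT.marginal_mono Measure.restrict_le_self x).trans (not_lt.1 hx)

end GraphexData

namespace Graphex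

lemma isProper (V : Graphex.{u}) : V.data.IsProper :=
  ⟨V.measurable_W, V.W_mem, V.W_symm, V.measurable_S, V.S_nonneg, V.I_nonneg⟩

lemma memL1L2_iff (V : Graphex.{u}) : V.MemL1L2 ↔ V.data.FiniteOn V.μ := V.isProper.memL1L2_iff

lemma ae_marginal_lt_top (V : Graphex.{u}) : ∀ᵐ x ∂V.μ, V.data.marginal V.μ x < ∞ := by
  filter_upwards [V.integrable_section] with x hx
  refine ENNReal.add_lt_top.2 ⟨?_, ENNReal.ofReal_lt_top⟩
  refine lt_of_eq_of_lt ?_ hx.2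
  refine lintegral_congr fun y => ?_
  rw [V.W_symm, Real.enorm_of_nonneg (V.W_mem _ _).1]

/-- Removing a set of small measure makes `‖𝕎‖₁` finite: inside the exceptional set of finite
measure it is enough to remove the points at which the marginal is large. -/
lemma exists_norm1_restrict_ne_top (V : Graphex.{u}) {ε : ℝ≥0} (hε : 0 < ε) :
    ∃ A, MeasurableSet A ∧ V.μ A ≤ ε ∧ V.data.norm1 (V.μ.restrict Aᶜ) ≠ ∞ := by
  obtain ⟨A, hA, hAf, hAn⟩ := V.exists_integrable_restrict
  have hm := V.isProper.measurable_marginal (μ := V.μ)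
  have hs : Tendsto (fun n : ℕ => V.μ.restrict Aᶜ {x | (n : ℝ≥0∞) < V.data.marginal V.μ x}) atTop
      (𝓝 0) := by
    have : IsFiniteMeasure (V.μ.restrict Aᶜ) := ⟨by simpa using hAf⟩
    have h0 : V.μ.restrict Aᶜ (⋂ n : ℕ, {x | (n : ℝ≥0∞) < V.data.marginal V.μ x}) = 0 := by
      refine measure_mono_null (t := {x | ¬ V.data.marginal V.μ x < ∞}) ?_
        (ae_iff.1 (ae_restrict_of_ae V.ae_marginal_lt_top))
      intro x hx hlt
      obtain ⟨n, hn⟩ := ENNReal.exists_nat_gt hlt.ne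
      exact absurd (Set.mem_iInter.1 hx n) (not_lt.2 hn.le)
    rw [← h0]
    refine tendsto_measure_iInter_atTop
      (fun n => (measurableSet_lt measurable_const hm).nullMeasurableSet) ?_ ⟨0, by finiteness⟩
    intro n m hnm x hx
    exact lt_of_le_of_lt (Nat.cast_le.2 hnm) (show (m : ℝ≥0∞) < _ from hx)
  obtain ⟨n, hn⟩ := (hs.eventually_le_const (pos_iff_ne_zero.2 (by simpa using hε.ne' :
    (ε : ℝ≥0∞) ≠ 0))).exists
  have hB : MeasurableSet (Aᶜ ∩ {x | V.data.marginal V.μ x ≤ n}) :=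
    hA.compl.inter (measurableSet_le hm measurable_const)
  have hcompl : (Aᶜ ∩ {x | (n : ℝ≥0∞) < V.data.marginal V.μ x})ᶜ =
      A ∪ (Aᶜ ∩ {x | V.data.marginal V.μ x ≤ n}) := by
    ext x
    by_cases hx : x ∈ A <;> simp [hx]
  refine ⟨Aᶜ ∩ {x | (n : ℝ≥0∞) < V.data.marginal V.μ x},
    hA.compl.inter (measurableSet_lt measurable_const hm), ?_, ?_⟩
  · rwa [Measure.restrict_apply (measurableSet_lt measurable_const hm), Set.inter_comm] at hn
  · rw [hcompl]
    refine ne_top_of_le_ne_top ?_ (V.isProper.norm1_restrict_union_le hB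
      (Set.disjoint_left.2 fun x hx hx' => hx'.1 hx) (D := n) fun x hx => hx.2)
    refine ENNReal.add_ne_top.2 ⟨hAn.ne, ENNReal.mul_ne_top (by simp) (ENNReal.mul_ne_top (by simp)
      (ne_top_of_le_ne_top hAf.ne (measure_mono Set.inter_subset_left)))⟩

lemma exists_isBounded_restrict (V : Graphex.{u}) {ε : ℝ≥0} (hε : 0 < ε) :
    ∃ C D : ℝ≥0, ∃ A, MeasurableSet A ∧ V.μ A ≤ ε ∧ V.data.IsBounded (V.μ.restrict Aᶜ) C D := by
  obtain ⟨A, hA, hμ, hn⟩ := V.exists_norm1_restrict_ne_top (half_pos hε)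
  obtain ⟨B, hB, hμ', hn'⟩ := V.isProper.exists_isBounded_restrict (half_pos hε)
    (ENNReal.coe_toNNReal hn).ge
  refine ⟨(V.data.norm1 (V.μ.restrict Aᶜ)).toNNReal,
    (V.data.norm1 (V.μ.restrict Aᶜ)).toNNReal / (ε / 2), A ∪ (B ∩ Aᶜ),
    hA.union (hB.inter hA.compl), ?_, ?_⟩
  rotate_left
  · rw [Measure.restrict_restrict hB.compl] at hn'
    have : (A ∪ (B ∩ Aᶜ))ᶜ = Bᶜ ∩ Aᶜ := by
      ext x
      by_cases hx : x ∈ A <;> simp [hx]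
    rw [this]
    exact hn'
  · refine (measure_union_le _ _).trans ?_
    rw [Measure.restrict_apply hB] at hμ'
    calc _ ≤ ((ε / 2 : ℝ≥0) : ℝ≥0∞) + (ε / 2 : ℝ≥0) := add_le_add hμ hμ'
      _ = ε := by rw [← ENNReal.coe_add, add_halves]

lemma exists_finiteOn (V : Graphex.{u}) {r : ℝ≥0} (hr : 0 < r) :
    ∃ ν, IsNearlyFull V.μ ν r ∧ V.data.FiniteOn ν := by
  obtain ⟨C, D, A, hA, hμ, hb⟩ := V.exists_isBounded_restrict hr
  exact ⟨_, isNearlyFull_restrict hA.compl (by rwa [compl_compl]),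
    V.isProper.finiteOn_of_isBounded hb⟩

lemma weakKernelDist_self (V : Graphex.{u}) : V.weakKernelDist V = 0 := by
  refine le_antisymm (ENNReal.le_of_forall_pos_le_add fun ε hε _ => ?_) zero_le
  rw [zero_add]
  obtain ⟨ν, n, f⟩ := V.exists_finiteOn (pow_pos hε 2)
  have := n.sigmaFinite
  exact GraphexData.deltaDiamond_le V.isProper V.isProper f f n n
    (by simp [GraphexData.delta22_self V.isProper f])

lemma weakKernelDist_ne_top (V V' : Graphex.{u}) : V.weakKernelDist V' ≠ ∞ := by
  obtain ⟨ν, n, f⟩ := V.exists_finiteOn one_pos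
  obtain ⟨ν', n', f'⟩ := V'.exists_finiteOn one_pos
  exact GraphexData.deltaDiamond_ne_top V.isProper V'.isProper f f' n n'

/-- The weak kernel distance as a pseudometric. -/
@[reducible]
noncomputable def weakKernelPseudoMetric : PseudoMetricSpace Graphex.{u} :=
  letI : PseudoEMetricSpace Graphex.{u} :=
    { edist := weakKernelDist
      edist_self := weakKernelDist_self
      edist_comm := fun V V' => GraphexData.deltaDiamond_comm V.isProper V'.isProper
      edist_triangle := fun V₁ V₂ V₃ =>
        GraphexData.deltaDiamond_triangle V₁.isProper V₂.isProper V₃.isProper }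
  PseudoEMetricSpace.toPseudoMetricSpace weakKernelDist_ne_top

/-- The kernel distance as a pseudometric on the graphexes in `L¹ ∩ L²`. -/
@[reducible]
noncomputable def kernelPseudoMetric : PseudoMetricSpace {V : Graphex.{u} // V.MemL1L2} :=
  letI : PseudoEMetricSpace {V : Graphex.{u} // V.MemL1L2} :=
    { edist := fun V V' => kernelDist V.1 V'.1
      edist_self := fun V => GraphexData.delta22_self V.1.isProper (V.1.memL1L2_iff.1 V.2)
      edist_comm := fun V V' => GraphexData.delta22_comm V.1.isProper V'.1.isProper
        (V.1.memL1L2_iff.1 V.2) (V'.1.memL1L2_iff.1 V'.2)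
      edist_triangle := fun V₁ V₂ V₃ => GraphexData.delta22_triangle V₁.1.isProper V₂.1.isProper
        V₃.1.isProper (V₁.1.memL1L2_iff.1 V₁.2) (V₂.1.memL1L2_iff.1 V₂.2)
        (V₃.1.memL1L2_iff.1 V₃.2) }
  PseudoEMetricSpace.toPseudoMetricSpace fun V V' =>
    GraphexData.delta22_ne_top V.1.isProper V'.1.isProper (V.1.memL1L2_iff.1 V.2)
      (V'.1.memL1L2_iff.1 V'.2)

lemma weakKernelPseudoMetric_edist (V V' : Graphex.{u}) :
    weakKernelPseudoMetric.edist V V' = V.weakKernelDist V' := rfl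

lemma kernelPseudoMetric_edist (V V' : {V : Graphex.{u} // V.MemL1L2}) :
    kernelPseudoMetric.edist V V' = V.1.kernelDist V'.1 := rfl

end Graphex

end Distances

/-! ### Weak regularity -/

section Regularity

/-- Rounding towards zero with finitely many values, with an error that is small even compared to
the square of a large argument. -/
lemma exists_rounding {δ : ℝ} (hδ : 0 < δ) :
    ∃ (m : ℕ) (c : ℝ → Fin (m + 1) × Bool) (v : Fin (m + 1) × Bool → ℝ), Measurable c ∧
      (∀ x, |v (c x)| ≤ |x|) ∧ ∀ x, |x - v (c x)| ≤ δ * (1 + x ^ 2) := by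
  obtain ⟨m, hm⟩ := exists_nat_gt (1 / δ ^ 2)
  have hm0 : (0 : ℝ) < m := lt_trans (by positivity) hm
  let a : ℝ → ℕ := fun x => min ⌊|x| / δ⌋₊ m
  let c : ℝ → Fin (m + 1) × Bool := fun x =>
    (⟨a x, Nat.lt_succ_of_le (min_le_right _ _)⟩, decide (0 ≤ x))
  let v : Fin (m + 1) × Bool → ℝ := fun i => (if i.2 then 1 else -1) * (δ * (i.1 : ℕ))
  have ha : ∀ x, δ * a x ≤ |x| := by
    intro x
    have h1 : (a x : ℝ) ≤ |x| / δ :=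
      (Nat.cast_le.2 (min_le_left _ _)).trans (Nat.floor_le (by positivity))
    rw [le_div_iff₀ hδ] at h1
    linarith
  have hv : ∀ x, v (c x) = (if 0 ≤ x then 1 else -1) * (δ * a x) := by
    intro x
    simp [v, c]
  have hd : ∀ x, |x - v (c x)| = |x| - δ * a x := by
    intro x
    rw [hv]
    have := ha x
    split_ifs with h
    · rw [abs_of_nonneg h] at this ⊢
      rw [abs_of_nonneg (by linarith)]
      ring
    · rw [abs_of_neg (not_le.1 h)] at this ⊢
      rw [abs_of_nonpos (by linarith)]
      ring
  refine ⟨m, c, v, ?_, fun x => ?_, fun x => ?_⟩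
  · have hq : Measurable fun x : ℝ => ⌊|x| / δ⌋₊ :=
      Nat.measurable_floor.comp ((measurable_norm (α := ℝ)).div_const δ)
    refine Measurable.prodMk ?_ ?_
    · exact (measurable_from_nat (f := fun j => (⟨min j m, Nat.lt_succ_of_le (min_le_right _ _)⟩ :
        Fin (m + 1)))).comp hq
    · refine measurable_to_bool ?_
      convert measurableSet_Ici (a := (0 : ℝ)) using 1
      ext x; simp
  · rw [hv, abs_mul, abs_of_nonneg (by positivity : 0 ≤ δ * (a x : ℝ))]
    refine (mul_le_of_le_one_left (by positivity) ?_).trans (ha x)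
    split_ifs <;> simp
  · rw [hd]
    rcases le_total ⌊|x| / δ⌋₊ m with h | h
    · have h1 : a x = ⌊|x| / δ⌋₊ := min_eq_left h
      have h2 := Nat.lt_floor_add_one (|x| / δ)
      rw [div_lt_iff₀ hδ] at h2
      rw [h1]
      nlinarith [sq_nonneg x]
    · have h2 : (m : ℝ) ≤ |x| / δ := (Nat.cast_le.2 h).trans (Nat.floor_le (by positivity))
      rw [le_div_iff₀ hδ] at h2
      have h3 : 1 < m * δ ^ 2 := by rwa [div_lt_iff₀ (by positivity)] at hm
      have h4 : |x| ≤ δ * x ^ 2 := by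
        rw [← sq_abs]
        have h5 : 1 ≤ δ * |x| := by nlinarith
        nlinarith [abs_nonneg x]
      have : 0 ≤ δ * (a x : ℝ) := by positivity
      linarith

variable {Ω : Type u} [MeasurableSpace Ω] {μ : Measure Ω}

lemma ofReal_integral_prod_sq [SFinite μ] {U : Ω → Ω → ℝ} (hU : Measurable (uncurry U))
    (h : Integrable (fun z : Ω × Ω => U z.1 z.2 ^ 2) (μ.prod μ)) :
    ∫⁻ x, ∫⁻ y, ‖U x y‖ₑ ^ 2 ∂μ ∂μ = ENNReal.ofReal (∫ z, U z.1 z.2 ^ 2 ∂(μ.prod μ)) := by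
  rw [ofReal_integral_eq_lintegral_ofReal h (ae_of_all _ fun z => sq_nonneg _), lintegral_prod]
  · simp only [Real.enorm_eq_ofReal_abs, ← ENNReal.ofReal_pow (abs_nonneg _), sq_abs]
  · have : Measurable fun z : Ω × Ω => U z.1 z.2 := hU
    fun_prop

lemma isL2Kernel_of_abs_le [IsFiniteMeasure μ] {U : Ω → Ω → ℝ} (hU : Measurable (uncurry U))
    {β : ℝ} (hβ : ∀ x y, |U x y| ≤ β) : IsL2Kernel U μ := by
  refine ⟨hU, ?_⟩
  refine ne_top_of_le_ne_top (b := ∫⁻ _, ∫⁻ _, ENNReal.ofReal β ^ 2 ∂μ ∂μ) ?_ ?_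
  · simp only [lintegral_const]
    finiteness
  · refine lintegral_mono fun x => lintegral_mono fun y => ?_
    rw [Real.enorm_eq_ofReal_abs]
    gcongr
    exact hβ x y

/-- Energy decrement: a kernel of large norm correlates with a rank one kernel, whose factors may be
rounded to functions with finitely many values. Subtracting a fixed multiple of it decreases the
`L²`-norm. -/
lemma exists_energy_decrement [IsFiniteMeasure μ] {M β ε δ : ℝ} (hM : μ.real Set.univ ≤ M)
    (hε : 0 < ε) (hδ : 0 ≤ δ) {U : Ω → Ω → ℝ} (hU : Measurable (uncurry U))
    (hβ : ∀ x y, |U x y| ≤ β) (hK : ENNReal.ofReal ε < kernelNorm U μ) {r : ℝ → ℝ}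
    (hr : Measurable r) {K : ℝ} (hrK : ∀ x, |r x| ≤ K) (hr1 : ∀ x, |r x| ≤ |x|)
    (hr2 : ∀ x, |x - r x| ≤ δ * (1 + x ^ 2)) (hβ0 : 0 ≤ β)
    (hδε : 2 * β * δ * (M + 1) ^ 2 ≤ ε / 2) :
    ∃ f g : Ω → ℝ, Measurable f ∧ Measurable g ∧
      ∫ z, (U z.1 z.2 - ε / 2 * (r (f z.1) * r (g z.2))) ^ 2 ∂(μ.prod μ)
        ≤ ∫ z, U z.1 z.2 ^ 2 ∂(μ.prod μ) - ε ^ 2 / 4 := by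
  have hL := isL2Kernel_of_abs_le (μ := μ) hU hβ
  obtain ⟨g, hg⟩ := lt_iSup_iff.1 hK
  obtain ⟨hg1, hg2⟩ := lt_iSup_iff.1 hg
  have hgm : Measurable g := (Lp.stronglyMeasurable g).measurable
  have hgL : MemLp g 2 μ := Lp.memLp g
  set h : Ω → ℝ := fun x => ∫ y, U x y * g y ∂μ
  have hhm : Measurable h := measurable_integral_kernel_mul hU hgm
  have hg' : eLpNorm g 2 μ = 1 := by
    rw [Lp.norm_def] at hg1
    rw [← ENNReal.toReal_eq_one_iff, hg1]
  have hhL : MemLp h 2 μ := by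
    refine ⟨hhm.aestronglyMeasurable, lt_of_le_of_lt (eLpNorm_kernel_le hgL) ?_⟩
    rw [hg', mul_one]
    exact hL.kernelNorm_ne_top.lt_top
  set N : ℝ := (eLpNorm h 2 μ).toReal
  have hN : ε < N := by
    rwa [ENNReal.ofReal_lt_iff_lt_toReal hε.le hhL.2.ne] at hg2
  have hN0 : 0 < N := hε.trans hN
  have hsq : ∀ {φ : Ω → ℝ}, MemLp φ 2 μ → ∫ x, φ x ^ 2 ∂μ = (eLpNorm φ 2 μ).toReal ^ 2 := by
    intro φ hφ
    rw [← ENNReal.toReal_pow, eLpNorm_two_sq, integral_eq_lintegral_of_nonneg_ae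
      (ae_of_all _ fun _ => sq_nonneg _) (hφ.1.pow 2)]
    congr 1
    refine lintegral_congr fun x => ?_
    rw [Real.enorm_eq_ofReal_abs, ← ENNReal.ofReal_pow (abs_nonneg _), sq_abs]
  -- The pair `f`, `g` of unit vectors witnesses the norm: `⟨f, U g⟩ = N > ε`.
  set f : Ω → ℝ := fun x => N⁻¹ * h x
  have hfm : Measurable f := hhm.const_mul _
  have hfL : MemLp f 2 μ := hhL.const_mul _
  have hf2 : ∫ x, f x ^ 2 ∂μ = 1 := by
    simp only [f, mul_pow, integral_const_mul]
    rw [hsq hhL]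
    have : (eLpNorm h 2 μ).toReal = N := rfl
    rw [this]
    field_simp
  have hg2' : ∫ x, g x ^ 2 ∂μ = 1 := by rw [hsq hgL, hg']; simp
  have hfh : ∫ x, f x * h x ∂μ = N := by
    have : ∀ x, f x * h x = N * f x ^ 2 := by
      intro x; simp only [f]; field_simp
    simp only [this, integral_const_mul, hf2, mul_one]
  -- First moments are controlled by second moments through `|x| ≤ 1 + x²`.
  have hI1 : ∀ {φ : Ω → ℝ}, MemLp φ 2 μ → Integrable (fun x => 1 + φ x ^ 2) μ :=
    fun hφ => (integrable_const _).add hφ.integrable_sq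
  have hM1 : ∀ {φ : Ω → ℝ}, MemLp φ 2 μ → ∫ x, φ x ^ 2 ∂μ = 1 →
      ∫ x, (1 + φ x ^ 2) ∂μ ≤ M + 1 := by
    intro φ hφ h1
    rw [integral_add (integrable_const _) hφ.integrable_sq, h1]
    simpa using hM
  have hab : ∀ x : ℝ, |x| ≤ 1 + x ^ 2 := fun x => by
    rw [← sq_abs]; nlinarith [sq_nonneg (|x| - 1), abs_nonneg x]
  set f' : Ω → ℝ := fun x => r (f x)
  set g' : Ω → ℝ := fun x => r (g x)
  have hf'm : Measurable f' := hr.comp hfm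
  have hg'm : Measurable g' := hr.comp hgm
  have hfI : Integrable f μ := hfL.integrable (by norm_num)
  have hgI : Integrable g μ := hgL.integrable (by norm_num)
  have bdd : ∀ {φ : Ω → ℝ}, Measurable φ → (∀ x, |φ x| ≤ K) → MemLp φ 2 μ := fun hφ hb =>
    MemLp.of_bound hφ.aestronglyMeasurable K (ae_of_all _ hb)
  have hf'L : MemLp f' 2 μ := bdd hf'm fun x => hrK _
  have hg'L : MemLp g' 2 μ := bdd hg'm fun x => hrK _
  have hf'I : Integrable f' μ := hf'L.integrable (by norm_num)
  have hg'I : Integrable g' μ := hg'L.integrable (by norm_num)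
  have intU : ∀ {φ ψ : Ω → ℝ}, Integrable φ μ → Integrable ψ μ →
      Integrable (fun z : Ω × Ω => U z.1 z.2 * (φ z.1 * ψ z.2)) (μ.prod μ) := by
    intro φ ψ hφ hψ
    exact (hφ.mul_prod hψ).bdd_mul (c := β) hU.aestronglyMeasurable (ae_of_all _ fun z => hβ _ _)
  have bndU : ∀ {φ ψ : Ω → ℝ}, Integrable φ μ → Integrable ψ μ →
      |∫ z, U z.1 z.2 * (φ z.1 * ψ z.2) ∂(μ.prod μ)| ≤ β * ((∫ x, |φ x| ∂μ) * ∫ x, |ψ x| ∂μ) := by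
    intro φ ψ hφ hψ
    rw [← integral_prod_mul, ← integral_const_mul]
    refine (abs_integral_le_integral_abs).trans (integral_mono (intU hφ hψ).abs
      ((hφ.abs.mul_prod hψ.abs).const_mul β) fun z => ?_)
    simp only [abs_mul]
    gcongr
    exact hβ _ _
  have h0 : ∫ z, U z.1 z.2 * (f z.1 * g z.2) ∂(μ.prod μ) = N := by
    rw [integral_prod _ (intU hfI hgI), ← hfh]
    refine integral_congr_ae (ae_of_all _ fun x => ?_)
    simp only [h]
    rw [← integral_const_mul]
    refine integral_congr_ae (ae_of_all _ fun y => ?_)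
    simp only; ring
  have hmono1 : ∀ {φ : Ω → ℝ}, MemLp φ 2 μ → ∫ x, φ x ^ 2 ∂μ = 1 → ∫ x, |φ x| ∂μ ≤ M + 1 := by
    intro φ hφ h1
    exact (integral_mono (hφ.integrable (by norm_num)).abs (hI1 hφ) fun x => hab _).trans
      (hM1 hφ h1)
  have hmono2 : ∀ {φ : Ω → ℝ}, MemLp φ 2 μ → ∫ x, φ x ^ 2 ∂μ = 1 → MemLp (fun x => r (φ x)) 2 μ →
      ∫ x, |φ x - r (φ x)| ∂μ ≤ δ * (M + 1) := by
    intro φ hφ h1 hφ'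
    calc ∫ x, |φ x - r (φ x)| ∂μ ≤ ∫ x, δ * (1 + φ x ^ 2) ∂μ :=
          integral_mono ((hφ.sub hφ').integrable (by norm_num)).abs ((hI1 hφ).const_mul δ)
            fun x => hr2 _
      _ ≤ δ * (M + 1) := by rw [integral_const_mul]; gcongr; exact hM1 hφ h1
  have hM0 : 0 ≤ M + 1 := by have := measureReal_nonneg (μ := μ) (s := Set.univ); linarith
  -- Rounding the factors changes the correlation by at most `ε / 2`.
  have hI' : ε / 2 ≤ ∫ z, U z.1 z.2 * (f' z.1 * g' z.2) ∂(μ.prod μ) := by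
    have e1 : ∫ z, U z.1 z.2 * (f' z.1 * g' z.2) ∂(μ.prod μ) =
        ∫ z, U z.1 z.2 * (f z.1 * g z.2) ∂(μ.prod μ)
        - ∫ z, U z.1 z.2 * ((f z.1 - f' z.1) * g z.2) ∂(μ.prod μ)
        - ∫ z, U z.1 z.2 * (f' z.1 * (g z.2 - g' z.2)) ∂(μ.prod μ) := by
      have i1 := intU hfI hgI
      have i2 := intU (hfI.sub hf'I) hgI
      have i3 := intU hf'I (hgI.sub hg'I)
      simp only [Pi.sub_apply] at i2 i3
      have i12 : Integrable (fun z : Ω × Ω => U z.1 z.2 * (f z.1 * g z.2)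
          - U z.1 z.2 * ((f z.1 - f' z.1) * g z.2)) (μ.prod μ) := i1.sub i2
      rw [← integral_sub i1 i2, ← integral_sub i12 i3]
      refine integral_congr_ae (ae_of_all _ fun z => ?_)
      simp only; ring
    have b1 := (abs_le.1 (bndU (hfI.sub hf'I) hgI)).2
    have b2 := (abs_le.1 (bndU hf'I (hgI.sub hg'I))).2
    simp only [Pi.sub_apply] at b1 b2
    have c1 : (∫ x, |f x - f' x| ∂μ) * ∫ x, |g x| ∂μ ≤ (δ * (M + 1)) * (M + 1) :=
      mul_le_mul (hmono2 hfL hf2 hf'L) (hmono1 hgL hg2') (integral_nonneg fun _ => abs_nonneg _)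
        (by positivity)
    have c2 : (∫ x, |f' x| ∂μ) * ∫ x, |g x - g' x| ∂μ ≤ (M + 1) * (δ * (M + 1)) :=
      mul_le_mul ((integral_mono hf'I.abs hfI.abs fun x => hr1 _).trans (hmono1 hfL hf2))
        (hmono2 hgL hg2' hg'L) (integral_nonneg fun _ => abs_nonneg _) hM0
    have d1 := mul_le_mul_of_nonneg_left c1 hβ0
    have d2 := mul_le_mul_of_nonneg_left c2 hβ0
    rw [e1, h0]
    nlinarith
  refine ⟨f, g, hfm, hgm, ?_⟩
  have j1 : Integrable (fun z : Ω × Ω => U z.1 z.2 ^ 2) (μ.prod μ) := by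
    refine (MemLp.of_bound (p := 2) (C := β) hU.aestronglyMeasurable
      (ae_of_all _ fun z => hβ _ _)).integrable_sq
  have j2 := intU hf'I hg'I
  have j3 : Integrable (fun z : Ω × Ω => f' z.1 ^ 2 * g' z.2 ^ 2) (μ.prod μ) :=
    hf'L.integrable_sq.mul_prod hg'L.integrable_sq
  have hle1 : ∀ {φ : Ω → ℝ}, MemLp φ 2 μ → ∫ x, φ x ^ 2 ∂μ = 1 → MemLp (fun x => r (φ x)) 2 μ →
      ∫ x, r (φ x) ^ 2 ∂μ ≤ 1 := fun hφ h1 hφ' => h1 ▸ integral_mono hφ'.integrable_sq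
        hφ.integrable_sq fun x => sq_le_sq.2 (hr1 _)
  have e2 : ∫ z, (U z.1 z.2 - ε / 2 * (f' z.1 * g' z.2)) ^ 2 ∂(μ.prod μ) =
      ∫ z, U z.1 z.2 ^ 2 ∂(μ.prod μ) - ε * ∫ z, U z.1 z.2 * (f' z.1 * g' z.2) ∂(μ.prod μ)
      + (ε / 2) ^ 2 * ((∫ x, f' x ^ 2 ∂μ) * ∫ x, g' x ^ 2 ∂μ) := by
    have j12 : Integrable (fun z : Ω × Ω => U z.1 z.2 ^ 2
        - ε * (U z.1 z.2 * (f' z.1 * g' z.2))) (μ.prod μ) := j1.sub (j2.const_mul ε)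
    rw [← integral_prod_mul, ← integral_const_mul, ← integral_const_mul,
      ← integral_sub j1 (j2.const_mul ε), ← integral_add j12 (j3.const_mul _)]
    refine integral_congr_ae (ae_of_all _ fun z => ?_)
    simp only; ring
  have e3 : (∫ x, f' x ^ 2 ∂μ) * ∫ x, g' x ^ 2 ∂μ ≤ 1 :=
    mul_le_one₀ (hle1 hfL hf2 hf'L) (integral_nonneg fun _ => sq_nonneg _) (hle1 hgL hg2' hg'L)
  calc _ = _ := e2
    _ ≤ _ := by nlinarith [sq_nonneg ε]

/-- Weak regularity: kernels with common bounds on spaces of bounded mass are close to pullbacks of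
one and the same finite kernel. -/
lemma exists_regularity_of_energy {M ε : ℝ} (hε : 0 < ε) (n : ℕ) : ∀ β : ℝ, 0 ≤ β →
    ∃ (k : ℕ) (B : Fin (k + 1) → Fin (k + 1) → ℝ), ∀ {Ω : Type u} [MeasurableSpace Ω]
      (μ : Measure Ω) [IsFiniteMeasure μ], μ.real Set.univ ≤ M → ∀ U : Ω → Ω → ℝ,
      Measurable (uncurry U) → (∀ x y, |U x y| ≤ β) →
      ∫ z, U z.1 z.2 ^ 2 ∂(μ.prod μ) ≤ n * (ε ^ 2 / 4) →
      ∃ p : Ω → Fin (k + 1), Measurable p ∧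
        kernelNorm (fun x y => U x y - B (p x) (p y)) μ ≤ ENNReal.ofReal ε := by
  induction n with
  | zero =>
    intro β hβ0
    refine ⟨0, fun _ _ => 0, ?_⟩
    intro Ω _ μ _ hM U hU hβ hE
    refine ⟨fun _ => 0, measurable_const, ?_⟩
    have j1 : Integrable (fun z : Ω × Ω => U z.1 z.2 ^ 2) (μ.prod μ) := by
      refine (MemLp.of_bound (p := 2) (C := β) hU.aestronglyMeasurable
        (ae_of_all _ fun z => hβ _ _)).integrable_sq
    simp only [sub_zero]
    refine ENNReal.le_of_sq_le_sq ((kernelNorm_sq_le_lintegral hU).trans ?_)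
    rw [ofReal_integral_prod_sq hU j1, ENNReal.ofReal_of_nonpos (by simpa using hE)]
    exact zero_le
  | succ n ih =>
    intro β hβ0
    obtain ⟨δ, hδ, hδε⟩ : ∃ δ > 0, 2 * β * δ * (M + 1) ^ 2 ≤ ε / 2 := by
      refine ⟨ε / 2 / (2 * β * (M + 1) ^ 2 + 1), by positivity, ?_⟩
      have h0 : 0 ≤ 2 * β * (M + 1) ^ 2 := by positivity
      calc 2 * β * (ε / 2 / (2 * β * (M + 1) ^ 2 + 1)) * (M + 1) ^ 2
          = (ε / 2) * ((2 * β * (M + 1) ^ 2) / (2 * β * (M + 1) ^ 2 + 1)) := by ring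
        _ ≤ ε / 2 * 1 := by
          gcongr
          rw [div_le_one (by positivity)]
          linarith
        _ = _ := mul_one _
    obtain ⟨m, c, v, hc, hv1, hv2⟩ := exists_rounding hδ
    obtain ⟨K, hK⟩ := (Set.finite_range fun i => |v i|).bddAbove
    have hK' : ∀ i, |v i| ≤ K := fun i => hK ⟨i, rfl⟩
    have hK0 : 0 ≤ K := (abs_nonneg _).trans (hK' 0)
    obtain ⟨k, B, hB⟩ := ih (β + ε / 2 * (K * K)) (by positivity)
    let G := Fin (m + 1) × Bool
    -- A label remembers whether a rank one kernel had to be subtracted, the label for the remaining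
    -- kernel, and the rounded values of the two factors.
    let κ := Bool × Fin (k + 1) × G × G
    let e : κ ≃ Fin (Fintype.card κ) := Fintype.equivFin κ
    have hcard : 0 < Fintype.card κ := Fintype.card_pos
    obtain ⟨j, hj⟩ := Nat.exists_eq_succ_of_ne_zero hcard.ne'
    let e' : κ ≃ Fin (j + 1) := e.trans (finCongr hj)
    let B₀ : κ → κ → ℝ := fun a b =>
      if a.1 then B a.2.1 b.2.1 + ε / 2 * (v a.2.2.1 * v b.2.2.2) else 0
    refine ⟨j, fun a b => B₀ (e'.symm a) (e'.symm b), ?_⟩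
    intro Ω _ μ _ hM U hU hβ hE
    suffices h : ∃ p : Ω → κ, Measurable p ∧
        kernelNorm (fun x y => U x y - B₀ (p x) (p y)) μ ≤ ENNReal.ofReal ε by
      obtain ⟨p, hp, hpk⟩ := h
      refine ⟨fun x => e' (p x), (measurable_of_countable e').comp hp, ?_⟩
      simpa using hpk
    rcases le_or_gt (kernelNorm U μ) (ENNReal.ofReal ε) with h | h
    · refine ⟨fun _ => (false, 0, 0, 0), measurable_const, ?_⟩
      simpa [B₀] using h
    · have hr : Measurable fun x => v (c x) := (measurable_of_countable v).comp hc
      obtain ⟨f, g, hf, hg, hfg⟩ := exists_energy_decrement hM hε hδ.le hU hβ h hr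
        (fun x => hK' _) hv1 hv2 hβ0 hδε
      have hU' : Measurable (uncurry fun x y => U x y - ε / 2 * (v (c (f x)) * v (c (g y)))) := by
        have h1 : Measurable fun z : Ω × Ω => U z.1 z.2 := hU
        have h2 : Measurable fun z : Ω × Ω => v (c (f z.1)) := hr.comp (hf.comp measurable_fst)
        have h3 : Measurable fun z : Ω × Ω => v (c (g z.2)) := hr.comp (hg.comp measurable_snd)
        exact h1.sub ((h2.mul h3).const_mul _)
      obtain ⟨p, hp, hpk⟩ := hB μ hM _ hU' (fun x y => by
        refine (abs_sub _ _).trans (add_le_add (hβ x y) ?_)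
        rw [abs_mul, abs_mul, abs_of_pos (half_pos hε)]
        gcongr <;> exact hK' _) (by
        refine hfg.trans ?_
        push_cast at hE
        linarith)
      refine ⟨fun x => (true, p x, c (f x), c (g x)), ?_, ?_⟩
      · exact measurable_const.prodMk (hp.prodMk ((hc.comp hf).prodMk (hc.comp hg)))
      · simp only [B₀, if_true]
        convert hpk using 3
        funext y
        ring

/-- Weak regularity: kernels with common bounds on spaces of bounded mass are close to pullbacks of
one and the same finite kernel. -/
lemma exists_regularity {M ε β : ℝ} (hε : 0 < ε) (hβ0 : 0 ≤ β) :
    ∃ (k : ℕ) (B : Fin (k + 1) → Fin (k + 1) → ℝ), ∀ {Ω : Type u} [MeasurableSpace Ω]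
      (μ : Measure Ω) [IsFiniteMeasure μ], μ.real Set.univ ≤ M → ∀ U : Ω → Ω → ℝ,
      Measurable (uncurry U) → (∀ x y, |U x y| ≤ β) →
      ∃ p : Ω → Fin (k + 1), Measurable p ∧
        kernelNorm (fun x y => U x y - B (p x) (p y)) μ ≤ ENNReal.ofReal ε := by
  obtain ⟨n, hn⟩ := exists_nat_ge (β ^ 2 * (M * M) / (ε ^ 2 / 4))
  obtain ⟨k, B, hB⟩ := exists_regularity_of_energy (M := M) hε n β hβ0
  refine ⟨k, B, ?_⟩
  intro Ω _ μ _ hM U hU hβ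
  refine hB μ hM U hU hβ ?_
  rw [div_le_iff₀ (by positivity)] at hn
  refine le_trans ?_ hn
  calc ∫ z, U z.1 z.2 ^ 2 ∂(μ.prod μ) ≤ ∫ _, β ^ 2 ∂(μ.prod μ) := by
        refine integral_mono (MemLp.of_bound (p := 2) (C := β) hU.aestronglyMeasurable
          (ae_of_all _ fun z => hβ _ _)).integrable_sq (integrable_const _) fun z => ?_
        rw [sq_le_sq, abs_of_nonneg hβ0]
        exact hβ _ _
    _ = β ^ 2 * (μ.real Set.univ * μ.real Set.univ) := by
        rw [integral_const, ← Set.univ_prod_univ, measureReal_prod_prod]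
        simp [mul_comm]
    _ ≤ _ := by
        have := measureReal_nonneg.trans hM
        gcongr

end Regularity

/-! ### Finite colourings of bounded graphexes -/

section TotalBoundedness

/-- Changing the labelling on a set of measure at most `s` changes a step kernel by little, in the
Hilbert-Schmidt norm and hence in the kernel norm. -/
lemma kernelNorm_step_sub_sq_le {X : Type*} [MeasurableSpace X] {γ : Measure X} [SFinite γ] {n : ℕ}
    {L L' : X → Fin (n + 1)} (hL : Measurable L) (hL' : Measurable L')
    {b : Fin (n + 1) → Fin (n + 1) → ℝ} (hb : ∀ i, b 0 i = 0) (hb' : ∀ i, b i 0 = 0) {β : ℝ≥0∞}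
    (hβ : ∀ i j, ‖b i j‖ₑ ≤ β) {M s : ℝ≥0∞} (hM : γ {x | L x ≠ 0} ≤ M) (hM' : γ {x | L' x ≠ 0} ≤ M)
    (hs : γ {x | L x ≠ L' x} ≤ s) :
    kernelNorm (fun x y => b (L x) (L y) - b (L' x) (L' y)) γ ^ 2 ≤ (2 * β) ^ 2 * (4 * s * M) := by
  have hbm : Measurable (uncurry fun x y => b (L x) (L y) - b (L' x) (L' y)) := by
    have h : Measurable (uncurry b) := measurable_of_countable _
    exact (h.comp ((hL.comp measurable_fst).prodMk (hL.comp measurable_snd))).sub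
      (h.comp ((hL'.comp measurable_fst).prodMk (hL'.comp measurable_snd)))
  refine (kernelNorm_sq_le_lintegral hbm).trans ?_
  set P : Set X := {x | L x ≠ L' x}
  set V : Set X := {x | L x ≠ 0} ∪ {x | L' x ≠ 0}
  have hP : MeasurableSet P := (measurableSet_eq_fun hL hL').compl
  have hV : MeasurableSet V := by
    refine MeasurableSet.union ?_ ?_
    · exact hL (measurableSet_singleton _).compl
    · exact hL' (measurableSet_singleton _).compl
  have hVm : γ V ≤ 2 * M := (measure_union_le _ _).trans (by rw [two_mul]; exact add_le_add hM hM')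
  -- The kernels differ only if one of the labels changes, and they vanish if a label is `0`.
  have hpt : ∀ x y, ‖b (L x) (L y) - b (L' x) (L' y)‖ₑ ^ 2 ≤ (2 * β) ^ 2 *
      (P.indicator 1 x * V.indicator 1 y + V.indicator 1 x * P.indicator 1 y) := by
    intro x y
    by_cases h0 : b (L x) (L y) = b (L' x) (L' y)
    · simp [h0]
    have hxV : x ∈ V := by
      by_contra h
      simp only [V, Set.mem_union, Set.mem_ofPred_eq, not_or, not_not] at h
      exact h0 (by rw [h.1, h.2, hb, hb])
    have hyV : y ∈ V := by
      by_contra h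
      simp only [V, Set.mem_union, Set.mem_ofPred_eq, not_or, not_not] at h
      exact h0 (by rw [h.1, h.2, hb', hb'])
    have h1 : ‖b (L x) (L y) - b (L' x) (L' y)‖ₑ ≤ 2 * β := by
      refine enorm_sub_le.trans ?_
      rw [two_mul]
      exact add_le_add (hβ _ _) (hβ _ _)
    have h2 : (1 : ℝ≥0∞) ≤
        P.indicator 1 x * V.indicator 1 y + V.indicator 1 x * P.indicator 1 y := by
      by_cases hx : x ∈ P
      · simp [hx, hyV]
      · by_cases hy : y ∈ P
        · simp [hx, hy, hxV]
        · simp only [P, Set.mem_ofPred_eq, not_not] at hx hy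
          exact absurd (by rw [hx, hy]) h0
    calc _ ≤ (2 * β) ^ 2 * 1 := by rw [mul_one]; gcongr
      _ ≤ _ := by gcongr
  have mi : ∀ {A : Set X}, MeasurableSet A → Measurable (A.indicator (1 : X → ℝ≥0∞)) :=
    fun hA => measurable_one.indicator hA
  calc _ ≤ ∫⁻ x, ∫⁻ y, (2 * β) ^ 2 *
        (P.indicator 1 x * V.indicator 1 y + V.indicator 1 x * P.indicator 1 y) ∂γ ∂γ :=
        lintegral_mono fun x => lintegral_mono fun y => hpt x y
    _ = (2 * β) ^ 2 * (γ P * γ V + γ V * γ P) := by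
        have : ∀ x, ∫⁻ y, (2 * β) ^ 2 *
            (P.indicator 1 x * V.indicator 1 y + V.indicator 1 x * P.indicator 1 y) ∂γ =
            (2 * β) ^ 2 * (P.indicator 1 x * γ V + V.indicator 1 x * γ P) := by
          intro x
          have hm : Measurable fun y => P.indicator (1 : X → ℝ≥0∞) x * V.indicator 1 y
              + V.indicator 1 x * P.indicator 1 y := ((mi hV).const_mul _).add ((mi hP).const_mul _)
          rw [lintegral_const_mul _ hm,
            lintegral_add_left ((mi hV).const_mul _), lintegral_const_mul _ (mi hV),
            lintegral_const_mul _ (mi hP), lintegral_indicator_one hV, lintegral_indicator_one hP]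
        simp_rw [this]
        have hm : Measurable fun x => P.indicator (1 : X → ℝ≥0∞) x * γ V
            + V.indicator 1 x * γ P := ((mi hP).mul_const _).add ((mi hV).mul_const _)
        rw [lintegral_const_mul _ hm,
            lintegral_add_left ((mi hP).mul_const _), lintegral_mul_const _ (mi hV),
            lintegral_mul_const _ (mi hP), lintegral_indicator_one hV, lintegral_indicator_one hP]
    _ ≤ (2 * β) ^ 2 * (s * (2 * M) + 2 * M * s) := by gcongr
    _ = _ := by ring

lemma eLpNorm_step_sub_sq_le {X : Type*} [MeasurableSpace X] {γ : Measure X} {n : ℕ}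
    {L L' : X → Fin (n + 1)} (hL : Measurable L) (hL' : Measurable L')
    {d : Fin (n + 1) → ℝ} {β : ℝ≥0∞} (hβ : ∀ i, ‖d i‖ₑ ≤ β) {s : ℝ≥0∞}
    (hs : γ {x | L x ≠ L' x} ≤ s) :
    eLpNorm (fun x => d (L x) - d (L' x)) 2 γ ^ 2 ≤ (2 * β) ^ 2 * s := by
  have hP : MeasurableSet {x | L x ≠ L' x} := (measurableSet_eq_fun hL hL').compl
  rw [eLpNorm_two_sq]
  calc _ ≤ ∫⁻ x, (2 * β) ^ 2 * {x | L x ≠ L' x}.indicator 1 x ∂γ := by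
        refine lintegral_mono fun x => ?_
        by_cases h : L x = L' x
        · simp [h]
        · have : x ∈ {x | L x ≠ L' x} := h
          rw [Set.indicator_of_mem this, Pi.one_apply, mul_one, two_mul]
          gcongr
          exact enorm_sub_le.trans (add_le_add (hβ _) (hβ _))
    _ = (2 * β) ^ 2 * γ {x | L x ≠ L' x} := by
        rw [lintegral_const_mul _ (measurable_one.indicator hP), lintegral_indicator_one hP]
    _ ≤ _ := by gcongr

namespace GraphexData

/-- Two graphexes approximated by the same step functions are close when the masses of corresponding
cells are. -/
lemma jointNear_of_step {Ω₁ Ω₂ : Type*} [MeasurableSpace Ω₁] [MeasurableSpace Ω₂]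
    {T₁ : GraphexData Ω₁} {μ₁ : Measure Ω₁}
    {T₂ : GraphexData Ω₂} {μ₂ : Measure Ω₂} [SFinite μ₁] [SFinite μ₂] (h₁ : T₁.IsProper)
    (h₂ : T₂.IsProper) (f₁ : T₁.FiniteOn μ₁) (f₂ : T₂.FiniteOn μ₂) {n : ℕ}
    {l₁ : Ω₁ → Fin (n + 1)} {l₂ : Ω₂ → Fin (n + 1)} (hl₁ : Measurable l₁) (hl₂ : Measurable l₂)
    {b : Fin (n + 1) → Fin (n + 1) → ℝ} (hb : ∀ i, b 0 i = 0) (hb' : ∀ i, b i 0 = 0)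
    {d : Fin (n + 1) → ℝ} (hd : d 0 = 0) {k₁ k₂ k₀ d₁ d₂ d₀ r : ℝ≥0∞}
    (hk₁ : kernelNorm (fun x y => T₁.W x y - b (l₁ x) (l₁ y)) μ₁ ≤ k₁)
    (hk₂ : kernelNorm (fun x y => T₂.W x y - b (l₂ x) (l₂ y)) μ₂ ≤ k₂)
    (hd₁ : eLpNorm (fun x => (T₁.marginal μ₁ x).toReal - d (l₁ x)) 2 μ₁ ≤ d₁)
    (hd₂ : eLpNorm (fun x => (T₂.marginal μ₂ x).toReal - d (l₂ x)) 2 μ₂ ≤ d₂)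
    (hr : ‖T₁.rho μ₁ - T₂.rho μ₂‖ₑ ≤ r) {β M s : ℝ≥0∞} (hM : M ≠ ∞)
    (hM₁ : μ₁ {x | l₁ x ≠ 0} ≤ M) (hM₂ : μ₂ {x | l₂ x ≠ 0} ≤ M)
    (hbβ : ∀ i j, ‖b i j‖ₑ ≤ β) (hdβ : ∀ i, ‖d i‖ₑ ≤ β)
    (hs : ∑ i : Fin n, ((μ₁ (l₁ ⁻¹' {i.succ}) - μ₂ (l₂ ⁻¹' {i.succ}))
          + (μ₂ (l₂ ⁻¹' {i.succ}) - μ₁ (l₁ ⁻¹' {i.succ}))) ≤ s)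
    (hk₀ : (2 * β) ^ 2 * (4 * s * M) ≤ k₀ ^ 2) (hd₀ : (2 * β) ^ 2 * s ≤ d₀ ^ 2) :
    JointNear T₁ μ₁ T₂ μ₂ (k₁ + k₀ + k₂) (d₁ + d₀ + d₂) r := by
  have hf₁ : ∀ i, i ≠ 0 → μ₁ (l₁ ⁻¹' {i}) ≠ ∞ := by
    intro i hi
    refine ne_top_of_le_ne_top hM (le_trans (measure_mono fun x hx => ?_) hM₁)
    have : l₁ x = i := hx
    simpa [this] using hi
  have hf₂ : ∀ i, i ≠ 0 → μ₂ (l₂ ⁻¹' {i}) ≠ ∞ := by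
    intro i hi
    refine ne_top_of_le_ne_top hM (le_trans (measure_mono fun x hx => ?_) hM₂)
    have : l₂ x = i := hx
    simpa [this] using hi
  have m₁ : ∀ i, i ≠ 0 → (μ₁.map (Sum.inl : Ω₁ → Ω₁ ⊕ ℝ)) (extendLabel l₁ ⁻¹' {i})
      = μ₁ (l₁ ⁻¹' {i}) := fun i _ => by
    rw [Measure.map_apply measurable_inl (measurable_extendLabel hl₁ (measurableSet_singleton i))]
    rfl
  have m₂ : ∀ i, i ≠ 0 → (μ₂.map (Sum.inl : Ω₂ → Ω₂ ⊕ ℝ)) (extendLabel l₂ ⁻¹' {i})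
      = μ₂ (l₂ ⁻¹' {i}) := fun i _ => by
    rw [Measure.map_apply measurable_inl (measurable_extendLabel hl₂ (measurableSet_singleton i))]
    rfl
  obtain ⟨γ, _, hγ₁, hγ₂, hγ⟩ := exists_glue (μ₁.map (Sum.inl : Ω₁ → Ω₁ ⊕ ℝ))
    (μ₂.map (Sum.inl : Ω₂ → Ω₂ ⊕ ℝ)) (measurable_extendLabel hl₁) (measurable_extendLabel hl₂)
    (fun i hi => (m₁ i hi).trans_ne (hf₁ i hi)) (fun i hi => (m₂ i hi).trans_ne (hf₂ i hi))
    (y₁ := Sum.inr 0) (y₂ := Sum.inr 0) rfl rfl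
  have C₁ : Covers γ Prod.fst μ₁ := ⟨measurable_fst, fun B hB => by
    rw [hγ₁ _ (measurableSet_inl_image.2 hB) (by simp), measurableEmbedding_inl.map_apply,
      Set.preimage_image_eq _ Sum.inl_injective]⟩
  have C₂ : Covers γ Prod.snd μ₂ := ⟨measurable_snd, fun B hB => by
    rw [hγ₂ _ (measurableSet_inl_image.2 hB) (by simp), measurableEmbedding_inl.map_apply,
      Set.preimage_image_eq _ Sum.inl_injective]⟩
  have hbad : γ {z | extendLabel l₁ z.1 ≠ extendLabel l₂ z.2} ≤ s := by
    refine hγ.trans (le_trans (le_of_eq ?_) hs)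
    refine Finset.sum_congr rfl fun i _ => ?_
    rw [m₁ _ i.succ_ne_zero, m₂ _ i.succ_ne_zero]
  have hV₁ : γ {z | extendLabel l₁ z.1 ≠ 0} ≤ M := by
    refine le_trans (le_of_eq ?_) hM₁
    rw [← C₁.measure_preimage _ (show MeasurableSet {x | l₁ x ≠ 0} from
      (measurableSet_eq_fun hl₁ measurable_const).compl)]
    congr 1
    ext ⟨x, y⟩
    rcases x with x | x <;> simp [extendLabel]
  have hV₂ : γ {z | extendLabel l₂ z.2 ≠ 0} ≤ M := by
    refine le_trans (le_of_eq ?_) hM₂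
    rw [← C₂.measure_preimage _ (show MeasurableSet {x | l₂ x ≠ 0} from
      (measurableSet_eq_fun hl₂ measurable_const).compl)]
    congr 1
    ext ⟨x, y⟩
    rcases y with y | y <;> simp [extendLabel]
  refine jointNear_of_covers h₁ h₂ f₁ f₂ C₁ C₂ (near_of_step h₁ h₂ f₁ f₂ C₁ C₂ hl₁ hl₂ hf₁ hf₂
    hb hb'
    hd hk₁ hk₂ ?_ hd₁ hd₂ ?_ hr)
  · exact ENNReal.le_of_sq_le_sq ((kernelNorm_step_sub_sq_le
      ((measurable_extendLabel hl₁).comp measurable_fst)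
      ((measurable_extendLabel hl₂).comp measurable_snd) hb hb' hbβ hV₁ hV₂ hbad).trans hk₀)
  · exact ENNReal.le_of_sq_le_sq ((eLpNorm_step_sub_sq_le
      ((measurable_extendLabel hl₁).comp measurable_fst)
      ((measurable_extendLabel hl₂).comp measurable_snd) hdβ hbad).trans hd₀)

/-- All `(C, D)`-bounded graphexes are close to the pullbacks of one finite step function. Where the
marginal is small, the graphon part contributes little to the kernel norm, by Schur's test;
elsewhere weak regularity applies, the mass being bounded by Markov's inequality. -/
lemma exists_uniform_step (C D : ℝ≥0) {ε : ℝ≥0} (hε : 0 < ε) :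
    ∃ (n : ℕ) (b : Fin (n + 1) → Fin (n + 1) → ℝ) (d : Fin (n + 1) → ℝ) (M : ℝ≥0),
      (∀ i, b 0 i = 0) ∧ (∀ i, b i 0 = 0) ∧ d 0 = 0 ∧
      ∀ {Ω : Type u} [MeasurableSpace Ω] (μ : Measure Ω) [SFinite μ] (T : GraphexData Ω),
        T.IsProper → T.IsBounded μ C D → ∃ l : Ω → Fin (n + 1), Measurable l ∧
          μ {x | l x ≠ 0} ≤ M ∧
          kernelNorm (fun x y => T.W x y - b (l x) (l y)) μ ≤ ε + ε + ε ∧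
          eLpNorm (fun x => (T.marginal μ x).toReal - d (l x)) 2 μ ≤ ε := by
  -- The threshold `τ` for the marginal: `τ D` bounds the square of the kernel norm of the part with
  -- small marginal, and `τ C` the square of the `L²`-norm of the marginal there.
  obtain ⟨τ, hτ, hτD, hτC⟩ : ∃ τ : ℝ≥0, 0 < τ ∧ τ * D ≤ ε ^ 2 ∧ τ * C ≤ ε ^ 2 / 2 := by
    refine ⟨ε ^ 2 / 2 / (C + D + 1), by positivity, ?_, ?_⟩
    · rw [div_mul_eq_mul_div, div_le_iff₀ (by positivity)]
      have h1 : ε ^ 2 / 2 ≤ ε ^ 2 := half_le_self zero_le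
      have h2 : D ≤ C + D + 1 := by
        calc D ≤ C + D := le_add_self
          _ ≤ _ := le_self_add
      exact mul_le_mul' h1 h2
    · rw [div_mul_eq_mul_div, div_le_iff₀ (by positivity)]
      have h2 : C ≤ C + D + 1 := by rw [add_assoc]; exact le_self_add
      gcongr
  set M : ℝ≥0 := C / τ
  obtain ⟨k, B, hB⟩ := exists_regularity.{u} (M := M) (ε := ε) (β := 1) hε zero_le_one
  obtain ⟨δ, hδ, hδM⟩ : ∃ δ : ℝ, 0 < δ ∧ (δ * (1 + (D : ℝ) ^ 2)) ^ 2 * M ≤ (ε : ℝ) ^ 2 / 2 := by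
    have hε' : (0 : ℝ) < ε := hε
    refine ⟨ε / 2 / ((1 + (D : ℝ) ^ 2) * (M + 1)), by positivity, ?_⟩
    have h3 : (ε / 2 / ((1 + (D : ℝ) ^ 2) * (M + 1)) * (1 + (D : ℝ) ^ 2)) = ε / 2 / (M + 1) := by
      field_simp
    rw [h3, div_pow, div_mul_eq_mul_div, div_le_iff₀ (by positivity)]
    have h4 : (M : ℝ) ≤ (M + 1) ^ 2 := by nlinarith [M.2, NNReal.coe_nonneg M]
    have h5 : ((ε : ℝ) / 2) ^ 2 ≤ (ε : ℝ) ^ 2 / 2 := by nlinarith [sq_nonneg (ε : ℝ)]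
    exact mul_le_mul h5 h4 (NNReal.coe_nonneg M) (by positivity)
  obtain ⟨m, c, v, hc, hv1, hv2⟩ := exists_rounding hδ
  let κ := Fin (k + 1) × (Fin (m + 1) × Bool)
  let e : κ ≃ Fin (Fintype.card κ) := Fintype.equivFin κ
  let b : Fin (Fintype.card κ + 1) → Fin (Fintype.card κ + 1) → ℝ :=
    fun i j => Fin.cases 0 (fun i' => Fin.cases 0 (fun j' => B (e.symm i').1 (e.symm j').1) j) i
  let d : Fin (Fintype.card κ + 1) → ℝ := Fin.cases 0 fun i => v (e.symm i).2
  have hb : ∀ i, b 0 i = 0 := fun i => rfl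
  have hb' : ∀ i, b i 0 = 0 := fun i => by cases i using Fin.cases <;> rfl
  refine ⟨Fintype.card κ, b, d, M, hb, hb', rfl, ?_⟩
  intro Ω _ μ _ T hT hCD
  have fT := hT.finiteOn_of_isBounded hCD
  have hDm := hT.measurable_marginal (μ := μ)
  have hD : ∀ᵐ x ∂μ, T.marginal μ x ≤ D := by
    filter_upwards [ae_le_essSup (f := T.marginal μ) (μ := μ)] with x hx using hx.trans hCD.2
  set A : Set Ω := {x | (τ : ℝ≥0∞) ≤ T.marginal μ x}
  have hA : MeasurableSet A := measurableSet_le measurable_const hDm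
  have hτ0 : (τ : ℝ≥0∞) ≠ 0 := by simpa using hτ.ne'
  have hμA : μ A ≤ M := by
    refine (meas_ge_le_lintegral_div hDm.aemeasurable hτ0 ENNReal.coe_ne_top).trans ?_
    rw [ENNReal.coe_div hτ.ne']
    gcongr
    exact hT.lintegral_marginal_le.trans hCD.1
  have : IsFiniteMeasure (μ.restrict A) := ⟨by
    rw [Measure.restrict_apply_univ]; exact hμA.trans_lt ENNReal.coe_lt_top⟩
  have hW1 : ∀ x y, |T.W x y| ≤ 1 := fun x y => by
    rw [abs_of_nonneg (hT.W_mem x y).1]; exact (hT.W_mem x y).2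
  obtain ⟨p, hp, hpB⟩ := hB (μ.restrict A) (by
    rw [measureReal_restrict_apply_univ]
    exact ENNReal.toReal_le_of_le_ofReal (NNReal.coe_nonneg _) (by simpa using hμA)) T.W
    hT.measurable_W hW1
  classical
  -- Labels combine the cell of the regularity lemma with the rounded marginal.
  let l : Ω → Fin (Fintype.card κ + 1) := fun x =>
    if x ∈ A then (e (p x, c (T.marginal μ x).toReal)).succ else 0
  have hl : Measurable l := by
    refine Measurable.ite hA ?_ measurable_const
    exact (measurable_of_countable fun a : κ => (e a).succ).comp
      (hp.prodMk (hc.comp hDm.ennreal_toReal))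
  have hlA : {x | l x ≠ 0} ⊆ A := by
    intro x hx
    by_contra h
    exact hx (by simp [l, h])
  have hlM : μ {x | l x ≠ 0} ≤ M := (measure_mono hlA).trans hμA
  have hlf : ∀ i, i ≠ 0 → μ (l ⁻¹' {i}) ≠ ∞ := by
    intro i hi
    refine ne_top_of_le_ne_top ENNReal.coe_ne_top (le_trans (measure_mono fun x hx => ?_) hlM)
    have : l x = i := hx
    simpa [this] using hi
  have hbA : ∀ x y, x ∈ A → y ∈ A → b (l x) (l y) = B (p x) (p y) := by
    intro x y hx hy
    simp [b, l, hx, hy]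
  refine ⟨l, hl, hlM, ?_, ?_⟩
  · have hWL := fT.isL2Kernel hT
    have hUL := hWL.sub (isL2Kernel_step hl hlf hb hb')
    have hWm : Measurable fun z : Ω × Ω => T.W z.1 z.2 := hT.measurable_W
    have i1 : MeasurableSet (A ×ˢ A) := hA.prod hA
    let U₁ : Ω → Ω → ℝ := fun x y => if x ∈ A then 0 else T.W x y
    let U₂ : Ω → Ω → ℝ := fun x y => if x ∈ A then (if y ∈ A then 0 else T.W x y) else 0
    let U₃ : Ω → Ω → ℝ := fun x y => if x ∈ A then
      (if y ∈ A then T.W x y - b (l x) (l y) else 0) else 0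
    have hA1 : MeasurableSet {z : Ω × Ω | z.1 ∈ A} := measurable_fst hA
    have hA2 : MeasurableSet {z : Ω × Ω | z.2 ∈ A} := measurable_snd hA
    have mU₁ : Measurable (uncurry U₁) := Measurable.ite hA1 measurable_const hWm
    have mU₂ : Measurable (uncurry U₂) :=
      Measurable.ite hA1 (Measurable.ite hA2 measurable_const hWm) measurable_const
    have mU₃ : Measurable (uncurry U₃) :=
      Measurable.ite hA1 (Measurable.ite hA2 hUL.measurable measurable_const) measurable_const
    have L₁ : IsL2Kernel U₁ μ := ⟨mU₁, ne_top_of_le_ne_top hWL.lintegral_sq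
      (lintegral_mono fun x => lintegral_mono fun y => by
        simp only [U₁]; split_ifs <;> simp)⟩
    have L₂ : IsL2Kernel U₂ μ := ⟨mU₂, ne_top_of_le_ne_top hWL.lintegral_sq
      (lintegral_mono fun x => lintegral_mono fun y => by
        simp only [U₂]; split_ifs <;> simp)⟩
    have L₃ : IsL2Kernel U₃ μ := ⟨mU₃, ne_top_of_le_ne_top hUL.lintegral_sq
      (lintegral_mono fun x => lintegral_mono fun y => by
        simp only [U₃]; split_ifs <;> simp)⟩
    have hb0 : ∀ x y, (x ∉ A ∨ y ∉ A) → b (l x) (l y) = 0 := by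
      rintro x y (h | h)
      · have : l x = 0 := by simp [l, h]
        rw [this, hb]
      · have : l y = 0 := by simp [l, h]
        rw [this, hb']
    have hsum : (fun x y => T.W x y - b (l x) (l y)) = fun x y => U₁ x y + U₂ x y + U₃ x y := by
      funext x y
      by_cases hx : x ∈ A <;> by_cases hy : y ∈ A <;> simp [U₁, U₂, U₃, hx, hy, hb0]
    have hWrow : ∀ x, ∫⁻ y, ‖T.W x y‖ₑ ∂μ ≤ T.marginal μ x := fun x => by
      refine le_trans (le_of_eq (lintegral_congr fun y => ?_)) le_self_add
      rw [Real.enorm_of_nonneg (hT.W_mem _ _).1]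
    have hWcol : ∀ y, ∫⁻ x, ‖T.W x y‖ₑ ∂μ ≤ T.marginal μ y := fun y => by
      refine le_trans (le_of_eq (lintegral_congr fun x => ?_)) (hWrow y)
      rw [hT.W_symm]
    have hnA : ∀ x, x ∉ A → T.marginal μ x ≤ τ := fun x hx => (not_le.1 hx).le
    have hτD' : (τ : ℝ≥0∞) * D ≤ (ε : ℝ≥0∞) ^ 2 := by exact_mod_cast hτD
    -- Rows with small marginal: Schur's test with row sums at most `τ` and column sums at most `D`.
    have b₁ : kernelNorm U₁ μ ≤ ε := by
      refine ENNReal.le_of_sq_le_sq ((kernelNorm_sq_le_schur mU₁ (a := τ) (b := D)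
        ENNReal.coe_ne_top (ae_of_all _ fun x => ?_) ?_ ENNReal.coe_ne_top).trans hτD')
      · by_cases hx : x ∈ A
        · simp [U₁, hx]
        · simp only [U₁, hx, if_false]
          exact (hWrow x).trans (hnA x hx)
      · filter_upwards [hD] with y hy
        refine le_trans (lintegral_mono fun x => ?_) ((hWcol y).trans hy)
        simp only [U₁]; split_ifs <;> simp
    have b₂ : kernelNorm U₂ μ ≤ ε := by
      refine ENNReal.le_of_sq_le_sq ((kernelNorm_sq_le_schur mU₂ (a := D) (b := τ)
        ENNReal.coe_ne_top ?_ (ae_of_all _ fun y => ?_) ENNReal.coe_ne_top).trans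
          ((mul_comm _ _).le.trans hτD'))
      · filter_upwards [hD] with x hx
        refine le_trans (lintegral_mono fun y => ?_) ((hWrow x).trans hx)
        simp only [U₂]; split_ifs <;> simp
      · by_cases hy : y ∈ A
        · simp [U₂, hy]
        · refine le_trans (lintegral_mono fun x => ?_) ((hWcol y).trans (hnA y hy))
          simp only [U₂]; split_ifs <;> simp
    have b₃ : kernelNorm U₃ μ ≤ ε := by
      refine (kernelNorm_le_restrict hA (fun x y hx => by simp [U₃, hx])
        (fun x y hy => by simp [U₃, hy])).trans ?_
      refine (kernelNorm_congr_ae (N := Aᶜ) (V := fun x y => T.W x y - B (p x) (p y)) ?_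
        fun x y hx hy => ?_).trans (hpB.trans (by simp))
      · rw [Measure.restrict_apply hA.compl]; simp
      · rw [Set.notMem_compl_iff] at hx hy
        simp [U₃, hx, hy, hbA]
    rw [hsum]
    refine (kernelNorm_add_le (L₁.add L₂) L₃).trans ?_
    gcongr
    refine (kernelNorm_add_le L₁ L₂).trans ?_
    gcongr
  · refine ENNReal.le_of_sq_le_sq ?_
    rw [eLpNorm_two_sq, ← lintegral_add_compl _ hA]
    have q₁ : ∫⁻ x in A, ‖(T.marginal μ x).toReal - d (l x)‖ₑ ^ 2 ∂μ
        ≤ ENNReal.ofReal ((ε : ℝ) ^ 2 / 2) := by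
      calc _ ≤ ∫⁻ x in A, ENNReal.ofReal ((δ * (1 + (D : ℝ) ^ 2)) ^ 2) ∂μ := by
            refine lintegral_mono_ae ?_
            filter_upwards [ae_restrict_of_ae hD, ae_restrict_mem hA] with x hx hxA
            rw [Real.enorm_eq_ofReal_abs, ← ENNReal.ofReal_pow (abs_nonneg _)]
            have hd' : d (l x) = v (c (T.marginal μ x).toReal) := by simp [d, l, hxA]
            have hx' : (T.marginal μ x).toReal ≤ D :=
              ENNReal.toReal_le_of_le_ofReal (NNReal.coe_nonneg _) (by simpa using hx)
            rw [hd']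
            gcongr
            refine (hv2 _).trans ?_
            gcongr
        _ = ENNReal.ofReal ((δ * (1 + (D : ℝ) ^ 2)) ^ 2) * μ A := by simp
        _ ≤ ENNReal.ofReal ((δ * (1 + (D : ℝ) ^ 2)) ^ 2) * ENNReal.ofReal M := by
            gcongr; simpa using hμA
        _ ≤ _ := by
            rw [← ENNReal.ofReal_mul (by positivity)]
            exact ENNReal.ofReal_le_ofReal hδM
    have q₂ : ∫⁻ x in Aᶜ, ‖(T.marginal μ x).toReal - d (l x)‖ₑ ^ 2 ∂μ
        ≤ ENNReal.ofReal ((ε : ℝ) ^ 2 / 2) := by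
      calc _ ≤ ∫⁻ x in Aᶜ, τ * T.marginal μ x ∂μ := by
            refine setLIntegral_mono' hA.compl fun x hx => ?_
            have hlx : l x = 0 := by
              have : x ∉ A := hx
              simp [l, this]
            have hx' : T.marginal μ x ≤ τ :=
              (not_le.1 (show ¬ (τ : ℝ≥0∞) ≤ T.marginal μ x from hx)).le
            have : d (l x) = 0 := by rw [hlx]; rfl
            rw [this, sub_zero, Real.enorm_of_nonneg ENNReal.toReal_nonneg,
              ENNReal.ofReal_toReal (ne_top_of_le_ne_top ENNReal.coe_ne_top hx'), sq]
            gcongr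
        _ ≤ ∫⁻ x, τ * T.marginal μ x ∂μ := setLIntegral_le_lintegral _ _
        _ = τ * ∫⁻ x, T.marginal μ x ∂μ := lintegral_const_mul _ hDm
        _ ≤ τ * C := by gcongr; exact hT.lintegral_marginal_le.trans hCD.1
        _ ≤ ((ε ^ 2 / 2 : ℝ≥0) : ℝ≥0∞) := by exact_mod_cast hτC
        _ = _ := by
            rw [← ENNReal.ofReal_coe_nnreal]
            push_cast
            rfl
    refine (add_le_add q₁ q₂).trans (le_of_eq ?_)
    rw [← ENNReal.ofReal_add (by positivity) (by positivity), add_halves,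
      ENNReal.ofReal_pow (NNReal.coe_nonneg _), ENNReal.ofReal_coe_nnreal]

end GraphexData

/-- Finitely many colours suffice to distinguish the `(C, D)`-bounded graphexes up to a given kernel
distance: the masses of the cells of the approximating step functions and the edge density, rounded
to a grid. -/
lemma Graphex.exists_colouring (C D : ℝ≥0) {ε : ℝ≥0} (hε : 0 < ε) :
    ∃ (κ : Type) (_ : Finite κ) (col : {V : Graphex.{u} // V.IsBounded C D} → κ),
      ∀ V V', col V = col V' → V.1.kernelDist V'.1 ≤ ε := by
  obtain ⟨e, he, he1, he2⟩ : ∃ e : ℝ≥0, 0 < e ∧ 7 * e ≤ ε ∧ 7 * e ≤ ε ^ 2 := by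
    refine ⟨min ε (ε ^ 2) / 7, by positivity, ?_, ?_⟩
    · rw [mul_div_cancel₀ _ (by norm_num)]; exact min_le_left _ _
    · rw [mul_div_cancel₀ _ (by norm_num)]; exact min_le_right _ _
  obtain ⟨n, b, d, M, hb, hb', hd, H⟩ := GraphexData.exists_uniform_step.{u} C D he
  obtain ⟨β, hβb, hβd⟩ : ∃ β : ℝ≥0, (∀ i j, ‖b i j‖ₑ ≤ β) ∧ ∀ i, ‖d i‖ₑ ≤ β := by
    obtain ⟨β₁, h₁⟩ := (Set.finite_range fun p : Fin (n + 1) × Fin (n + 1) => ‖b p.1 p.2‖₊).bddAbove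
    obtain ⟨β₂, h₂⟩ := (Set.finite_range fun p : Fin (n + 1) => ‖d p‖₊).bddAbove
    refine ⟨max β₁ β₂, fun i j => ?_, fun i => ?_⟩
    · exact ENNReal.coe_le_coe.2 ((h₁ ⟨(i, j), rfl⟩).trans (le_max_left _ _))
    · exact ENNReal.coe_le_coe.2 ((h₂ ⟨i, rfl⟩).trans (le_max_right _ _))
  obtain ⟨s, hs, hs1, hs2⟩ : ∃ s : ℝ≥0, 0 < s ∧ (2 * β) ^ 2 * (4 * s * M) ≤ e ^ 2 ∧
      (2 * β) ^ 2 * s ≤ e ^ 2 := by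
    have hq : 0 < (2 * β) ^ 2 * (4 * M + 1) + 1 := by positivity
    refine ⟨e ^ 2 / ((2 * β) ^ 2 * (4 * M + 1) + 1), by positivity, ?_, ?_⟩
    · have : (2 * β) ^ 2 * (4 * (e ^ 2 / ((2 * β) ^ 2 * (4 * M + 1) + 1)) * M)
          = e ^ 2 * ((2 * β) ^ 2 * (4 * M) / ((2 * β) ^ 2 * (4 * M + 1) + 1)) := by ring
      rw [this]
      refine mul_le_of_le_one_right' ((div_le_one₀ hq).2 ?_)
      rw [mul_add, add_assoc]
      exact le_self_add
    · have : (2 * β) ^ 2 * (e ^ 2 / ((2 * β) ^ 2 * (4 * M + 1) + 1))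
          = e ^ 2 * ((2 * β) ^ 2 / ((2 * β) ^ 2 * (4 * M + 1) + 1)) := by ring
      rw [this]
      refine mul_le_of_le_one_right' ((div_le_one₀ hq).2 ?_)
      rw [mul_add, mul_one, add_comm ((2 * β) ^ 2 * (4 * M)), add_assoc]
      exact le_self_add
  obtain ⟨δ, hδ, hδ1, hδ2⟩ : ∃ δ : ℝ, 0 < δ ∧ n * (2 * (2 * (δ * (1 + (M : ℝ) ^ 2)))) ≤ s ∧
      2 * (δ * (1 + (C : ℝ) ^ 2)) ≤ (ε : ℝ) ^ 3 := by
    have hs' : (0 : ℝ) < s := hs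
    have hε' : (0 : ℝ) < ε := hε
    refine ⟨min (s / ((n + 1) * (4 * (1 + (M : ℝ) ^ 2)))) ((ε : ℝ) ^ 3 / (2 * (1 + (C : ℝ) ^ 2))),
      by positivity, ?_, ?_⟩
    · calc (n : ℝ) * (2 * (2 * (_ * (1 + (M : ℝ) ^ 2)))) ≤
          ((n : ℝ) + 1) * (2 * (2 * (s / ((n + 1) * (4 * (1 + (M : ℝ) ^ 2))) *
            (1 + (M : ℝ) ^ 2)))) := by
            gcongr
            · linarith
            · exact min_le_left _ _
        _ = (s : ℝ) := by field_simp; norm_num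
    · calc 2 * (_ * (1 + (C : ℝ) ^ 2)) ≤
          2 * ((ε : ℝ) ^ 3 / (2 * (1 + (C : ℝ) ^ 2)) * (1 + (C : ℝ) ^ 2)) := by
            gcongr
            exact min_le_right _ _
        _ = _ := by field_simp
  obtain ⟨m, c, v, -, -, hv⟩ := exists_rounding hδ
  have hclose : ∀ {K x y : ℝ}, |x| ≤ K → |y| ≤ K → c x = c y →
      |x - y| ≤ 2 * (δ * (1 + K ^ 2)) := by
    intro K x y hx hy hxy
    have h1 := hv x
    have h2 := hv y
    rw [← hxy] at h2
    have e1 : x ^ 2 ≤ K ^ 2 := sq_le_sq' (abs_le.1 hx).1 (abs_le.1 hx).2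
    have e2 : y ^ 2 ≤ K ^ 2 := sq_le_sq' (abs_le.1 hy).1 (abs_le.1 hy).2
    have h1' : |x - v (c x)| ≤ δ * (1 + K ^ 2) := h1.trans (by gcongr)
    have h2' : |y - v (c x)| ≤ δ * (1 + K ^ 2) := h2.trans (by gcongr)
    rw [abs_le] at *
    constructor <;> linarith
  choose l hl hlM hlk hld using fun V : {V : Graphex.{u} // V.IsBounded C D} =>
    H V.1.μ V.1.data V.1.isProper V.2
  -- The colour consists of the rounded masses of the cells and the rounded edge density.
  refine ⟨(Fin n → Fin (m + 1) × Bool) × (Fin (m + 1) × Bool), inferInstance, fun V =>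
    (fun i => c (V.1.μ (l V ⁻¹' {i.succ})).toReal, c (V.1.data.rho V.1.μ)), fun V V' h => ?_⟩
  have f := V.1.isProper.finiteOn_of_isBounded V.2
  have f' := V'.1.isProper.finiteOn_of_isBounded V'.2
  have hmass : ∀ (V : {V : Graphex.{u} // V.IsBounded C D}) (i : Fin n),
      V.1.μ (l V ⁻¹' {i.succ}) ≤ M := by
    intro V i
    refine (measure_mono fun x hx => ?_).trans (hlM V)
    have : l V x = i.succ := hx
    simp [this]
  have hrho : ∀ V : {V : Graphex.{u} // V.IsBounded C D}, |V.1.data.rho V.1.μ| ≤ C := by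
    intro V
    have f := V.1.isProper.finiteOn_of_isBounded V.2
    rw [V.1.isProper.rho_eq f.1, abs_of_nonneg ENNReal.toReal_nonneg]
    exact ENNReal.toReal_le_of_le_ofReal (NNReal.coe_nonneg _) (by simpa using V.2.1)
  have hdiff : ∀ i : Fin n, (V.1.μ (l V ⁻¹' {i.succ}) - V'.1.μ (l V' ⁻¹' {i.succ}))
      + (V'.1.μ (l V' ⁻¹' {i.succ}) - V.1.μ (l V ⁻¹' {i.succ}))
        ≤ ENNReal.ofReal (2 * (2 * (δ * (1 + (M : ℝ) ^ 2)))) := by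
    intro i
    have a1 := hmass V i
    have a2 := hmass V' i
    have a3 : ∀ {x : ℝ≥0∞}, x ≤ M → |x.toReal| ≤ M := fun {x} hx => by
      rw [abs_of_nonneg ENNReal.toReal_nonneg]
      exact ENNReal.toReal_le_of_le_ofReal (NNReal.coe_nonneg _) (by simpa using hx)
    have a4 := hclose (a3 a1) (a3 a2) (congrFun (congrArg Prod.fst h) i)
    have a5 : ∀ {x y : ℝ≥0∞}, x ≤ M → y ≤ M → ENNReal.toReal x - ENNReal.toReal y
        ≤ 2 * (δ * (1 + (M : ℝ) ^ 2)) → x - y ≤ ENNReal.ofReal (2 * (δ * (1 + (M : ℝ) ^ 2))) := by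
      intro x y hx hy hxy
      rw [← ENNReal.ofReal_toReal (ne_top_of_le_ne_top ENNReal.coe_ne_top hx),
        ← ENNReal.ofReal_toReal (ne_top_of_le_ne_top ENNReal.coe_ne_top hy),
        ← ENNReal.ofReal_sub _ ENNReal.toReal_nonneg]
      exact ENNReal.ofReal_le_ofReal hxy
    rw [two_mul (2 * _), ENNReal.ofReal_add (by positivity) (by positivity)]
    rw [abs_le] at a4
    exact add_le_add (a5 a1 a2 a4.2) (a5 a2 a1 (by linarith))
  have hN := GraphexData.jointNear_of_step (k₀ := e) (d₀ := e) (β := β) (M := M) (s := s)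
    (r := (ε : ℝ≥0∞) ^ 3) V.1.isProper V'.1.isProper f f' (hl V) (hl V')
    hb hb' hd (hlk V) (hlk V') (hld V) (hld V') (by
      rw [Real.enorm_eq_ofReal_abs]
      have := (hclose (hrho V) (hrho V') (congrArg Prod.snd h)).trans hδ2
      refine (ENNReal.ofReal_le_ofReal this).trans (le_of_eq ?_)
      rw [ENNReal.ofReal_pow (NNReal.coe_nonneg _), ENNReal.ofReal_coe_nnreal])
    ENNReal.coe_ne_top (hlM V) (hlM V') hβb hβd (by
      refine (Finset.sum_le_sum fun i _ => hdiff i).trans ?_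
      rw [Finset.sum_const, Finset.card_univ, Fintype.card_fin, nsmul_eq_mul,
        ← ENNReal.ofReal_natCast, ← ENNReal.ofReal_mul (by positivity)]
      exact (ENNReal.ofReal_le_ofReal hδ1).trans (by simp))
    (by exact_mod_cast hs1) (by exact_mod_cast hs2)
  refine GraphexData.JointNear.delta22_le' V.1.isProper V'.1.isProper f f' (hN.mono ?_ ?_ le_rfl)
  · calc (e + e + e + e + (e + e + e) : ℝ≥0∞) = ((7 * e : ℝ≥0) : ℝ≥0∞) := by push_cast; ring
      _ ≤ ε := by exact_mod_cast he1
  · calc (e + e + e : ℝ≥0∞) ≤ e + e + e + 4 * e := le_self_add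
      _ = ((7 * e : ℝ≥0) : ℝ≥0∞) := by push_cast; ring
      _ ≤ ε ^ 2 := by exact_mod_cast he2

end TotalBoundedness

/-! ### Averaging over finitely many cells -/

section Stepping

lemma lintegral_eq_sum_preimage {Z κ : Type*} [MeasurableSpace Z] [Fintype κ] [MeasurableSpace κ]
    [MeasurableSingletonClass κ] (η : Measure Z) {L : Z → κ} (hL : Measurable L) (f : Z → ℝ≥0∞) :
    ∫⁻ z, f z ∂η = ∑ k, ∫⁻ z in L ⁻¹' {k}, f z ∂η := by
  have h := lintegral_iUnion (μ := η) (fun k => hL (measurableSet_singleton k)) (fun i j hij =>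
    Set.disjoint_left.2 fun z hz hz' => hij (hz.symm.trans hz')) f
  rw [tsum_fintype] at h
  rw [← h, ← Set.preimage_iUnion, Set.iUnion_of_singleton, Set.preimage_univ, setLIntegral_univ]

/-- Cell averages are the best approximation in `L²` by a step function. -/
lemma lintegral_sub_average_le {Z κ : Type*} [MeasurableSpace Z] [Fintype κ] [MeasurableSpace κ]
    [MeasurableSingletonClass κ] {η : Measure Z} {L : Z → κ} (hL : Measurable L) {f : Z → ℝ}
    (hf : Measurable f) {a c : κ → ℝ}
    (h : ∀ k, a k = c k ∨ (η (L ⁻¹' {k}) ≠ ∞ ∧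
      a k * η.real (L ⁻¹' {k}) = ∫ z in L ⁻¹' {k}, f z ∂η)) :
    ∫⁻ z, ‖f z - a (L z)‖ₑ ^ 2 ∂η ≤ ∫⁻ z, ‖f z - c (L z)‖ₑ ^ 2 ∂η := by
  rw [lintegral_eq_sum_preimage η hL, lintegral_eq_sum_preimage η hL]
  refine Finset.sum_le_sum fun k _ => ?_
  have hc : MeasurableSet (L ⁻¹' {k}) := hL (measurableSet_singleton k)
  have hcell : ∀ a : κ → ℝ, ∫⁻ z in L ⁻¹' {k}, ‖f z - a (L z)‖ₑ ^ 2 ∂η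
      = ∫⁻ z in L ⁻¹' {k}, ‖f z - a k‖ₑ ^ 2 ∂η := fun a =>
    setLIntegral_congr_fun hc fun z hz => by
      have : L z = k := hz
      simp only [this]
  rw [hcell, hcell]
  rcases h k with h | ⟨hfin, h⟩
  · rw [h]
  by_cases htop : ∫⁻ z in L ⁻¹' {k}, ‖f z - c k‖ₑ ^ 2 ∂η = ∞
  · rw [htop]; exact le_top
  have : IsFiniteMeasure (η.restrict (L ⁻¹' {k})) := ⟨by
    rw [Measure.restrict_apply_univ]; exact hfin.lt_top⟩
  have g2 : MemLp (fun z => f z - c k) 2 (η.restrict (L ⁻¹' {k})) :=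
    memLp_two_of_lintegral_sq (hf.sub_const _) htop
  have g1 := g2.integrable (by norm_num)
  have f1 : Integrable f (η.restrict (L ⁻¹' {k})) := by
    exact (g1.add (integrable_const (c k))).congr (ae_of_all _ fun z => by simp)
  have a2 : MemLp (fun z => f z - a k) 2 (η.restrict (L ⁻¹' {k})) := by
    have := g2.sub (memLp_const (a k - c k))
    refine this.ae_eq (ae_of_all _ fun z => ?_)
    simp
  have hconv : ∀ {b : ℝ}, MemLp (fun z => f z - b) 2 (η.restrict (L ⁻¹' {k})) →
      ∫⁻ z in L ⁻¹' {k}, ‖f z - b‖ₑ ^ 2 ∂η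
        = ENNReal.ofReal (∫ z in L ⁻¹' {k}, (f z - b) ^ 2 ∂η) := by
    intro b hb
    rw [ofReal_integral_eq_lintegral_ofReal hb.integrable_sq (ae_of_all _ fun z => sq_nonneg _)]
    simp only [Real.enorm_eq_ofReal_abs, ← ENNReal.ofReal_pow (abs_nonneg _), sq_abs]
  rw [hconv a2, hconv g2]
  refine ENNReal.ofReal_le_ofReal ?_
  have e1 : ∀ z, (f z - a k) ^ 2 = (f z - c k) ^ 2 - (2 * (a k - c k) * f z
      - (a k - c k) * (a k + c k)) := fun z => by ring
  have i1 : Integrable (fun z => 2 * (a k - c k) * f z) (η.restrict (L ⁻¹' {k})) := f1.const_mul _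
  have i2 : Integrable (fun z => 2 * (a k - c k) * f z - (a k - c k) * (a k + c k))
      (η.restrict (L ⁻¹' {k})) := i1.sub (integrable_const _)
  simp_rw [e1]
  rw [integral_sub g2.integrable_sq i2, integral_sub i1 (integrable_const _),
    integral_const_mul, ← h,
    integral_const, smul_eq_mul, measureReal_restrict_apply_univ]
  have h0 : 0 ≤ η.real (L ⁻¹' {k}) := measureReal_nonneg
  nlinarith [mul_nonneg (sq_nonneg (a k - c k)) h0]

namespace GraphexData

variable {Ω : Type*} [MeasurableSpace Ω] {T : GraphexData Ω} {μ : Measure Ω} {n : ℕ}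
  {l : Ω → Fin (n + 1)}

/-- Mass of the graphon part on a pair of cells. -/
noncomputable def cellMass (T : GraphexData Ω) (μ : Measure Ω) (l : Ω → Fin (n + 1))
    (i j : Fin (n + 1)) : ℝ≥0∞ :=
  ∫⁻ x in l ⁻¹' {i}, ∫⁻ y in l ⁻¹' {j}, ENNReal.ofReal (T.W x y) ∂μ ∂μ

/-- Averages of a graphex over the cells with non-zero label. The edges to the part with label `0`
become star edges, and the edges inside that part become dust, so that no mass is lost. -/
noncomputable def average (T : GraphexData Ω) (μ : Measure Ω) (l : Ω → Fin (n + 1)) :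
    GraphexData (Fin (n + 1)) where
  W i j := if i = 0 ∨ j = 0 then 0
    else (T.cellMass μ l i j / (μ (l ⁻¹' {i}) * μ (l ⁻¹' {j}))).toReal
  S i := if i = 0 then 0 else
    ((T.cellMass μ l i 0 + ∫⁻ x in l ⁻¹' {i}, ENNReal.ofReal (T.S x) ∂μ) / μ (l ⁻¹' {i})).toReal
  I := T.I + (∫⁻ x in l ⁻¹' {0}, ENNReal.ofReal (T.S x) ∂μ).toReal
    + (1 / 2) * (T.cellMass μ l 0 0).toReal

/-- The masses of the cells with non-zero label. -/
noncomputable def cellMeasure (μ : Measure Ω) (l : Ω → Fin (n + 1)) : Measure (Fin (n + 1)) :=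
  (μ.map l).restrict {0}ᶜ

lemma cellMeasure_singleton (hl : Measurable l) {i : Fin (n + 1)} (hi : i ≠ 0) :
    cellMeasure μ l {i} = μ (l ⁻¹' {i}) := by
  rw [cellMeasure, Measure.restrict_apply (measurableSet_singleton i),
    Set.inter_eq_left.2 (by simpa using hi.symm), Measure.map_apply hl (measurableSet_singleton i)]

lemma cellMeasure_zero : cellMeasure μ l {0} = 0 := by
  rw [cellMeasure, Measure.restrict_apply (measurableSet_singleton 0)]
  simp

lemma lintegral_cellMeasure (hl : Measurable l) (f : Fin (n + 1) → ℝ≥0∞) :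
    ∫⁻ i, f i ∂(cellMeasure μ l) = ∑ i : Fin n, f i.succ * μ (l ⁻¹' {i.succ}) := by
  rw [lintegral_fintype, Fin.sum_univ_succ, cellMeasure_zero, mul_zero, zero_add]
  refine Finset.sum_congr rfl fun i _ => ?_
  rw [cellMeasure_singleton hl i.succ_ne_zero]

lemma average_vanishesOff : (T.average μ l).VanishesOff {0}ᶜ := by
  refine ⟨fun i j hi => ?_, fun i hi => ?_⟩
  · simp only [Set.mem_compl_iff, Set.mem_singleton_iff, not_not] at hi
    simp [average, hi]
  · simp only [Set.mem_compl_iff, Set.mem_singleton_iff, not_not] at hi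
    simp [average, hi]

section

variable [SFinite μ] (hT : T.IsProper) (hl : Measurable l)

include hT in
lemma cellMass_symm (i j : Fin (n + 1)) : T.cellMass μ l i j = T.cellMass μ l j i := by
  unfold cellMass
  have hm : Measurable fun z : Ω × Ω => ENNReal.ofReal (T.W z.1 z.2) :=
    hT.measurable_W.ennreal_ofReal
  rw [lintegral_lintegral_swap hm.aemeasurable]
  simp only [hT.W_symm]

omit [SFinite μ] in
include hT in
lemma cellMass_le (i j : Fin (n + 1)) :
    T.cellMass μ l i j ≤ μ (l ⁻¹' {i}) * μ (l ⁻¹' {j}) := by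
  calc T.cellMass μ l i j ≤ ∫⁻ _ in l ⁻¹' {i}, ∫⁻ _ in l ⁻¹' {j}, 1 ∂μ ∂μ :=
        lintegral_mono fun x => lintegral_mono fun y => by
          simpa using (hT.W_mem x y).2
    _ = _ := by simp [mul_comm]

include hT hl in
lemma sum_cellMass (i : Fin (n + 1)) : ∑ j, T.cellMass μ l i j
    + ∫⁻ x in l ⁻¹' {i}, ENNReal.ofReal (T.S x) ∂μ = ∫⁻ x in l ⁻¹' {i}, T.marginal μ x ∂μ := by
  rw [hT.lintegral_marginal]
  congr 1
  unfold cellMass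
  rw [← lintegral_finsetSum]
  · refine lintegral_congr fun x => ?_
    rw [lintegral_eq_sum_preimage μ hl]
  · intro j _
    exact hT.measurable_lintegral_W

omit [SFinite μ] in
include hT in
lemma average_W_mem (i j : Fin (n + 1)) : (T.average μ l).W i j ∈ Set.Icc (0 : ℝ) 1 := by
  simp only [average]
  split_ifs
  · simp
  · refine ⟨ENNReal.toReal_nonneg, ENNReal.toReal_le_of_le_ofReal zero_le_one ?_⟩
    rw [ENNReal.ofReal_one]
    exact ENNReal.div_le_of_le_mul (by rw [one_mul]; exact cellMass_le hT i j)

include hT in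
lemma average_isProper : (T.average μ l).IsProper where
  measurable_W := measurable_of_countable _
  W_mem := average_W_mem hT
  W_symm i j := by
    simp only [average, or_comm, cellMass_symm hT i j, mul_comm]
  measurable_S := measurable_of_countable _
  S_nonneg i := by
    simp only [average]
    split_ifs
    · exact le_rfl
    · exact ENNReal.toReal_nonneg
  I_nonneg := add_nonneg (add_nonneg hT.I_nonneg ENNReal.toReal_nonneg)
    (mul_nonneg (by norm_num) ENNReal.toReal_nonneg)

variable (hf : ∀ i, i ≠ 0 → μ (l ⁻¹' {i}) ≠ ∞)

omit [SFinite μ] in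
include hT hf in
lemma average_W_mul {i j : Fin (n + 1)} (hi : i ≠ 0) (hj : j ≠ 0) :
    ENNReal.ofReal ((T.average μ l).W i j) * (μ (l ⁻¹' {i}) * μ (l ⁻¹' {j})) =
      T.cellMass μ l i j := by
  have h1 : T.cellMass μ l i j / (μ (l ⁻¹' {i}) * μ (l ⁻¹' {j})) ≠ ∞ :=
    ne_top_of_le_ne_top ENNReal.one_ne_top
      (ENNReal.div_le_of_le_mul (by rw [one_mul]; exact cellMass_le hT i j))
  simp only [average, hi, hj, or_self, if_false]
  rw [ENNReal.ofReal_toReal h1]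
  rcases eq_or_ne (μ (l ⁻¹' {i}) * μ (l ⁻¹' {j})) 0 with h0 | h0
  · rw [h0, mul_zero]
    exact (le_zero_iff.1 ((cellMass_le hT i j).trans h0.le)).symm
  · exact ENNReal.div_mul_cancel h0 (ENNReal.mul_ne_top (hf i hi) (hf j hj))

include hT hf in
lemma average_S_mul (hfin : T.norm1 μ ≠ ∞) {i : Fin (n + 1)} (hi : i ≠ 0) :
    ENNReal.ofReal ((T.average μ l).S i) * μ (l ⁻¹' {i}) =
      T.cellMass μ l i 0 + ∫⁻ x in l ⁻¹' {i}, ENNReal.ofReal (T.S x) ∂μ := by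
  have hle : T.cellMass μ l i 0 + ∫⁻ x in l ⁻¹' {i}, ENNReal.ofReal (T.S x) ∂μ ≤
      ∫⁻ x in l ⁻¹' {i}, T.marginal μ x ∂μ := by
    rw [hT.lintegral_marginal]
    gcongr
    unfold cellMass
    gcongr
    exact Measure.restrict_le_self
  simp only [average, hi, if_false]
  rcases eq_or_ne (μ (l ⁻¹' {i})) 0 with h0 | h0
  · have : ∫⁻ x in l ⁻¹' {i}, T.marginal μ x ∂μ = 0 := setLIntegral_measure_zero _ _ h0
    rw [h0, mul_zero]
    exact (le_zero_iff.1 (hle.trans this.le)).symm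
  · have hne : T.cellMass μ l i 0 + ∫⁻ x in l ⁻¹' {i}, ENNReal.ofReal (T.S x) ∂μ ≠ ∞ :=
      ne_top_of_le_ne_top hfin (hle.trans ((setLIntegral_le_lintegral _ _).trans
        hT.lintegral_marginal_le))
    rw [ENNReal.ofReal_toReal (ENNReal.div_ne_top hne h0), ENNReal.div_mul_cancel h0 (hf i hi)]

include hT hl hf in
/-- The marginal of the averages is the average of the marginal. -/
lemma average_marginal_mul (hfin : T.norm1 μ ≠ ∞) {i : Fin (n + 1)} (hi : i ≠ 0) :
    (T.average μ l).marginal (cellMeasure μ l) i * μ (l ⁻¹' {i}) =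
      ∫⁻ x in l ⁻¹' {i}, T.marginal μ x ∂μ := by
  rw [marginal, add_mul, average_S_mul hT hf hfin hi, lintegral_cellMeasure hl, Finset.sum_mul,
    ← sum_cellMass hT hl, Fin.sum_univ_succ, ← add_assoc]
  congr 1
  rw [add_comm]
  congr 1
  refine Finset.sum_congr rfl fun j _ => ?_
  rw [← average_W_mul hT hf hi j.succ_ne_zero]
  ring

include hT hl hf in
/-- Averaging keeps `‖𝕎‖₁`: the part with label `0` is accounted for by the star and dust parts. -/
lemma average_norm1 (hfin : T.norm1 μ ≠ ∞) :
    (T.average μ l).norm1 (cellMeasure μ l) = T.norm1 μ := by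
  rw [(average_isProper hT).norm1_eq, hT.norm1_eq]
  have hS0 : ∫⁻ x in l ⁻¹' {0}, ENNReal.ofReal (T.S x) ∂μ ≠ ∞ := by
    refine ne_top_of_le_ne_top hfin ((setLIntegral_le_lintegral _ _).trans (le_trans ?_
      hT.lintegral_marginal_le))
    rw [hT.lintegral_marginal]
    exact le_add_self
  have hA0 : T.cellMass μ l 0 0 ≠ ∞ := by
    refine ne_top_of_le_ne_top hfin (le_trans ?_ hT.lintegral_W_le)
    unfold cellMass
    refine (setLIntegral_le_lintegral _ _).trans (lintegral_mono fun x => ?_)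
    exact setLIntegral_le_lintegral _ _
  have hI : 2 * ENNReal.ofReal (T.average μ l).I = 2 * ENNReal.ofReal T.I +
      2 * (∫⁻ x in l ⁻¹' {0}, ENNReal.ofReal (T.S x) ∂μ) + T.cellMass μ l 0 0 := by
    simp only [average]
    rw [ENNReal.ofReal_add (add_nonneg hT.I_nonneg ENNReal.toReal_nonneg)
      (mul_nonneg (by norm_num) ENNReal.toReal_nonneg),
      ENNReal.ofReal_add hT.I_nonneg ENNReal.toReal_nonneg, ENNReal.ofReal_toReal hS0,
      ENNReal.ofReal_mul (by norm_num), ENNReal.ofReal_toReal hA0, mul_add, mul_add, ← mul_assoc,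
      one_div, ENNReal.ofReal_inv_of_pos two_pos, ENNReal.ofReal_ofNat,
      ENNReal.mul_inv_cancel (by simp) (by simp), one_mul]
  rw [hI, lintegral_cellMeasure hl, lintegral_cellMeasure hl]
  simp_rw [lintegral_cellMeasure hl]
  have hW : ∫⁻ x, ∫⁻ y, ENNReal.ofReal (T.W x y) ∂μ ∂μ = ∑ i, ∑ j, T.cellMass μ l i j := by
    rw [lintegral_eq_sum_preimage μ hl]
    refine Finset.sum_congr rfl fun i _ => ?_
    unfold cellMass
    rw [← lintegral_finsetSum _ fun j _ => hT.measurable_lintegral_W]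
    refine lintegral_congr fun x => ?_
    rw [lintegral_eq_sum_preimage μ hl]
  rw [hW, lintegral_eq_sum_preimage μ hl (fun x => ENNReal.ofReal (T.S x))]
  have e1 : ∀ i : Fin n, (∑ j : Fin n, ENNReal.ofReal ((T.average μ l).W i.succ j.succ)
      * μ (l ⁻¹' {j.succ})) * μ (l ⁻¹' {i.succ}) = ∑ j : Fin n, T.cellMass μ l i.succ j.succ := by
    intro i
    rw [Finset.sum_mul]
    refine Finset.sum_congr rfl fun j _ => ?_
    rw [← average_W_mul hT hf i.succ_ne_zero j.succ_ne_zero]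
    ring
  simp_rw [e1, average_S_mul hT hf hfin (Fin.succ_ne_zero _), Fin.sum_univ_succ (n := n),
    Finset.sum_add_distrib, cellMass_symm hT 0 (Fin.succ _)]
  ring

include hT hl hf in
lemma average_finiteOn (hfin : T.norm1 μ ≠ ∞) : (T.average μ l).FiniteOn (cellMeasure μ l) := by
  refine ⟨by rwa [average_norm1 hT hl hf hfin], ?_⟩
  rw [lintegral_cellMeasure hl]
  refine (ENNReal.sum_lt_top.2 fun i _ => ?_).ne
  rw [sq, mul_assoc, average_marginal_mul hT hl hf hfin i.succ_ne_zero, lt_top_iff_ne_top]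
  have h1 : ∫⁻ x in l ⁻¹' {i.succ}, T.marginal μ x ∂μ ≠ ∞ :=
    ne_top_of_le_ne_top hfin ((setLIntegral_le_lintegral _ _).trans hT.lintegral_marginal_le)
  rcases eq_or_ne (μ (l ⁻¹' {i.succ})) 0 with h0 | h0
  · rw [setLIntegral_measure_zero _ _ h0, mul_zero]; simp
  · refine ENNReal.mul_ne_top ?_ h1
    have := average_marginal_mul hT hl hf hfin i.succ_ne_zero
    intro htop
    rw [htop, ENNReal.top_mul h0] at this
    exact h1 this.symm

include hT hl hf in
lemma average_marginal_le (hfin : T.norm1 μ ≠ ∞) {D : ℝ≥0∞} (hD : ∀ᵐ x ∂μ, T.marginal μ x ≤ D) :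
    ∀ᵐ i ∂(cellMeasure μ l), (T.average μ l).marginal (cellMeasure μ l) i ≤ D := by
  rw [ae_iff_of_countable]
  intro i hi
  have hi0 : i ≠ 0 := by
    rintro rfl
    exact hi cellMeasure_zero
  rw [cellMeasure_singleton hl hi0] at hi
  refine (ENNReal.mul_le_mul_iff_left hi (hf i hi0)).1 ?_
  rw [average_marginal_mul hT hl hf hfin hi0]
  calc ∫⁻ x in l ⁻¹' {i}, T.marginal μ x ∂μ ≤ ∫⁻ _ in l ⁻¹' {i}, D ∂μ :=
        lintegral_mono_ae (ae_restrict_of_ae hD)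
    _ = D * μ (l ⁻¹' {i}) := by simp

end

/-- Every graphex in `L¹ ∩ L²` is approximated by averages over finitely many cells. -/
lemma exists_average_jointNear [SigmaFinite μ] (hT : T.IsProper) (fT : T.FiniteOn μ) {ε : ℝ≥0∞}
    (hε : ε ≠ 0) : ∃ (n : ℕ) (l : Ω → Fin (n + 1)), Measurable l ∧
      (∀ i, i ≠ 0 → μ (l ⁻¹' {i}) ≠ ∞) ∧
      JointNear T μ (T.average μ l) (cellMeasure μ l) ε ε 0 := by
  obtain ⟨n, l, b, d, hl, hf, hb, hb', hd, hU, hD⟩ :=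
    exists_step_approx (fT.isL2Kernel hT) (fT.memLp_marginal hT) hε
  have hfin := fT.norm1_ne_top
  have hA := average_isProper (l := l) (μ := μ) hT
  have fA := average_finiteOn hT hl hf hfin
  have hsf : SFinite (cellMeasure μ l) := by unfold cellMeasure; infer_instance
  refine ⟨n, l, hl, hf, ?_⟩
  -- The labelling itself gives the partial coupling, with label `0` sent to the appended line.
  let p : Ω → Fin (n + 1) ⊕ ℝ := fun x => if l x = 0 then Sum.inr 0 else Sum.inl (l x)
  have hp : Measurable p := by
    refine Measurable.ite (hl (measurableSet_singleton 0)) measurable_const ?_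
    exact measurable_inl.comp hl
  have C₁ : Covers μ (Sum.inl : Ω → Ω ⊕ ℝ) μ := covers_inl μ
  have C₂ : Covers μ p (cellMeasure μ l) := by
    refine ⟨hp, fun B hB => ?_⟩
    rw [cellMeasure, Measure.restrict_apply hB, Measure.map_apply hl
      (hB.inter (measurableSet_singleton 0).compl)]
    congr 1
    ext x
    by_cases h : l x = 0 <;> simp [p, h]
  have hWp : ∀ x y, (((T.average μ l).extend).pullback p).W x y =
      (T.average μ l).W (l x) (l y) := by
    intro x y
    simp only [GraphexData.pullback, p]
    by_cases hx : l x = 0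
    · rw [if_pos hx, hx, (average_vanishesOff (T := T) (μ := μ) (l := l)).W_eq 0 (l y) (by simp)]
      rfl
    · by_cases hy : l y = 0
      · rw [if_pos hy, hy, average_vanishesOff.W_eq' hA (l x) 0 (by simp)]
        simp [hx, extend]
      · simp [hx, hy, extend]
  refine jointNear_of_covers hT hA fT fA C₁ C₂ ⟨?_, ?_, ?_⟩
  · refine ENNReal.le_of_sq_le_sq ((kernelNorm_sq_le_lintegral ?_).trans (le_trans ?_ hU))
    · exact (hT.extend.pullback measurable_inl).measurable_W.sub
        (hA.extend.pullback hp).measurable_W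
    simp_rw [hWp]
    have hWm : Measurable fun z : Ω × Ω => T.W z.1 z.2 := hT.measurable_W
    have m1 : ∀ c : Fin (n + 1) → Fin (n + 1) → ℝ, ∫⁻ x, ∫⁻ y, ‖T.W x y - c (l x) (l y)‖ₑ ^ 2 ∂μ ∂μ
        = ∫⁻ z, ‖T.W z.1 z.2 - (uncurry c) (l z.1, l z.2)‖ₑ ^ 2 ∂(μ.prod μ) := by
      intro c
      rw [lintegral_prod]
      · rfl
      · refine Measurable.aemeasurable ((hWm.sub ?_).enorm.pow_const 2)
        exact (measurable_of_countable (uncurry c)).comp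
          ((hl.comp measurable_fst).prodMk (hl.comp measurable_snd))
    change ∫⁻ x, ∫⁻ y, ‖T.W x y - (T.average μ l).W (l x) (l y)‖ₑ ^ 2 ∂μ ∂μ ≤ _
    rw [m1, m1]
    refine lintegral_sub_average_le (L := fun z : Ω × Ω => (l z.1, l z.2))
      ((hl.comp measurable_fst).prodMk (hl.comp measurable_snd)) hWm ?_
    rintro ⟨i, j⟩
    simp only [uncurry_apply_pair]
    by_cases hi : i = 0
    · left
      rw [hi, hb, average_vanishesOff.W_eq _ _ (by simp)]
    by_cases hj : j = 0
    · left
      rw [hj, hb', average_vanishesOff.W_eq' hA _ _ (by simp)]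
    right
    have hpre : (fun z : Ω × Ω => (l z.1, l z.2)) ⁻¹' {(i, j)} = (l ⁻¹' {i}) ×ˢ (l ⁻¹' {j}) := by
      ext z; simp
    rw [hpre, measureReal_def, Measure.prod_prod]
    refine ⟨ENNReal.mul_ne_top (hf i hi) (hf j hj), ?_⟩
    rw [← Measure.prod_restrict, integral_eq_lintegral_of_nonneg_ae
      (ae_of_all _ fun z => (hT.W_mem _ _).1) hWm.aestronglyMeasurable,
      lintegral_prod _ hWm.ennreal_ofReal.aemeasurable]
    have := average_W_mul hT hf hi hj
    unfold cellMass at this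
    rw [← this, ENNReal.toReal_mul, ENNReal.toReal_mul, ENNReal.toReal_mul,
      ENNReal.toReal_ofReal (hA.W_mem i j).1]
  -- Averages over cells are best approximations in `L²` among step functions.
  · refine le_trans (ENNReal.le_of_sq_le_sq ?_) hD
    rw [eLpNorm_two_sq, eLpNorm_two_sq]
    simp_rw [C₁.marginal_eq hT, C₂.marginal_eq hA]
    have hp' : ∀ x, Sum.elim ((T.average μ l).marginal (cellMeasure μ l)) 0 (p x)
        = (T.average μ l).marginal (cellMeasure μ l) (l x) := by
      intro x
      simp only [p]
      by_cases hx : l x = 0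
      · rw [if_pos hx, hx, average_vanishesOff.marginal_eq 0 (by simp)]
        rfl
      · rw [if_neg hx]; rfl
    simp_rw [hp', Sum.elim_inl]
    refine lintegral_sub_average_le
      (a := fun i => ((T.average μ l).marginal (cellMeasure μ l) i).toReal) hl
      hT.measurable_marginal.ennreal_toReal fun i => ?_
    by_cases hi : i = 0
    · left
      rw [hi, hd, average_vanishesOff.marginal_eq 0 (by simp)]
      rfl
    · refine Or.inr ⟨hf i hi, ?_⟩
      rw [measureReal_def, ← ENNReal.toReal_mul, average_marginal_mul hT hl hf hfin hi,
        integral_toReal hT.measurable_marginal.aemeasurable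
          (ae_restrict_of_ae (fT.ae_lt_top hT))]
  · rw [C₁.rho_eq hT hfin, C₂.rho_eq hA fA.norm1_ne_top, hT.rho_eq hfin, hA.rho_eq fA.norm1_ne_top,
      average_norm1 hT hl hf hfin]
    simp

end GraphexData

end Stepping

/-! ### Realizing step graphexes on the line -/

section Transfer

/-- Lebesgue measure has no atoms: the volume of `A ∩ [-t, t]` takes all intermediate values. -/
lemma exists_subset_volume_eq {A : Set ℝ} (hA : MeasurableSet A) {a : ℝ≥0∞} (ha : a ≠ ∞)
    (h : a ≤ volume A) : ∃ B ⊆ A, MeasurableSet B ∧ volume B = a := by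
  rcases h.eq_or_lt with h | h
  · exact ⟨A, subset_rfl, hA, h.symm⟩
  let F : ℝ → ℝ≥0∞ := fun t => volume (A ∩ Set.Icc (-t) t)
  have hmono : ∀ s t : ℝ, s ≤ t → F t ≤ F s + ENNReal.ofReal (2 * (t - s)) := by
    intro s t hst
    have hsub : A ∩ Set.Icc (-t) t ⊆ (A ∩ Set.Icc (-s) s) ∪
        (Set.Icc (-t) (-s) ∪ Set.Icc s t) := by
      rintro x ⟨hxA, hx1, hx2⟩
      by_cases h1 : x < -s
      · exact Or.inr (Or.inl ⟨hx1, h1.le⟩)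
      · by_cases h2 : s < x
        · exact Or.inr (Or.inr ⟨h2.le, hx2⟩)
        · exact Or.inl ⟨hxA, not_lt.1 h1, not_lt.1 h2⟩
    refine (measure_mono hsub).trans ((measure_union_le _ _).trans ?_)
    gcongr
    refine (measure_union_le _ _).trans (le_of_eq ?_)
    rw [Real.volume_Icc, Real.volume_Icc, ← ENNReal.ofReal_add (by linarith) (by linarith)]
    congr 1
    ring
  have hFfin : ∀ t, F t ≠ ∞ := fun t =>
    ne_top_of_le_ne_top (by simp [Real.volume_Icc]) (measure_mono Set.inter_subset_right)
  have hmono' : Monotone F := fun s t hst => measure_mono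
    (Set.inter_subset_inter_right _ (Set.Icc_subset_Icc (neg_le_neg hst) hst))
  have hlip : LipschitzWith 2 fun t => (F t).toReal := by
    refine LipschitzWith.of_le_add_mul _ fun s t => ?_
    rcases le_total s t with hst | hst
    · have := ENNReal.toReal_mono (hFfin t) (hmono' hst)
      have h0 : 0 ≤ dist s t := dist_nonneg
      simp only [NNReal.coe_ofNat]
      linarith
    · have := ENNReal.toReal_mono (ENNReal.add_ne_top.2 ⟨hFfin t, ENNReal.ofReal_ne_top⟩)
        (hmono t s hst)
      rw [ENNReal.toReal_add (hFfin t) ENNReal.ofReal_ne_top,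
        ENNReal.toReal_ofReal (by linarith)] at this
      rw [Real.dist_eq, abs_of_nonneg (by linarith)]
      simpa using this
  have hlim : Tendsto (fun n : ℕ => F n) atTop (𝓝 (volume A)) := by
    have hU : A = ⋃ n : ℕ, A ∩ Set.Icc (-(n : ℝ)) n := by
      rw [← Set.inter_iUnion]
      refine (Set.inter_eq_left.2 fun x _ => ?_).symm
      obtain ⟨n, hn⟩ := exists_nat_ge |x|
      exact Set.mem_iUnion.2 ⟨n, abs_le.1 hn⟩
    conv => enter [3, 1]; rw [hU]
    refine tendsto_measure_iUnion_atTop fun m n hmn => ?_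
    have : (m : ℝ) ≤ n := by exact_mod_cast hmn
    exact Set.inter_subset_inter_right _ (Set.Icc_subset_Icc (neg_le_neg this) this)
  obtain ⟨n, hn⟩ := (hlim.eventually_const_lt h).exists
  have h0 : F 0 = 0 := by
    have : F 0 ≤ volume (Set.Icc (-0 : ℝ) 0) := measure_mono Set.inter_subset_right
    simpa using this
  have hivt : a.toReal ∈ (fun t => (F t).toReal) '' Set.Icc 0 (n : ℝ) := by
    refine intermediate_value_Icc (Nat.cast_nonneg n) hlip.continuous.continuousOn ⟨?_, ?_⟩
    · simp [h0]
    · exact ENNReal.toReal_mono (hFfin _) hn.le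
  obtain ⟨t, -, ht⟩ := hivt
  exact ⟨A ∩ Set.Icc (-t) t, Set.inter_subset_left, hA.inter measurableSet_Icc,
    (ENNReal.toReal_eq_toReal_iff' (hFfin t) ha).1 ht⟩

/-- A subset of the line can be divided into pieces of prescribed finite measures and a rest. -/
lemma exists_subdivision {κ : Type*} [Fintype κ] [MeasurableSpace κ] [DiscreteMeasurableSpace κ]
    (s₀ : κ) {A : Set ℝ} (hA : MeasurableSet A) {a : κ → ℝ≥0∞} (ha : ∀ s, a s ≠ ∞)
    (h : ∑ s, a s ≤ volume A) :
    ∃ q : ℝ → κ, Measurable q ∧ ∀ s, s ≠ s₀ → volume (A ∩ q ⁻¹' {s}) = a s := by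
  classical
  suffices H : ∀ F : Finset κ, s₀ ∉ F → ∃ q : ℝ → κ, Measurable q ∧ (∀ x, q x = s₀ ∨ q x ∈ F) ∧
      ∀ s ∈ F, volume (A ∩ q ⁻¹' {s}) = a s by
    obtain ⟨q, hq, -, hqs⟩ := H (Finset.univ.erase s₀) (Finset.notMem_erase _ _)
    exact ⟨q, hq, fun s hs => hqs s (Finset.mem_erase.2 ⟨hs, Finset.mem_univ s⟩)⟩
  intro F
  induction F using Finset.induction_on with
  | empty => exact fun _ => ⟨fun _ => s₀, measurable_const, fun _ => Or.inl rfl, by simp⟩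
  | insert t F ht ih =>
    intro hs₀
    rw [Finset.mem_insert, not_or] at hs₀
    obtain ⟨q, hq, hqF, hqs⟩ := ih hs₀.2
    have hR : MeasurableSet (A ∩ q ⁻¹' {s₀}) := hA.inter (hq (measurableSet_singleton _))
    have hle : a t ≤ volume (A ∩ q ⁻¹' {s₀}) := by
      have hsum : volume A ≤ volume (A ∩ q ⁻¹' {s₀}) + ∑ s ∈ F, a s := by
        have hsub : A ⊆ (A ∩ q ⁻¹' {s₀}) ∪ ⋃ s ∈ F, (A ∩ q ⁻¹' {s}) := by
          intro x hx
          rcases hqF x with h | h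
          · exact Or.inl ⟨hx, h⟩
          · exact Or.inr (Set.mem_biUnion h ⟨hx, rfl⟩)
        refine (measure_mono hsub).trans ((measure_union_le _ _).trans ?_)
        gcongr
        refine (measure_biUnion_finset_le _ _).trans (Finset.sum_le_sum fun s hs => (hqs s hs).le)
      have hfin : ∑ s ∈ F, a s ≠ ∞ := (ENNReal.sum_lt_top.2 fun s _ => (ha s).lt_top).ne
      have hle2 : a t + ∑ s ∈ F, a s ≤ ∑ s, a s := by
        rw [← Finset.sum_insert ht]
        exact Finset.sum_le_sum_of_subset (Finset.subset_univ _)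
      exact (ENNReal.add_le_add_iff_right hfin).1 (hle2.trans (h.trans hsum))
    obtain ⟨B, hBR, hB, hBa⟩ := exists_subset_volume_eq hR (ha t) hle
    refine ⟨fun x => if x ∈ B then t else q x, Measurable.ite hB measurable_const hq,
      fun x => ?_, fun s hs => ?_⟩
    · by_cases hx : x ∈ B
      · simp [hx]
      · simp only [hx, if_false, Finset.mem_insert]
        rcases hqF x with h | h
        · exact Or.inl h
        · exact Or.inr (Or.inr h)
    · by_cases hst : s = t
      · subst hst
        rw [← hBa]
        congr 1
        ext x
        by_cases hx : x ∈ B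
        · simp [hx, (hBR hx).1]
        · simp only [Set.mem_inter_iff, Set.mem_preimage, hx, if_false, Set.mem_singleton_iff,
            iff_false, not_and]
          intro _ hqx
          rcases hqF x with h | h
          · exact hs₀.1 (h.symm.trans hqx)
          · exact ht (hqx ▸ h)
      · have hsF : s ∈ F := (Finset.mem_insert.1 hs).resolve_left hst
        rw [← hqs s hsF]
        congr 1
        ext x
        by_cases hx : x ∈ B
        · have hqx : q x = s₀ := (hBR hx).2
          have : s₀ ≠ s := fun h => hs₀.2 (h ▸ hsF)
          simp [hx, hqx, this, Ne.symm hst]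
        · simp [hx]

namespace GraphexData

/-- A comparison of two step graphexes is witnessed by a measure `g` on pairs of labels, where the
label `0` plays the role of the appended lines. -/
lemma JointNear.exists_label_coupling {k k' : ℕ} {T : GraphexData (Fin (k + 1))}
    {T' : GraphexData (Fin (k' + 1))} {ν : Measure (Fin (k + 1))} {ν' : Measure (Fin (k' + 1))}
    [SFinite ν] [SFinite ν'] (hT : T.IsProper) (hT' : T'.IsProper) (fT : T.FiniteOn ν)
    (fT' : T'.FiniteOn ν') (vT : T.VanishesOff {0}ᶜ) (vT' : T'.VanishesOff {0}ᶜ) {a d r : ℝ≥0∞}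
    (h : JointNear T ν T' ν' a d r) :
    ∃ g : Measure (Fin (k + 1) × Fin (k' + 1)), SFinite g ∧
      (∀ i, i ≠ 0 → g (Prod.fst ⁻¹' {i}) = ν {i}) ∧ (∀ j, j ≠ 0 → g (Prod.snd ⁻¹' {j}) = ν' {j}) ∧
      (T.pullback Prod.fst).FiniteOn g ∧ (T'.pullback Prod.snd).FiniteOn g ∧
      (T.pullback Prod.fst).Near (T'.pullback Prod.snd) g a d r := by
  obtain ⟨γ, _, c, c', hN⟩ := h
  have hL : ∀ {n : ℕ}, Measurable (extendLabel (id : Fin (n + 1) → Fin (n + 1))) :=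
    fun {n} => measurable_extendLabel measurable_id
  let q : (Fin (k + 1) ⊕ ℝ) × (Fin (k' + 1) ⊕ ℝ) → Fin (k + 1) × Fin (k' + 1) :=
    fun z => (extendLabel id z.1, extendLabel id z.2)
  have hq : Measurable q := (hL.comp measurable_fst).prodMk (hL.comp measurable_snd)
  have e : ∀ {n : ℕ} {R : GraphexData (Fin (n + 1))}, R.IsProper → R.VanishesOff {0}ᶜ →
      R.pullback (extendLabel id) = R.extend := by
    intro n R hR vR
    have hW0 : ∀ i, R.W 0 i = 0 := fun i => vR.W_eq _ _ (by simp)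
    have hW0' : ∀ i, R.W i 0 = 0 := fun i => vR.W_eq' hR _ _ (by simp)
    have hS0 : R.S 0 = 0 := vR.S_eq _ (by simp)
    have h1 : (R.pullback (extendLabel id)).W = R.extend.W := by
      funext x y
      rcases x with x | x <;> rcases y with y | y <;>
        simp [GraphexData.pullback, extend, extendLabel, hW0, hW0']
    have h2 : (R.pullback (extendLabel id)).S = R.extend.S := by
      funext x
      rcases x with x | x <;> simp [GraphexData.pullback, extend, extendLabel, hS0]
    calc R.pullback (extendLabel id) = ⟨(R.pullback (extendLabel id)).W,
          (R.pullback (extendLabel id)).S, R.I⟩ := rfl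
      _ = ⟨R.extend.W, R.extend.S, R.I⟩ := by rw [h1, h2]
      _ = R.extend := rfl
  have e₁ : (T.pullback Prod.fst).pullback q = T.extend.pullback Prod.fst := by
    rw [← e hT vT]; rfl
  have e₂ : (T'.pullback Prod.snd).pullback q = T'.extend.pullback Prod.snd := by
    rw [← e hT' vT']; rfl
  have P₁ := hT.pullback (measurable_fst (α := Fin (k + 1)) (β := Fin (k' + 1)))
  have P₂ := hT'.pullback (measurable_snd (α := Fin (k + 1)) (β := Fin (k' + 1)))
  have F₁ : (T.pullback Prod.fst).FiniteOn (γ.map q) := by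
    rw [← P₁.finiteOn_pullback hq MeasurableSet.univ vanishesOff_univ rfl, e₁]
    exact (c.finiteOn_iff hT).2 fT
  have F₂ : (T'.pullback Prod.snd).FiniteOn (γ.map q) := by
    rw [← P₂.finiteOn_pullback hq MeasurableSet.univ vanishesOff_univ rfl, e₂]
    exact (c'.finiteOn_iff hT').2 fT'
  refine ⟨γ.map q, inferInstance, fun i hi => ?_, fun j hj => ?_, F₁, F₂, ?_⟩
  · rw [Measure.map_apply hq (measurable_fst (measurableSet_singleton i)),
      ← c.measure_preimage _ (measurableSet_singleton i)]
    congr 1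
    ext ⟨x, y⟩
    rcases x with x | x <;> simp [q, extendLabel, Ne.symm hi]
  · rw [Measure.map_apply hq (measurable_snd (measurableSet_singleton j)),
      ← c'.measure_preimage _ (measurableSet_singleton j)]
    congr 1
    ext ⟨x, y⟩
    rcases y with y | y <;> simp [q, extendLabel, Ne.symm hj]
  · refine Near.of_pullback P₁ P₂ F₁ F₂ hq MeasurableSet.univ
      vanishesOff_univ vanishesOff_univ rfl ?_
    rw [e₁, e₂]
    exact hN

/-- One step of the transfer to the line. Given a labelling of the line by the cells of one step
graphex, the cells are subdivided according to a comparison measure, which gives a labelling by the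
cells of the next one. The exceptional set consists of the parts by which the two measures had to be
decreased. -/
lemma exists_refinement {k k' : ℕ} {T : GraphexData (Fin (k + 1))}
    {T' : GraphexData (Fin (k' + 1))} {m ν : Measure (Fin (k + 1))} {m' ν' : Measure (Fin (k' + 1))}
    [IsFiniteMeasure m] [IsFiniteMeasure m'] (hT : T.IsProper) (hT' : T'.IsProper)
    (fT : T.FiniteOn ν) (fT' : T'.FiniteOn ν') (vT : T.VanishesOff {0}ᶜ)
    (vT' : T'.VanishesOff {0}ᶜ) {t : ℝ≥0} (hν : IsNearlyFull m ν t) (hν' : IsNearlyFull m' ν' t)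
    {a d r : ℝ≥0∞} (h : JointNear T ν T' ν' a d r) {p : ℝ → Fin (k + 1)} (hp : Measurable p)
    (hpm : ∀ i, i ≠ 0 → volume (p ⁻¹' {i}) = m {i}) :
    ∃ (p' : ℝ → Fin (k' + 1)) (B : Set ℝ), Measurable p' ∧ MeasurableSet B ∧
      volume B ≤ 2 * t ∧ (∀ j, j ≠ 0 → volume (p' ⁻¹' {j}) = m' {j}) ∧
      (T.pullback p).Near (T'.pullback p') (volume.restrict Bᶜ) a d r := by
  classical
  have : IsFiniteMeasure ν := ⟨(hν.le _).trans_lt (measure_lt_top m _)⟩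
  have : IsFiniteMeasure ν' := ⟨(hν'.le _).trans_lt (measure_lt_top m' _)⟩
  obtain ⟨g, _, hg₁, hg₂, F₁, F₂, hN⟩ := h.exists_label_coupling hT hT' fT fT' vT vT'
  have hgfin : ∀ i j, (i, j) ≠ (0, 0) → g {(i, j)} ≠ ∞ := by
    intro i j hij
    by_cases hi : i = 0
    · have hj : j ≠ 0 := fun hj => hij (by rw [hi, hj])
      refine ne_top_of_le_ne_top (measure_ne_top ν' {j}) ?_
      rw [← hg₂ j hj]
      exact measure_mono (by simp)
    · refine ne_top_of_le_ne_top (measure_ne_top ν {i}) ?_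
      rw [← hg₁ i hi]
      exact measure_mono (by simp)
  have hgsum₁ : ∀ i, i ≠ 0 → ∑ j, g {(i, j)} = ν {i} := by
    intro i hi
    rw [← hg₁ i hi, show (Prod.fst ⁻¹' {i} : Set (Fin (k + 1) × Fin (k' + 1)))
      = ⋃ j, {(i, j)} by ext ⟨x, y⟩; simp [eq_comm],
      measure_iUnion (fun j j' hjj => by simpa using hjj) (fun _ => measurableSet_singleton _),
      tsum_fintype]
  have hgsum₂ : ∀ j, j ≠ 0 → ∑ i, g {(i, j)} = ν' {j} := by
    intro j hj
    rw [← hg₂ j hj, show (Prod.snd ⁻¹' {j} : Set (Fin (k + 1) × Fin (k' + 1)))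
      = ⋃ i, {(i, j)} by ext ⟨x, y⟩; simp [eq_comm],
      measure_iUnion (fun j j' hjj => by simpa using hjj) (fun _ => measurableSet_singleton _),
      tsum_fintype]
  -- The prescribed measures of the pieces of cell `i`. A piece carries a new label and a flag,
  -- which is `false` on the exceptional set: on the parts by which `m'` exceeds `ν'`, taken from
  -- the cell with label `0`, and on those by which `m` exceeds `ν`, where the new label is `0`. The
  -- pair `(0, true)` marks what remains of the cell.
  let A : Fin (k + 1) → Fin (k' + 1) × Bool → ℝ≥0∞ := fun i s =>
    if i = 0 then (if s.1 = 0 then 0 else if s.2 then g {(0, s.1)} else m' {s.1} - ν' {s.1})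
    else (if s.2 then (if s.1 = 0 then 0 else g {(i, s.1)})
      else if s.1 = 0 then m {i} - ν {i} else 0)
  have hAfin : ∀ i s, A i s ≠ ∞ := by
    rintro i ⟨j, b⟩
    have h1 : m' {j} - ν' {j} ≠ ∞ := ne_top_of_le_ne_top (measure_ne_top m' {j}) tsub_le_self
    have h2 : m {i} - ν {i} ≠ ∞ := ne_top_of_le_ne_top (measure_ne_top m {i}) tsub_le_self
    simp only [A]
    split_ifs with hi hj hb hb hj hj
    · simp
    · exact hgfin 0 j (by simp [hj])
    · exact h1
    · simp
    · exact hgfin i j (by simp [hi])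
    · exact h2
    · simp
  have hνm : ∀ i, ν {i} + (m {i} - ν {i}) = m {i} := fun i => add_tsub_cancel_of_le (hν.le _)
  have hνm' : ∀ i, ν' {i} + (m' {i} - ν' {i}) = m' {i} := fun i => add_tsub_cancel_of_le (hν'.le _)
  have hAsum : ∀ i, i ≠ 0 → g {(i, 0)} + ∑ s, A i s = m {i} := by
    intro i hi
    have h1 := hνm i
    obtain ⟨e, he⟩ : ∃ e, m {i} - ν {i} = e := ⟨_, rfl⟩
    rw [he] at h1
    rw [Fintype.sum_prod_type, Fin.sum_univ_succ]
    simp only [Fintype.sum_bool, A, hi, if_false, if_true, Bool.false_eq_true, Fin.succ_ne_zero,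
      zero_add, add_zero]
    rw [he, ← h1, ← hgsum₁ i hi, Fin.sum_univ_succ]
    ring
  have hAle : ∀ i, ∑ s, A i s ≤ volume (p ⁻¹' {i}) := by
    intro i
    by_cases hi : i = 0
    · have htop : volume (p ⁻¹' {0}) = ∞ := by
        by_contra hne
        have : volume (Set.univ : Set ℝ) ≠ ∞ := by
          rw [← Set.preimage_univ (f := p), ← Set.iUnion_of_singleton, Set.preimage_iUnion]
          refine ((measure_iUnion_fintype_le _ _).trans_lt (ENNReal.sum_lt_top.2 fun i _ => ?_)).ne
          by_cases hi : i = 0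
          · rw [hi]; exact lt_top_iff_ne_top.2 hne
          · rw [hpm i hi]; exact measure_lt_top m _
        exact this Real.volume_univ
      rw [hi, htop]
      exact le_top
    · rw [hpm i hi, ← hAsum i hi]
      exact le_add_self
  choose q hq hqA using fun i => exists_subdivision ((0, true) : Fin (k' + 1) × Bool)
    (hp (measurableSet_singleton i)) (hAfin i) (hAle i)
  let Q : ℝ → Fin (k' + 1) × Bool := fun x => q (p x) x
  have hQ : Measurable Q := by
    have : Measurable (uncurry fun (x : ℝ) (i : Fin (k + 1)) => q i x) :=
      measurable_from_prod_countable_left fun i => hq i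
    exact this.comp (measurable_id.prodMk hp)
  have hcell : ∀ i (s : Fin (k' + 1) × Bool), s ≠ (0, true) →
      volume (p ⁻¹' {i} ∩ Q ⁻¹' {s}) = A i s := by
    intro i s hs
    rw [← hqA i s hs]
    congr 1
    ext x
    simp only [Set.mem_inter_iff, Set.mem_preimage, Set.mem_singleton_iff, Q]
    exact and_congr_right fun h => by rw [h]
  have hmeasc : ∀ i (s : Fin (k' + 1) × Bool), MeasurableSet (p ⁻¹' {i} ∩ Q ⁻¹' {s}) := fun i s =>
    (hp (measurableSet_singleton i)).inter (hQ (measurableSet_singleton s))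
  have hpart : ∀ (s : Fin (k' + 1) × Bool),
      volume (Q ⁻¹' {s}) = ∑ i, volume (p ⁻¹' {i} ∩ Q ⁻¹' {s}) := by
    intro s
    have h1 := lintegral_eq_sum_preimage (volume.restrict (Q ⁻¹' {s})) hp fun _ => 1
    simp only [lintegral_one, Measure.restrict_apply_univ] at h1
    rw [h1]
    exact Finset.sum_congr rfl fun i _ => by
      rw [Measure.restrict_apply (hp (measurableSet_singleton i))]
  have hpart' : ∀ i, volume (p ⁻¹' {i}) = ∑ s, volume (p ⁻¹' {i} ∩ Q ⁻¹' {s}) := by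
    intro i
    have h1 := lintegral_eq_sum_preimage (volume.restrict (p ⁻¹' {i})) hQ fun _ => 1
    simp only [lintegral_one, Measure.restrict_apply_univ] at h1
    rw [h1]
    exact Finset.sum_congr rfl fun s _ => by
      rw [Measure.restrict_apply (hQ (measurableSet_singleton s)), Set.inter_comm]
  -- The rest of a cell of finite mass is what the comparison measure couples with label `0`.
  have hrest : ∀ i, i ≠ 0 → volume (p ⁻¹' {i} ∩ Q ⁻¹' {(0, true)}) = g {(i, 0)} := by
    intro i hi
    have h1 := hpart' i
    have h4 : ∑ s, A i s = A i (0, true) + ∑ s ∈ Finset.univ.erase (0, true), A i s :=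
      (Finset.add_sum_erase _ _ (Finset.mem_univ _)).symm
    rw [hpm i hi, ← hAsum i hi, h4,
      ← Finset.add_sum_erase _ _ (Finset.mem_univ ((0, true) : Fin (k' + 1) × Bool))] at h1
    have h2 : ∑ s ∈ Finset.univ.erase ((0, true) : Fin (k' + 1) × Bool),
        volume (p ⁻¹' {i} ∩ Q ⁻¹' {s})
        = ∑ s ∈ Finset.univ.erase ((0, true) : Fin (k' + 1) × Bool), A i s :=
      Finset.sum_congr rfl fun s hs => hcell i s (Finset.ne_of_mem_erase hs)
    have h3 : A i (0, true) = 0 := by simp [A]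
    rw [h2, h3, zero_add] at h1
    exact ((ENNReal.add_left_inj
      (ENNReal.sum_lt_top.2 fun s _ => (hAfin i s).lt_top).ne).1 h1).symm
  have hQb : ∀ b, MeasurableSet {x | (Q x).2 = b} := fun b =>
    (measurable_snd.comp hQ) (measurableSet_singleton b)
  have hsumle : ∀ {n : ℕ} {M N : Measure (Fin (n + 1))} [IsFiniteMeasure M],
      IsNearlyFull M N t → ∑ i, (M {i} - N {i}) ≤ t := by
    intro n M N _ hMN
    have : IsFiniteMeasure N := ⟨(hMN.le _).trans_lt (measure_lt_top M _)⟩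
    have h1 : ∑ i, (M {i} - N {i}) + ∑ i, N {i} = ∑ i, M {i} := by
      rw [← Finset.sum_add_distrib]
      exact Finset.sum_congr rfl fun i _ => tsub_add_cancel_of_le (hMN.le _)
    have h2 : ∀ K : Measure (Fin (n + 1)), ∑ i, K {i} = K Set.univ := fun K => by
      rw [sum_measure_singleton, Finset.coe_univ]
    rw [h2, h2] at h1
    have h3 := (hMN Set.univ MeasurableSet.univ).1
    rw [← h1, add_comm] at h3
    exact (ENNReal.add_le_add_iff_left (measure_ne_top N _)).1 h3
  refine ⟨fun x => (Q x).1, {x | (Q x).2 = false}, measurable_fst.comp hQ, hQb _, ?_, ?_, ?_⟩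
  · have hB : {x | (Q x).2 = false} = ⋃ j, Q ⁻¹' {(j, false)} := by
      ext x
      simp [Prod.ext_iff]
    rw [hB]
    refine (measure_iUnion_fintype_le _ _).trans ?_
    have h1 : ∀ j, volume (Q ⁻¹' {(j, false)}) =
        (if j = 0 then 0 else m' {j} - ν' {j}) +
          ∑ i : Fin k, if j = 0 then m {i.succ} - ν {i.succ} else 0 := by
      intro j
      rw [hpart, Fin.sum_univ_succ, hcell _ _ (by simp)]
      congr 1
      refine Finset.sum_congr rfl fun i _ => ?_
      rw [hcell _ _ (by simp)]
      simp [A]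
    simp_rw [h1]
    rw [Finset.sum_add_distrib, two_mul]
    refine add_le_add (le_trans (Finset.sum_le_sum fun j _ => ?_) (hsumle hν')) ?_
    · split_ifs
      · exact zero_le
      · exact le_rfl
    · rw [Fin.sum_univ_succ]
      simp only [if_true, Fin.succ_ne_zero, if_false, Finset.sum_const_zero, add_zero]
      refine le_trans ?_ (hsumle hν)
      rw [Fin.sum_univ_succ (n := k)]
      exact le_add_self
  · intro j hj
    have hU : (fun x => (Q x).1) ⁻¹' {j} = Q ⁻¹' {(j, true)} ∪ Q ⁻¹' {(j, false)} := by
      ext x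
      simp only [Set.mem_preimage, Set.mem_singleton_iff, Set.mem_union, Prod.ext_iff]
      cases (Q x).2 <;> simp
    rw [hU, measure_union (Set.disjoint_left.2 fun x hx hx' => by
      have : ((j, true) : Fin (k' + 1) × Bool) = (j, false) := hx.symm.trans hx'
      simp at this) (hQ (measurableSet_singleton _)), hpart, hpart]
    have h1 := hνm' j
    obtain ⟨e, he⟩ : ∃ e, m' {j} - ν' {j} = e := ⟨_, rfl⟩
    rw [he] at h1
    rw [← h1, ← hgsum₂ j hj]
    congr 1
    · refine Finset.sum_congr rfl fun i _ => ?_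
      rw [hcell _ _ (by simp [hj])]
      by_cases hi : i = 0 <;> simp [A, hi, hj]
    · rw [Fin.sum_univ_succ, hcell _ _ (by simp)]
      rw [Finset.sum_eq_zero fun i _ => by rw [hcell _ _ (by simp)]; simp [A, hj]]
      simp [A, hj, he]
  · have hQ1 : Measurable fun x => (p x, (Q x).1) := hp.prodMk (measurable_fst.comp hQ)
    have P₁ := hT.pullback (measurable_fst (α := Fin (k + 1)) (β := Fin (k' + 1)))
    have P₂ := hT'.pullback (measurable_snd (α := Fin (k + 1)) (β := Fin (k' + 1)))
    refine hN.pullback P₁ P₂ F₁ F₂ (q := fun x => (p x, (Q x).1)) hQ1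
      (Z := {((0 : Fin (k + 1)), (0 : Fin (k' + 1)))}ᶜ) (measurableSet_singleton _).compl ?_ ?_ ?_
    · refine ⟨fun x y hx => ?_, fun x hx => ?_⟩
      · simp only [Set.mem_compl_iff, Set.mem_singleton_iff, not_not] at hx
        exact vT.W_eq _ _ (by simp [hx])
      · simp only [Set.mem_compl_iff, Set.mem_singleton_iff, not_not] at hx
        exact vT.S_eq _ (by simp [hx])
    · refine ⟨fun x y hx => ?_, fun x hx => ?_⟩
      · simp only [Set.mem_compl_iff, Set.mem_singleton_iff, not_not] at hx
        exact vT'.W_eq _ _ (by simp [hx])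
      · simp only [Set.mem_compl_iff, Set.mem_singleton_iff, not_not] at hx
        exact vT'.S_eq _ (by simp [hx])
    · refine Measure.ext_of_singleton fun z => ?_
      obtain ⟨i, j⟩ := z
      rw [Measure.restrict_apply (measurableSet_singleton _),
        Measure.restrict_apply (measurableSet_singleton _)]
      by_cases hij : (i, j) = (0, 0)
      · rw [hij]; simp
      · rw [Set.inter_eq_left.2 (by simpa using Ne.symm hij),
          Measure.map_apply hQ1 (measurableSet_singleton _),
          Measure.restrict_apply (hQ1 (measurableSet_singleton _))]
        have hset : (fun x => (p x, (Q x).1)) ⁻¹' {(i, j)} ∩ {x | (Q x).2 = false}ᶜ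
            = p ⁻¹' {i} ∩ Q ⁻¹' {(j, true)} := by
          ext x
          simp only [Set.mem_inter_iff, Set.mem_preimage, Set.mem_singleton_iff,
            Set.mem_compl_iff, Set.mem_ofPred_eq, Prod.ext_iff, Bool.not_eq_false, and_assoc]
        rw [hset]
        by_cases hj : j = 0
        · subst hj
          exact hrest i fun hi => hij (by rw [hi])
        · rw [hcell _ _ (by simp [hj])]
          by_cases hi : i = 0 <;> simp [A, hi, hj]

end GraphexData

end Transfer

/-! ### Limits in the sense of convex combinations -/

section WeakLimit

/-- A bounded sequence in a Hilbert space has a limit point in the sense of convex combinations: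
the minimizers of the norm on the closed convex hulls of the tails converge. -/
lemma exists_forall_mem_closure_convexHull {H : Type*} [NormedAddCommGroup H]
    [InnerProductSpace ℝ H] [CompleteSpace H] {x : ℕ → H} {R : ℝ} (hR : ∀ n, ‖x n‖ ≤ R) :
    ∃ v, ∀ m, v ∈ closure (convexHull ℝ (x '' Set.Ici m)) := by
  let K : ℕ → Set H := fun m => closure (convexHull ℝ (x '' Set.Ici m))
  have hK : ∀ m, Convex ℝ (K m) := fun m => (convex_convexHull ℝ _).closure
  have hx : ∀ m n, m ≤ n → x n ∈ K m := fun m n h =>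
    subset_closure (subset_convexHull ℝ _ ⟨n, h, rfl⟩)
  have hanti : ∀ m n, m ≤ n → K n ⊆ K m := fun m n h =>
    closure_mono (convexHull_mono (Set.image_mono (Set.Ici_subset_Ici.2 h)))
  have hmin : ∀ m, ∃ v ∈ K m, ∀ w ∈ K m, ‖v‖ ≤ ‖w‖ := by
    intro m
    obtain ⟨v, hv, h⟩ := exists_norm_eq_iInf_of_complete_convex ⟨x m, hx m m le_rfl⟩
      isClosed_closure.isComplete (hK m) 0
    refine ⟨v, hv, fun w hw => ?_⟩
    rw [zero_sub, norm_neg] at h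
    rw [h]
    refine (ciInf_le ⟨0, Set.forall_mem_range.2 fun _ => norm_nonneg _⟩
      (⟨w, hw⟩ : K m)).trans (le_of_eq ?_)
    simp
  choose v hv hvmin using hmin
  have hmono : Monotone fun m => ‖v m‖ ^ 2 := fun m n h =>
    pow_le_pow_left₀ (norm_nonneg _) (hvmin m _ (hanti m n h (hv n))) 2
  have hbdd : BddAbove (Set.range fun m => ‖v m‖ ^ 2) := by
    refine ⟨R ^ 2, Set.forall_mem_range.2 fun m => ?_⟩
    exact pow_le_pow_left₀ (norm_nonneg _) ((hvmin m _ (hx m m le_rfl)).trans (hR m)) 2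
  have hlim := tendsto_atTop_ciSup hmono hbdd
  set L := ⨆ m, ‖v m‖ ^ 2 with hL
  have hdist : ∀ m n, m ≤ n → dist (v m) (v n) ≤ √(2 * (L - ‖v m‖ ^ 2)) := by
    intro m n h
    refine Real.le_sqrt_of_sq_le ?_
    have h1 := parallelogram_law_with_norm ℝ (v m) (v n)
    have h2 : ‖v m‖ ≤ ‖(1 / 2 : ℝ) • v m + (1 / 2 : ℝ) • v n‖ :=
      hvmin m _ (hK m (hv m) (hanti m n h (hv n)) (by norm_num) (by norm_num) (by norm_num))
    rw [← smul_add, norm_smul, Real.norm_of_nonneg (by norm_num)] at h2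
    have h3 : ‖v n‖ ^ 2 ≤ L := le_ciSup hbdd n
    rw [dist_eq_norm]
    nlinarith [norm_nonneg (v m), norm_nonneg (v m + v n)]
  have hcau : CauchySeq v := by
    refine cauchySeq_of_le_tendsto_0' _ hdist ?_
    have : Tendsto (fun m => √(2 * (L - ‖v m‖ ^ 2))) atTop (𝓝 √(2 * (L - L))) :=
      (Real.continuous_sqrt.tendsto _).comp ((tendsto_const_nhds.sub hlim).const_mul 2)
    simpa using this
  obtain ⟨w, hw⟩ := cauchySeq_tendsto_of_complete hcau
  exact ⟨w, fun m => isClosed_closure.mem_of_tendsto hw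
    ((eventually_ge_atTop m).mono fun n hn => hanti m n hn (hv n))⟩

variable {X : Type*} [MeasurableSpace X] {μ : Measure X}

/-- A sequence of symmetric kernels with values in `[0, 1]` has convex combinations of its tails
which converge almost everywhere to a kernel of the same type. -/
lemma exists_convexHull_tendsto [SFinite μ] {W : ℕ → X → X → ℝ}
    (hW : ∀ n, Measurable (uncurry (W n))) (h01 : ∀ n x y, W n x y ∈ Set.Icc (0 : ℝ) 1)
    (hsymm : ∀ n x y, W n x y = W n y x) :
    ∃ (V : ℕ → X → X → ℝ) (U : X → X → ℝ), (∀ m, V m ∈ convexHull ℝ (W '' Set.Ici m)) ∧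
      Measurable (uncurry U) ∧ (∀ x y, U x y ∈ Set.Icc (0 : ℝ) 1) ∧ (∀ x y, U x y = U y x) ∧
      ∀ᵐ p ∂(μ.prod μ), Tendsto (fun m => V m p.1 p.2) atTop (𝓝 (U p.1 p.2)) := by
  -- An equivalent finite measure makes bounded kernels square integrable.
  let ω := μ.toFinite
  have hmem : ∀ n, MemLp (uncurry (W n)) 2 (ω.prod ω) := fun n => by
    refine MemLp.of_bound (hW n).aestronglyMeasurable 1 (ae_of_all _ fun p => ?_)
    have := h01 n p.1 p.2
    rw [Real.norm_eq_abs, abs_le]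
    exact ⟨by simpa [uncurry] using (by linarith [this.1] : -1 ≤ W n p.1 p.2), this.2⟩
  let x : ℕ → Lp ℝ 2 (ω.prod ω) := fun n => (hmem n).toLp
  have hbd : ∀ n, ‖x n‖ ≤ ((ω.prod ω) Set.univ).toReal ^ (1 / 2 : ℝ) * 1 := by
    intro n
    have h1 := Lp.norm_le_of_ae_bound (f := x n) (C := 1) zero_le_one (by
      filter_upwards [(hmem n).coeFn_toLp] with p hp
      rw [hp, Real.norm_eq_abs, abs_le]
      have := h01 n p.1 p.2
      exact ⟨by simpa [uncurry] using (by linarith [this.1] : -1 ≤ W n p.1 p.2), this.2⟩)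
    refine h1.trans (le_of_eq ?_)
    simp [measureUnivNNReal]
    rfl
  obtain ⟨v, hv⟩ := exists_forall_mem_closure_convexHull hbd
  have hrep : ∀ m, ∀ h ∈ convexHull ℝ (x '' Set.Ici m),
      ∃ f ∈ convexHull ℝ (W '' Set.Ici m), h =ᵐ[ω.prod ω] uncurry f := by
    intro m
    refine fun h hh => convexHull_min (t := {h : Lp ℝ 2 (ω.prod ω) |
      ∃ f ∈ convexHull ℝ (W '' Set.Ici m), h =ᵐ[ω.prod ω] uncurry f}) ?_ ?_ hh
    · rintro _ ⟨n, hn, rfl⟩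
      exact ⟨W n, subset_convexHull ℝ _ ⟨n, hn, rfl⟩, (hmem n).coeFn_toLp⟩
    · rintro h₁ ⟨f₁, hf₁, e₁⟩ h₂ ⟨f₂, hf₂, e₂⟩ a b ha hb hab
      refine ⟨a • f₁ + b • f₂, convex_convexHull ℝ _ hf₁ hf₂ ha hb hab, ?_⟩
      filter_upwards [Lp.coeFn_add (a • h₁) (b • h₂), Lp.coeFn_smul a h₁, Lp.coeFn_smul b h₂,
        e₁, e₂]
        with p hp hp₁ hp₂ q₁ q₂
      rw [hp, Pi.add_apply, hp₁, hp₂, Pi.smul_apply, Pi.smul_apply, q₁, q₂]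
      simp [uncurry]
  have hV : ∀ m : ℕ, ∃ f ∈ convexHull ℝ (W '' Set.Ici m),
      eLpNorm (uncurry f - ⇑v) 2 (ω.prod ω) ≤ ENNReal.ofReal (1 / (m + 1)) := by
    intro m
    obtain ⟨h, hh, hd⟩ := Metric.mem_closure_iff.1 (hv m) (1 / ((m : ℝ) + 1)) (by positivity)
    obtain ⟨f, hf, e⟩ := hrep m h hh
    refine ⟨f, hf, ?_⟩
    rw [dist_comm, Lp.dist_def] at hd
    rw [← eLpNorm_congr_ae (e.sub (EventuallyEq.refl _ v))]
    refine (ENNReal.le_ofReal_iff_toReal_le ?_ (by positivity)).2 hd.le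
    rw [← eLpNorm_congr_ae (Lp.coeFn_sub h v)]
    exact (Lp.eLpNorm_lt_top _).ne
  choose V hVc hVv using hV
  have hVP : ∀ m, Measurable (uncurry (V m)) ∧ (∀ x y, V m x y ∈ Set.Icc (0 : ℝ) 1) ∧
      ∀ x y, V m x y = V m y x := by
    intro m
    refine convexHull_min (t := {f : X → X → ℝ | Measurable (uncurry f) ∧
      (∀ x y, f x y ∈ Set.Icc (0 : ℝ) 1) ∧ ∀ x y, f x y = f y x}) ?_ ?_ (hVc m)
    · rintro _ ⟨n, -, rfl⟩
      exact ⟨hW n, h01 n, hsymm n⟩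
    · rintro f ⟨f1, f2, f3⟩ g ⟨g1, g2, g3⟩ a b ha hb hab
      refine ⟨(f1.const_mul a).add (g1.const_mul b), fun x y => ?_, fun x y => ?_⟩
      · exact convex_Icc (0 : ℝ) 1 (f2 x y) (g2 x y) ha hb hab
      · simp only [Pi.add_apply, Pi.smul_apply, f3 x y, g3 x y]
  have hlim : Tendsto (fun m => eLpNorm (uncurry (V m) - ⇑v) 2 (ω.prod ω)) atTop (𝓝 0) := by
    refine tendsto_of_tendsto_of_tendsto_of_le_of_le tendsto_const_nhds ?_ (fun _ => zero_le) hVv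
    have := ENNReal.tendsto_ofReal (tendsto_one_div_add_atTop_nhds_zero_nat (𝕜 := ℝ))
    simpa using this
  obtain ⟨ns, hns, hae⟩ := (tendstoInMeasure_of_tendsto_eLpNorm two_ne_zero
    (fun m => (hVP m).1.aestronglyMeasurable) (Lp.aestronglyMeasurable v)
    hlim).exists_seq_tendsto_ae
  have hbb : ∀ x y, IsBoundedUnder (· ≤ ·) atTop fun m => V (ns m) x y := fun x y =>
    isBoundedUnder_of ⟨1, fun m => ((hVP (ns m)).2.1 x y).2⟩
  have hbc : ∀ x y, IsBoundedUnder (· ≥ ·) atTop fun m => V (ns m) x y := fun x y =>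
    isBoundedUnder_of ⟨0, fun m => ((hVP (ns m)).2.1 x y).1⟩
  -- The upper limit is measurable, symmetric and bounded everywhere, not only almost everywhere.
  refine ⟨fun m => V (ns m), fun x y => limsup (fun m => V (ns m) x y) atTop, fun m => ?_, ?_,
    fun x y => ⟨?_, ?_⟩, fun x y => ?_, ?_⟩
  · exact convexHull_mono (Set.image_mono (Set.Ici_subset_Ici.2 (hns.id_le m))) (hVc (ns m))
  · exact Measurable.limsup fun m => (hVP (ns m)).1
  · exact le_limsup_of_frequently_le (Frequently.of_forall fun m => ((hVP (ns m)).2.1 x y).1)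
      (hbb x y)
  · exact limsup_le_of_le (hbc x y).isCoboundedUnder_le
      (Eventually.of_forall fun m => ((hVP (ns m)).2.1 x y).2)
  · simp only [fun m => (hVP (ns m)).2.2 x y]
  · have hac : μ.prod μ ≪ ω.prod ω :=
      (absolutelyContinuous_toFinite μ).prod (absolutelyContinuous_toFinite μ)
    filter_upwards [hac.ae_le hae] with p hp
    have hp' : Tendsto (fun m => V (ns m) p.1 p.2) atTop (𝓝 (v p)) := hp
    rwa [hp'.limsup_eq]

/-- Lower semicontinuity of the kernel norm under bounded convergence almost everywhere. -/
lemma kernelNorm_le_of_tendsto [SigmaFinite μ] {U : X → X → ℝ} {V : ℕ → X → X → ℝ} {R : ℝ}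
    (hV : ∀ m, Measurable (uncurry (V m))) (hU : Measurable (uncurry U))
    (hR : ∀ m x y, |V m x y| ≤ R)
    (hlim : ∀ᵐ p ∂(μ.prod μ), Tendsto (fun m => V m p.1 p.2) atTop (𝓝 (U p.1 p.2)))
    {c : ℝ≥0∞} (hc : ∀ᶠ m in atTop, kernelNorm (V m) μ ≤ c) : kernelNorm U μ ≤ c := by
  refine kernelNorm_le fun g hgm hg => ?_
  have hlim' : ∀ᵐ x ∂μ, ∀ᵐ y ∂μ, Tendsto (fun m => V m x y) atTop (𝓝 (U x y)) :=
    Measure.ae_ae_of_ae_prod hlim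
  -- Test functions supported on sets of finite measure are integrable, so that dominated
  -- convergence applies.
  let F := spanningSets μ
  let G : ℕ → X → ℝ := fun j => (F j).indicator g
  have hF : ∀ j, MeasurableSet (F j) := measurableSet_spanningSets μ
  have hGm : ∀ j, Measurable (G j) := fun j => hgm.indicator (hF j)
  have hG2 : ∀ j, MemLp (G j) 2 μ := fun j => hg.indicator (hF j)
  have hGn : ∀ j, eLpNorm (G j) 2 μ ≤ eLpNorm g 2 μ := fun j => eLpNorm_indicator_le g
  have hG1 : ∀ j, Integrable (G j) μ := fun j => by
    rw [integrable_indicator_iff (hF j)]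
    have : IsFiniteMeasure (μ.restrict (F j)) := ⟨by simpa using measure_spanningSets_lt_top μ j⟩
    exact (hg.restrict (F j)).integrable one_le_two
  have h1 : ∀ j, eLpNorm (fun x => ∫ y, U x y * G j y ∂μ) 2 μ ≤ c * eLpNorm g 2 μ := by
    intro j
    have ht : ∀ᵐ x ∂μ, Tendsto (fun m => ∫ y, V m x y * G j y ∂μ) atTop
        (𝓝 (∫ y, U x y * G j y ∂μ)) := by
      filter_upwards [hlim'] with x hx
      refine tendsto_integral_of_dominated_convergence (fun y => R * |G j y|) (fun m => ?_)
        ((hG1 j).abs.const_mul R) (fun m => ae_of_all _ fun y => ?_) ?_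
      · exact (((hV m).of_uncurry_left (x := x)).mul (hGm j)).aestronglyMeasurable
      · rw [Real.norm_eq_abs, abs_mul]
        exact mul_le_mul_of_nonneg_right (hR m x y) (abs_nonneg _)
      · filter_upwards [hx] with y hy
        exact hy.mul_const _
    refine (Lp.eLpNorm_lim_le_liminf_eLpNorm (fun m =>
      (measurable_integral_kernel_mul (hV m) (hGm j)).aestronglyMeasurable) _ ht).trans ?_
    refine liminf_le_of_frequently_le' (hc.mono fun m hm => ?_).frequently
    exact (eLpNorm_kernel_le (hG2 j)).trans (mul_le_mul' hm (hGn j))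
  let E : Set X := {x | Integrable (fun y => U x y * g y) μ}
  have hE : MeasurableSet E := measurableSet_integrable
    (hU.mul (hgm.comp measurable_snd)).stronglyMeasurable
  have ht : ∀ x, Tendsto (fun j => E.indicator (fun x => ∫ y, U x y * G j y ∂μ) x) atTop
      (𝓝 (∫ y, U x y * g y ∂μ)) := by
    intro x
    by_cases hx : x ∈ E
    · simp only [Set.indicator_of_mem hx]
      refine tendsto_integral_of_dominated_convergence (fun y => |U x y * g y|) (fun j => ?_)
        (Integrable.abs hx) (fun j => ae_of_all _ fun y => ?_) (ae_of_all _ fun y => ?_)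
      · exact ((hU.of_uncurry_left (x := x)).mul (hGm j)).aestronglyMeasurable
      · rw [Real.norm_eq_abs, abs_mul, abs_mul]
        refine mul_le_mul_of_nonneg_left ?_ (abs_nonneg _)
        by_cases hy : y ∈ F j <;> simp [G, hy]
      · refine tendsto_const_nhds.congr' ?_
        have hy : y ∈ ⋃ j, F j := by rw [iUnion_spanningSets]; trivial
        obtain ⟨j₀, hj₀⟩ := Set.mem_iUnion.1 hy
        filter_upwards [eventually_ge_atTop j₀] with j hj
        have hjy : y ∈ F j := monotone_spanningSets μ hj hj₀
        simp [G, hjy]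
    · simp only [Set.indicator_of_notMem hx]
      rw [integral_undef hx]
      exact tendsto_const_nhds
  refine (Lp.eLpNorm_lim_le_liminf_eLpNorm (fun j =>
    ((measurable_integral_kernel_mul hU (hGm j)).indicator hE).aestronglyMeasurable) _
    (ae_of_all _ ht)).trans ?_
  refine liminf_le_of_frequently_le' (Frequently.of_forall fun j => ?_)
  exact (eLpNorm_indicator_le _).trans (h1 j)

/-- An `L²` limit that is also a limit almost everywhere, for sequences that are Cauchy at a
summable rate. -/
lemma exists_ae_tendsto_of_cauchy_eLpNorm {f : ℕ → X → ℝ} (hf : ∀ n, Measurable (f n))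
    {b : ℕ → ℝ≥0∞} (hb : ∑' n, b n ≠ ∞) {N : ℕ}
    (h : ∀ n m, N ≤ n → n ≤ m → eLpNorm (fun x => f n x - f m x) 2 μ ≤ b n) :
    ∃ F : X → ℝ, Measurable F ∧ (∀ᵐ x ∂μ, Tendsto (fun n => f n x) atTop (𝓝 (F x))) ∧
      ∀ n, N ≤ n → eLpNorm (fun x => f n x - F x) 2 μ ≤ b n := by
  have hB : ∑' n, (b (n + N) + (b (n + N) + 2⁻¹ ^ n)) ≠ ∞ := by
    have h1 : ∑' n, b (n + N) ≠ ∞ := ne_top_of_le_ne_top hb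
      (ENNReal.tsum_comp_le_tsum_of_injective (add_left_injective N) b)
    rw [ENNReal.tsum_add, ENNReal.tsum_add, ENNReal.tsum_geometric]
    simp only [ENNReal.one_sub_inv_two, inv_inv, ne_eq, ENNReal.add_eq_top, h1, false_or]
    exact ENNReal.ofNat_ne_top
  have hsub : ∀ n m, eLpNorm (fun x => f n x - f m x) 2 μ =
      eLpNorm (fun x => f m x - f n x) 2 μ := by
    intro n m
    rw [← eLpNorm_neg]
    congr 1
    funext x
    simp
  have hae := Lp.ae_tendsto_of_cauchy_eLpNorm (f := fun n => f (n + N)) (μ := μ) (p := 2)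
    (fun n => (hf _).aestronglyMeasurable) one_le_two hB fun K n m hn hm => by
      have e : f (n + N) - f (m + N) = (fun x => f (n + N) x - f (K + N) x)
          + fun x => f (K + N) x - f (m + N) x := by
        funext x; simp
      rw [e]
      refine (eLpNorm_add_le ((hf _).sub (hf _)).aestronglyMeasurable
        ((hf _).sub (hf _)).aestronglyMeasurable one_le_two).trans_lt ?_
      have hbf : b (K + N) ≠ ∞ := fun h => hb (ENNReal.tsum_eq_top_of_eq_top ⟨_, h⟩)
      refine ENNReal.add_lt_add_of_le_of_lt ?_ ?_ ?_
      · exact ne_top_of_le_ne_top hbf ((hsub _ _).trans_le (h _ _ (by omega) (by omega)))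
      · exact (hsub _ _).trans_le (h _ _ (by omega) (by omega))
      · refine (h _ _ (by omega) (by omega)).trans_lt (ENNReal.lt_add_right hbf ?_)
        simp
  obtain ⟨F, hF, hlim⟩ := measurable_limit_of_tendsto_metrizable_ae
    (fun n => (hf (n + N)).aemeasurable) hae
  have hlim' : ∀ᵐ x ∂μ, Tendsto (fun n => f n x) atTop (𝓝 (F x)) := by
    filter_upwards [hlim] with x hx
    exact (tendsto_add_atTop_iff_nat N).1 hx
  refine ⟨F, hF, hlim', fun n hn => ?_⟩
  refine (Lp.eLpNorm_lim_le_liminf_eLpNorm (f := fun m x => f n x - f m x)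
    (fun m => ((hf n).sub (hf m)).aestronglyMeasurable) _
    (hlim'.mono fun x hx => tendsto_const_nhds.sub hx)).trans ?_
  exact liminf_le_of_frequently_le'
    ((eventually_ge_atTop n).mono fun m hm => h n m hn hm).frequently

end WeakLimit

/-! ### Limits of the three components -/

namespace GraphexData

section Limit

variable {X : Type*} [MeasurableSpace X] {μ : Measure X}

/-- A sequence of data in `L¹ ∩ L²` on one measure space which is a Cauchy sequence, at the summable
rate `b`, on each member of an increasing sequence of sets whose union has null complement. -/
structure IsLocallyCauchy (A : ℕ → GraphexData X) (μ : Measure X) (G : ℕ → Set X)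
    (b : ℕ → ℝ≥0∞) : Prop where
  proper : ∀ n, (A n).IsProper
  finiteOn : ∀ n, (A n).FiniteOn μ
  measurableSet : ∀ N, MeasurableSet (G N)
  monotone : Monotone G
  measure_compl : ∀ N, μ (G N)ᶜ ≠ ∞
  measure_compl_iUnion : μ (⋃ N, G N)ᶜ = 0
  tsum_ne_top : ∑' n, b n ≠ ∞
  near : ∀ N n m, N ≤ n → n ≤ m → (A n).Near (A m) (μ.restrict (G N)) (b n) (b n) (b n)

variable {A : ℕ → GraphexData X} {G : ℕ → Set X} {b : ℕ → ℝ≥0∞}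

namespace IsLocallyCauchy

lemma finiteOn_restrict (h : IsLocallyCauchy A μ G b) (n N : ℕ) :
    (A n).FiniteOn (μ.restrict (G N)) :=
  (h.finiteOn n).mono (h.proper n) Measure.restrict_le_self

lemma tendsto_rate (h : IsLocallyCauchy A μ G b) : Tendsto b atTop (𝓝 0) :=
  ENNReal.tendsto_atTop_zero_of_tsum_ne_top h.tsum_ne_top

/-- The kernel norm is convex, so the Cauchy property extends to convex combinations of tails. -/
lemma isL2Kernel_of_mem_convexHull [SFinite μ] (h : IsLocallyCauchy A μ G b) {N n m : ℕ}
    (hN : N ≤ n) (hn : n ≤ m) {f : X → X → ℝ}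
    (hf : f ∈ convexHull ℝ ((fun k => (A k).W) '' Set.Ici m)) :
    IsL2Kernel f (μ.restrict (G N)) ∧
      kernelNorm (fun x y => (A n).W x y - f x y) (μ.restrict (G N)) ≤ b n := by
  refine convexHull_min (t := {f | IsL2Kernel f (μ.restrict (G N)) ∧
    kernelNorm (fun x y => (A n).W x y - f x y) (μ.restrict (G N)) ≤ b n}) ?_ ?_ hf
  · rintro _ ⟨k, hk, rfl⟩
    exact ⟨(h.finiteOn_restrict k N).isL2Kernel (h.proper k), (h.near N n k hN (hn.trans hk)).1⟩
  · rintro f ⟨f1, f2⟩ g ⟨g1, g2⟩ s t hs ht hst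
    have hc : ∀ (c : ℝ) {u : X → X → ℝ}, IsL2Kernel u (μ.restrict (G N)) →
        IsL2Kernel (fun x y => c * u x y) (μ.restrict (G N)) := by
      intro c u hu
      refine ⟨hu.measurable.const_mul c, ?_⟩
      have e : ∀ x, ∫⁻ y, ‖c * u x y‖ₑ ^ 2 ∂(μ.restrict (G N))
          = ‖c‖ₑ ^ 2 * ∫⁻ y, ‖u x y‖ₑ ^ 2 ∂(μ.restrict (G N)) := fun x => by
        rw [← lintegral_const_mul _ ((hu.measurable_section x).enorm.pow_const 2)]
        simp only [enorm_mul, mul_pow]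
      simp only [e]
      rw [lintegral_const_mul' _ _ (by simp)]
      exact ENNReal.mul_ne_top (by simp) hu.lintegral_sq
    refine ⟨(hc s f1).add (hc t g1), ?_⟩
    have hW := (h.finiteOn_restrict n N).isL2Kernel (h.proper n)
    have e : (fun x y => (A n).W x y - (s • f + t • g) x y) = fun x y =>
        s * ((A n).W x y - f x y) + t * ((A n).W x y - g x y) := by
      funext x y
      simp only [Pi.add_apply, Pi.smul_apply, smul_eq_mul]
      linear_combination (-(A n).W x y) * hst
    rw [e]
    refine (kernelNorm_add_le (hc s (hW.sub f1)) (hc t (hW.sub g1))).trans ?_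
    calc _ ≤ ‖s‖ₑ * b n + ‖t‖ₑ * b n := add_le_add
          ((kernelNorm_const_mul s).trans (mul_le_mul_right f2 _))
          ((kernelNorm_const_mul t).trans (mul_le_mul_right g2 _))
      _ = b n := by
        rw [← add_mul, Real.enorm_of_nonneg hs, Real.enorm_of_nonneg ht, ← ENNReal.ofReal_add hs ht,
          hst, ENNReal.ofReal_one, one_mul]

/-- The graphon part of the limit. -/
lemma exists_limit_W [SigmaFinite μ] (h : IsLocallyCauchy A μ G b) :
    ∃ (V : ℕ → X → X → ℝ) (U : X → X → ℝ),
      (∀ m, V m ∈ convexHull ℝ ((fun k => (A k).W) '' Set.Ici m)) ∧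
      Measurable (uncurry U) ∧ (∀ x y, U x y ∈ Set.Icc (0 : ℝ) 1) ∧ (∀ x y, U x y = U y x) ∧
      (∀ᵐ x ∂μ, ∀ᵐ y ∂μ, Tendsto (fun m => V m x y) atTop (𝓝 (U x y))) ∧
      ∀ N n, N ≤ n → kernelNorm (fun x y => (A n).W x y - U x y) (μ.restrict (G N)) ≤ b n := by
  obtain ⟨V, U, hV, hU, h01, hs, hlim⟩ := exists_convexHull_tendsto (μ := μ)
    (W := fun k => (A k).W) (fun n => (h.proper n).measurable_uncurry)
    (fun n => (h.proper n).W_mem) fun n => (h.proper n).W_symm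
  refine ⟨V, U, hV, hU, h01, hs, Measure.ae_ae_of_ae_prod hlim, fun N n hN => ?_⟩
  have hb : ∀ m, Measurable (uncurry (V m)) ∧ ∀ x y, V m x y ∈ Set.Icc (0 : ℝ) 1 := by
    intro m
    refine convexHull_min (t := {f : X → X → ℝ | Measurable (uncurry f) ∧
      ∀ x y, f x y ∈ Set.Icc (0 : ℝ) 1}) ?_ ?_ (hV m)
    · rintro _ ⟨k, -, rfl⟩
      exact ⟨(h.proper k).measurable_uncurry, (h.proper k).W_mem⟩
    · rintro f ⟨f1, f2⟩ g ⟨g1, g2⟩ s t hs ht hst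
      exact ⟨(f1.const_mul s).add (g1.const_mul t),
        fun x y => convex_Icc (0 : ℝ) 1 (f2 x y) (g2 x y) hs ht hst⟩
  refine kernelNorm_le_of_tendsto (U := fun x y => (A n).W x y - U x y)
    (V := fun m x y => (A n).W x y - V m x y) (R := 1)
    (fun m => (h.proper n).measurable_uncurry.sub (hb m).1)
    ((h.proper n).measurable_uncurry.sub hU) (fun m x y => ?_) ?_ ?_
  · have h1 := (h.proper n).W_mem x y
    have h2 := (hb m).2 x y
    rw [abs_le]
    constructor <;> linarith [h1.1, h1.2, h2.1, h2.2]
  · rw [Measure.prod_restrict]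
    filter_upwards [ae_restrict_of_ae hlim] with p hp
    exact tendsto_const_nhds.sub hp
  · filter_upwards [eventually_ge_atTop n] with m hm
    exact (h.isL2Kernel_of_mem_convexHull hN hm (hV m)).2

/-- The marginals of the limit. -/
lemma exists_limit_marginal [SFinite μ] (h : IsLocallyCauchy A μ G b) :
    ∃ D : ℕ → X → ℝ, ∀ N, Measurable (D N) ∧
      (∀ᵐ x ∂(μ.restrict (G N)), Tendsto (fun n => ((A n).marginal (μ.restrict (G N)) x).toReal)
        atTop (𝓝 (D N x))) ∧
      ∀ n, N ≤ n → eLpNorm (fun x => ((A n).marginal (μ.restrict (G N)) x).toReal - D N x) 2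
        (μ.restrict (G N)) ≤ b n := by
  have := fun N => exists_ae_tendsto_of_cauchy_eLpNorm (μ := μ.restrict (G N))
    (f := fun n x => ((A n).marginal (μ.restrict (G N)) x).toReal)
    (fun n => (h.proper n).measurable_marginal.ennreal_toReal) h.tsum_ne_top
    (fun n m hN hn => (h.near N n m hN hn).2)
  choose D hD using this
  exact ⟨D, hD⟩

lemma exists_limit_rho (h : IsLocallyCauchy A μ G b) :
    ∃ r : ℕ → ℝ, ∀ N n, N ≤ n → ‖(A n).rho (μ.restrict (G N)) - r N‖ₑ ≤ b n := by
  have hb : ∀ n, b n ≠ ∞ := fun n hn => h.tsum_ne_top (ENNReal.tsum_eq_top_of_eq_top ⟨n, hn⟩)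
  have : ∀ N, ∃ r, ∀ n, N ≤ n → ‖(A n).rho (μ.restrict (G N)) - r‖ₑ ≤ b n := by
    intro N
    have hcau : CauchySeq fun n => (A (n + N)).rho (μ.restrict (G N)) := by
      refine cauchySeq_of_le_tendsto_0' (fun n => (b (n + N)).toReal) (fun n m hnm => ?_) ?_
      · have h1 := (h.near N (n + N) (m + N) (by omega) (by omega)).3
        rw [dist_eq_norm, ← toReal_enorm]
        exact ENNReal.toReal_mono (hb _) h1
      · have h1 := (ENNReal.tendsto_toReal ENNReal.zero_ne_top).comp
          ((tendsto_add_atTop_iff_nat N).2 h.tendsto_rate)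
        simpa [Function.comp_def] using h1
    obtain ⟨r, hr⟩ := cauchySeq_tendsto_of_complete hcau
    have hr' : Tendsto (fun n => (A n).rho (μ.restrict (G N))) atTop (𝓝 r) :=
      (tendsto_add_atTop_iff_nat N).1 hr
    refine ⟨r, fun n hn => ?_⟩
    refine le_of_tendsto ((continuous_enorm.tendsto _).comp (tendsto_const_nhds.sub hr')) ?_
    filter_upwards [eventually_ge_atTop n] with m hm
    exact (h.near N n m hn hm).3
  choose r hr using this
  exact ⟨r, hr⟩

end IsLocallyCauchy

/-- Upper bounds for the integral of a section pass to convex combinations. -/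
lemma lintegral_le_of_mem_convexHull {ν : Measure X} {x : X} {c : ℝ≥0∞} {s : Set (X → X → ℝ)}
    (hm : ∀ f ∈ s, Measurable (f x)) (h0 : ∀ f ∈ s, ∀ y, 0 ≤ f x y)
    (hc : ∀ f ∈ s, ∫⁻ y, ENNReal.ofReal (f x y) ∂ν ≤ c) {f : X → X → ℝ}
    (hf : f ∈ convexHull ℝ s) : ∫⁻ y, ENNReal.ofReal (f x y) ∂ν ≤ c := by
  refine (convexHull_min (t := {f : X → X → ℝ | Measurable (f x) ∧ (∀ y, 0 ≤ f x y) ∧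
    ∫⁻ y, ENNReal.ofReal (f x y) ∂ν ≤ c}) (fun f hf => ⟨hm f hf, h0 f hf, hc f hf⟩) ?_ hf).2.2
  rintro f ⟨f1, f2, f3⟩ g ⟨g1, g2, g3⟩ a b ha hb hab
  refine ⟨(f1.const_mul a).add (g1.const_mul b), fun y => ?_, ?_⟩
  · exact add_nonneg (mul_nonneg ha (f2 y)) (mul_nonneg hb (g2 y))
  · have e : ∀ y, ENNReal.ofReal ((a • f + b • g) x y) =
        ENNReal.ofReal a * ENNReal.ofReal (f x y) + ENNReal.ofReal b * ENNReal.ofReal (g x y) := by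
      intro y
      rw [← ENNReal.ofReal_mul ha, ← ENNReal.ofReal_mul hb,
        ← ENNReal.ofReal_add (mul_nonneg ha (f2 y)) (mul_nonneg hb (g2 y))]
      rfl
    simp only [e]
    rw [lintegral_add_left (f1.ennreal_ofReal.const_mul _), lintegral_const_mul _ f1.ennreal_ofReal,
      lintegral_const_mul _ g1.ennreal_ofReal]
    calc _ ≤ ENNReal.ofReal a * c + ENNReal.ofReal b * c := by gcongr
      _ = c := by
        rw [← add_mul, ← ENNReal.ofReal_add ha hb, hab, ENNReal.ofReal_one, one_mul]

/-- Two-sided bounds for the integral of a section pass to convex combinations. -/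
lemma abs_integral_sub_le_of_mem_convexHull {ν : Measure X} {x : X} {l c : ℝ}
    {s : Set (X → X → ℝ)} (hm : ∀ f ∈ s, Integrable (f x) ν)
    (hc : ∀ f ∈ s, |∫ y, f x y ∂ν - l| ≤ c) {f : X → X → ℝ}
    (hf : f ∈ convexHull ℝ s) : |∫ y, f x y ∂ν - l| ≤ c := by
  refine (convexHull_min (t := {f : X → X → ℝ | Integrable (f x) ν ∧
    |∫ y, f x y ∂ν - l| ≤ c}) (fun f hf => ⟨hm f hf, hc f hf⟩) ?_ hf).2
  rintro f ⟨f1, f2⟩ g ⟨g1, g2⟩ a b ha hb hab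
  refine ⟨(f1.const_mul a).add (g1.const_mul b), ?_⟩
  have e : ∫ y, (a • f + b • g) x y ∂ν = a * ∫ y, f x y ∂ν + b * ∫ y, g x y ∂ν := by
    rw [← integral_const_mul, ← integral_const_mul,
      ← integral_add (f1.const_mul a) (g1.const_mul b)]
    rfl
  rw [e]
  have e2 : a * ∫ y, f x y ∂ν + b * ∫ y, g x y ∂ν - l =
      a * (∫ y, f x y ∂ν - l) + b * (∫ y, g x y ∂ν - l) := by
    linear_combination l * hab
  rw [e2]
  refine (abs_add_le _ _).trans ?_
  rw [abs_mul, abs_mul, abs_of_nonneg ha, abs_of_nonneg hb]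
  calc _ ≤ a * c + b * c := by gcongr
    _ = c := by rw [← add_mul, hab, one_mul]

namespace IsLocallyCauchy

variable {V : ℕ → X → X → ℝ} {U : X → X → ℝ} {D : ℕ → X → ℝ}

lemma restrict_eq_add (h : IsLocallyCauchy A μ G b) {N M : ℕ} (hNM : N ≤ M) :
    μ.restrict (G M) = μ.restrict (G N) + μ.restrict (G M \ G N) := by
  rw [← Measure.restrict_union Set.disjoint_sdiff_right
    ((h.measurableSet M).diff (h.measurableSet N)),
    Set.union_sdiff_cancel (h.monotone hNM)]

lemma measure_diff_lt_top (h : IsLocallyCauchy A μ G b) (N M : ℕ) : μ (G M \ G N) < ∞ :=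
  (measure_mono (fun _ hx => hx.2)).trans_lt (h.measure_compl N).lt_top

/-- The limit of the marginals dominates the integral of the limit kernel. -/
lemma lintegral_limit_le [SFinite μ] (h : IsLocallyCauchy A μ G b)
    (hV : ∀ m, V m ∈ convexHull ℝ ((fun k => (A k).W) '' Set.Ici m))
    (hlim : ∀ᵐ x ∂μ, ∀ᵐ y ∂μ, Tendsto (fun m => V m x y) atTop (𝓝 (U x y))) {N : ℕ}
    (hD : ∀ᵐ x ∂(μ.restrict (G N)), Tendsto
      (fun n => ((A n).marginal (μ.restrict (G N)) x).toReal) atTop (𝓝 (D N x))) :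
    ∀ᵐ x ∂(μ.restrict (G N)), ∫⁻ y in G N, ENNReal.ofReal (U x y) ∂μ ≤ ENNReal.ofReal (D N x) := by
  have hfin : ∀ᵐ x ∂(μ.restrict (G N)), ∀ n, (A n).marginal (μ.restrict (G N)) x < ∞ :=
    ae_all_iff.2 fun n => (h.finiteOn_restrict n N).ae_lt_top (h.proper n)
  filter_upwards [ae_restrict_of_ae hlim, hD, hfin] with x hx hDx hfx
  have hDx' : Tendsto (fun n => (A n).marginal (μ.restrict (G N)) x) atTop
      (𝓝 (ENNReal.ofReal (D N x))) := by
    refine (ENNReal.tendsto_ofReal hDx).congr fun n => ?_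
    exact ENNReal.ofReal_toReal (hfx n).ne
  have hVm : ∀ m, Measurable (V m x) := fun m => by
    refine convexHull_min (t := {f : X → X → ℝ | Measurable (f x)}) ?_ ?_ (hV m)
    · rintro _ ⟨k, -, rfl⟩
      exact (h.proper k).measurable_section x
    · exact fun f hf g hg a b _ _ _ => (hf.const_mul a).add (hg.const_mul b)
  refine ENNReal.le_of_forall_pos_le_add fun ε hε _ => ?_
  have hev : ∀ᶠ m in atTop, ∫⁻ y in G N, ENNReal.ofReal (V m x y) ∂μ
      ≤ ENNReal.ofReal (D N x) + ε := by
    have h1 : ∀ᶠ n in atTop, (A n).marginal (μ.restrict (G N)) x ≤ ENNReal.ofReal (D N x) + ε :=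
      (hDx'.eventually_lt_const (ENNReal.lt_add_right ENNReal.ofReal_ne_top
        (by simpa using hε.ne'))).mono fun n hn => hn.le
    obtain ⟨n₀, hn₀⟩ := eventually_atTop.1 h1
    filter_upwards [eventually_ge_atTop n₀] with m hm
    refine lintegral_le_of_mem_convexHull ?_ ?_ ?_ (hV m)
    · rintro _ ⟨k, -, rfl⟩
      exact (h.proper k).measurable_section x
    · rintro _ ⟨k, -, rfl⟩ y
      exact ((h.proper k).W_mem x y).1
    · rintro _ ⟨k, hk, rfl⟩
      exact le_self_add.trans (hn₀ k (hm.trans hk))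
  calc ∫⁻ y in G N, ENNReal.ofReal (U x y) ∂μ
      = ∫⁻ y in G N, liminf (fun m => ENNReal.ofReal (V m x y)) atTop ∂μ := by
        refine lintegral_congr_ae ?_
        filter_upwards [ae_restrict_of_ae hx] with y hy
        exact (ENNReal.tendsto_ofReal hy).liminf_eq.symm
    _ ≤ liminf (fun m => ∫⁻ y in G N, ENNReal.ofReal (V m x y) ∂μ) atTop :=
        lintegral_liminf_le fun m => (hVm m).ennreal_ofReal
    _ ≤ _ := liminf_le_of_frequently_le' hev.frequently

/-- The limits of the marginals on two of the sets differ by the contribution of the limit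
kernel. -/
lemma limit_marginal_sub [SFinite μ] (h : IsLocallyCauchy A μ G b)
    (hV : ∀ m, V m ∈ convexHull ℝ ((fun k => (A k).W) '' Set.Ici m))
    (hlim : ∀ᵐ x ∂μ, ∀ᵐ y ∂μ, Tendsto (fun m => V m x y) atTop (𝓝 (U x y)))
    (hD : ∀ N, ∀ᵐ x ∂(μ.restrict (G N)), Tendsto
      (fun n => ((A n).marginal (μ.restrict (G N)) x).toReal) atTop (𝓝 (D N x))) {N M : ℕ}
    (hNM : N ≤ M) :
    ∀ᵐ x ∂(μ.restrict (G N)), D M x - D N x = ∫ y in G M \ G N, U x y ∂μ := by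
  have hfin : ∀ᵐ x ∂(μ.restrict (G M)), ∀ n, (A n).marginal (μ.restrict (G M)) x < ∞ :=
    ae_all_iff.2 fun n => (h.finiteOn_restrict n M).ae_lt_top (h.proper n)
  have hle : μ.restrict (G N) ≤ μ.restrict (G M) := Measure.restrict_mono_set _ (h.monotone hNM)
  have hac : ∀ {p : X → Prop}, (∀ᵐ x ∂(μ.restrict (G M)), p x) → ∀ᵐ x ∂(μ.restrict (G N)), p x :=
    fun hp => ae_mono hle hp
  have : IsFiniteMeasure (μ.restrict (G M \ G N)) :=
    ⟨by simpa using h.measure_diff_lt_top N M⟩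
  filter_upwards [ae_restrict_of_ae hlim, hD N, hac (hD M), hac hfin] with x hx hDN hDM hfx
  have hint : ∀ k, Integrable ((A k).W x) (μ.restrict (G M \ G N)) := fun k =>
    Integrable.of_bound ((h.proper k).measurable_section x).aestronglyMeasurable 1
      (ae_of_all _ fun y => by
        rw [Real.norm_of_nonneg ((h.proper k).W_mem _ _).1]; exact ((h.proper k).W_mem _ _).2)
  have h1 : Tendsto (fun n => ∫ y in G M \ G N, (A n).W x y ∂μ) atTop (𝓝 (D M x - D N x)) := by
    refine (hDM.sub hDN).congr fun n => ?_
    have h2 := hfx n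
    rw [h.restrict_eq_add hNM] at h2 ⊢
    rw [(h.proper n).toReal_marginal_add h2.ne]
    ring
  have hVm : ∀ m, Measurable (V m x) ∧ ∀ y, V m x y ∈ Set.Icc (0 : ℝ) 1 := fun m => by
    refine convexHull_min (t := {f : X → X → ℝ | Measurable (f x) ∧
      ∀ y, f x y ∈ Set.Icc (0 : ℝ) 1}) ?_ ?_ (hV m)
    · rintro _ ⟨k, -, rfl⟩
      exact ⟨(h.proper k).measurable_section x, (h.proper k).W_mem x⟩
    · exact fun f hf g hg a b ha hb hab => ⟨(hf.1.const_mul a).add (hg.1.const_mul b),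
        fun y => convex_Icc (0 : ℝ) 1 (hf.2 y) (hg.2 y) ha hb hab⟩
  have h2 : Tendsto (fun m => ∫ y in G M \ G N, V m x y ∂μ) atTop (𝓝 (D M x - D N x)) := by
    rw [Metric.tendsto_atTop'] at h1
    rw [Metric.tendsto_atTop']
    intro ε hε
    obtain ⟨n₀, hn₀⟩ := h1 (ε / 2) (by linarith)
    refine ⟨n₀, fun m hm => ?_⟩
    rw [Real.dist_eq]
    refine (abs_integral_sub_le_of_mem_convexHull (c := ε / 2) ?_ ?_ (hV m)).trans_lt (by linarith)
    · rintro _ ⟨k, -, rfl⟩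
      exact hint k
    · rintro _ ⟨k, hk, rfl⟩
      have h3 := hn₀ k (lt_of_lt_of_le hm hk)
      rw [Real.dist_eq] at h3
      exact h3.le
  refine tendsto_nhds_unique h2 (tendsto_integral_of_dominated_convergence (fun _ => 1)
    (fun m => (hVm m).1.aestronglyMeasurable) (integrable_const 1)
    (fun m => ae_of_all _ fun y => ?_) (ae_restrict_of_ae hx))
  rw [Real.norm_of_nonneg ((hVm m).2 y).1]
  exact ((hVm m).2 y).2

/-- The star part of the limit, which makes its marginals equal to the limits of the marginals. -/
lemma exists_limit_S [SFinite μ] (h : IsLocallyCauchy A μ G b)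
    (hV : ∀ m, V m ∈ convexHull ℝ ((fun k => (A k).W) '' Set.Ici m))
    (hU : Measurable (uncurry U)) (h01 : ∀ x y, U x y ∈ Set.Icc (0 : ℝ) 1)
    (hlim : ∀ᵐ x ∂μ, ∀ᵐ y ∂μ, Tendsto (fun m => V m x y) atTop (𝓝 (U x y)))
    (hDm : ∀ N, Measurable (D N))
    (hD : ∀ N, ∀ᵐ x ∂(μ.restrict (G N)), Tendsto
      (fun n => ((A n).marginal (μ.restrict (G N)) x).toReal) atTop (𝓝 (D N x))) :
    ∃ S : X → ℝ, Measurable S ∧ (∀ x, 0 ≤ S x) ∧ ∀ N, ∀ᵐ x ∂(μ.restrict (G N)),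
      (∫⁻ y in G N, ENNReal.ofReal (U x y) ∂μ) + ENNReal.ofReal (S x)
        = ENNReal.ofReal (D N x) := by
  let L : ℕ → X → ℝ≥0∞ := fun N x => ∫⁻ y in G N, ENNReal.ofReal (U x y) ∂μ
  have hL : ∀ N, Measurable (L N) := fun N => hU.ennreal_ofReal.lintegral_prod_right'
  -- On `G N` the difference is the same for all larger sets `G M`: the sequence is eventually
  -- constant, and its upper limit is a measurable choice of that constant.
  let S : X → ℝ := fun x => (limsup (fun N => ENNReal.ofReal (D N x) - L N x) atTop).toReal
  refine ⟨S, (Measurable.limsup fun N => (hDm N).ennreal_ofReal.sub (hL N)).ennreal_toReal,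
    fun x => ENNReal.toReal_nonneg, fun N => ?_⟩
  have h1 := h.lintegral_limit_le hV hlim (hD N)
  have h2 : ∀ᵐ x ∂(μ.restrict (G N)), ∀ M, N ≤ M →
      D M x - D N x = ∫ y in G M \ G N, U x y ∂μ := by
    rw [ae_all_iff]
    intro M
    by_cases hNM : N ≤ M
    · filter_upwards [h.limit_marginal_sub hV hlim hD hNM] with x hx _ using hx
    · exact ae_of_all _ fun x hM => absurd hM hNM
  filter_upwards [h1, h2, hD N] with x hx1 hx2 hx3
  have h0 : 0 ≤ D N x := ge_of_tendsto' hx3 fun n => ENNReal.toReal_nonneg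
  have hconst : ∀ M, N ≤ M → ENNReal.ofReal (D M x) - L M x = ENNReal.ofReal (D N x) - L N x := by
    intro M hM
    have hfin : ∫⁻ y in G M \ G N, ENNReal.ofReal (U x y) ∂μ ≠ ∞ := by
      refine ne_top_of_le_ne_top (h.measure_diff_lt_top N M).ne ?_
      refine (lintegral_mono (g := fun _ => 1) fun y => ?_).trans (by simp)
      exact ENNReal.ofReal_le_one.2 (h01 x y).2
    have e1 : L M x = L N x + ∫⁻ y in G M \ G N, ENNReal.ofReal (U x y) ∂μ := by
      simp only [L]
      rw [h.restrict_eq_add hM, lintegral_add_measure]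
    have e2 : ∫ y in G M \ G N, U x y ∂μ
        = (∫⁻ y in G M \ G N, ENNReal.ofReal (U x y) ∂μ).toReal :=
      integral_eq_lintegral_of_nonneg_ae (ae_of_all _ fun y => (h01 x y).1)
        hU.of_uncurry_left.aestronglyMeasurable
    have e3 : ENNReal.ofReal (D M x) = ENNReal.ofReal (D N x)
        + ∫⁻ y in G M \ G N, ENNReal.ofReal (U x y) ∂μ := by
      rw [← ENNReal.ofReal_toReal hfin, ← e2, ← hx2 M hM, ← ENNReal.ofReal_add h0]
      · congr 1; ring
      · rw [hx2 M hM, e2]; exact ENNReal.toReal_nonneg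
    rw [e1, e3, ENNReal.add_sub_add_eq_sub_right hfin]
  have hS : ENNReal.ofReal (S x) = ENNReal.ofReal (D N x) - L N x := by
    have : limsup (fun N => ENNReal.ofReal (D N x) - L N x) atTop
        = ENNReal.ofReal (D N x) - L N x :=
      (tendsto_const_nhds.congr' ((eventually_ge_atTop N).mono fun M hM =>
        (hconst M hM).symm)).limsup_eq
    simp only [S]
    rw [this, ENNReal.ofReal_toReal (ne_top_of_le_ne_top ENNReal.ofReal_ne_top tsub_le_self)]
  rw [hS]
  exact add_tsub_cancel_of_le hx1

end IsLocallyCauchy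

end Limit

end GraphexData

/-! ### The limit of a locally Cauchy sequence -/

namespace GraphexData

section LimitExists

variable {X : Type*} [MeasurableSpace X] {μ : Measure X}

lemma tendsto_setLIntegral_iUnion {f : X → ℝ≥0∞} {F : ℕ → Set X}
    (hF : ∀ j, MeasurableSet (F j)) (hmono : Monotone F) :
    Tendsto (fun j => ∫⁻ x in F j, f x ∂μ) atTop (𝓝 (∫⁻ x in ⋃ j, F j, f x ∂μ)) := by
  have := tendsto_measure_iUnion_atTop (μ := μ.withDensity f) hmono
  simpa only [Function.comp_def, withDensity_apply _ (hF _),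
    withDensity_apply _ (MeasurableSet.iUnion hF)] using this

/-- `‖𝕎‖₁` is continuous along increasing sequences of sets, by monotone convergence; only the upper
bound is recorded. -/
lemma IsProper.norm1_iUnion_le [SFinite μ] {T : GraphexData X} (hT : T.IsProper) {F : ℕ → Set X}
    (hF : ∀ j, MeasurableSet (F j)) (hmono : Monotone F) {C : ℝ≥0∞}
    (h : ∀ j, T.norm1 (μ.restrict (F j)) ≤ C) : T.norm1 (μ.restrict (⋃ j, F j)) ≤ C := by
  have e : ∀ B : Set X, ∫⁻ x in B, ∫⁻ y in B, ENNReal.ofReal (T.W x y) ∂μ ∂μ =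
      ∫⁻ p in B ×ˢ B, ENNReal.ofReal (T.W p.1 p.2) ∂(μ.prod μ) := fun B => by
    rw [← Measure.prod_restrict, lintegral_prod _ hT.measurable_W.ennreal_ofReal.aemeasurable]
  have hU : (⋃ j, F j) ×ˢ (⋃ j, F j) = ⋃ j, F j ×ˢ F j :=
    (Set.iUnion_prod_of_monotone hmono hmono).symm
  refine le_of_tendsto' (f := fun j => T.norm1 (μ.restrict (F j))) (x := atTop) ?_ h
  simp only [hT.norm1_eq, e, hU]
  exact ((tendsto_setLIntegral_iUnion (fun j => (hF j).prod (hF j))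
    (fun i j hij => Set.prod_mono (hmono hij) (hmono hij))).add
    (ENNReal.Tendsto.const_mul (tendsto_setLIntegral_iUnion hF hmono) (Or.inr (by simp)))).add
    tendsto_const_nhds

lemma marginal_iUnion_le {T : GraphexData X} {F : ℕ → Set X}
    (hF : ∀ j, MeasurableSet (F j)) (hmono : Monotone F) {C : ℝ≥0∞} {x : X}
    (h : ∀ᶠ j in atTop, T.marginal (μ.restrict (F j)) x ≤ C) :
    T.marginal (μ.restrict (⋃ j, F j)) x ≤ C :=
  le_of_tendsto (f := fun j => T.marginal (μ.restrict (F j)) x) (x := atTop)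
    ((tendsto_setLIntegral_iUnion hF hmono).add tendsto_const_nhds) h

variable {A : ℕ → GraphexData X} {G : ℕ → Set X} {b : ℕ → ℝ≥0∞}
  {U : X → X → ℝ} {D : ℕ → X → ℝ}

lemma integral_indicator_one_mul {E B : Set X} (hE : MeasurableSet E) (hEB : E ⊆ B) (f : X → ℝ) :
    ∫ x, f x * E.indicator (fun _ => (1 : ℝ)) x ∂(μ.restrict B) = ∫ x in E, f x ∂μ := by
  have e : (fun x => f x * E.indicator (fun _ => (1 : ℝ)) x) = E.indicator f := by
    funext x
    by_cases hx : x ∈ E <;> simp [hx]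
  rw [e, integral_indicator hE, Measure.restrict_restrict hE, Set.inter_eq_left.2 hEB]

lemma memLp_indicator_one {E B : Set X} (hE : MeasurableSet E) (hfin : μ E ≠ ∞) :
    MemLp (E.indicator fun _ => (1 : ℝ)) 2 (μ.restrict B) :=
  memLp_indicator_const 2 hE 1 (Or.inr (ne_top_of_le_ne_top hfin (Measure.restrict_le_self _)))

namespace IsLocallyCauchy

lemma tendsto_integral_W [SFinite μ] (h : IsLocallyCauchy A μ G b) (hU : Measurable (uncurry U))
    (h01 : ∀ x y, U x y ∈ Set.Icc (0 : ℝ) 1)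
    (hker : ∀ N n, N ≤ n →
      kernelNorm (fun x y => (A n).W x y - U x y) (μ.restrict (G N)) ≤ b n) {N : ℕ} {E : Set X}
    (hE : MeasurableSet E) (hsub : E ⊆ G N) (hfin : μ E ≠ ∞) :
    Tendsto (fun n => ∫ x in E, ∫ y in E, (A n).W x y ∂μ ∂μ) atTop
      (𝓝 (∫ x in E, ∫ y in E, U x y ∂μ ∂μ)) := by
  have hg := memLp_indicator_one (B := G N) hE hfin
  have hgm : Measurable (E.indicator fun _ => (1 : ℝ)) := measurable_const.indicator hE
  set g := E.indicator fun _ : X => (1 : ℝ) with hgdef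
  have hEf : IsFiniteMeasure (μ.restrict E) := ⟨by simpa using hfin.lt_top⟩
  have hint : ∀ {K : X → X → ℝ}, Measurable (uncurry K) → (∀ x y, K x y ∈ Set.Icc (0 : ℝ) 1) →
      (∀ x, Integrable (K x) (μ.restrict E)) ∧
        Integrable (fun x => ∫ y in E, K x y ∂μ) (μ.restrict E) := by
    intro K hK hK1
    have h1 : ∀ x y, ‖K x y‖ ≤ 1 := fun x y => by
      rw [Real.norm_of_nonneg (hK1 _ _).1]; exact (hK1 _ _).2
    refine ⟨fun x => Integrable.of_bound hK.of_uncurry_left.aestronglyMeasurable 1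
      (ae_of_all _ (h1 x)), ?_⟩
    refine Integrable.of_bound (StronglyMeasurable.integral_prod_right'
      hK.stronglyMeasurable).aestronglyMeasurable ((μ.restrict E).real Set.univ)
      (ae_of_all _ fun x => ?_)
    exact (norm_integral_le_of_norm_le_const (ae_of_all _ (h1 x))).trans (by simp)
  have hbd : ∀ n, N ≤ n → edist (∫ x in E, ∫ y in E, (A n).W x y ∂μ ∂μ)
      (∫ x in E, ∫ y in E, U x y ∂μ ∂μ) ≤ b n * (eLpNorm g 2 (μ.restrict (G N))
        * eLpNorm g 2 (μ.restrict (G N))) := by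
    intro n hn
    obtain ⟨i1, i2⟩ := hint (h.proper n).measurable_uncurry (h.proper n).W_mem
    obtain ⟨j1, j2⟩ := hint hU h01
    have h1 := enorm_integral_kernel_le (μ := μ.restrict (G N))
      (U := fun x y => (A n).W x y - U x y) ((h.proper n).measurable_uncurry.sub hU) hg hgm hg
    have e : ∫ x, g x * ∫ y, ((A n).W x y - U x y) * g y ∂(μ.restrict (G N)) ∂(μ.restrict (G N))
        = (∫ x in E, ∫ y in E, (A n).W x y ∂μ ∂μ) - ∫ x in E, ∫ y in E, U x y ∂μ ∂μ := by
      rw [← integral_sub i2 j2]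
      simp only [mul_comm (g _) (integral _ _)]
      rw [hgdef, integral_indicator_one_mul hE hsub]
      refine integral_congr_ae (ae_of_all _ fun x => ?_)
      simp only
      rw [integral_indicator_one_mul hE hsub, integral_sub (i1 x) (j1 x)]
    rw [e] at h1
    rw [edist_eq_enorm_sub]
    refine h1.trans ?_
    rw [mul_assoc]
    exact mul_le_mul_left (hker N n hn) _
  rw [tendsto_iff_edist_tendsto_0]
  have hlim : Tendsto (fun n => b n * (eLpNorm g 2 (μ.restrict (G N))
      * eLpNorm g 2 (μ.restrict (G N)))) atTop (𝓝 0) := by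
    have := ENNReal.Tendsto.mul_const (b := eLpNorm g 2 (μ.restrict (G N))
      * eLpNorm g 2 (μ.restrict (G N))) h.tendsto_rate
      (Or.inr (ENNReal.mul_ne_top hg.2.ne hg.2.ne))
    simpa using this
  exact tendsto_of_tendsto_of_tendsto_of_le_of_le' tendsto_const_nhds hlim
    (Eventually.of_forall fun _ => zero_le) ((eventually_ge_atTop N).mono hbd)

lemma memLp_limit_marginal [SFinite μ] (h : IsLocallyCauchy A μ G b) {N : ℕ}
    (hDm : Measurable (D N))
    (hD : ∀ n, N ≤ n → eLpNorm (fun x => ((A n).marginal (μ.restrict (G N)) x).toReal - D N x) 2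
        (μ.restrict (G N)) ≤ b n) : MemLp (D N) 2 (μ.restrict (G N)) := by
  have h1 := (h.finiteOn_restrict N N).memLp_marginal (h.proper N)
  have h2 : MemLp (fun x => ((A N).marginal (μ.restrict (G N)) x).toReal - D N x) 2
      (μ.restrict (G N)) :=
    ⟨((h.proper N).measurable_marginal.ennreal_toReal.sub hDm).aestronglyMeasurable,
      (hD N le_rfl).trans_lt (lt_top_iff_ne_top.2 fun hn =>
        h.tsum_ne_top (ENNReal.tsum_eq_top_of_eq_top ⟨N, hn⟩))⟩
  have h3 := h1.sub h2
  convert h3 using 1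
  funext x
  simp

lemma tendsto_integral_marginal [SFinite μ] (h : IsLocallyCauchy A μ G b) {N : ℕ}
    (hDm : Measurable (D N))
    (hD : ∀ n, N ≤ n → eLpNorm (fun x => ((A n).marginal (μ.restrict (G N)) x).toReal - D N x) 2
        (μ.restrict (G N)) ≤ b n) {E : Set X}
    (hE : MeasurableSet E) (hsub : E ⊆ G N) (hfin : μ E ≠ ∞) :
    Tendsto (fun n => ∫ x in E, ((A n).marginal (μ.restrict (G N)) x).toReal ∂μ) atTop
      (𝓝 (∫ x in E, D N x ∂μ)) := by
  have hg := memLp_indicator_one (B := G N) hE hfin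
  have hDL := h.memLp_limit_marginal hDm hD
  have hEf : IsFiniteMeasure (μ.restrict E) := ⟨by simpa using hfin.lt_top⟩
  have hint : ∀ {f : X → ℝ}, MemLp f 2 (μ.restrict (G N)) → Integrable f (μ.restrict E) :=
    fun hf => (hf.mono_measure (Measure.restrict_mono_set _ hsub)).integrable one_le_two
  have hbd : ∀ n, N ≤ n → edist (∫ x in E, ((A n).marginal (μ.restrict (G N)) x).toReal ∂μ)
      (∫ x in E, D N x ∂μ) ≤ b n * eLpNorm (E.indicator fun _ => (1 : ℝ)) 2 (μ.restrict (G N)) := by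
    intro n hn
    rw [edist_eq_enorm_sub, ← integral_sub
      (hint ((h.finiteOn_restrict n N).memLp_marginal (h.proper n))) (hint hDL),
      ← integral_indicator_one_mul hE hsub]
    refine (enorm_integral_mul_le
      ((h.proper n).measurable_marginal.ennreal_toReal.sub hDm).aestronglyMeasurable hg.1).trans ?_
    exact mul_le_mul_left (hD n hn) _
  rw [tendsto_iff_edist_tendsto_0]
  have hlim := ENNReal.Tendsto.mul_const (b := eLpNorm (E.indicator fun _ => (1 : ℝ)) 2
    (μ.restrict (G N))) h.tendsto_rate (Or.inr hg.2.ne)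
  rw [zero_mul] at hlim
  exact tendsto_of_tendsto_of_tendsto_of_le_of_le' tendsto_const_nhds hlim
    (Eventually.of_forall fun _ => zero_le) ((eventually_ge_atTop N).mono hbd)

lemma tendsto_rho (h : IsLocallyCauchy A μ G b) {r : ℝ} {N : ℕ}
    (hr : ∀ n, N ≤ n → ‖(A n).rho (μ.restrict (G N)) - r‖ₑ ≤ b n) :
    Tendsto (fun n => (A n).rho (μ.restrict (G N))) atTop (𝓝 r) := by
  rw [tendsto_iff_edist_tendsto_0]
  refine tendsto_of_tendsto_of_tendsto_of_le_of_le' tendsto_const_nhds h.tendsto_rate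
    (Eventually.of_forall fun _ => zero_le) ((eventually_ge_atTop N).mono fun n hn => ?_)
  rw [edist_eq_enorm_sub]
  exact hr n hn

variable {T : GraphexData X} {r : ℕ → ℝ}

/-- The graphon and the star part of the limit do not have more mass than what the edge densities
leave for them: mass can only be lost to the dust part. -/
lemma norm1_limit_le [SigmaFinite μ] (h : IsLocallyCauchy A μ G b) (hT : T.IsProper)
    (hI : T.I = 0) {N : ℕ} (hDm : Measurable (D N))
    (hker : ∀ N n, N ≤ n →
      kernelNorm (fun x y => (A n).W x y - T.W x y) (μ.restrict (G N)) ≤ b n)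
    (hD : ∀ n, N ≤ n → eLpNorm (fun x => ((A n).marginal (μ.restrict (G N)) x).toReal - D N x) 2
        (μ.restrict (G N)) ≤ b n)
    (hmarg : ∀ᵐ x ∂(μ.restrict (G N)), T.marginal (μ.restrict (G N)) x = ENNReal.ofReal (D N x))
    (hD0 : ∀ᵐ x ∂(μ.restrict (G N)), 0 ≤ D N x)
    (hr : ∀ n, N ≤ n → ‖(A n).rho (μ.restrict (G N)) - r N‖ₑ ≤ b n) :
    T.norm1 (μ.restrict (G N)) ≤ ENNReal.ofReal (r N) := by
  have key : ∀ E : Set X, MeasurableSet E → E ⊆ G N → μ E ≠ ∞ →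
      T.norm1 (μ.restrict E) ≤ ENNReal.ofReal (r N) := by
    intro E hE hsub hfin
    have hEf : IsFiniteMeasure (μ.restrict E) := ⟨by simpa using hfin.lt_top⟩
    have hle : μ.restrict E ≤ μ.restrict (G N) := Measure.restrict_mono_set _ hsub
    have hadd : μ.restrict (G N \ E) + μ.restrict E = μ.restrict (G N) := by
      rw [add_comm, ← Measure.restrict_union Set.disjoint_sdiff_right
        ((h.measurableSet N).diff hE), Set.union_sdiff_cancel hsub]
    -- The inequality `2 ∫_E D ≤ ρ + ∫_{E × E} W` holds along the sequence, as the remaining part of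
    -- the graphex has nonnegative norm, and each of the terms converges.
    have h1 : 2 * ∫ x in E, D N x ∂μ ≤ r N + ∫ x in E, ∫ y in E, T.W x y ∂μ ∂μ := by
      refine le_of_tendsto_of_tendsto'
        ((h.tendsto_integral_marginal hDm hD hE hsub hfin).const_mul 2)
        ((h.tendsto_rho hr).add (h.tendsto_integral_W hT.measurable_uncurry hT.W_mem hker hE hsub
          hfin)) fun n => ?_
      have h2 := (h.proper n).rho_eq_of_add (γ' := μ.restrict (G N \ E)) (η := μ.restrict E)
        (by rw [hadd]; exact (h.finiteOn_restrict n N).1)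
      rw [hadd, (h.proper n).rho_eq (ne_top_of_le_ne_top (h.finiteOn_restrict n N).1
        ((h.proper n).norm1_mono (Measure.restrict_mono_set _ Set.sdiff_subset)))] at h2
      have h3 : 0 ≤ ((A n).norm1 (μ.restrict (G N \ E))).toReal := ENNReal.toReal_nonneg
      linarith
    have h2 := hT.norm1_add (γ' := 0) (η := μ.restrict E)
    have h00 : T.norm1 (0 : Measure X) = 0 := by simp [norm1, hI]
    rw [zero_add, h00, zero_add] at h2
    have hWfin : ∫⁻ x in E, ∫⁻ y in E, ENNReal.ofReal (T.W x y) ∂μ ∂μ ≠ ∞ := by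
      refine ne_top_of_le_ne_top (b := ∫⁻ x in E, ∫⁻ y in E, 1 ∂μ ∂μ) ?_
        (lintegral_mono fun x => lintegral_mono fun y =>
        ENNReal.ofReal_le_one.2 (hT.W_mem x y).2)
      simpa using ENNReal.mul_ne_top hfin hfin
    refine (ENNReal.add_le_add_iff_right hWfin).1 ?_
    rw [h2]
    have hW0 : 0 ≤ ∫ x in E, ∫ y in E, T.W x y ∂μ ∂μ := by
      rw [hT.integral_W_eq hWfin]; exact ENNReal.toReal_nonneg
    have hDint : Integrable (D N) (μ.restrict E) :=
      ((h.memLp_limit_marginal hDm hD).mono_measure hle).integrable one_le_two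
    have hD0' : ∀ᵐ x ∂(μ.restrict E), 0 ≤ D N x := ae_mono hle hD0
    calc 2 * ∫⁻ x in E, T.marginal (μ.restrict E) x ∂μ
        ≤ 2 * ∫⁻ x in E, ENNReal.ofReal (D N x) ∂μ := by
          refine mul_le_mul_right (lintegral_mono_ae ?_) _
          filter_upwards [ae_mono hle hmarg] with x hx
          rw [← hx]
          exact hT.marginal_mono hle x
      _ = ENNReal.ofReal (2 * ∫ x in E, D N x ∂μ) := by
          rw [← ofReal_integral_eq_lintegral_ofReal hDint hD0',
            ENNReal.ofReal_mul (by norm_num), ENNReal.ofReal_ofNat]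
      _ ≤ ENNReal.ofReal (r N + ∫ x in E, ∫ y in E, T.W x y ∂μ ∂μ) := ENNReal.ofReal_le_ofReal h1
      _ ≤ ENNReal.ofReal (r N) + ENNReal.ofReal (∫ x in E, ∫ y in E, T.W x y ∂μ ∂μ) :=
          ENNReal.ofReal_add_le
      _ = _ := by rw [hT.integral_W_eq hWfin, ENNReal.ofReal_toReal hWfin]
  have hU : G N = ⋃ j, spanningSets μ j ∩ G N := by
    rw [← Set.iUnion_inter, iUnion_spanningSets, Set.univ_inter]
  rw [hU]
  refine hT.norm1_iUnion_le (fun j => (measurableSet_spanningSets μ j).inter (h.measurableSet N))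
    (fun i j hij => Set.inter_subset_inter_left _ (monotone_spanningSets μ hij)) fun j => ?_
  exact key _ ((measurableSet_spanningSets μ j).inter (h.measurableSet N)) Set.inter_subset_right
    ((measure_mono Set.inter_subset_left).trans_lt (measure_spanningSets_lt_top μ j)).ne

/-- A locally Cauchy sequence has a limit. The kernels have a limit in the sense of convex
combinations of tails; the star part is what is missing to the limits of the marginals, and the dust
part what is missing to the limits of the edge densities. -/
theorem exists_limit [SigmaFinite μ] (h : IsLocallyCauchy A μ G b) :
    ∃ B : GraphexData X, B.IsProper ∧ (∀ N, B.FiniteOn (μ.restrict (G N))) ∧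
      (∀ N n, N ≤ n → (A n).Near B (μ.restrict (G N)) (b n) (b n) (b n)) ∧
      (∀ C : ℝ≥0∞, (∀ n, (A n).norm1 μ ≤ C) → B.norm1 μ ≤ C) ∧
      (∀ C : ℝ≥0∞, (∀ n, ∀ᵐ x ∂μ, (A n).marginal μ x ≤ C) →
        ∀ᵐ x ∂μ, B.marginal μ x ≤ C) := by
  obtain ⟨V, U, hV, hU, h01, hs, hlim, hker⟩ := h.exists_limit_W
  obtain ⟨D, hD⟩ := h.exists_limit_marginal
  obtain ⟨r, hr⟩ := h.exists_limit_rho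
  obtain ⟨S, hSm, hS0, hS⟩ := h.exists_limit_S hV hU h01 hlim (fun N => (hD N).1)
    fun N => (hD N).2.1
  let T : GraphexData X := ⟨U, S, 0⟩
  have hT : T.IsProper := ⟨hU, h01, hs, hSm, hS0, le_rfl⟩
  have hD0 : ∀ N, ∀ᵐ x ∂(μ.restrict (G N)), 0 ≤ D N x := fun N =>
    (hD N).2.1.mono fun x hx => ge_of_tendsto' hx fun n => ENNReal.toReal_nonneg
  have hTn : ∀ N, T.norm1 (μ.restrict (G N)) ≤ ENNReal.ofReal (r N) := fun N =>
    h.norm1_limit_le hT rfl (hD N).1 hker (hD N).2.2 (hS N) (hD0 N) (hr N)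
  have hsq : ∀ N (B : GraphexData X), B.marginal (μ.restrict (G N))
      = T.marginal (μ.restrict (G N)) →
      ∫⁻ x, B.marginal (μ.restrict (G N)) x ^ 2 ∂(μ.restrict (G N)) ≠ ∞ := by
    intro N B hB
    have h1 := (h.memLp_limit_marginal (hD N).1 (hD N).2.2).2.ne
    have h2 : ∫⁻ x, ‖D N x‖ₑ ^ 2 ∂(μ.restrict (G N)) ≠ ∞ := by
      rw [← eLpNorm_two_sq]; exact ENNReal.pow_ne_top h1
    refine ne_top_of_le_ne_top h2 (lintegral_mono_ae ?_)
    filter_upwards [hS N] with x hx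
    have hx' : T.marginal (μ.restrict (G N)) x = ENNReal.ofReal (D N x) := hx
    rw [hB, hx']
    exact pow_le_pow_left' (Real.ofReal_le_enorm _) 2
  have hTf : ∀ N, T.FiniteOn (μ.restrict (G N)) := fun N =>
    ⟨ne_top_of_le_ne_top ENNReal.ofReal_ne_top (hTn N), hsq N T rfl⟩
  have hr0 : ∀ N, 0 ≤ r N := fun N => ge_of_tendsto' (h.tendsto_rho (hr N)) fun n => by
    rw [(h.proper n).rho_eq (h.finiteOn_restrict n N).1]; exact ENNReal.toReal_nonneg
  have hTr : ∀ N, T.rho (μ.restrict (G N)) ≤ r N := fun N => by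
    rw [hT.rho_eq (hTf N).1]
    exact ENNReal.toReal_le_of_le_ofReal (hr0 N) (hTn N)
  -- The missing edge density does not depend on the set on which it is computed.
  have hconst : ∀ N, r N - T.rho (μ.restrict (G N)) = r 0 - T.rho (μ.restrict (G 0)) := by
    intro N
    have hE : MeasurableSet (G N \ G 0) := (h.measurableSet N).diff (h.measurableSet 0)
    have hfin := (h.measure_diff_lt_top 0 N).ne
    have hEf : IsFiniteMeasure (μ.restrict (G N \ G 0)) := ⟨by simpa using hfin.lt_top⟩
    have hadd := h.restrict_eq_add (zero_le (a := N))
    have e1 : r 0 = r N + (∫ x in G N \ G 0, ∫ y in G N \ G 0, U x y ∂μ ∂μ)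
        - 2 * ∫ x in G N \ G 0, D N x ∂μ := by
      refine tendsto_nhds_unique (h.tendsto_rho (hr 0)) ((((h.tendsto_rho (hr N)).add
        (h.tendsto_integral_W hU h01 hker hE Set.sdiff_subset hfin)).sub
        ((h.tendsto_integral_marginal (hD N).1 (hD N).2.2 hE Set.sdiff_subset hfin).const_mul
          2)).congr fun n => ?_)
      have := (h.proper n).rho_eq_of_add (γ' := μ.restrict (G 0)) (η := μ.restrict (G N \ G 0))
        (by rw [← hadd]; exact (h.finiteOn_restrict n N).1)
      rw [← hadd] at this
      exact this.symm
    have e2 := hT.rho_eq_of_add (γ' := μ.restrict (G 0)) (η := μ.restrict (G N \ G 0))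
      (by rw [← hadd]; exact (hTf N).1)
    rw [← hadd] at e2
    have e3 : ∫ x in G N \ G 0, (T.marginal (μ.restrict (G N)) x).toReal ∂μ
        = ∫ x in G N \ G 0, D N x ∂μ := by
      have hle : μ.restrict (G N \ G 0) ≤ μ.restrict (G N) :=
        Measure.restrict_mono_set _ Set.sdiff_subset
      refine integral_congr_ae ?_
      filter_upwards [ae_mono hle (hS N), ae_mono hle (hD0 N)] with x hx hx0
      have hx' : T.marginal (μ.restrict (G N)) x = ENNReal.ofReal (D N x) := hx
      rw [hx', ENNReal.toReal_ofReal hx0]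
    rw [e3] at e2
    have e4 : ∫ x in G N \ G 0, ∫ y in G N \ G 0, T.W x y ∂μ ∂μ
      = ∫ x in G N \ G 0, ∫ y in G N \ G 0, U x y ∂μ ∂μ := rfl
    rw [e4] at e2
    linarith
  -- The dust part contributes `2 I` to the edge density.
  let B : GraphexData X := ⟨U, S, (r 0 - T.rho (μ.restrict (G 0))) / 2⟩
  have hI0 : 0 ≤ B.I := div_nonneg (sub_nonneg.2 (hTr 0)) (by norm_num)
  have hB : B.IsProper := ⟨hU, h01, hs, hSm, hS0, hI0⟩
  have hBn : ∀ N, B.norm1 (μ.restrict (G N)) = ENNReal.ofReal (r N) := by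
    intro N
    have e1 : B.norm1 (μ.restrict (G N)) = T.norm1 (μ.restrict (G N)) + 2 * ENNReal.ofReal B.I := by
      rw [hB.norm1_eq, hT.norm1_eq]
      simp [B, T]
    have e2 : T.norm1 (μ.restrict (G N)) = ENNReal.ofReal (T.rho (μ.restrict (G N))) := by
      rw [hT.rho_eq (hTf N).1, ENNReal.ofReal_toReal (hTf N).1]
    have e3 : 0 ≤ T.rho (μ.restrict (G N)) := by
      rw [hT.rho_eq (hTf N).1]; exact ENNReal.toReal_nonneg
    have e4 : (2 : ℝ≥0∞) * ENNReal.ofReal B.I = ENNReal.ofReal (2 * B.I) := by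
      rw [ENNReal.ofReal_mul (by norm_num), ENNReal.ofReal_ofNat]
    rw [e1, e2, e4, ← ENNReal.ofReal_add e3 (by positivity)]
    congr 1
    have := hconst N
    simp only [B]
    linarith
  have hBf : ∀ N, B.FiniteOn (μ.restrict (G N)) := fun N =>
    ⟨by rw [hBn]; exact ENNReal.ofReal_ne_top, hsq N B rfl⟩
  have hμ : μ.restrict (⋃ N, G N) = μ :=
    Measure.restrict_eq_self_of_ae_mem (mem_ae_iff.2 h.measure_compl_iUnion)
  refine ⟨B, hB, hBf, fun N n hn => ⟨hker N n hn, ?_, ?_⟩, fun C hC => ?_, fun C hC => ?_⟩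
  · rw [← eLpNorm_congr_ae (f := fun x => ((A n).marginal (μ.restrict (G N)) x).toReal - D N x)]
    · exact (hD N).2.2 n hn
    · filter_upwards [hS N, hD0 N] with x hx hx0
      have hx' : B.marginal (μ.restrict (G N)) x = ENNReal.ofReal (D N x) := hx
      rw [hx', ENNReal.toReal_ofReal hx0]
  · rw [hB.rho_eq (hBf N).1, hBn, ENNReal.toReal_ofReal (hr0 N)]
    exact hr N n hn
  · rw [← hμ]
    refine hB.norm1_iUnion_le h.measurableSet h.monotone fun N => ?_
    rw [hBn]
    refine le_of_tendsto' (ENNReal.tendsto_ofReal (h.tendsto_rho (hr N))) fun n => ?_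
    rw [(h.proper n).rho_eq (h.finiteOn_restrict n N).1,
      ENNReal.ofReal_toReal (h.finiteOn_restrict n N).1]
    exact ((h.proper n).norm1_mono Measure.restrict_le_self).trans (hC n)
  · have h1 : ∀ N, ∀ᵐ x ∂μ, x ∈ G N → B.marginal (μ.restrict (G N)) x ≤ C := by
      intro N
      rw [← ae_restrict_iff' (h.measurableSet N)]
      have h2 : ∀ᵐ x ∂(μ.restrict (G N)), ∀ n, (A n).marginal μ x ≤ C :=
        ae_all_iff.2 fun n => ae_restrict_of_ae (hC n)
      have hfin : ∀ᵐ x ∂(μ.restrict (G N)), ∀ n, (A n).marginal (μ.restrict (G N)) x < ∞ :=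
        ae_all_iff.2 fun n => (h.finiteOn_restrict n N).ae_lt_top (h.proper n)
      filter_upwards [hS N, (hD N).2.1, h2, hfin] with x hx hlx hCx hfx
      have hx' : B.marginal (μ.restrict (G N)) x = ENNReal.ofReal (D N x) := hx
      rw [hx']
      refine le_of_tendsto' (ENNReal.tendsto_ofReal hlx) fun n => ?_
      rw [ENNReal.ofReal_toReal (hfx n).ne]
      exact ((h.proper n).marginal_mono Measure.restrict_le_self x).trans (hCx n)
    have h3 : ∀ᵐ x ∂μ, x ∈ ⋃ N, G N := mem_ae_iff.2 h.measure_compl_iUnion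
    filter_upwards [ae_all_iff.2 h1, h3] with x hx hxU
    obtain ⟨N, hN⟩ := Set.mem_iUnion.1 hxU
    rw [← hμ]
    exact marginal_iUnion_le h.measurableSet h.monotone
      ((eventually_ge_atTop N).mono fun M hM => hx M (h.monotone hM hN))

end IsLocallyCauchy

end LimitExists

end GraphexData

/-! ### Limits of sequences of step graphexes -/

section LineSequence

namespace GraphexData

variable {k : ℕ → ℕ} {T : ∀ n, GraphexData (Fin (k n + 1))} {m ν : ∀ n, Measure (Fin (k n + 1))}
  {ν' : ∀ n, Measure (Fin (k (n + 1) + 1))} {t : ℕ → ℝ≥0} {a d r : ℕ → ℝ≥0∞}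

/-- A sequence of step graphexes, each comparable to the next one, can be realized on one line. -/
lemma exists_labellings [∀ n, IsFiniteMeasure (m n)] (hT : ∀ n, (T n).IsProper)
    (vT : ∀ n, (T n).VanishesOff {0}ᶜ) (fν : ∀ n, (T n).FiniteOn (ν n))
    (fν' : ∀ n, (T (n + 1)).FiniteOn (ν' n)) (hν : ∀ n, IsNearlyFull (m n) (ν n) (t n))
    (hν' : ∀ n, IsNearlyFull (m (n + 1)) (ν' n) (t n))
    (hJ : ∀ n, JointNear (T n) (ν n) (T (n + 1)) (ν' n) (a n) (d n) (r n)) :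
    ∃ (p : ∀ n, ℝ → Fin (k n + 1)) (B : ℕ → Set ℝ), (∀ n, Measurable (p n)) ∧
      (∀ n i, i ≠ 0 → volume (p n ⁻¹' {i}) = m n {i}) ∧ (∀ n, MeasurableSet (B n)) ∧
      (∀ n, volume (B n) ≤ 2 * t n) ∧
      ∀ n, ((T n).pullback (p n)).Near ((T (n + 1)).pullback (p (n + 1)))
        (volume.restrict (B n)ᶜ) (a n) (d n) (r n) := by
  let P : ℕ → Type := fun n => {p : ℝ → Fin (k n + 1) //
    Measurable p ∧ ∀ i, i ≠ 0 → volume (p ⁻¹' {i}) = m n {i}}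
  have hstep : ∀ n (p : P n), ∃ p' : P (n + 1), ∃ B : Set ℝ, MeasurableSet B ∧
      volume B ≤ 2 * t n ∧ ((T n).pullback p.1).Near ((T (n + 1)).pullback p'.1)
        (volume.restrict Bᶜ) (a n) (d n) (r n) := by
    intro n p
    obtain ⟨p', B, hp', hB, hBt, hpm', hN⟩ := exists_refinement (hT n) (hT (n + 1)) (fν n) (fν' n)
      (vT n) (vT (n + 1)) (hν n) (hν' n) (hJ n) p.2.1 p.2.2
    exact ⟨⟨p', hp', hpm'⟩, B, hB, hBt, hN⟩
  have h0 : Nonempty (P 0) := by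
    obtain ⟨q, hq, hqs⟩ := exists_subdivision (0 : Fin (k 0 + 1)) MeasurableSet.univ
      (a := fun i => m 0 {i}) (fun i => measure_ne_top _ _) (by rw [Real.volume_univ]; exact le_top)
    exact ⟨q, hq, fun i hi => by simpa using hqs i hi⟩
  choose f B hB hBt hN using hstep
  let p : ∀ n, P n := fun n => Nat.rec (Classical.choice h0) f n
  exact ⟨fun n => (p n).1, fun n => B n (p n), fun n => (p n).2.1, fun n => (p n).2.2,
    fun n => hB n (p n), fun n => hBt n (p n), fun n => hN n (p n)⟩

end GraphexData

open GraphexData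

/-- Completeness for sequences of step graphexes: the limit graphex, realizations of the step
graphexes on its feature space, and an increasing sequence of sets on which they converge. -/
theorem Graphex.exists_limit {k : ℕ → ℕ} {T : ∀ n, GraphexData (Fin (k n + 1))}
    {m ν : ∀ n, Measure (Fin (k n + 1))} {ν' : ∀ n, Measure (Fin (k (n + 1) + 1))}
    [∀ n, IsFiniteMeasure (m n)] (hT : ∀ n, (T n).IsProper)
    (vT : ∀ n, (T n).VanishesOff {0}ᶜ) (fT : ∀ n, (T n).FiniteOn (m n))
    {t c : ℕ → ℝ≥0} (ht : ∑' n, (t n : ℝ≥0∞) ≠ ∞) (hc : ∀ n, (c n : ℝ≥0∞) ≤ 2⁻¹ ^ n)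
    (hν : ∀ n, IsNearlyFull (m n) (ν n) (t n))
    (hν' : ∀ n, IsNearlyFull (m (n + 1)) (ν' n) (t n))
    (hJ : ∀ n, JointNear (T n) (ν n) (T (n + 1)) (ν' n) (c n) (c n ^ 2) (c n ^ 3)) :
    ∃ (V : Graphex.{u}) (p : ∀ n, V.Ω → Fin (k n + 1)) (G : ℕ → Set V.Ω),
      (∀ n, Measurable (p n)) ∧
      (∀ n, (V.μ.map (p n)).restrict {0}ᶜ = (m n).restrict {0}ᶜ) ∧
      (∀ N, MeasurableSet (G N)) ∧ (∀ N, V.μ (G N)ᶜ ≤ ∑' n, 2 * (t (n + N) : ℝ≥0∞)) ∧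
      (∀ N, V.data.FiniteOn (V.μ.restrict (G N))) ∧
      (∃ b : ℕ → ℝ≥0∞, Tendsto b atTop (𝓝 0) ∧ ∀ N n, N ≤ n →
        ((T n).pullback (p n)).Near V.data (V.μ.restrict (G N)) (b n) (b n) (b n)) ∧
      (∀ C : ℝ≥0∞, (∀ n, (T n).norm1 (m n) ≤ C) → V.norm1 ≤ C) ∧
      (∀ C : ℝ≥0∞, (∀ n, ∀ᵐ i ∂(m n), (T n).marginal (m n) i ≤ C) →
        ∀ᵐ x ∂V.μ, V.data.marginal V.μ x ≤ C) := by
  obtain ⟨p₀, B₀, hp₀, hpm₀, hB₀, hBt₀, hN₀⟩ := exists_labellings hT vT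
    (fun n => (fT n).mono (hT n) (hν n).le) (fun n => (fT (n + 1)).mono (hT (n + 1)) (hν' n).le)
    hν hν' hJ
  -- The line is lifted to the universe of the feature spaces.
  let X := ULift.{u} ℝ
  let lam : Measure X := (volume : Measure ℝ).map MeasurableEquiv.ulift.symm
  have hlamσ : SigmaFinite lam := MeasurableEquiv.ulift.symm.sigmaFinite_map
  have hdown : Measurable (ULift.down : X → ℝ) := MeasurableEquiv.ulift.measurable
  have hmap : lam.map ULift.down = volume :=
    MeasurableEquiv.ulift.map_map_symm
  have hpre : ∀ {E : Set ℝ}, MeasurableSet E → lam (ULift.down ⁻¹' E) = volume E := fun hE => by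
    rw [← Measure.map_apply hdown hE, hmap]
  let p : ∀ n, X → Fin (k n + 1) := fun n x => p₀ n x.down
  let B : ℕ → Set X := fun n => ULift.down ⁻¹' B₀ n
  have hp : ∀ n, Measurable (p n) := fun n => (hp₀ n).comp hdown
  have hB : ∀ n, MeasurableSet (B n) := fun n => hdown (hB₀ n)
  have hrestr : ∀ n, (lam.map (p n)).restrict {0}ᶜ = (m n).restrict {0}ᶜ := by
    intro n
    refine Measure.ext_of_singleton fun i => ?_
    rw [Measure.restrict_apply (measurableSet_singleton _),
      Measure.restrict_apply (measurableSet_singleton _)]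
    by_cases hi : i = 0
    · subst hi; simp
    · rw [Set.inter_eq_left.2 (by simpa using Ne.symm hi),
        Measure.map_apply (hp n) (measurableSet_singleton i), ← hpm₀ n i hi,
        ← hpre (hp₀ n (measurableSet_singleton i))]
      rfl
  have hrestr₀ : ∀ n, ((volume : Measure ℝ).map (p₀ n)).restrict {0}ᶜ = (m n).restrict {0}ᶜ := by
    intro n
    rw [← hrestr n, ← hmap, Measure.map_map (hp₀ n) hdown]
    rfl
  have h0 : ∀ n, MeasurableSet ({0}ᶜ : Set (Fin (k n + 1))) := fun n =>
    (measurableSet_singleton _).compl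
  let A : ℕ → GraphexData X := fun n => (T n).pullback (p n)
  have hA : ∀ n, (A n).IsProper := fun n => (hT n).pullback (hp n)
  have fA : ∀ n, (A n).FiniteOn lam := fun n =>
    ((hT n).finiteOn_pullback (hp n) (h0 n) (vT n) (hrestr n)).2 (fT n)
  have fA₀ : ∀ n, ((T n).pullback (p₀ n)).FiniteOn volume := fun n =>
    ((hT n).finiteOn_pullback (hp₀ n) (h0 n) (vT n) (hrestr₀ n)).2 (fT n)
  have hN : ∀ n, (A n).Near (A (n + 1)) (lam.restrict (B n)ᶜ) (c n) (c n ^ 2) (c n ^ 3) := by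
    intro n
    have hA₀ := (hT n).pullback (hp₀ n)
    have hA₀' := (hT (n + 1)).pullback (hp₀ (n + 1))
    refine Near.pullback hA₀ hA₀' ((fA₀ n).mono hA₀ Measure.restrict_le_self)
      ((fA₀ (n + 1)).mono hA₀' Measure.restrict_le_self) hdown MeasurableSet.univ vanishesOff_univ
      vanishesOff_univ ?_ (hN₀ n)
    rw [Measure.restrict_univ, Measure.restrict_univ, ← hmap,
      Measure.restrict_map hdown (hB₀ n).compl]
    rfl
  -- `G N` avoids all exceptional sets from index `N` on.
  let G : ℕ → Set X := fun N => ⋂ n, (B (n + N))ᶜ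
  have hG : ∀ N, MeasurableSet (G N) := fun N => MeasurableSet.iInter fun n => (hB _).compl
  have hGB : ∀ N n, N ≤ n → G N ⊆ (B n)ᶜ := fun N n hn x hx => by
    have := Set.mem_iInter.1 hx (n - N)
    rwa [Nat.sub_add_cancel hn] at this
  have hGmono : Monotone G := fun N M hNM x hx => Set.mem_iInter.2 fun n =>
    hGB N (n + M) (by omega) hx
  have htail : ∀ N, lam (G N)ᶜ ≤ ∑' n, 2 * (t (n + N) : ℝ≥0∞) := by
    intro N
    have e : (G N)ᶜ = ⋃ n, B (n + N) := by simp [G, Set.compl_iInter]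
    rw [e]
    refine (measure_iUnion_le _).trans (ENNReal.tsum_le_tsum fun n => ?_)
    rw [hpre (hB₀ _)]
    exact hBt₀ _
  have ht2 : ∑' n, 2 * (t n : ℝ≥0∞) ≠ ∞ := by
    rw [ENNReal.tsum_mul_left]
    exact ENNReal.mul_ne_top (by simp) ht
  have hG0 : lam (G 0)ᶜ ≠ ∞ := ne_top_of_le_ne_top ht2 (htail 0)
  obtain ⟨s, hs⟩ : ∃ s : ℝ≥0, lam (G 0)ᶜ ≤ (s : ℝ≥0∞) ^ 2 := by
    refine ⟨NNReal.sqrt (lam (G 0)ᶜ).toNNReal, ?_⟩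
    rw [← ENNReal.coe_pow, NNReal.sq_sqrt, ENNReal.coe_toNNReal hG0]
  -- Passing to the smaller set costs a constant factor, which is the same for all sets.
  let L : ℝ≥0∞ := (1 + s) ^ 2
  have hL1 : 1 ≤ L := one_le_pow₀ le_self_add
  have hN' : ∀ N n, N ≤ n → (A n).Near (A (n + 1)) (lam.restrict (G N)) (L * 2⁻¹ ^ n)
      (L * 2⁻¹ ^ n) (L * 2⁻¹ ^ n) := by
    intro N n hn
    have hadd : lam.restrict (G N) + lam.restrict ((B n)ᶜ \ G N) = lam.restrict (B n)ᶜ := by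
      rw [← Measure.restrict_union Set.disjoint_sdiff_right ((hB n).compl.diff (hG N)),
        Set.union_sdiff_cancel (hGB N n hn)]
    have hE : lam ((B n)ᶜ \ G N) ≤ (s : ℝ≥0∞) ^ 2 :=
      (measure_mono fun x hx hx' => hx.2 (hGmono (Nat.zero_le N) hx')).trans hs
    have hEf : IsFiniteMeasure (lam.restrict ((B n)ᶜ \ G N)) :=
      ⟨by simpa using hE.trans_lt (by simp)⟩
    have h1 := Near.of_add (γ' := lam.restrict (G N)) (η := lam.restrict ((B n)ᶜ \ G N)) (hA n)
      (hA (n + 1))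
      (by rw [hadd]; exact (fA n).mono (hA n) Measure.restrict_le_self)
      (by rw [hadd]; exact (fA (n + 1)).mono (hA (n + 1)) Measure.restrict_le_self)
      (s := s) (by simpa using hE) (by rw [hadd]; exact hN n)
    have hc1 : (c n : ℝ≥0∞) ≤ 1 := (hc n).trans (pow_le_one₀ zero_le (by simp))
    have hs1 : (c n : ℝ≥0∞) + s ≤ 1 + s := add_le_add_left hc1 _
    have h11 : (1 : ℝ≥0∞) ≤ 1 + s := le_self_add
    refine h1.mono ?_ ?_ ?_
    · calc (c n : ℝ≥0∞) = 1 * c n := (one_mul _).symm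
        _ ≤ L * 2⁻¹ ^ n := mul_le_mul' hL1 (hc n)
    · calc (c n : ℝ≥0∞) ^ 2 + c n * s = (c n + s) * c n := by ring
        _ ≤ L * 2⁻¹ ^ n := by
          refine mul_le_mul' (hs1.trans ?_) (hc n)
          simp only [L, sq]
          calc (1 : ℝ≥0∞) + s = 1 * (1 + s) := (one_mul _).symm
            _ ≤ _ := mul_le_mul_left h11 _
    · calc (c n : ℝ≥0∞) ^ 3 + 2 * c n ^ 2 * s + c n * s ^ 2 = (c n + s) ^ 2 * c n := by ring
        _ ≤ L * 2⁻¹ ^ n := mul_le_mul' (pow_le_pow_left' hs1 2) (hc n)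
  have hnear : ∀ N n j, N ≤ n → (A n).Near (A (n + j)) (lam.restrict (G N))
      (∑ i ∈ Finset.range j, L * 2⁻¹ ^ (n + i)) (∑ i ∈ Finset.range j, L * 2⁻¹ ^ (n + i))
      (∑ i ∈ Finset.range j, L * 2⁻¹ ^ (n + i)) := by
    intro N n j hn
    have fA' : ∀ n, (A n).FiniteOn (lam.restrict (G N)) := fun n =>
      (fA n).mono (hA n) Measure.restrict_le_self
    induction j with
    | zero => simpa using near_self (A n) (lam.restrict (G N))
    | succ j ih =>
      simp only [Finset.sum_range_succ]
      exact ih.trans (hA _) (hA _) (hA _) (fA' _) (fA' _) (fA' _) (hN' N (n + j) (by omega))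
  let b : ℕ → ℝ≥0∞ := fun n => L * 2 * 2⁻¹ ^ n
  have hbsum : ∀ n j, ∑ i ∈ Finset.range j, L * 2⁻¹ ^ (n + i) ≤ b n := by
    intro n j
    calc ∑ i ∈ Finset.range j, L * 2⁻¹ ^ (n + i) ≤ ∑' i, L * 2⁻¹ ^ (n + i) :=
          ENNReal.sum_le_tsum _
      _ = L * 2⁻¹ ^ n * ∑' i, 2⁻¹ ^ i := by
          rw [← ENNReal.tsum_mul_left]
          refine tsum_congr fun i => ?_
          rw [pow_add, mul_assoc]
      _ = b n := by
          rw [ENNReal.tsum_geometric, ENNReal.one_sub_inv_two, inv_inv]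
          simp only [b]
          ring
  have hLtop : L * 2 ≠ ∞ := ENNReal.mul_ne_top (ENNReal.pow_ne_top (by simp)) (by simp)
  have hbt : ∑' n, b n ≠ ∞ := by
    rw [ENNReal.tsum_mul_left, ENNReal.tsum_geometric, ENNReal.one_sub_inv_two, inv_inv]
    exact ENNReal.mul_ne_top hLtop (by simp)
  have hcauchy : IsLocallyCauchy A lam G b :=
    { proper := hA
      finiteOn := fA
      measurableSet := hG
      monotone := hGmono
      measure_compl := fun N => ne_top_of_le_ne_top hG0
        (measure_mono (Set.compl_subset_compl.2 (hGmono (Nat.zero_le N))))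
      measure_compl_iUnion := by
        have h1 := ENNReal.tendsto_sum_nat_add _ ht2
        refine le_antisymm (ge_of_tendsto' h1 fun N => ?_) zero_le
        exact (measure_mono (Set.compl_subset_compl.2 (Set.subset_iUnion G N))).trans (htail N)
      tsum_ne_top := hbt
      near := fun N n j hn hj => by
        obtain ⟨i, rfl⟩ := Nat.exists_eq_add_of_le hj
        exact (hnear N n i hn).mono (hbsum n i) (hbsum n i) (hbsum n i) }
  obtain ⟨Y, hY, fY, nY, cY, dY⟩ := hcauchy.exists_limit
  let V : Graphex.{u} :=
    { Ω := X
      μ := lam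
      data := Y
      measurable_W := hY.measurable_W
      W_mem := hY.W_mem
      W_symm := hY.W_symm
      measurable_S := hY.measurable_S
      S_nonneg := hY.S_nonneg
      I_nonneg := hY.I_nonneg
      integrable_section := by
        have h1 : ∀ N, ∀ᵐ x ∂lam, x ∈ G N → Integrable (fun y => Y.W y x) lam := by
          intro N
          rw [← ae_restrict_iff' (hG N)]
          filter_upwards [(fY N).ae_lt_top hY] with x hx
          have hfin : ∫⁻ y, ENNReal.ofReal (Y.W x y) ∂lam < ∞ := by
            rw [← lintegral_add_compl _ (hG N)]
            refine ENNReal.add_lt_top.2 ⟨(le_self_add.trans_lt hx), ?_⟩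
            refine lt_of_le_of_lt (b := lam (G N)ᶜ) ?_
              (hcauchy.measure_compl N).lt_top
            refine (lintegral_mono (g := fun _ => 1) fun y => ?_).trans (by simp)
            exact ENNReal.ofReal_le_one.2 (hY.W_mem x y).2
          simp only [fun y => hY.W_symm y x]
          refine ⟨(hY.measurable_section x).aestronglyMeasurable, ?_⟩
          rw [hasFiniteIntegral_iff_ofReal (ae_of_all _ fun y => (hY.W_mem x y).1)]
          exact hfin
        have h3 : ∀ᵐ x ∂lam, x ∈ ⋃ N, G N := mem_ae_iff.2 hcauchy.measure_compl_iUnion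
        filter_upwards [ae_all_iff.2 h1, h3] with x hx hxU
        obtain ⟨N, hN⟩ := Set.mem_iUnion.1 hxU
        exact hx N hN
      exists_integrable_restrict := ⟨G 0, hG 0, hG0.lt_top, (fY 0).1.lt_top⟩ }
  refine ⟨V, p, G, hp, hrestr, hG, htail, fY, ⟨b, hcauchy.tendsto_rate, nY⟩, fun C hC => ?_,
    fun C hC => ?_⟩
  · refine cY C fun n => ?_
    rw [(hT n).norm1_pullback (hp n) (h0 n) (vT n) (hrestr n)]
    exact hC n
  · refine dY C fun n => ?_
    have h1 : ∀ᵐ i ∂(lam.map (p n)).restrict {0}ᶜ, (T n).marginal (m n) i ≤ C := by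
      rw [hrestr n]
      exact ae_restrict_of_ae (hC n)
    rw [ae_restrict_iff' (h0 n)] at h1
    filter_upwards [ae_of_ae_map (hp n).aemeasurable h1] with x hx
    rw [(hT n).marginal_pullback (hp n) (h0 n) (vT n) (hrestr n)]
    by_cases hx0 : p n x = 0
    · rw [(vT n).marginal_eq _ (by simp [hx0])]
      exact zero_le
    · exact hx hx0

end LineSequence

/-! ### Limits of rapidly convergent sequences of graphexes -/

section SequentialCompleteness

namespace GraphexData

/-- Data in `L¹ ∩ L²` are approximated in `δ_{2→2}` by step graphexes of the same norm, whose
marginals satisfy the same upper bounds. -/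
lemma exists_step_delta22_le {Ω : Type*} [MeasurableSpace Ω] {T : GraphexData Ω} {μ : Measure Ω}
    [SigmaFinite μ] (hT : T.IsProper) (fT : T.FiniteOn μ) {c : ℝ≥0} (hc : 0 < c) :
    ∃ (n : ℕ) (T' : GraphexData (Fin (n + 1))) (m : Measure (Fin (n + 1))), IsFiniteMeasure m ∧
      m {0} = 0 ∧ T'.IsProper ∧ T'.VanishesOff {0}ᶜ ∧ T'.FiniteOn m ∧
      delta22 T μ T' m ≤ c ∧ T'.norm1 m = T.norm1 μ ∧
      ∀ D : ℝ≥0∞, (∀ᵐ x ∂μ, T.marginal μ x ≤ D) → ∀ᵐ i ∂m, T'.marginal m i ≤ D := by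
  obtain ⟨n, l, hl, hf, hJ⟩ := exists_average_jointNear (ε := min c (c ^ 2)) hT fT
    (lt_min (by simpa using hc) (by exact_mod_cast pow_pos hc 2)).ne'
  have hfin : IsFiniteMeasure (cellMeasure μ l) := by
    refine ⟨?_⟩
    have h1 := lintegral_cellMeasure (μ := μ) hl fun _ => 1
    simp only [lintegral_one, one_mul] at h1
    rw [h1]
    exact ENNReal.sum_lt_top.2 fun i _ => (hf _ (Fin.succ_ne_zero i)).lt_top
  have hp := average_isProper (μ := μ) (l := l) hT
  have hfo := average_finiteOn hT hl hf fT.1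
  refine ⟨n, T.average μ l, cellMeasure μ l, hfin, cellMeasure_zero, hp, average_vanishesOff, hfo,
    JointNear.delta22_le' hT hp fT hfo
      (hJ.mono (min_le_left _ _) (min_le_right _ _) zero_le), average_norm1 hT hl hf fT.1,
    fun D hD => average_marginal_le hT hl hf fT.1 hD⟩

variable {X : Type*} [MeasurableSpace X] {n : ℕ} {T : GraphexData (Fin (n + 1))}
  {m : Measure (Fin (n + 1))} {η : Measure X}

/-- A realization of a step graphex on another measure space has distance zero from it. -/
lemma jointNear_pullback_label [SFinite m] [SFinite η] (hT : T.IsProper) (fT : T.FiniteOn m)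
    (vT : T.VanishesOff {0}ᶜ) (hm : m {0} = 0) {p : X → Fin (n + 1)} (hp : Measurable p)
    (h : (η.map p).restrict {0}ᶜ = m.restrict {0}ᶜ) :
    JointNear T m (T.pullback p) η 0 0 0 := by
  have h0 : MeasurableSet ({0}ᶜ : Set (Fin (n + 1))) := (measurableSet_singleton _).compl
  have hTp := hT.pullback hp
  have fTp := (hT.finiteOn_pullback hp h0 vT h).2 fT
  let p₁ : X → Fin (n + 1) ⊕ ℝ := fun x => if p x = 0 then Sum.inr 0 else Sum.inl (p x)
  have hp₁ : Measurable p₁ := Measurable.ite (hp (measurableSet_singleton 0)) measurable_const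
    (measurable_inl.comp hp)
  have hc : Covers η p₁ m := by
    refine ⟨hp₁, fun B hB => ?_⟩
    have e : p₁ ⁻¹' (Sum.inl '' B) = p ⁻¹' (B ∩ {0}ᶜ) := by
      ext x
      by_cases hx : p x = 0 <;> simp [p₁, hx]
    rw [e, ← Measure.map_apply hp (hB.inter h0), ← Measure.restrict_apply hB, h,
      Measure.restrict_apply hB]
    refine measure_congr ?_
    have : ({0}ᶜ : Set (Fin (n + 1))) ∈ ae m := by simpa [mem_ae_iff] using hm
    filter_upwards [this] with i hi
    exact propext ⟨fun hx => hx.1, fun hx => ⟨hx, hi⟩⟩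
  have e : T.extend.pullback p₁ = (T.pullback p).extend.pullback Sum.inl := by
    have hW : (T.extend.pullback p₁).W = (T.pullback p).W := by
      funext x y
      by_cases hx : p x = 0
      · have h1 : T.W 0 (p y) = 0 := vT.W_eq _ _ (by simp)
        simp [GraphexData.pullback, extend, p₁, hx, h1]
      · by_cases hy : p y = 0
        · have h1 : T.W (p x) 0 = 0 := vT.W_eq' hT _ _ (by simp)
          simp [GraphexData.pullback, extend, p₁, hx, hy, h1]
        · simp [GraphexData.pullback, extend, p₁, hx, hy]
    have hS : (T.extend.pullback p₁).S = (T.pullback p).S := by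
      funext x
      by_cases hx : p x = 0
      · have h1 : T.S 0 = 0 := vT.S_eq _ (by simp)
        simp [GraphexData.pullback, extend, p₁, hx, h1]
      · simp [GraphexData.pullback, extend, p₁, hx]
    calc T.extend.pullback p₁ = ⟨(T.extend.pullback p₁).W, (T.extend.pullback p₁).S, T.I⟩ := rfl
      _ = (T.pullback p).extend.pullback Sum.inl := by rw [hW, hS]; rfl
  refine jointNear_of_covers hT hTp fT fTp hc (covers_inl η) ?_
  rw [e]
  exact near_self _ _

lemma Near.delta22_le {X : Type*} [MeasurableSpace X] {A B : GraphexData X} {η : Measure X}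
    [SigmaFinite η] (hA : A.IsProper) (hB : B.IsProper) (fA : A.FiniteOn η) (fB : B.FiniteOn η)
    {c : ℝ≥0∞} (h : A.Near B η c (c ^ 2) (c ^ 3)) : delta22 A η B η ≤ c :=
  (jointNear_of_covers hA hB fA fB (covers_inl η) (covers_inl η) h).delta22_le' hA hB fA fB

end GraphexData

open GraphexData

lemma eventually_le_min_pow {b : ℕ → ℝ≥0∞} (hb : Tendsto b atTop (𝓝 0)) {ε : ℝ≥0} (hε : 0 < ε) :
    ∀ᶠ n in atTop, b n ≤ ε ∧ b n ≤ ε ^ 2 ∧ b n ≤ ε ^ 3 := by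
  have h1 : ∀ k : ℕ, ∀ᶠ n in atTop, b n ≤ (ε : ℝ≥0∞) ^ k := fun k =>
    hb.eventually_le_const (by exact_mod_cast pow_pos hε k)
  filter_upwards [h1 1, h1 2, h1 3] with n h1 h2 h3
  exact ⟨by simpa using h1, h2, h3⟩

lemma tendsto_zero_of_eventually_le_two_mul {b : ℕ → ℝ≥0∞}
    (h : ∀ ε : ℝ≥0, 0 < ε → ∀ᶠ n in atTop, b n ≤ 2 * ε) : Tendsto b atTop (𝓝 0) := by
  rw [ENNReal.tendsto_nhds_zero]
  intro ε hε
  obtain ⟨δ, hδ, hδε⟩ := ENNReal.lt_iff_exists_nnreal_btwn.1 (ENNReal.half_pos hε.ne')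
  filter_upwards [h δ (by simpa using hδ)] with n hn
  refine hn.trans ?_
  calc (2 : ℝ≥0∞) * δ ≤ 2 * (ε / 2) := mul_le_mul_right hδε.le _
    _ = ε := ENNReal.mul_div_cancel two_ne_zero (by simp)

lemma tendsto_inv_two_pow :
    Tendsto (fun n : ℕ => ((2⁻¹ ^ (n + 2) : ℝ≥0) : ℝ≥0∞)) atTop (𝓝 0) := by
  rw [← ENNReal.coe_zero, ENNReal.tendsto_coe]
  exact (tendsto_add_atTop_iff_nat 2).2
    (tendsto_pow_atTop_nhds_zero_of_lt_one zero_le (by rw [← NNReal.coe_lt_coe]; norm_num))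

lemma inv_two_pow_sum_lt (n : ℕ) :
    ((2⁻¹ ^ (n + 2) : ℝ≥0) : ℝ≥0∞) + 2⁻¹ ^ (n + 2) + ((2⁻¹ ^ (n + 3) : ℝ≥0) : ℝ≥0∞) < 2⁻¹ ^ n := by
  have h : (2⁻¹ ^ (n + 2) + 2⁻¹ ^ (n + 2) + 2⁻¹ ^ (n + 3) : ℝ≥0) < 2⁻¹ ^ n := by
    have : (0 : ℝ≥0) < 2⁻¹ ^ n := by positivity
    rw [← NNReal.coe_lt_coe] at this ⊢
    push_cast at this ⊢
    rw [pow_add, pow_add]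
    norm_num
    linarith
  have e : ∀ k : ℕ, ((2⁻¹ : ℝ≥0∞) ^ k) = ((2⁻¹ ^ k : ℝ≥0) : ℝ≥0∞) := fun k => by
    rw [ENNReal.coe_pow, ENNReal.coe_inv two_ne_zero]; rfl
  rw [e, e, ← ENNReal.coe_add, ← ENNReal.coe_add]
  exact_mod_cast h

/-- A sequence of graphexes with rapidly decreasing weak kernel distances has a limit, and bounds
for the norms and the marginals are inherited by the limit. -/
lemma Graphex.exists_tendsto_weakKernelDist {V : ℕ → Graphex.{u}}
    (hV : ∀ n, (V n).weakKernelDist (V (n + 1)) < 2⁻¹ ^ (n + 2)) :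
    ∃ Y : Graphex.{u}, Tendsto (fun n => (V n).weakKernelDist Y) atTop (𝓝 0) ∧
      (∀ C : ℝ≥0∞, (∀ n, (V n).norm1 ≤ C) → Y.norm1 ≤ C) ∧
      (∀ C : ℝ≥0∞, (∀ n, ∀ᵐ x ∂(V n).μ, (V n).data.marginal (V n).μ x ≤ C) →
        ∀ᵐ x ∂Y.μ, Y.data.marginal Y.μ x ≤ C) := by
  -- Each graphex is replaced by a step graphex at a distance that is summable.
  have hstep : ∀ n, ∃ (k : ℕ) (T : GraphexData (Fin (k + 1))) (m : Measure (Fin (k + 1))),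
      IsFiniteMeasure m ∧ m {0} = 0 ∧ T.IsProper ∧ T.VanishesOff {0}ᶜ ∧ T.FiniteOn m ∧
      deltaDiamond (V n).data (V n).μ T m ≤ ((2⁻¹ ^ (n + 2) : ℝ≥0) : ℝ≥0∞) ∧
      T.norm1 m ≤ (V n).norm1 ∧
      ∀ D : ℝ≥0∞, (∀ᵐ x ∂(V n).μ, (V n).data.marginal (V n).μ x ≤ D) →
        ∀ᵐ i ∂m, T.marginal m i ≤ D := by
    intro n
    have hc : (0 : ℝ≥0) < 2⁻¹ ^ (n + 3) := by positivity
    obtain ⟨κ, hκ, fκ⟩ := (V n).exists_finiteOn (r := (2⁻¹ ^ (n + 3)) ^ 2) (pow_pos hc 2)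
    have : SigmaFinite κ := hκ.sigmaFinite
    obtain ⟨k, T, m, hm, hm0, hT, vT, fT, hd, hn, hD⟩ :=
      exists_step_delta22_le (V n).isProper fκ hc
    refine ⟨k, T, m, hm, hm0, hT, vT, fT, ?_, ?_, fun D hVD => hD D ?_⟩
    · refine (deltaDiamond_triangle (V n).isProper (V n).isProper hT (μ₂ := κ)).trans ?_
      refine (add_le_add (deltaDiamond_self_le (V n).isProper fκ hκ)
        ((deltaDiamond_le_delta22 (V n).isProper hT fκ fT).trans hd)).trans (le_of_eq ?_)
      rw [← ENNReal.coe_add, ENNReal.coe_inj, pow_succ (2⁻¹ : ℝ≥0) (n + 2), ← mul_add]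
      have : (2⁻¹ + 2⁻¹ : ℝ≥0) = 1 := by
        rw [← NNReal.coe_inj]; push_cast; norm_num
      rw [this, mul_one]
    · rw [hn]
      exact (V n).isProper.norm1_mono hκ.le
    · filter_upwards [ae_mono hκ.le hVD] with x hx
      exact ((V n).isProper.marginal_mono hκ.le x).trans hx
  choose k T m hm hm0 hT vT fT hd hn hD using hstep
  have hTT : ∀ n, deltaDiamond (T n) (m n) (T (n + 1)) (m (n + 1)) < 2⁻¹ ^ n := by
    intro n
    refine lt_of_le_of_lt ?_ (inv_two_pow_sum_lt n)
    refine (deltaDiamond_triangle (hT n) (V (n + 1)).isProper (hT (n + 1))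
      (μ₂ := (V (n + 1)).μ)).trans (add_le_add ?_ (hd (n + 1)))
    refine (deltaDiamond_triangle (hT n) (V n).isProper (V (n + 1)).isProper
      (μ₂ := (V n).μ)).trans (add_le_add ?_ (hV n).le)
    rw [deltaDiamond_comm (hT n) (V n).isProper]
    exact hd n
  choose c hc ν ν' fν fν' hν hν' hJ using fun n =>
    exists_of_deltaDiamond_lt (hT n) (hT (n + 1)) (hTT n)
  have hct : ∑' n, ((c n ^ 2 : ℝ≥0) : ℝ≥0∞) ≠ ∞ := by
    refine ne_top_of_le_ne_top (b := ∑' n, (2⁻¹ : ℝ≥0∞) ^ n) ?_ (ENNReal.tsum_le_tsum fun n => ?_)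
    · rw [ENNReal.tsum_geometric, ENNReal.one_sub_inv_two, inv_inv]; simp
    · have h1 : (c n : ℝ≥0∞) ≤ 1 := (hc n).le.trans (pow_le_one₀ zero_le (by simp))
      rw [ENNReal.coe_pow, sq]
      calc (c n : ℝ≥0∞) * c n ≤ 1 * 2⁻¹ ^ n := mul_le_mul' h1 (hc n).le
        _ = _ := one_mul _
  obtain ⟨Y, p, G, hp, hrestr, hG, htail, fY, ⟨b, hb, hN⟩, hY1, hY2⟩ :=
    Graphex.exists_limit.{u} hT vT fT hct (fun n => (hc n).le) hν hν' hJ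
  refine ⟨Y, ?_, fun C hC => hY1 C fun n => (hn n).trans (hC n),
    fun C hC => hY2 C fun n => hD n C (hC n)⟩
  have h0 : ∀ n, MeasurableSet ({0}ᶜ : Set (Fin (k n + 1))) := fun n =>
    (measurableSet_singleton _).compl
  have hA : ∀ n, ((T n).pullback (p n)).IsProper := fun n => (hT n).pullback (hp n)
  have fA : ∀ n, ((T n).pullback (p n)).FiniteOn Y.μ := fun n =>
    ((hT n).finiteOn_pullback (hp n) (h0 n) (vT n) (hrestr n)).2 (fT n)
  have h2 : Tendsto (fun N => ∑' n, 2 * ((c (n + N) ^ 2 : ℝ≥0) : ℝ≥0∞)) atTop (𝓝 0) :=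
    ENNReal.tendsto_sum_nat_add (fun n => 2 * ((c n ^ 2 : ℝ≥0) : ℝ≥0∞)) (by
      rw [ENNReal.tsum_mul_left]; exact ENNReal.mul_ne_top (by simp) hct)
  have key : ∀ ε : ℝ≥0, 0 < ε → ∀ᶠ n in atTop, (V n).weakKernelDist Y ≤ 2 * ε := by
    intro ε hε
    obtain ⟨N, hN2⟩ := (h2.eventually_le_const
      (by exact_mod_cast pow_pos hε 2 : (0 : ℝ≥0∞) < (ε : ℝ≥0∞) ^ 2)).exists
    filter_upwards [eventually_ge_atTop N, eventually_le_min_pow hb hε,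
      tendsto_inv_two_pow.eventually_le_const (by simpa using hε : (0 : ℝ≥0∞) < ε)]
        with n hnN hbn h3n
    have d1 : deltaDiamond (T n) (m n) ((T n).pullback (p n)) Y.μ ≤ 0 :=
      (deltaDiamond_le_delta22 (hT n) (hA n) (fT n) (fA n)).trans
        (JointNear.delta22_le' (hT n) (hA n) (fT n) (fA n) (by
          simpa using jointNear_pullback_label (hT n) (fT n) (vT n) (hm0 n) (hp n) (hrestr n)))
    have fA' := (fA n).mono (hA n) (Measure.restrict_le_self (s := G N))
    have hfull : IsNearlyFull Y.μ (Y.μ.restrict (G N)) (ε ^ 2) :=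
      isNearlyFull_restrict (hG N) ((htail N).trans (by simpa using hN2))
    have d2 : deltaDiamond ((T n).pullback (p n)) Y.μ Y.data Y.μ ≤ ε :=
      deltaDiamond_le (hA n) Y.isProper fA' (fY N) hfull hfull
        (Near.delta22_le (hA n) Y.isProper fA' (fY N)
          ((hN N n hnN).mono hbn.1 hbn.2.1 hbn.2.2))
    calc (V n).weakKernelDist Y
        ≤ deltaDiamond (V n).data (V n).μ (T n) (m n) + deltaDiamond (T n) (m n) Y.data Y.μ :=
          deltaDiamond_triangle (V n).isProper (hT n) Y.isProper
      _ ≤ ε + (0 + ε) := add_le_add ((hd n).trans h3n)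
          ((deltaDiamond_triangle (hT n) (hA n) Y.isProper (μ₂ := Y.μ)).trans (add_le_add d1 d2))
      _ = 2 * ε := by rw [zero_add, two_mul]
  exact tendsto_zero_of_eventually_le_two_mul key

/-- The analogue of `Graphex.exists_tendsto_weakKernelDist` for the kernel distance. -/
lemma Graphex.exists_tendsto_kernelDist {V : ℕ → Graphex.{u}}
    (fV : ∀ n, (V n).data.FiniteOn (V n).μ)
    (hV : ∀ n, (V n).kernelDist (V (n + 1)) < 2⁻¹ ^ (n + 2)) :
    ∃ Y : Graphex.{u}, Y.data.FiniteOn Y.μ ∧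
      Tendsto (fun n => (V n).kernelDist Y) atTop (𝓝 0) ∧
      (∀ C : ℝ≥0∞, (∀ n, (V n).norm1 ≤ C) → Y.norm1 ≤ C) ∧
      (∀ C : ℝ≥0∞, (∀ n, ∀ᵐ x ∂(V n).μ, (V n).data.marginal (V n).μ x ≤ C) →
        ∀ᵐ x ∂Y.μ, Y.data.marginal Y.μ x ≤ C) := by
  choose k T m hm hm0 hT vT fT hd hn hD using fun n =>
    exists_step_delta22_le (V n).isProper (fV n)
      (by positivity : (0 : ℝ≥0) < 2⁻¹ ^ (n + 2))
  have hTT : ∀ n, delta22 (T n) (m n) (T (n + 1)) (m (n + 1)) < 2⁻¹ ^ n := by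
    intro n
    refine lt_of_le_of_lt ?_ (inv_two_pow_sum_lt n)
    refine (delta22_triangle (hT n) (V (n + 1)).isProper (hT (n + 1)) (fT n) (fV (n + 1))
      (fT (n + 1))).trans (add_le_add ?_ (hd (n + 1)))
    refine (delta22_triangle (hT n) (V n).isProper (V (n + 1)).isProper (fT n) (fV n)
      (fV (n + 1))).trans (add_le_add ?_ (hV n).le)
    rw [delta22_comm (hT n) (V n).isProper (fT n) (fV n)]
    exact hd n
  have e : ∀ n : ℕ, ((2⁻¹ ^ n : ℝ≥0) : ℝ≥0∞) = 2⁻¹ ^ n := fun n => by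
    rw [ENNReal.coe_pow, ENNReal.coe_inv two_ne_zero]; rfl
  have hJ : ∀ n, JointNear (T n) (m n) (T (n + 1)) (m (n + 1)) ((2⁻¹ ^ n : ℝ≥0) : ℝ≥0∞)
      (((2⁻¹ ^ n : ℝ≥0) : ℝ≥0∞) ^ 2) (((2⁻¹ ^ n : ℝ≥0) : ℝ≥0∞) ^ 3) := fun n => by
    rw [e]; exact jointNear_of_delta22_lt (hTT n)
  -- No mass has to be removed here, so the exceptional sets are null sets.
  obtain ⟨Y, p, G, hp, hrestr, hG, htail, fY, ⟨b, hb, hN⟩, hY1, hY2⟩ :=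
    Graphex.exists_limit.{u} (ν := m) (ν' := fun n => m (n + 1)) (t := fun _ => 0)
      (c := fun n => 2⁻¹ ^ n) hT vT fT (by simp) (fun n => (e n).le)
      (fun n => isNearlyFull_self _ _) (fun n => isNearlyFull_self _ _) hJ
  have hG0 : Y.μ.restrict (G 0) = Y.μ := Measure.restrict_eq_self_of_ae_mem
    (mem_ae_iff.2 (le_antisymm ((htail 0).trans (by simp)) zero_le))
  have fY0 := fY 0
  rw [hG0] at fY0
  refine ⟨Y, fY0, ?_, fun C hC => hY1 C fun n => (hn n).le.trans (hC n),
    fun C hC => hY2 C fun n => hD n C (hC n)⟩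
  have h0 : ∀ n, MeasurableSet ({0}ᶜ : Set (Fin (k n + 1))) := fun n =>
    (measurableSet_singleton _).compl
  have hA : ∀ n, ((T n).pullback (p n)).IsProper := fun n => (hT n).pullback (hp n)
  have fA : ∀ n, ((T n).pullback (p n)).FiniteOn Y.μ := fun n =>
    ((hT n).finiteOn_pullback (hp n) (h0 n) (vT n) (hrestr n)).2 (fT n)
  have key : ∀ ε : ℝ≥0, 0 < ε → ∀ᶠ n in atTop, (V n).kernelDist Y ≤ 2 * ε := by
    intro ε hε
    filter_upwards [eventually_le_min_pow hb hε,
      tendsto_inv_two_pow.eventually_le_const (by simpa using hε : (0 : ℝ≥0∞) < ε)] with n hbn h3n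
    have d1 : delta22 (T n) (m n) ((T n).pullback (p n)) Y.μ ≤ 0 :=
      JointNear.delta22_le' (hT n) (hA n) (fT n) (fA n) (by
        simpa using jointNear_pullback_label (hT n) (fT n) (vT n) (hm0 n) (hp n) (hrestr n))
    have hN0 := hN 0 n (Nat.zero_le n)
    rw [hG0] at hN0
    have d2 : delta22 ((T n).pullback (p n)) Y.μ Y.data Y.μ ≤ ε :=
      Near.delta22_le (hA n) Y.isProper (fA n) fY0 (hN0.mono hbn.1 hbn.2.1 hbn.2.2)
    calc (V n).kernelDist Y
        ≤ delta22 (V n).data (V n).μ (T n) (m n) + delta22 (T n) (m n) Y.data Y.μ :=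
          delta22_triangle (V n).isProper (hT n) Y.isProper (fV n) (fT n) fY0
      _ ≤ ε + (0 + ε) := add_le_add ((hd n).trans h3n)
          ((delta22_triangle (hT n) (hA n) Y.isProper (fT n) (fA n) fY0).trans
            (add_le_add d1 d2))
      _ = 2 * ε := by rw [zero_add, two_mul]
  exact tendsto_zero_of_eventually_le_two_mul key

end SequentialCompleteness

/-! ### Tightness and compactness -/

section Compactness

section Criteria

variable {α : Type*} [PseudoEMetricSpace α] {s : Set α}

/-- Total boundedness in terms of finite colourings, so that no centres of balls have to be
produced: any member of a colour class serves as one. -/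
lemma totallyBounded_of_colouring (h : ∀ ε : ℝ≥0, 0 < ε → ∃ (κ : Type) (_ : Finite κ)
    (col : s → κ), ∀ x y, col x = col y → edist x.1 y.1 ≤ ε) : TotallyBounded s := by
  rw [EMetric.totallyBounded_iff]
  intro ε hε
  obtain ⟨δ, hδ, hδε⟩ := ENNReal.lt_iff_exists_nnreal_btwn.1 hε
  obtain ⟨κ, _, col, hcol⟩ := h δ (by simpa using hδ)
  -- One representative is chosen for each colour that occurs.
  choose f hf using fun i : Set.range col => i.2
  refine ⟨Set.range fun i => (f i).1, Set.finite_range _, fun x hx => ?_⟩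
  refine Set.mem_biUnion (Set.mem_range_self (⟨col ⟨x, hx⟩, ⟨x, hx⟩, rfl⟩ : Set.range col)) ?_
  exact (hcol ⟨x, hx⟩ _ (hf ⟨col ⟨x, hx⟩, ⟨x, hx⟩, rfl⟩).symm).trans_lt hδε

/-- Completeness need only be checked on sequences whose consecutive distances decrease
geometrically. -/
lemma isComplete_of_fast_sequences (H : ∀ x : ℕ → α, (∀ n, x n ∈ s) →
    (∀ n, edist (x n) (x (n + 1)) < 2⁻¹ ^ (n + 2)) →
    ∃ y ∈ s, Tendsto (fun n => edist (x n) y) atTop (𝓝 0)) : IsComplete s := by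
  rw [← completeSpace_coe_iff_isComplete]
  refine EMetric.complete_of_convergent_controlled_sequences (fun n => 2⁻¹ ^ (n + 2))
    (fun n => ENNReal.pow_pos (by simp) _) fun x hx => ?_
  obtain ⟨y, hy, hlim⟩ := H (fun n => (x n).1) (fun n => (x n).2)
    fun n => hx n n (n + 1) le_rfl n.le_succ
  exact ⟨⟨y, hy⟩, tendsto_iff_edist_tendsto_0.2 hlim⟩

end Criteria

open GraphexData

namespace Graphex

/-- The restriction of a graphex to a subset of its feature space: the measure is restricted, the
space stays the same. -/
noncomputable def restrict (V : Graphex.{u}) (B : Set V.Ω) : Graphex.{u} where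
  Ω := V.Ω
  μ := V.μ.restrict B
  data := V.data
  measurable_W := V.measurable_W
  W_mem := V.W_mem
  W_symm := V.W_symm
  measurable_S := V.measurable_S
  S_nonneg := V.S_nonneg
  I_nonneg := V.I_nonneg
  integrable_section := by
    filter_upwards [ae_restrict_of_ae V.integrable_section] with x hx using hx.restrict
  exists_integrable_restrict := by
    obtain ⟨A, hA, hfin, hn⟩ := V.exists_integrable_restrict
    refine ⟨A, hA, (Measure.restrict_le_self _).trans_lt hfin,
      (V.isProper.norm1_mono ?_).trans_lt hn⟩
    rw [Measure.restrict_restrict hA]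
    exact Measure.restrict_mono_set _ Set.inter_subset_left

/-- Members of a tight set of graphexes can be distinguished up to any given weak kernel distance by
finitely many colours. -/
lemma IsTight.exists_colouring {𝒮 : Set Graphex.{u}} (h : IsTight 𝒮) {ε : ℝ≥0} (hε : 0 < ε) :
    ∃ (κ : Type) (_ : Finite κ) (col : 𝒮 → κ),
      ∀ V V', col V = col V' → V.1.weakKernelDist V'.1 ≤ ε := by
  have hε3 : 0 < ε / 3 := by positivity
  obtain ⟨C, D, hCD⟩ := h ((ε / 3) ^ 2) (pow_pos hε3 2)
  choose A hA hAμ hAb using hCD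
  obtain ⟨κ, hκ, col, hcol⟩ := Graphex.exists_colouring.{u} C D hε3
  have f : ∀ V : 𝒮, V.1.data.FiniteOn (V.1.μ.restrict (A V.1 V.2)ᶜ) := fun V =>
    V.1.isProper.finiteOn_of_isBounded (hAb V.1 V.2)
  have hself : ∀ V : 𝒮, deltaDiamond V.1.data V.1.μ V.1.data (V.1.μ.restrict (A V.1 V.2)ᶜ)
      ≤ (ε / 3 : ℝ≥0) := fun V =>
    deltaDiamond_self_le V.1.isProper (f V)
      (isNearlyFull_restrict (hA V.1 V.2).compl (by rw [compl_compl]; exact hAμ V.1 V.2))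
  refine ⟨κ, hκ, fun V => col ⟨V.1.restrict (A V.1 V.2)ᶜ, hAb V.1 V.2⟩, fun V V' hVV => ?_⟩
  have h1 : deltaDiamond V.1.data (V.1.μ.restrict (A V.1 V.2)ᶜ) V'.1.data
      (V'.1.μ.restrict (A V'.1 V'.2)ᶜ) ≤ (ε / 3 : ℝ≥0) :=
    (deltaDiamond_le_delta22 V.1.isProper V'.1.isProper (f V) (f V')).trans (hcol _ _ hVV)
  calc V.1.weakKernelDist V'.1
      ≤ deltaDiamond V.1.data V.1.μ V'.1.data (V'.1.μ.restrict (A V'.1 V'.2)ᶜ) +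
          deltaDiamond V'.1.data (V'.1.μ.restrict (A V'.1 V'.2)ᶜ) V'.1.data V'.1.μ :=
        deltaDiamond_triangle V.1.isProper V'.1.isProper V'.1.isProper
    _ ≤ ((ε / 3 : ℝ≥0) + (ε / 3 : ℝ≥0)) + (ε / 3 : ℝ≥0) := by
        refine add_le_add ((deltaDiamond_triangle V.1.isProper V.1.isProper V'.1.isProper
          (μ₂ := V.1.μ.restrict (A V.1 V.2)ᶜ)).trans (add_le_add (hself V) h1)) ?_
        rw [deltaDiamond_comm V'.1.isProper V'.1.isProper]
        exact hself V'
    _ = ε := by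
        rw [← ENNReal.coe_add, ← ENNReal.coe_add, add_thirds]

lemma isTight_setOf_norm1_le (C : ℝ≥0) : IsTight {V : Graphex.{u} | V.norm1 ≤ C} := fun ε hε =>
  ⟨C, C / ε, fun V hV => V.isProper.exists_isBounded_restrict hε hV⟩

lemma IsTight.mono {𝒮 𝒮' : Set Graphex.{u}} (h : IsTight 𝒮') (hs : 𝒮 ⊆ 𝒮') : IsTight 𝒮 :=
  fun ε hε => (h ε hε).imp fun _ => Exists.imp fun _ hD V hV => hD V (hs hV)

end Graphex

/-- A measure which is nearly full dominates half of the original measure outside a small set. -/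
lemma IsNearlyFull.exists_restrict_le {Ω : Type*} [MeasurableSpace Ω] {μ ν : Measure Ω}
    [SigmaFinite μ] {r : ℝ≥0} (h : IsNearlyFull μ ν r) :
    ∃ A, MeasurableSet A ∧ μ A ≤ 2 * r ∧ μ.restrict Aᶜ ≤ (2 : ℝ≥0∞) • ν := by
  obtain ⟨θ, hθ, hθ1, rfl⟩ := exists_density_of_le h.le
  have hκ := measure_univ_le_of_add_le (fun B hB => (h B hB).1)
    (withDensity_add_withDensity_one_sub μ hθ hθ1)
  have hA : MeasurableSet {x | θ x < 2⁻¹} := measurableSet_lt hθ measurable_const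
  refine ⟨{x | θ x < 2⁻¹}, hA, ?_, Measure.le_iff.2 fun E hE => ?_⟩
  · rw [withDensity_apply _ MeasurableSet.univ, Measure.restrict_univ] at hκ
    calc μ {x | θ x < 2⁻¹} = ∫⁻ x in {x | θ x < 2⁻¹}, 1 ∂μ := by simp
      _ ≤ ∫⁻ x in {x | θ x < 2⁻¹}, 2 * (1 - θ x) ∂μ := by
          refine setLIntegral_mono' hA fun x hx => ?_
          have h1 : (2⁻¹ : ℝ≥0∞) ≤ 1 - θ x := by
            rw [← ENNReal.one_sub_inv_two]
            exact tsub_le_tsub_left (le_of_lt hx) 1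
          calc (1 : ℝ≥0∞) = 2 * 2⁻¹ := (ENNReal.mul_inv_cancel two_ne_zero (by simp)).symm
            _ ≤ _ := mul_le_mul_right h1 _
      _ ≤ ∫⁻ x, 2 * (1 - θ x) ∂μ := setLIntegral_le_lintegral _ _
      _ = 2 * ∫⁻ x, (1 - θ x) ∂μ := lintegral_const_mul _ (measurable_const.sub hθ)
      _ ≤ 2 * r := mul_le_mul_right hκ _
  · rw [Measure.restrict_apply hE, Measure.smul_apply, withDensity_apply _ hE, smul_eq_mul,
      ← lintegral_const_mul _ hθ]
    calc μ (E ∩ {x | θ x < 2⁻¹}ᶜ) = ∫⁻ x in E ∩ {x | θ x < 2⁻¹}ᶜ, 1 ∂μ := by simp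
      _ ≤ ∫⁻ x in E ∩ {x | θ x < 2⁻¹}ᶜ, 2 * θ x ∂μ := by
          refine setLIntegral_mono' (hE.inter hA.compl) fun x hx => ?_
          calc (1 : ℝ≥0∞) = 2 * 2⁻¹ := (ENNReal.mul_inv_cancel two_ne_zero (by simp)).symm
            _ ≤ _ := mul_le_mul_right (not_lt.1 fun h' : θ x < 2⁻¹ => hx.2 h') _
      _ ≤ ∫⁻ x in E, 2 * θ x ∂μ := lintegral_mono_set Set.inter_subset_left

namespace GraphexData

lemma norm1_two_smul_le {Ω : Type*} [MeasurableSpace Ω] (T : GraphexData Ω)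
    (ν : Measure Ω) : T.norm1 ((2 : ℝ≥0∞) • ν) ≤ 4 * T.norm1 ν := by
  have e : T.norm1 ((2 : ℝ≥0∞) • ν) = 4 * (∫⁻ x, ∫⁻ y, ‖T.W x y‖ₑ ∂ν ∂ν)
      + 4 * (∫⁻ x, ‖T.S x‖ₑ ∂ν) + 2 * ‖T.I‖ₑ := by
    simp only [norm1, lintegral_smul_measure, smul_eq_mul]
    rw [lintegral_const_mul' _ _ (by simp)]
    ring
  rw [e, norm1, mul_add, mul_add]
  have h2 : (2 : ℝ≥0∞) ≤ 4 := by norm_num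
  refine add_le_add (add_le_add le_rfl ?_) ?_
  · exact mul_le_mul_right (le_mul_of_one_le_left' one_le_two) _
  · exact mul_le_mul' h2 (le_mul_of_one_le_left' one_le_two)

/-- For proper data the edge density is `‖𝕎‖₁`, so comparable graphexes have comparable norms. -/
lemma JointNear.norm1_le {Ω₁ Ω₂ : Type*} [MeasurableSpace Ω₁] [MeasurableSpace Ω₂]
    {T₁ : GraphexData Ω₁} {T₂ : GraphexData Ω₂} {μ₁ : Measure Ω₁} {μ₂ : Measure Ω₂} [SFinite μ₁]
    [SFinite μ₂] (h₁ : T₁.IsProper) (h₂ : T₂.IsProper) (f₁ : T₁.norm1 μ₁ ≠ ∞)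
    (f₂ : T₂.norm1 μ₂ ≠ ∞) {k d r : ℝ≥0∞} (h : JointNear T₁ μ₁ T₂ μ₂ k d r) :
    T₁.norm1 μ₁ ≤ T₂.norm1 μ₂ + r := by
  obtain ⟨γ, _, c₁, c₂, hN⟩ := h
  have h3 := hN.3
  rw [c₁.rho_eq h₁ f₁, c₂.rho_eq h₂ f₂, h₁.rho_eq f₁, h₂.rho_eq f₂] at h3
  have e : T₁.norm1 μ₁ = ‖((T₂.norm1 μ₂).toReal)
      + ((T₁.norm1 μ₁).toReal - (T₂.norm1 μ₂).toReal)‖ₑ := by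
    rw [add_sub_cancel, Real.enorm_of_nonneg ENNReal.toReal_nonneg, ENNReal.ofReal_toReal f₁]
  rw [e]
  refine (enorm_add_le _ _).trans (add_le_add (le_of_eq ?_) h3)
  rw [Real.enorm_of_nonneg ENNReal.toReal_nonneg, ENNReal.ofReal_toReal f₂]

end GraphexData

namespace Graphex

/-- Graphexes close to a given one become uniformly bounded after removing small sets. -/
lemma exists_isBounded_of_weakKernelDist_lt (V : Graphex.{u}) {ε e : ℝ≥0} (hε : 0 < ε)
    (he : 0 < e) (he1 : e ≤ 1) (heε : 8 * e ^ 2 ≤ ε) :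
    ∃ C : ℝ≥0, ∀ V' : Graphex.{u}, V'.weakKernelDist V < e → ∃ A : Set V'.Ω, MeasurableSet A ∧
      V'.μ A ≤ ε ∧ V'.data.IsBounded (V'.μ.restrict Aᶜ) C (C / (ε / 2)) := by
  obtain ⟨A₀, hA₀, hμ₀, hn₀⟩ := V.exists_norm1_restrict_ne_top (pow_pos he 2)
  set C₀ := V.data.norm1 (V.μ.restrict A₀ᶜ) with hC₀
  have hCtop : 4 * (C₀ + 4) ≠ ∞ :=
    ENNReal.mul_ne_top (by simp) (ENNReal.add_ne_top.2 ⟨hn₀, by simp⟩)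
  refine ⟨(4 * (C₀ + 4)).toNNReal, fun V' hV' => ?_⟩
  obtain ⟨c, hc, ν₁, ν₂, f₁, f₂, n₁, n₂, hJ⟩ := exists_of_deltaDiamond_lt V'.isProper V.isProper hV'
  have hce : c ≤ e := by exact_mod_cast hc.le
  have : SigmaFinite ν₁ := n₁.sigmaFinite
  have : SigmaFinite ν₂ := n₂.sigmaFinite
  obtain ⟨κ, nκ, hJ'⟩ := hJ.restrict_right V'.isProper V.isProper f₁ f₂
    (isNearlyFull_restrict (μ := ν₂) (r := e ^ 2) hA₀.compl
      ((Measure.le_iff'.1 n₂.le _).trans (by rwa [compl_compl])))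
  have : SigmaFinite κ := nκ.sigmaFinite
  have fκ := f₁.mono V'.isProper nκ.le
  have hle : V.data.norm1 (ν₂.restrict A₀ᶜ) ≤ C₀ :=
    V.isProper.norm1_mono (Measure.restrict_mono subset_rfl n₂.le)
  have hκ : V'.data.norm1 κ ≤ C₀ + 4 := by
    refine (hJ'.norm1_le V'.isProper V.isProper fκ.1 (ne_top_of_le_ne_top hn₀ hle)).trans
      (add_le_add hle ?_)
    have hc1 : c ≤ 1 := hce.trans he1
    have : c ^ 3 + 2 * c ^ 2 * e + c * e ^ 2 ≤ 4 := by
      calc c ^ 3 + 2 * c ^ 2 * e + c * e ^ 2 ≤ 1 ^ 3 + 2 * 1 ^ 2 * 1 + 1 * 1 ^ 2 := by gcongr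
        _ = 4 := by norm_num
    exact_mod_cast this
  obtain ⟨A, hA, hAμ, hAle⟩ := (n₁.trans nκ).exists_restrict_le
  have hn : V'.data.norm1 (V'.μ.restrict Aᶜ) ≤ ((4 * (C₀ + 4)).toNNReal : ℝ≥0) := by
    rw [ENNReal.coe_toNNReal hCtop]
    exact (V'.isProper.norm1_mono hAle).trans
      ((V'.data.norm1_two_smul_le κ).trans (mul_le_mul_right hκ _))
  obtain ⟨B, hB, hBμ, hBb⟩ := V'.isProper.exists_isBounded_restrict (half_pos hε) hn
  refine ⟨A ∪ (B ∩ Aᶜ), hA.union (hB.inter hA.compl), ?_, ?_⟩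
  · rw [Measure.restrict_apply hB] at hBμ
    have hA2 : V'.μ A ≤ (ε / 2 : ℝ≥0) := by
      refine hAμ.trans ?_
      have hc2 : c ^ 2 ≤ e ^ 2 := pow_le_pow_left' hce 2
      have : 2 * (c ^ 2 + e ^ 2) ≤ ε / 2 := by
        rw [le_div_iff₀ (by norm_num)]
        calc 2 * (c ^ 2 + e ^ 2) * 2 ≤ 2 * (e ^ 2 + e ^ 2) * 2 := by gcongr
          _ = 8 * e ^ 2 := by ring
          _ ≤ ε := heε
      exact_mod_cast this
    calc _ ≤ ((ε / 2 : ℝ≥0) : ℝ≥0∞) + (ε / 2 : ℝ≥0) :=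
          (measure_union_le _ _).trans (add_le_add hA2 hBμ)
      _ = ε := by rw [← ENNReal.coe_add, add_halves]
  · rw [Measure.restrict_restrict hB.compl] at hBb
    have : (A ∪ (B ∩ Aᶜ))ᶜ = Bᶜ ∩ Aᶜ := by
      ext x
      by_cases hx : x ∈ A <;> simp [hx]
    rw [this]
    exact hBb

/-- Sets of graphexes that are totally bounded for the weak kernel distance are tight. -/
lemma isTight_of_finite_net {𝒮 : Set Graphex.{u}}
    (h : ∀ e : ℝ≥0, 0 < e → ∃ t : Set Graphex.{u}, t.Finite ∧
      ∀ V ∈ 𝒮, ∃ V' ∈ t, V.weakKernelDist V' < e) : IsTight 𝒮 := by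
  intro ε hε
  obtain ⟨e, he, he1, heε⟩ : ∃ e : ℝ≥0, 0 < e ∧ e ≤ 1 ∧ 8 * e ^ 2 ≤ ε := by
    refine ⟨min 1 (ε / 8), lt_min one_pos (by positivity), min_le_left _ _, ?_⟩
    calc 8 * (min 1 (ε / 8)) ^ 2 = 8 * (min 1 (ε / 8) * min 1 (ε / 8)) := by rw [sq]
      _ ≤ 8 * (1 * (ε / 8)) := by
          gcongr
          · exact min_le_left _ _
          · exact min_le_right _ _
      _ = ε := by rw [one_mul, mul_div_cancel₀ _ (by norm_num)]
  obtain ⟨t, ht, hnet⟩ := h e he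
  choose C hC using fun V : Graphex.{u} =>
    V.exists_isBounded_of_weakKernelDist_lt hε he he1 heε
  obtain ⟨K, hK⟩ := (ht.image C).bddAbove
  refine ⟨K, K / (ε / 2), fun V hV => ?_⟩
  obtain ⟨V', hV't, hVV'⟩ := hnet V hV
  obtain ⟨A, hA, hAμ, hb1, hb2⟩ := hC V' V hVV'
  have hCK : C V' ≤ K := hK (Set.mem_image_of_mem C hV't)
  refine ⟨A, hA, hAμ, hb1.trans (by exact_mod_cast hCK), hb2.trans ?_⟩
  have : C V' / (ε / 2) ≤ K / (ε / 2) := by gcongr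
  exact_mod_cast this

lemma isBounded_iff {V : Graphex.{u}} {C D : ℝ≥0} :
    V.IsBounded C D ↔ V.norm1 ≤ C ∧ ∀ᵐ x ∂V.μ, V.data.marginal V.μ x ≤ D :=
  and_congr_right fun _ => ⟨fun h => (ENNReal.ae_le_essSup _).mono fun _ hx => hx.trans h,
    fun h => essSup_le_of_ae_le _ h⟩

lemma memL1L2_of_isBounded {V : Graphex.{u}} {C D : ℝ≥0} (h : V.IsBounded C D) : V.MemL1L2 :=
  V.memL1L2_iff.2 (V.isProper.finiteOn_of_isBounded h)

end Graphex

end Compactness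

theorem mainTheorem3 :
    (∃ m : PseudoMetricSpace Graphex.{u},
      (∀ V₁ V₂ : Graphex.{u}, edist V₁ V₂ = Graphex.weakKernelDist V₁ V₂) ∧
      CompleteSpace Graphex.{u} ∧
      (∀ 𝒮 : Set Graphex.{u}, IsCompact (closure 𝒮) ↔ Graphex.IsTight 𝒮) ∧
      (∀ C : ℝ≥0, IsCompact {V : Graphex.{u} | V.norm1 ≤ C}) ∧
      (∀ C D : ℝ≥0, IsCompact {V : Graphex.{u} | V.IsBounded C D})) ∧
    (∀ (V : Graphex.{u}) (C D : ℝ≥0), V.IsBounded C D → V.MemL1L2) ∧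
    (∃ m : PseudoMetricSpace {V : Graphex.{u} // V.MemL1L2},
      (∀ V₁ V₂ : {V : Graphex.{u} // V.MemL1L2},
        edist V₁ V₂ = Graphex.kernelDist V₁.1 V₂.1) ∧
      (∀ C D : ℝ≥0, IsCompact {V : {V : Graphex.{u} // V.MemL1L2} | V.1.IsBounded C D})) := by
  refine ⟨⟨Graphex.weakKernelPseudoMetric, Graphex.weakKernelPseudoMetric_edist, ?_⟩,
    fun V C D h => Graphex.memL1L2_of_isBounded h,
    ⟨Graphex.kernelPseudoMetric, Graphex.kernelPseudoMetric_edist, fun C D => ?_⟩⟩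
  · let _ : PseudoMetricSpace Graphex.{u} := Graphex.weakKernelPseudoMetric
    have htb : ∀ {𝒮 : Set Graphex.{u}}, Graphex.IsTight 𝒮 → TotallyBounded 𝒮 := fun h =>
      totallyBounded_of_colouring fun ε hε => h.exists_colouring hε
    have hcomplete : CompleteSpace Graphex.{u} := by
      refine completeSpace_iff_isComplete_univ.2 (isComplete_of_fast_sequences fun V _ hV => ?_)
      obtain ⟨Y, hY, -⟩ := Graphex.exists_tendsto_weakKernelDist hV
      exact ⟨Y, trivial, hY⟩
    refine ⟨hcomplete, fun 𝒮 => ⟨fun h => ?_, fun h => ?_⟩, fun C => ?_, fun C D => ?_⟩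
    · refine Graphex.isTight_of_finite_net fun e he => ?_
      obtain ⟨t, ht, hnet⟩ := EMetric.totallyBounded_iff.1
        (h.totallyBounded.subset subset_closure) e (by simpa using he)
      refine ⟨t, ht, fun V hV => ?_⟩
      obtain ⟨V', hV', hVV'⟩ := Set.mem_iUnion₂.1 (hnet hV)
      exact ⟨V', hV', hVV'⟩
    · exact isCompact_iff_totallyBounded_isComplete.2 ⟨(htb h).closure, isClosed_closure.isComplete⟩
    · refine isCompact_iff_totallyBounded_isComplete.2 ⟨htb (Graphex.isTight_setOf_norm1_le C),
        isComplete_of_fast_sequences fun V hVs hV => ?_⟩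
      obtain ⟨Y, hY, hY1, -⟩ := Graphex.exists_tendsto_weakKernelDist hV
      exact ⟨Y, hY1 C hVs, hY⟩
    · refine isCompact_iff_totallyBounded_isComplete.2
        ⟨htb ((Graphex.isTight_setOf_norm1_le C).mono fun V hV => hV.1),
        isComplete_of_fast_sequences fun V hVs hV => ?_⟩
      obtain ⟨Y, hY, hY1, hY2⟩ := Graphex.exists_tendsto_weakKernelDist hV
      exact ⟨Y, Graphex.isBounded_iff.2 ⟨hY1 C fun n => (hVs n).1,
        hY2 D fun n => (Graphex.isBounded_iff.1 (hVs n)).2⟩, hY⟩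
  · let _ : PseudoMetricSpace {V : Graphex.{u} // V.MemL1L2} := Graphex.kernelPseudoMetric
    refine isCompact_iff_totallyBounded_isComplete.2
      ⟨totallyBounded_of_colouring fun ε hε => ?_, isComplete_of_fast_sequences fun V hVs hV => ?_⟩
    · obtain ⟨κ, hκ, col, hcol⟩ := Graphex.exists_colouring.{u} C D hε
      exact ⟨κ, hκ, fun V => col ⟨V.1.1, V.2⟩, fun V V' h => hcol _ _ h⟩
    · obtain ⟨Y, fY, hY, hY1, hY2⟩ := Graphex.exists_tendsto_kernelDist (V := fun n => (V n).1)
        (fun n => (V n).1.memL1L2_iff.1 (V n).2) hV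
      exact ⟨⟨Y, Y.memL1L2_iff.2 fY⟩, Graphex.isBounded_iff.2 ⟨hY1 C fun n => (hVs n).1,
        hY2 D fun n => (Graphex.isBounded_iff.1 (hVs n)).2⟩, hY⟩
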